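/- Let $n\ge 1$, $\alpha>0$, $0\le d<2\alpha$ and $b_1\ge b_2>0$. Let $Q(D)$ be a homogeneous pseudo-differential operator of order $d$, i.e. the Fourier multiplier with a symbol $Q:\mathbb{R}^n\setminus\{0\}\to\mathbb{C}$ that is smooth and satisfies $Q(\lambda\xi)=\lambda^dQ(\xi)$ for $\lambda>0$. Let either $f_1(u)=\pm|u|^{b_1}u$ and $f_2(u)=\pm|u|^{b_2}u$, or $f_1(u)=\pm|u|^{b_1+1}$ and $f_2(u)=\pm|u|^{b_2+1}$ (the signs are arbitrary). Consider, for complex-valued functions, the Cauchy problem $$u_t+(-\Delta)^\alpha u=Q(D)\big(f_1(u)+f_2(u)\big)\ \text{ on }(0,\infty)\times\mathbb{R}^n,\qquad u(0)=\varphi ;\qquad(*)$$ the choice $d=0$, $Q=1$ gives the nonlinear term $f_1(u)+f_2(u)$. Let $r_j=nb_j/(2\alpha-d)>1$ for $j=1,2$, and let $(q_j,p_j,r_j)$ be generalized admissible triplets, i.e. $$\frac1{q_j}=\frac n{2\alpha}\Big(\frac1{r_j}-\frac1{p_j}\Big),\qquad r_j\le p_j<\infty,\qquad p_j<\frac{nr_j}{n-2\alpha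 r_j}\ \text{ if } n>2\alpha r_j ,$$ with moreover $r_j<p_j\le r_j(1+b_j)$. For $1<p<\infty$, $0<q<\infty$, let $\dot{\mathcal C}_q([0,\infty);L^p)$ be the set of $u\in C((0,\infty);L^p(\mathbb{R}^n))$ with $\sup_{t>0}t^{1/q}\|u(t)\|_{L^p}<\infty$ and $\lim_{t\to0^+}t^{1/q}\|u(t)\|_{L^p}=0$. With $S_\alpha(t)=e^{-t(-\Delta)^\alpha}$, a solution of $(*)$ is a mild solution: $u(0)=\varphi$ and, for every $t>0$, $$u(t)=S_\alpha(t)\varphi+\int_0^tS_\alpha(t-s)Q(D)\big[f_1(u(s))+f_2(u(s))\big]\,ds\quad\text{a.e. in }\mathbb{R}^n,$$ where, so that the integral is meaningful, for each $j$ there is some $h_j\in[1,\infty)$ with $f_j(u)\in C((0,\infty);L^{h_j})\cap L^1((0,T);L^{h_j})$ for all $T>0$ (this is automatic for $u\in C([0,\infty);L^{r_j})\cap\dot{\mathcal C}_{q_j}([0,\infty);L^{p_j})$ if $p_j\ge 1+b_j$). Then there is $\delta>0$ such that for every $\varphi\in L^{r_1}\cap L^{r_2}$ with $\|\varphi\|_{L^{r_1}}+\|\varphi\|_{L^{r_2}}<\delta$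 there exists a unique solution $$u\in C([0,\infty);L^{r_1}\cap L^{r_2})\cap\dot{\mathcal C}_{q_1}([0,\infty);L^{p_1})\cap\dot{\mathcal C}_{q_2}([0,\infty);L^{p_2})$$ of $(*)$. In particular, if $b_1=b_2$, one obtains the corresponding result for the single nonlinear term $f_1$: there is $\delta>0$ such that for every $\varphi\in L^{r_1}$ with $\|\varphi\|_{L^{r_1}}<\delta$ the problem $u_t+(-\Delta)^\alpha u=Q(D)f_1(u)$, $u(0)=\varphi$, has a unique mild solution $u\in C([0,\infty);L^{r_1})\cap\dot{\mathcal C}_{q_1}([0,\infty);L^{p_1})$. -/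

import Mathlib

open MeasureTheory Filter Topology Set
open scoped ENNReal ContDiff

namespace FracDissipative

/-- Euclidean space `ℝⁿ`. -/
abbrev Space (n : ℕ) := EuclideanSpace ℝ (Fin n)

/-- `Q` is the symbol of a homogeneous pseudo-differential operator `Q(D)` of order `d`
(a Fourier multiplier): it is smooth away from the origin and positively homogeneous of degree `d`.
The value `Q 0` is irrelevant. -/
structure IsHomogeneousSymbol {n : ℕ} (d : ℝ) (Q : Space n → ℂ) : Prop where
  smooth : ContDiffOn ℝ ∞ Q {0}ᶜ
  homogeneous : ∀ l : ℝ, 0 < l → ∀ ξ : Space n, ξ ≠ 0 → Q (l • ξ) = ((l ^ d : ℝ) : ℂ) * Q ξ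

/-- The identity operator is a homogeneous pseudo-differential operator of order `0`, so that the
equation without `Q(D)` is the case `d = 0`, `Q = 1` of the equation with `Q(D)`. -/
theorem isHomogeneousSymbol_one (n : ℕ) :
    IsHomogeneousSymbol (n := n) 0 (fun _ => 1) where
  smooth := contDiffOn_const
  homogeneous := by intro l _ ξ _; simp

/-- The convolution kernel of `Q(D) e^{-t(-Δ)^α}`:
`(2π)⁻ⁿ ∫ e^{i x·ξ} Q(ξ) e^{-t|ξ|^{2α}} dξ`. -/
noncomputable def kernel {n : ℕ} (α : ℝ) (Q : Space n → ℂ) (t : ℝ) (x : Space n) : ℂ :=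
  (((2 * Real.pi) ^ n)⁻¹ : ℝ) *
    ∫ ξ : Space n, Complex.exp (Complex.I * ((inner ℝ x ξ : ℝ) : ℂ)) * Q ξ *
      ((Real.exp (-t * ‖ξ‖ ^ (2 * α)) : ℝ) : ℂ)

/-- `Q(D) S_α(t) g`, for `t > 0`, where `S_α(t) = e^{-t(-Δ)^α}`. -/
noncomputable def symbolSemigroup {n : ℕ} (α : ℝ) (Q : Space n → ℂ) (t : ℝ) (g : Space n → ℂ)
    (x : Space n) : ℂ :=
  ∫ y : Space n, kernel α Q t (x - y) * g y

/-- The semigroup `S_α(t) g`, for `t > 0`. -/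
noncomputable def semigroup {n : ℕ} (α : ℝ) (t : ℝ) (g : Space n → ℂ) (x : Space n) : ℂ :=
  symbolSemigroup α (fun _ => 1) t g x

/-- `v ∈ C(I; L^p(ℝⁿ))`. -/
structure ContinuousInLp {n : ℕ} (I : Set ℝ) (p : ℝ) (v : ℝ → Space n → ℂ) : Prop where
  memLp : ∀ t ∈ I, MemLp (v t) (ENNReal.ofReal p) volume
  tendsto : ∀ t₀ ∈ I,
    Tendsto (fun t => eLpNorm (v t - v t₀) (ENNReal.ofReal p) volume) (𝓝[I] t₀) (𝓝 0)

/-- `(q, p, r)` is a generalized admissible triplet for the equation of order `2α` in `ℝⁿ`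
(`q = ∞` exactly when `p = r`). -/
structure IsGenAdmissible (n : ℕ) (α : ℝ) (q : ℝ≥0∞) (p r : ℝ) : Prop where
  inv_eq : q⁻¹ = ENNReal.ofReal (n / (2 * α) * (1 / r - 1 / p))
  one_lt : 1 < r
  le : r ≤ p
  lt : 2 * r * α < n → p < n * r / (n - 2 * α * r)

/-- `v ∈ Ċ_q([0,∞); L^p(ℝⁿ))`: `v` is continuous on `(0,∞)` with values in `L^p`,
`sup_{t > 0} t^{1/q} ‖v(t)‖_p < ∞` and `t^{1/q} ‖v(t)‖_p → 0` as `t → 0+`. -/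
structure MemDotC {n : ℕ} (q : ℝ≥0∞) (p : ℝ) (v : ℝ → Space n → ℂ) : Prop where
  continuous : ContinuousInLp (Ioi 0) p v
  bounded : ∃ C : ℝ, ∀ t : ℝ, 0 < t →
    ENNReal.ofReal (t ^ q⁻¹.toReal) * eLpNorm (v t) (ENNReal.ofReal p) volume ≤ ENNReal.ofReal C
  tendsto_zero :
    Tendsto (fun t : ℝ => ENNReal.ofReal (t ^ q⁻¹.toReal) *
      eLpNorm (v t) (ENNReal.ofReal p) volume) (𝓝[>] 0) (𝓝 0)

/-- `f(z) = ±|z|^b z`. -/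
def IsSignedPower (b : ℝ) (f : ℂ → ℂ) : Prop :=
  (∀ z, f z = ((‖z‖ ^ b : ℝ) : ℂ) * z) ∨ (∀ z, f z = -(((‖z‖ ^ b : ℝ) : ℂ) * z))

/-- `f(z) = ±|z|^{b+1}`. -/
def IsAbsPower (b : ℝ) (f : ℂ → ℂ) : Prop :=
  (∀ z, f z = ((‖z‖ ^ (b + 1) : ℝ) : ℂ)) ∨ (∀ z, f z = -((‖z‖ ^ (b + 1) : ℝ) : ℂ))

/-- The nonlinear term `f(u)` is a function of time with values in one Lebesgue space `L^h`,
`1 ≤ h < ∞`, on which the operators `Q(D) S_α(t)` act: `f(u) ∈ C((0,∞); L^h)`, and `f(u)` is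
integrable near `t = 0` with values in `L^h`. -/
def AdmissibleSource {n : ℕ} (f : ℂ → ℂ) (u : ℝ → Space n →ₘ[volume] ℂ) : Prop :=
  ∃ h : ℝ, 1 ≤ h ∧ ContinuousInLp (Ioi 0) h (fun s y => f (u s y)) ∧
    ∀ T : ℝ, 0 < T →
      ∫⁻ s in Ioc 0 T, eLpNorm (fun y => f (u s y)) (ENNReal.ofReal h) volume < ⊤

/-- `u` is a global mild solution of `u_t + (-Δ)^α u = Q(D)(f₁(u) + f₂(u))`, `u(0) = φ`, that is,
a solution of the integral equation
`u(t) = S_α(t) φ + ∫₀ᵗ S_α(t-s) Q(D)(f₁(u(s)) + f₂(u(s))) ds`. Only the values of `u` at times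
`t ≥ 0` matter. -/
structure IsMildSolution {n : ℕ} (α : ℝ) (Q : Space n → ℂ) (f₁ f₂ : ℂ → ℂ) (φ : Space n → ℂ)
    (u : ℝ → Space n →ₘ[volume] ℂ) : Prop where
  initial : u 0 =ᵐ[volume] φ
  source₁ : AdmissibleSource f₁ u
  source₂ : AdmissibleSource f₂ u
  integrable : ∀ t : ℝ, 0 < t → ∀ᵐ x : Space n,
    IntegrableOn (fun s => symbolSemigroup α Q (t - s) (fun y => f₁ (u s y) + f₂ (u s y)) x)
      (Ioo 0 t)
  integral_eq : ∀ t : ℝ, 0 < t → ∀ᵐ x : Space n,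
    u t x = semigroup α t φ x +
      ∫ s in Ioo 0 t, symbolSemigroup α Q (t - s) (fun y => f₁ (u s y) + f₂ (u s y)) x

end FracDissipative

open FracDissipative

set_option linter.unusedSectionVars false

/-! Linear part. The kernel of `Q(D) S_α(t)` is self-similar in `t`. Once it lies in a suitable
`L^m` at `t = 1`, Young's inequality gives the smoothing bound from `L^h` to `L^P` with constant `C
t^{-(d + n(1/h - 1/P))/(2α)}`. The symbol is singular at the origin, so integration by parts alone
yields too little decay. But `-∂_t` of the kernel is the kernel of `|ξ|^{2α} Q`, whose symbol is
smoother. Starting from `|ξ|^{2αk} Q` with `k` large and integrating `k` times over `t ∈ (1, ∞)`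
gives decay of every order below `n + d` (`IsHomogeneousSymbol.exists_norm_kernel_le`), hence `L^m`
for all `m > 1`. For `S_α` itself `m = 1` is needed as well. There the integration runs over `(0,
1)`, and the kernel tends to `0` away from the origin as `t → 0` (`exists_norm_heatKernel_le`).

Nonlinear part. A single auxiliary exponent `x` serves all the powers `b_j`: each `|u|^{b_j}` is
estimated in `L^{1/x}`, that is, `u` in `L^{b_j/x}`. Because `r_j = n b_j/(2α - d)` is critical,
`S_α(t)` decays from `L^{r_j}` to `L^{b_j/x}` like `t^{-θ/b_j}`, where `θ = 1 - (d + nx)/(2α)` does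
not depend on `j` (`decayRate_div_eq`). So `|u|^{b_j}` has size `t^{-θ}` in `L^{1/x}` for every `j`.
Multiplication by it sends the weight `t^{-β}` in `L^P` to `t^{-θ-β}` in `L^h`, `1/h = x + 1/P`. The
Duhamel integral, whose kernel has singularity `1 - θ`, brings back exactly `t^{-β}` in `L^P`. Both
nonlinear terms therefore contract in the same spaces, with a factor governed by the radius `ρ`
alone (`weightedBound_duhamel_sub`). The constraints `nx < 2α - d`, `nx(1 + b_j) > 2α - d` and `x(1
+ b_j) ≤ b_j` make the time integrals converge and keep the Lebesgue exponents at least `1`. Such an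
`x` exists because `r_j > 1` means `(2α - d)/n < b_j`.

Existence. Picard iteration closes in the spaces `L^{b_j/x}` and carries along every other
admissible pair `(P, β)`. The weighted norms vanish as `t → 0` because those of `S_α(t)φ` do and the
remainder is contracted. The spaces `L^{r_j}` and `L^{p_j}` are then reached by the Duhamel formula,
or by treating `L^{p_j}` as a contraction space itself (`exists_solution`).

Uniqueness. A competitor `v` has no a priori smallness, and may fail to lie in `L^{b_j/x}` at the
start. Since `|f_j(z)| = |z|^{1+b_j}`, the source condition bounds `v` locally in time in
`L^{h_j(1+b_j)}`. Together with `L^{p_j}`, `p_j > r_j`, this is subcritical, so a bootstrap puts `v`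
in every high `L^p` away from `t = 0`. Restarted at a small `t₀ > 0`, `v` is continuous up to its
initial time in `L^{b_j/x}`. Its weighted norms then start from `0`, and since `v(t₀)` is still
small in `L^{r_j}`, a continuity argument keeps them below `ρ`. Letting `t₀ → 0` shows that `v` lies
in the contraction ball, where solutions are unique (`isSmallSolution_of_sources`,
`isSmallSolution_unique`).

All this is carried out for a finite family of nonlinear terms. The two assertions are the cases of
the index types `Fin 2` and `Unit`. -/

namespace FracDissipative

/-! ### Homogeneous functions and the regularity of exponentially damped symbols. -/

section Homogeneous

variable {E F : Type} [NormedAddCommGroup E] [InnerProductSpace ℝ E] [FiniteDimensional ℝ E]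
  [MeasurableSpace E] [BorelSpace E]
  [NormedAddCommGroup F] [NormedSpace ℝ F]

/-- `H` is smooth away from the origin, positively homogeneous of degree `D`, and `H 0 = 0`. -/
structure IsHomogeneousSmooth (D : ℝ) (H : E → F) : Prop where
  smooth : ContDiffOn ℝ ∞ H {0}ᶜ
  homogeneous : ∀ l : ℝ, 0 < l → ∀ ξ : E, ξ ≠ 0 → H (l • ξ) = l ^ D • H ξ
  zero : H 0 = 0

namespace IsHomogeneousSmooth

theorem contDiffAt {D : ℝ} {H : E → F} (h : IsHomogeneousSmooth D H) {ξ : E} (hξ : ξ ≠ 0) :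
    ContDiffAt ℝ ∞ H ξ :=
  h.smooth.contDiffAt (isOpen_compl_singleton.mem_nhds hξ)

theorem exists_norm_le {D : ℝ} {H : E → F} (h : IsHomogeneousSmooth D H) :
    ∃ C : ℝ, 0 ≤ C ∧ ∀ ξ, ‖H ξ‖ ≤ C * ‖ξ‖ ^ D := by
  have hc : ContinuousOn H (Metric.sphere (0 : E) 1) :=
    h.smooth.continuousOn.mono fun x hx => by
      simp only [mem_compl_iff, mem_singleton_iff]
      rintro rfl
      simp at hx
  obtain ⟨C, hC⟩ := (isCompact_sphere (0 : E) 1).exists_bound_of_continuousOn hc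
  refine ⟨max C 0, le_max_right _ _, fun ξ => ?_⟩
  rcases eq_or_ne ξ 0 with rfl | hξ
  · rw [h.zero, norm_zero]
    positivity
  have hn : 0 < ‖ξ‖ := norm_pos_iff.2 hξ
  have h1 : H ξ = ‖ξ‖ ^ D • H (‖ξ‖⁻¹ • ξ) := by
    rw [← h.homogeneous _ hn _ (smul_ne_zero (inv_ne_zero hn.ne') hξ), smul_smul,
      mul_inv_cancel₀ hn.ne', one_smul]
  have h2 : ‖H (‖ξ‖⁻¹ • ξ)‖ ≤ C := hC _ (by simp [norm_smul, hn.ne'])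
  rw [h1, norm_smul, Real.norm_of_nonneg (Real.rpow_nonneg hn.le _), mul_comm]
  gcongr
  exact h2.trans (le_max_left _ _)

/-- Since `D > 1`, the bound `‖ξ‖ ^ D` is `o(‖ξ‖)`. At the origin, vanishing to high order replaces
smoothness. -/
theorem hasFDerivAt_zero {D : ℝ} (hD : 1 < D) {H : E → F} {C : ℝ}
    (h : ∀ ξ, ‖H ξ‖ ≤ C * ‖ξ‖ ^ D) :
    HasFDerivAt H (0 : E →L[ℝ] F) 0 := by
  have h0 : H 0 = 0 := by
    have := h 0
    rw [norm_zero, Real.zero_rpow (by linarith), mul_zero] at this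
    exact norm_le_zero_iff.1 this
  rw [hasFDerivAt_iff_isLittleO_nhds_zero]
  simp only [zero_add, h0, sub_zero, zero_apply]
  have h1 : H =O[𝓝 0] fun ξ : E => ‖ξ‖ ^ D :=
    Asymptotics.IsBigO.of_bound C (Eventually.of_forall fun ξ => by
      rw [Real.norm_of_nonneg (Real.rpow_nonneg (norm_nonneg _) _)]
      exact h ξ)
  refine h1.trans_isLittleO ?_
  have h2 : (fun ξ : E => ‖ξ‖ ^ D) = fun ξ => ‖ξ‖ ^ (D - 1) * ‖ξ‖ := by
    ext ξ
    rcases eq_or_ne ξ 0 with rfl | hξ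
    · simp [Real.zero_rpow (by linarith : D ≠ 0)]
    · rw [← Real.rpow_add_one (norm_ne_zero_iff.2 hξ)]
      congr 1
      ring
  rw [h2]
  have h3 : Tendsto (fun ξ : E => ‖ξ‖ ^ (D - 1)) (𝓝 0) (𝓝 0) := by
    have : Continuous fun ξ : E => ‖ξ‖ ^ (D - 1) :=
      continuous_norm.rpow_const fun _ => Or.inr (by linarith)
    simpa [Real.zero_rpow (by linarith : D - 1 ≠ 0)] using this.tendsto 0
  have := ((Asymptotics.isLittleO_one_iff ℝ).2 h3).mul_isBigO
    (Asymptotics.isBigO_refl (fun ξ : E => ‖ξ‖) (𝓝 0))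
  refine Asymptotics.IsLittleO.of_norm_right ?_
  simpa using this

theorem fderiv_smul {D : ℝ} {H : E → F} (h : IsHomogeneousSmooth D H) {l : ℝ} (hl : 0 < l)
    {ξ : E} (hξ : ξ ≠ 0) : fderiv ℝ H (l • ξ) = l ^ (D - 1) • fderiv ℝ H ξ := by
  have hlξ : l • ξ ≠ 0 := smul_ne_zero hl.ne' hξ
  have h1 : HasFDerivAt (fun η : E => H (l • η)) (l • fderiv ℝ H (l • ξ)) ξ := by
    have a1 := ((h.contDiffAt hlξ).differentiableAt (by simp)).hasFDerivAt
    have a2 : HasFDerivAt (fun η : E => l • η) (l • ContinuousLinearMap.id ℝ E) ξ :=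
      (hasFDerivAt_id ξ).const_smul l
    have := a1.comp ξ a2
    rw [ContinuousLinearMap.comp_smul, ContinuousLinearMap.comp_id] at this
    exact this
  have h2 : HasFDerivAt (fun η : E => l ^ D • H η) (l ^ D • fderiv ℝ H ξ) ξ :=
    ((h.contDiffAt hξ).differentiableAt (by simp)).hasFDerivAt.const_smul _
  have h3 : (fun η : E => H (l • η)) =ᶠ[𝓝 ξ] fun η : E => l ^ D • H η := by
    filter_upwards [isOpen_compl_singleton.mem_nhds hξ] with η hη
    exact h.homogeneous l hl η hη
  have h4 := h1.unique (h2.congr_of_eventuallyEq h3)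
  have h5 : fderiv ℝ H (l • ξ) = l⁻¹ • l • fderiv ℝ H (l • ξ) := by
    rw [smul_smul, inv_mul_cancel₀ hl.ne', one_smul]
  rw [h5, h4, smul_smul, Real.rpow_sub_one hl.ne']
  congr 1
  field_simp

/-- Differentiation lowers the degree by one and, as long as `D > 1`, preserves the normalisation at
the origin. This makes induction on the number of derivatives possible. -/
theorem fderiv {D : ℝ} (hD : 1 < D) {H : E → F} (h : IsHomogeneousSmooth D H) :
    IsHomogeneousSmooth (D - 1) (fderiv ℝ H) where
  smooth := h.smooth.fderiv_of_isOpen isOpen_compl_singleton (by simp)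
  homogeneous := fun _ hl _ hξ => h.fderiv_smul hl hξ
  zero := by
    obtain ⟨C, -, hC⟩ := h.exists_norm_le
    exact (hasFDerivAt_zero hD hC).fderiv

theorem norm_rpow {a : ℝ} (ha : a ≠ 0) : IsHomogeneousSmooth a fun ξ : E => ‖ξ‖ ^ a where
  smooth := by
    intro ξ hξ
    have hξ' : ξ ≠ 0 := hξ
    exact ((contDiffAt_norm ℝ hξ').rpow_const_of_ne (norm_ne_zero_iff.2 hξ')).contDiffWithinAt
  homogeneous := by
    intro l hl ξ _
    simp only [norm_smul, Real.norm_of_nonneg hl.le, smul_eq_mul]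
    exact Real.mul_rpow hl.le (norm_nonneg _)
  zero := by simp [Real.zero_rpow ha]

/-- The factor `g` will be the derivative of `‖ξ‖ ^ a'`, whose degree `a' - 1` may be negative.
Hence nothing is asked of `g` at the origin: the zero of `H` there is enough. -/
theorem smulRight {D a : ℝ} {H : E → F} {g : E → E →L[ℝ] ℝ}
    (hgs : ContDiffOn ℝ ∞ g {0}ᶜ)
    (hgh : ∀ l : ℝ, 0 < l → ∀ ξ : E, ξ ≠ 0 → g (l • ξ) = l ^ a • g ξ)
    (h : IsHomogeneousSmooth D H) :
    IsHomogeneousSmooth (a + D) fun ξ => (g ξ).smulRight (H ξ) where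
  smooth := hgs.smulRight h.smooth
  homogeneous := by
    intro l hl ξ hξ
    rw [hgh l hl ξ hξ, h.homogeneous l hl ξ hξ, Real.rpow_add hl]
    ext v
    simp only [ContinuousLinearMap.smulRight_apply, smul_apply, smul_smul,
      smul_eq_mul]
    congr 1
    ring
  zero := by ext; simp [h.zero]

theorem neg {D : ℝ} {H : E → F} (h : IsHomogeneousSmooth D H) :
    IsHomogeneousSmooth D fun ξ => -H ξ where
  smooth := h.smooth.neg
  homogeneous := by
    intro l hl ξ hξ
    rw [h.homogeneous l hl ξ hξ, smul_neg]
  zero := by simp [h.zero]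

end IsHomogeneousSmooth

theorem tendsto_rpow_mul_exp_neg_rpow {a t : ℝ} (ha : 0 < a) (ht : 0 < t) (s : ℝ) :
    Tendsto (fun r : ℝ => r ^ s * Real.exp (-t * r ^ a)) atTop (𝓝 0) := by
  have h1 := (tendsto_rpow_mul_exp_neg_mul_atTop_nhds_zero (s / a) t ht).comp
    (tendsto_rpow_atTop ha)
  refine h1.congr' ?_
  filter_upwards [eventually_gt_atTop 0] with r hr
  simp only [Function.comp]
  rw [← Real.rpow_mul hr.le]
  congr 2
  field_simp

theorem integrable_norm_rpow_mul_exp {a t D : ℝ} (ha : 0 < a) (ht : 0 < t) (hD : 0 ≤ D) :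
    Integrable fun ξ : E => ‖ξ‖ ^ D * Real.exp (-t * ‖ξ‖ ^ a) := by
  have hcont : Continuous fun ξ : E => ‖ξ‖ ^ D * Real.exp (-t * ‖ξ‖ ^ a) :=
    (continuous_norm.rpow_const fun _ => Or.inr hD).mul
      (Real.continuous_exp.comp (continuous_const.mul
        (continuous_norm.rpow_const fun _ => Or.inr ha.le)))
  set m : ℝ := Module.finrank ℝ E + 1 with hm
  have hm1 : (Module.finrank ℝ E : ℝ) < m := by linarith
  have hmpos : 0 < m := by positivity
  refine hcont.locallyIntegrable.integrable_of_isBigO_cocompact (g := fun ξ : E => (1 + ‖ξ‖) ^ (-m))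
    ?_ ((integrable_one_add_norm hm1).integrableAtFilter _)
  have h1 : Tendsto (fun ξ : E => ‖ξ‖ ^ (D + m) * Real.exp (-t * ‖ξ‖ ^ a)) (cocompact E) (𝓝 0) :=
    (tendsto_rpow_mul_exp_neg_rpow ha ht (D + m)).comp tendsto_norm_cocompact_atTop
  have h2 : ∀ᶠ ξ : E in cocompact E, 1 ≤ ‖ξ‖ :=
    tendsto_norm_cocompact_atTop.eventually_ge_atTop 1
  refine Asymptotics.IsBigO.of_bound (2 ^ m) ?_
  filter_upwards [h1.eventually_le_const one_pos, h2] with ξ h3 h4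
  have hpos : 0 < ‖ξ‖ := by linarith
  rw [Real.norm_of_nonneg (by positivity), Real.norm_of_nonneg (by positivity)]
  have h5 : ‖ξ‖ ^ D * Real.exp (-t * ‖ξ‖ ^ a) =
      ‖ξ‖ ^ (-m) * (‖ξ‖ ^ (D + m) * Real.exp (-t * ‖ξ‖ ^ a)) := by
    rw [← mul_assoc, ← Real.rpow_add hpos]
    congr 2
    ring
  rw [h5]
  calc ‖ξ‖ ^ (-m) * (‖ξ‖ ^ (D + m) * Real.exp (-t * ‖ξ‖ ^ a)) ≤ ‖ξ‖ ^ (-m) * 1 := by gcongr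
    _ = 2 ^ m * (2 * ‖ξ‖) ^ (-m) := by
      rw [Real.mul_rpow two_pos.le hpos.le, ← mul_assoc, ← Real.rpow_add two_pos]
      simp
    _ ≤ 2 ^ m * (1 + ‖ξ‖) ^ (-m) := by
      gcongr 2 ^ m * ?_
      exact Real.rpow_le_rpow_of_nonpos (by linarith) (by linarith) (by linarith)

theorem aestronglyMeasurable_of_continuousOn_compl_zero [Nontrivial E] {H : E → F}
    (h : ContinuousOn H {0}ᶜ) : AEStronglyMeasurable H (volume : Measure E) := by
  have h1 := h.aestronglyMeasurable (μ := (volume : Measure E)) (measurableSet_singleton 0).compl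
  have h2 : (volume : Measure E).restrict {0}ᶜ = volume :=
    Measure.restrict_eq_self_of_ae_mem (by simp [ae_iff])
  rwa [h2] at h1

theorem IsHomogeneousSmooth.integrable [Nontrivial E] {D a t : ℝ} (ha : 0 < a) (ht : 0 < t)
    (hD : 0 ≤ D) {H : E → F} (h : IsHomogeneousSmooth D H) :
    Integrable fun ξ : E => Real.exp (-t * ‖ξ‖ ^ a) • H ξ := by
  obtain ⟨C, hC0, hC⟩ := h.exists_norm_le
  refine ((integrable_norm_rpow_mul_exp (E := E) ha ht hD).const_mul C).mono' ?_ ?_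
  · refine AEStronglyMeasurable.smul ?_
      (aestronglyMeasurable_of_continuousOn_compl_zero h.smooth.continuousOn)
    exact (Real.continuous_exp.comp (continuous_const.mul
        (continuous_norm.rpow_const fun _ => Or.inr ha.le))).aestronglyMeasurable
  · refine Eventually.of_forall fun ξ => ?_
    rw [norm_smul, Real.norm_of_nonneg (Real.exp_pos _).le]
    calc _ ≤ Real.exp (-t * ‖ξ‖ ^ a) * (C * ‖ξ‖ ^ D) := by gcongr; exact hC ξ
      _ = _ := by ring

theorem integrable_iteratedFDeriv_zero {G : E → F} (h : Integrable G) :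
    Integrable (iteratedFDeriv ℝ 0 G) := by
  have h2 : iteratedFDeriv ℝ 0 G = (continuousMultilinearCurryFin0 ℝ E F).symm ∘ G :=
    iteratedFDeriv_zero_eq_comp
  rw [h2]
  exact ((continuousMultilinearCurryFin0 ℝ E
    F).symm.toContinuousLinearEquiv.toContinuousLinearMap).integrable_comp h

theorem integrable_iteratedFDeriv_succ {G : E → F} {k : ℕ}
    (h : Integrable (iteratedFDeriv ℝ k (fderiv ℝ G))) :
    Integrable (iteratedFDeriv ℝ (k + 1) G) := by
  have h2 : iteratedFDeriv ℝ (k + 1) G = fun ξ =>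
      (continuousMultilinearCurryRightEquiv' ℝ k E F).symm (iteratedFDeriv ℝ k (fderiv ℝ G) ξ) :=
    funext fun ξ => iteratedFDeriv_succ_eq_comp_right
  refine h.norm.mono' ?_ (Eventually.of_forall fun ξ => ?_)
  · rw [h2]
    exact (continuousMultilinearCurryRightEquiv' ℝ k E F).symm.continuous.comp_aestronglyMeasurable
      h.1
  · exact norm_iteratedFDeriv_fderiv.ge

theorem integrable_iteratedFDeriv_add {G₁ G₂ : E → F} {k : ℕ}
    (hG₁ : ContDiff ℝ k G₁) (hG₂ : ContDiff ℝ k G₂)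
    (h₁ : Integrable (iteratedFDeriv ℝ k G₁)) (h₂ : Integrable (iteratedFDeriv ℝ k G₂)) :
    Integrable (iteratedFDeriv ℝ k fun ξ => G₁ ξ + G₂ ξ) := by
  have h5 : iteratedFDeriv ℝ k (fun ξ => G₁ ξ + G₂ ξ) = fun ξ => iteratedFDeriv ℝ k G₁ ξ +
      iteratedFDeriv ℝ k G₂ ξ := iteratedFDeriv_add (𝕜 := ℝ) hG₁ hG₂
  have h6 : AEStronglyMeasurable (iteratedFDeriv ℝ k fun ξ => G₁ ξ + G₂ ξ)
      (volume : Measure E) := by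
    rw [h5]
    exact h₁.1.add h₂.1
  refine (h₁.norm.add h₂.norm).mono' h6 (Eventually.of_forall fun ξ => ?_)
  rw [h5]
  exact norm_add_le _ _

/-- The derivative of `e^{-‖ξ‖^a} H` is `e^{-‖ξ‖^a} (H₁ + H₂)`, where `H₁` is the derivative of `H`,
of degree `D - 1`, and `H₂` comes from the exponential and has degree `D + a - 1`. Each derivative
thus costs at most one degree and keeps the form of the function, while the exponential ensures
integrability at infinity. The target space `F` varies in the induction because derivatives take
values in `E →L[ℝ] F`. -/
theorem IsHomogeneousSmooth.contDiff_and_integrable [Nontrivial E] {a : ℝ} (ha : 0 < a) (M : ℕ) :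
    ∀ {F : Type} [NormedAddCommGroup F] [NormedSpace ℝ F] {D : ℝ} {H : E → F},
      (M : ℝ) < D → IsHomogeneousSmooth D H →
      ContDiff ℝ M (fun ξ : E => Real.exp (-1 * ‖ξ‖ ^ a) • H ξ) ∧
      ∀ k ≤ M, Integrable (iteratedFDeriv ℝ k fun ξ : E => Real.exp (-1 * ‖ξ‖ ^ a) • H ξ) := by
  induction M with
  | zero =>
    intro F _ _ D H hD h
    have hD' : 0 < D := by simpa using hD
    have hexp : Continuous fun ξ : E => Real.exp (-1 * ‖ξ‖ ^ a) :=
      (Real.continuous_exp.comp (continuous_const.mul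
        (continuous_norm.rpow_const fun _ => Or.inr ha.le)))
    refine ⟨?_, ?_⟩
    · simp only [CharP.cast_eq_zero, contDiff_zero]
      refine hexp.smul (continuous_iff_continuousAt.2 fun ξ => ?_)
      rcases eq_or_ne ξ 0 with rfl | hξ
      · obtain ⟨C, hC0, hC⟩ := h.exists_norm_le
        rw [ContinuousAt, h.zero]
        refine squeeze_zero_norm hC ?_
        have : Continuous fun ξ : E => C * ‖ξ‖ ^ D :=
          continuous_const.mul (continuous_norm.rpow_const fun _ => Or.inr hD'.le)
        simpa [Real.zero_rpow hD'.ne'] using this.tendsto 0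
      · exact (h.contDiffAt hξ).continuousAt
    · intro k hk
      obtain rfl : k = 0 := by omega
      exact integrable_iteratedFDeriv_zero (h.integrable ha one_pos hD'.le)
  | succ M ih =>
    intro F _ _ D H hD h
    push_cast at hD
    have hM : (0 : ℝ) ≤ M := Nat.cast_nonneg M
    have hD1 : 1 < D := by linarith
    set G : E → F := fun ξ : E => Real.exp (-1 * ‖ξ‖ ^ a) • H ξ with hG
    set H₁ : E → E →L[ℝ] F := _root_.fderiv ℝ H with hH₁
    set H₂ : E → E →L[ℝ] F :=
      fun ξ => -(_root_.fderiv ℝ (fun ξ : E => ‖ξ‖ ^ a) ξ).smulRight (H ξ) with hH₂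
    have hl := IsHomogeneousSmooth.norm_rpow (E := E) ha.ne'
    have g1 : IsHomogeneousSmooth (D - 1) H₁ := h.fderiv hD1
    have g2 : IsHomogeneousSmooth (a - 1 + D) H₂ :=
      (IsHomogeneousSmooth.smulRight
        (hl.smooth.fderiv_of_isOpen isOpen_compl_singleton (by simp))
        (fun _ hl0 _ hξ => hl.fderiv_smul hl0 hξ) h).neg
    have ih1 := ih (show (M : ℝ) < D - 1 by linarith) g1
    have ih2 := ih (show (M : ℝ) < a - 1 + D by linarith) g2
    have hder : ∀ ξ, HasFDerivAt G (Real.exp (-1 * ‖ξ‖ ^ a) • H₁ ξ +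
        Real.exp (-1 * ‖ξ‖ ^ a) • H₂ ξ) ξ := by
      intro ξ
      rcases eq_or_ne ξ 0 with rfl | hξ
      · rw [g1.zero, g2.zero]
        simp only [smul_zero, add_zero]
        obtain ⟨C, hC0, hC⟩ := h.exists_norm_le
        refine IsHomogeneousSmooth.hasFDerivAt_zero hD1 (C := C) fun ξ => ?_
        rw [hG]
        simp only
        rw [norm_smul, Real.norm_of_nonneg (Real.exp_pos _).le]
        calc _ ≤ 1 * ‖H ξ‖ := by
              gcongr
              rw [Real.exp_le_one_iff]
              have : 0 ≤ ‖ξ‖ ^ a := by positivity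
              linarith
          _ ≤ _ := by simpa using hC ξ
      · have a1 := ((hl.contDiffAt hξ).differentiableAt (by simp)).hasFDerivAt
        have a2 := ((h.contDiffAt hξ).differentiableAt (by simp)).hasFDerivAt
        have a3 := ((a1.const_mul (-1)).exp).smul a2
        have h3 : Real.exp (-1 * ‖ξ‖ ^ a) • H₁ ξ + Real.exp (-1 * ‖ξ‖ ^ a) • H₂ ξ =
            Real.exp (-1 * ‖ξ‖ ^ a) • _root_.fderiv ℝ H ξ + ContinuousLinearMap.smulRight
              (Real.exp (-1 * ‖ξ‖ ^ a) • (-1 : ℝ) • _root_.fderiv ℝ (fun ξ => ‖ξ‖ ^ a) ξ) (H ξ) := by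
          ext v
          simp [hH₁, hH₂, smul_smul]
        rw [h3]
        exact a3
    have hfd : _root_.fderiv ℝ G = fun ξ => Real.exp (-1 * ‖ξ‖ ^ a) • H₁ ξ +
        Real.exp (-1 * ‖ξ‖ ^ a) • H₂ ξ := funext fun ξ => (hder ξ).fderiv
    refine ⟨?_, ?_⟩
    · rw [Nat.cast_succ, contDiff_succ_iff_fderiv]
      refine ⟨fun ξ => (hder ξ).differentiableAt, by simp, ?_⟩
      rw [hfd]
      exact ih1.1.add ih2.1
    · intro k hk
      rcases k with _ | k
      · exact integrable_iteratedFDeriv_zero (h.integrable ha one_pos (by linarith))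
      · have hkM : (k : ℕ∞ω) ≤ M := by exact_mod_cast Nat.le_of_succ_le_succ hk
        refine integrable_iteratedFDeriv_succ ?_
        rw [hfd]
        exact integrable_iteratedFDeriv_add (ih1.1.of_le hkM) (ih2.1.of_le hkM)
          (ih1.2 k (Nat.le_of_succ_le_succ hk)) (ih2.2 k (Nat.le_of_succ_le_succ hk))

end Homogeneous

/-! ### The kernel of `Q(D) S_α(t)`: Fourier representation, scaling and time derivative. -/

section Kernel

open FourierTransform

variable {n : ℕ} {α d : ℝ} {Q : Space n → ℂ}

/-- The symbol of `Q(D) (-Δ)^α`. -/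
noncomputable def laplaceSymbol (α : ℝ) (Q : Space n → ℂ) (ξ : Space n) : ℂ :=
  ((‖ξ‖ ^ (2 * α) : ℝ) : ℂ) * Q ξ

/-- The value at the origin is reset to `0`; no integral over `ξ` sees the change when `n ≥ 1`. -/
theorem IsHomogeneousSymbol.isHomogeneousSmooth (hQ : IsHomogeneousSymbol d Q) :
    IsHomogeneousSmooth d fun ξ => if ξ = 0 then 0 else Q ξ where
  smooth := hQ.smooth.congr fun ξ hξ => if_neg hξ
  homogeneous := by
    intro l hl ξ hξ
    rw [if_neg hξ, if_neg (smul_ne_zero hl.ne' hξ), hQ.homogeneous l hl ξ hξ]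
    simp
  zero := by simp

theorem IsHomogeneousSymbol.laplaceSymbol (hα : 0 < α) (hQ : IsHomogeneousSymbol d Q) :
    IsHomogeneousSymbol (2 * α + d) (laplaceSymbol α Q) where
  smooth := by
    have h := (IsHomogeneousSmooth.norm_rpow (E := Space n) (a := 2 * α) (by positivity)).smooth
    exact (Complex.ofRealCLM.contDiff.comp_contDiffOn h).mul hQ.smooth
  homogeneous := by
    intro l hl ξ hξ
    simp only [FracDissipative.laplaceSymbol, hQ.homogeneous l hl ξ hξ, norm_smul,
      Real.norm_of_nonneg hl.le, Real.mul_rpow hl.le (norm_nonneg _), Real.rpow_add hl]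
    push_cast
    ring

theorem kernel_eq_fourier (t : ℝ) (x : Space n) :
    kernel α Q t x = (((2 * Real.pi) ^ n)⁻¹ : ℝ) *
      𝓕 (fun ξ : Space n => Q ξ * ((Real.exp (-t * ‖ξ‖ ^ (2 * α)) : ℝ) : ℂ))
        (-((2 * Real.pi)⁻¹ • x)) := by
  rw [kernel, Real.fourier_eq']
  congr 1
  refine integral_congr_ae (Eventually.of_forall fun ξ => ?_)
  simp only [inner_neg_right, inner_smul_right, smul_eq_mul, mul_assoc]
  congr 2
  rw [real_inner_comm, mul_comm]
  congr 1
  congr 1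
  have := Real.pi_pos.ne'
  field_simp

variable [Nontrivial (Space n)]

theorem ae_ne_zero : ∀ᵐ ξ : Space n, ξ ≠ 0 := by simp [ae_iff]

theorem IsHomogeneousSymbol.integrable (hα : 0 < α) (hd : 0 ≤ d) (hQ : IsHomogeneousSymbol d Q)
    {t : ℝ} (ht : 0 < t) :
    Integrable fun ξ : Space n => Q ξ * ((Real.exp (-t * ‖ξ‖ ^ (2 * α)) : ℝ) : ℂ) := by
  have h := hQ.isHomogeneousSmooth.integrable (a := 2 * α) (by positivity) ht hd
  refine h.congr ?_
  filter_upwards [ae_ne_zero] with ξ hξ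
  simp [hξ, mul_comm]

/-- Substitution `ξ ↦ t^{-1/(2α)} ξ`: it turns `t‖ξ‖^{2α}` into `‖ξ‖^{2α}`, while the Jacobian and
the homogeneity of `Q` produce the prefactor. -/
theorem kernel_smul_rpow (hα : 0 < α) (hQ : IsHomogeneousSymbol d Q)
    {t : ℝ} (ht : 0 < t) (x : Space n) :
    kernel α Q t x = ((t ^ (-((n + d) / (2 * α))) : ℝ) : ℂ) *
      kernel α Q 1 (t ^ (-(1 / (2 * α))) • x) := by
  set c : ℝ := t ^ (-(1 / (2 * α))) with hc
  have hcpos : 0 < c := Real.rpow_pos_of_pos ht _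
  rw [kernel, kernel]
  have h1 := Measure.integral_comp_smul (volume : Measure (Space n))
    (fun ξ : Space n => Complex.exp (Complex.I * ((inner ℝ x ξ : ℝ) : ℂ)) * Q ξ *
      ((Real.exp (-t * ‖ξ‖ ^ (2 * α)) : ℝ) : ℂ)) c
  have h2 : (fun ξ : Space n => Complex.exp (Complex.I * ((inner ℝ x (c • ξ) : ℝ) : ℂ)) * Q (c • ξ) *
      ((Real.exp (-t * ‖c • ξ‖ ^ (2 * α)) : ℝ) : ℂ)) =ᵐ[volume] fun ξ : Space n =>
      ((c ^ d : ℝ) : ℂ) * (Complex.exp (Complex.I * ((inner ℝ (c • x) ξ : ℝ) : ℂ)) * Q ξ *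
      ((Real.exp (-1 * ‖ξ‖ ^ (2 * α)) : ℝ) : ℂ)) := by
    filter_upwards [ae_ne_zero] with ξ hξ
    have e1 : t * ‖c • ξ‖ ^ (2 * α) = ‖ξ‖ ^ (2 * α) := by
      rw [norm_smul, Real.norm_of_nonneg hcpos.le, Real.mul_rpow hcpos.le (norm_nonneg _), hc,
        ← Real.rpow_mul ht.le, ← mul_assoc]
      have : -(1 / (2 * α)) * (2 * α) = -1 := by field_simp
      rw [this, Real.rpow_neg_one, mul_inv_cancel₀ ht.ne', one_mul]
    have e2 : -t * ‖c • ξ‖ ^ (2 * α) = -1 * ‖ξ‖ ^ (2 * α) := by rw [← e1]; ring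
    rw [hQ.homogeneous c hcpos ξ hξ, e2, real_inner_smul_left, real_inner_smul_right]
    ring
  rw [integral_congr_ae h2, integral_const_mul] at h1
  have hcn : 0 < c ^ n := pow_pos hcpos n
  rw [finrank_euclideanSpace, Fintype.card_fin, abs_of_pos (inv_pos.2 hcn)] at h1
  have h3 : ∀ z : ℂ, z = ((c ^ n : ℝ) : ℂ) * ((c ^ n)⁻¹ • z) := by
    intro z
    rw [Complex.real_smul, ← mul_assoc, ← Complex.ofReal_mul, mul_inv_cancel₀ hcn.ne']
    simp
  rw [h3 (∫ ξ : Space n, Complex.exp (Complex.I * ((inner ℝ x ξ : ℝ) : ℂ)) * Q ξ *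
      ((Real.exp (-t * ‖ξ‖ ^ (2 * α)) : ℝ) : ℂ)), ← h1]
  have h4 : t ^ (-((n + d) / (2 * α))) = c ^ n * c ^ d := by
    rw [← Real.rpow_natCast, ← Real.rpow_add hcpos, hc, ← Real.rpow_mul ht.le]
    congr 1
    ring
  rw [h4]
  push_cast
  ring

theorem continuous_kernel_one (hα : 0 < α) (hd : 0 ≤ d) (hQ : IsHomogeneousSymbol d Q) :
    Continuous (kernel α Q 1) := by
  have h : Continuous (𝓕 (fun ξ : Space n => Q ξ *
      ((Real.exp (-1 * ‖ξ‖ ^ (2 * α)) : ℝ) : ℂ))) :=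
    VectorFourier.fourierIntegral_continuous Real.continuous_fourierChar
      (by exact continuous_inner) (hQ.integrable hα hd one_pos)
  have : kernel α Q 1 = fun x => (((2 * Real.pi) ^ n)⁻¹ : ℝ) *
      𝓕 (fun ξ : Space n => Q ξ * ((Real.exp (-1 * ‖ξ‖ ^ (2 * α)) : ℝ) : ℂ))
        (-((2 * Real.pi)⁻¹ • x)) := funext fun x => kernel_eq_fourier 1 x
  rw [this]
  exact continuous_const.mul (h.comp (f := fun x => -((2 * Real.pi)⁻¹ • x)) (by fun_prop))

theorem continuousOn_kernel (hα : 0 < α) (hd : 0 ≤ d) (hQ : IsHomogeneousSymbol d Q) :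
    ContinuousOn (fun z : ℝ × Space n => kernel α Q z.1 z.2) (Ioi 0 ×ˢ univ) := by
  have h1 : ContinuousOn (fun z : ℝ × Space n => ((z.1 ^ (-((n + d) / (2 * α))) : ℝ) : ℂ) *
      kernel α Q 1 (z.1 ^ (-(1 / (2 * α))) • z.2)) (Ioi 0 ×ˢ univ) := by
    have h2 : ∀ a : ℝ, ContinuousOn (fun z : ℝ × Space n => z.1 ^ a) (Ioi 0 ×ˢ univ) := fun a =>
      continuousOn_fst.rpow_const fun z hz => Or.inl (ne_of_gt hz.1)
    exact (Complex.continuous_ofReal.comp_continuousOn (h2 _)).mul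
      ((continuous_kernel_one hα hd hQ).comp_continuousOn ((h2 _).smul continuousOn_snd))
  exact h1.congr fun z hz => kernel_smul_rpow hα hQ hz.1 z.2

/-- Differentiating `e^{-t‖ξ‖^{2α}}` multiplies the symbol by `-‖ξ‖^{2α}`. Differentiation under the
integral is dominated, for times above `t / 2`, by the integrand at `t / 2`. -/
theorem hasDerivAt_kernel (hα : 0 < α) (hd : 0 ≤ d) (hQ : IsHomogeneousSymbol d Q)
    {t : ℝ} (ht : 0 < t) (x : Space n) :
    HasDerivAt (fun s => kernel α Q s x) (-kernel α (laplaceSymbol α Q) t x) t := by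
  have hL := hQ.laplaceSymbol hα
  have hmeas : ∀ s : ℝ, 0 < s → ∀ R : Space n → ℂ, ∀ D : ℝ, 0 ≤ D → IsHomogeneousSymbol D R →
      Integrable (fun ξ : Space n => Complex.exp (Complex.I * ((inner ℝ x ξ : ℝ) : ℂ)) * R ξ *
        ((Real.exp (-s * ‖ξ‖ ^ (2 * α)) : ℝ) : ℂ)) := by
    intro s hs R D hD hR
    simp only [mul_assoc]
    refine (hR.integrable hα hD hs).bdd_mul (c := 1) ?_ (Eventually.of_forall fun ξ => ?_)
    · exact (Complex.continuous_exp.comp (continuous_const.mul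
        (Complex.continuous_ofReal.comp (continuous_const.inner continuous_id)))).aestronglyMeasurable
    · rw [mul_comm, Complex.norm_exp_ofReal_mul_I]
  have h := hasDerivAt_integral_of_dominated_loc_of_deriv_le (μ := (volume : Measure (Space n)))
    (F := fun s ξ => Complex.exp (Complex.I * ((inner ℝ x ξ : ℝ) : ℂ)) * Q ξ *
      ((Real.exp (-s * ‖ξ‖ ^ (2 * α)) : ℝ) : ℂ))
    (F' := fun s ξ => -(Complex.exp (Complex.I * ((inner ℝ x ξ : ℝ) : ℂ)) * laplaceSymbol α Q ξ *
      ((Real.exp (-s * ‖ξ‖ ^ (2 * α)) : ℝ) : ℂ)))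
    (x₀ := t) (s := Ioi (t / 2))
    (bound := fun ξ => ‖laplaceSymbol α Q ξ * ((Real.exp (-(t / 2) * ‖ξ‖ ^ (2 * α)) : ℝ) : ℂ)‖)
    (Ioi_mem_nhds (by linarith)) ?_ (hmeas t ht Q d hd hQ) ?_ ?_ ?_ ?_
  · have h2 := h.2.const_mul ((((2 * Real.pi) ^ n)⁻¹ : ℝ) : ℂ)
    rw [integral_neg, mul_neg] at h2
    exact h2
  · filter_upwards [Ioi_mem_nhds ht] with s hs
    exact (hmeas s hs Q d hd hQ).1
  · exact (hmeas t ht _ _ (by positivity) hL).neg.1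
  · refine Eventually.of_forall fun ξ s hs => ?_
    simp only [norm_neg, norm_mul, Complex.norm_real]
    rw [mul_comm Complex.I, Complex.norm_exp_ofReal_mul_I, one_mul]
    gcongr ?_ * ?_
    rw [Real.norm_of_nonneg (Real.exp_pos _).le, Real.norm_of_nonneg (Real.exp_pos _).le,
      Real.exp_le_exp]
    have : 0 ≤ ‖ξ‖ ^ (2 * α) := by positivity
    have hs' : t / 2 < s := hs
    nlinarith
  · exact (hL.integrable hα (by positivity) (half_pos ht)).norm
  · refine Eventually.of_forall fun ξ s _ => ?_
    have h1 : HasDerivAt (fun s : ℝ => Real.exp (-s * ‖ξ‖ ^ (2 * α)))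
        (Real.exp (-s * ‖ξ‖ ^ (2 * α)) * (-1 * ‖ξ‖ ^ (2 * α))) s :=
      (((hasDerivAt_id s).neg).mul_const _).exp
    have h2 := h1.ofReal_comp.const_mul (Complex.exp (Complex.I * ((inner ℝ x ξ : ℝ) : ℂ)) * Q ξ)
    refine h2.congr_deriv ?_
    simp only [FracDissipative.laplaceSymbol]
    push_cast
    ring

end Kernel

/-! ### Spatial decay of the kernel. -/

section KernelDecay

open FourierTransform

/-- Comparison with a primitive of `C t^{-c-1}`. The sign of `c` is free: `c > 0` serves integration
up to `t = ∞`, and `c < 0` integration down to `t = 0`. -/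
theorem norm_sub_le_of_norm_deriv_le_rpow {f f' : ℝ → ℂ} {C c a b : ℝ} (hc : c ≠ 0) (ha : 0 < a)
    (hab : a ≤ b) (hf : ∀ t, 0 < t → HasDerivAt f (f' t) t)
    (hb : ∀ t, 0 < t → ‖f' t‖ ≤ C * t ^ (-c - 1)) :
    ‖f b - f a‖ ≤ C / c * (a ^ (-c) - b ^ (-c)) := by
  have hpos : ∀ x ∈ Icc a b, 0 < x := fun x hx => ha.trans_le hx.1
  have hB : ∀ x ∈ Icc a b, HasDerivAt (fun t : ℝ => C / c * (a ^ (-c) - t ^ (-c)))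
      (C * x ^ (-c - 1)) x := by
    intro x hx
    have h1 := ((Real.hasDerivAt_rpow_const (p := -c) (Or.inl (hpos x hx).ne')).const_sub
      (a ^ (-c))).const_mul (C / c)
    refine h1.congr_deriv ?_
    field_simp
  have h := image_norm_le_of_norm_deriv_right_le_deriv_boundary' (a := a) (b := b)
    (f := fun t => f t - f a) (f' := f') (B := fun t : ℝ => C / c * (a ^ (-c) - t ^ (-c)))
    (B' := fun x => C * x ^ (-c - 1))
    (fun x hx => ((hf x (hpos x hx)).sub_const _).continuousAt.continuousWithinAt)
    (fun x hx => ((hf x (hpos x ⟨hx.1, hx.2.le⟩)).sub_const _).hasDerivWithinAt) (by simp)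
    (fun x hx => (hB x hx).continuousAt.continuousWithinAt)
    (fun x hx => (hB x ⟨hx.1, hx.2.le⟩).hasDerivWithinAt)
    (fun x hx => hb x (hpos x ⟨hx.1, hx.2.le⟩))
  exact h (right_mem_Icc.2 hab)

variable {n : ℕ} {α d : ℝ} {Q : Space n → ℂ} [Nontrivial (Space n)]

theorem exists_norm_kernel_one_le (α : ℝ) (Q : Space n → ℂ) :
    ∃ C : ℝ, 0 ≤ C ∧ ∀ x, ‖kernel α Q 1 x‖ ≤ C := by
  refine ⟨((2 * Real.pi) ^ n)⁻¹ * ∫ ξ : Space n, ‖Q ξ *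
    ((Real.exp (-1 * ‖ξ‖ ^ (2 * α)) : ℝ) : ℂ)‖, by positivity, fun x => ?_⟩
  rw [kernel_eq_fourier, norm_mul, Complex.norm_real, Real.norm_of_nonneg (by positivity)]
  gcongr
  exact VectorFourier.norm_fourierIntegral_le_integral_norm _ _ _ _ _

theorem norm_rpow_mul_norm_kernel_le (hα : 0 < α) (hQ : IsHomogeneousSymbol d Q)
    {M C : ℝ} (hC : ∀ x, ‖x‖ ^ M * ‖kernel α Q 1 x‖ ≤ C) {t : ℝ} (ht : 0 < t) (x : Space n) :
    ‖x‖ ^ M * ‖kernel α Q t x‖ ≤ C * t ^ (-((n + d - M) / (2 * α))) := by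
  have h := hC (t ^ (-(1 / (2 * α))) • x)
  have hp : 0 < t ^ (-(1 / (2 * α))) := Real.rpow_pos_of_pos ht _
  rw [norm_smul, Real.norm_of_nonneg hp.le, Real.mul_rpow hp.le (norm_nonneg _),
    ← Real.rpow_mul ht.le] at h
  rw [kernel_smul_rpow hα hQ ht, norm_mul, Complex.norm_real,
    Real.norm_of_nonneg (Real.rpow_nonneg ht.le _)]
  have e : t ^ (-((n + d) / (2 * α))) =
      t ^ (-((n + d - M) / (2 * α))) * t ^ (-(1 / (2 * α)) * M) := by
    rw [← Real.rpow_add ht]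
    congr 1
    field_simp
    ring
  rw [e]
  have hp2 : 0 ≤ t ^ (-((n + d - M) / (2 * α))) := Real.rpow_nonneg ht.le _
  nlinarith [mul_le_mul_of_nonneg_right h hp2]

theorem norm_rpow_mul_norm_laplace_le (hα : 0 < α) (hQ : IsHomogeneousSymbol d Q)
    {M C : ℝ} (hC : ∀ x, ‖x‖ ^ M * ‖kernel α (laplaceSymbol α Q) 1 x‖ ≤ C)
    (hM : (n + d - M) / (2 * α) ≠ 0) (hd : 0 ≤ d) {s t : ℝ} (hs : 0 < s) (hst : s ≤ t)
    (x : Space n) :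
    ‖x‖ ^ M * ‖kernel α Q t x - kernel α Q s x‖ ≤ C / ((n + d - M) / (2 * α)) *
      (s ^ (-((n + d - M) / (2 * α))) - t ^ (-((n + d - M) / (2 * α)))) := by
  have hxM : 0 ≤ ‖x‖ ^ M := by positivity
  have h := norm_sub_le_of_norm_deriv_le_rpow (C := C)
    (f := fun t => ((‖x‖ ^ M : ℝ) : ℂ) * kernel α Q t x) hM hs hst
    (fun t ht => (hasDerivAt_kernel hα hd hQ ht x).const_mul _) ?_
  · rwa [← mul_sub, norm_mul, Complex.norm_real, Real.norm_of_nonneg hxM] at h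
  · intro t ht
    rw [norm_mul, norm_neg, Complex.norm_real, Real.norm_of_nonneg hxM]
    refine (norm_rpow_mul_norm_kernel_le hα (hQ.laplaceSymbol hα) hC ht x).trans_eq ?_
    congr 2
    field_simp
    ring

/-- Integration by parts: the damped symbol has `⌈M⌉ < d` integrable derivatives, and each is worth
one power of `‖x‖`. -/
theorem exists_norm_rpow_mul_norm_kernel_le_of_lt (hα : 0 < α) (hQ : IsHomogeneousSymbol d Q)
    {M : ℝ} (hM : 0 ≤ M) (hMd : M + 1 < d) :
    ∃ C : ℝ, ∀ x, ‖x‖ ^ M * ‖kernel α Q 1 x‖ ≤ C := by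
  set m := ⌈M⌉₊ with hm
  have hm1 : M ≤ m := Nat.le_ceil M
  have hm2 : (m : ℝ) < d := (Nat.ceil_lt_add_one hM).trans hMd
  have hd : 0 ≤ d := by linarith
  obtain ⟨hG, hGi⟩ := hQ.isHomogeneousSmooth.contDiff_and_integrable
    (a := 2 * α) (by positivity) m hm2
  set G : Space n → ℂ := fun ξ => Real.exp (-1 * ‖ξ‖ ^ (2 * α)) • if ξ = 0 then 0 else Q ξ with hGdef
  have hae : (fun ξ : Space n => Q ξ * ((Real.exp (-1 * ‖ξ‖ ^ (2 * α)) : ℝ) : ℂ)) =ᵐ[volume] G := by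
    filter_upwards [ae_ne_zero] with ξ hξ
    simp [hGdef, hξ, mul_comm]
  have hb := fun w : Space n => Real.pow_mul_norm_iteratedFDeriv_fourier_le (K := 0) (N := m)
    (f := G) hG (by
      intro k j hk hj
      obtain rfl : k = 0 := by simpa using hk
      simpa using (hGi j (by exact_mod_cast hj)).norm) (k := 0) (n := m) le_rfl le_rfl w
  simp only [norm_iteratedFDeriv_zero] at hb
  obtain ⟨C₁, hC₁⟩ : ∃ C₁, ∀ w : Space n, ‖w‖ ^ m * ‖𝓕 G w‖ ≤ C₁ := ⟨_, hb⟩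
  obtain ⟨C₀, hC₀, hC₀'⟩ := exists_norm_kernel_one_le α Q
  set P : ℝ := (2 * Real.pi) ^ n with hP
  have hPpos : 0 < P := by positivity
  refine ⟨C₀ + P⁻¹ * (2 * Real.pi) ^ m * C₁, fun x => ?_⟩
  have h1 : ‖x‖ ^ m * ‖kernel α Q 1 x‖ ≤ P⁻¹ * (2 * Real.pi) ^ m * C₁ := by
    rw [kernel_eq_fourier, Real.fourier_congr_ae hae, norm_mul, Complex.norm_real,
      Real.norm_of_nonneg (inv_pos.2 hPpos).le]
    have h2 := hC₁ (-((2 * Real.pi)⁻¹ • x))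
    rw [norm_neg, norm_smul, Real.norm_of_nonneg (by positivity), mul_pow] at h2
    have hp : (0 : ℝ) < (2 * Real.pi) ^ m := by positivity
    calc ‖x‖ ^ m * (P⁻¹ * ‖𝓕 G (-((2 * Real.pi)⁻¹ • x))‖)
        = P⁻¹ * (2 * Real.pi) ^ m * ((2 * Real.pi)⁻¹ ^ m * ‖x‖ ^ m *
          ‖𝓕 G (-((2 * Real.pi)⁻¹ • x))‖) := by
          rw [inv_pow]
          field_simp
      _ ≤ _ := by gcongr
  have h3 : ‖x‖ ^ M ≤ 1 + ‖x‖ ^ m := by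
    rcases le_total ‖x‖ 1 with hx | hx
    · have := Real.rpow_le_one (norm_nonneg x) hx hM
      have : 0 ≤ ‖x‖ ^ m := by positivity
      linarith
    · have := Real.rpow_le_rpow_of_exponent_le hx hm1
      rw [Real.rpow_natCast] at this
      linarith
  calc ‖x‖ ^ M * ‖kernel α Q 1 x‖ ≤ (1 + ‖x‖ ^ m) * ‖kernel α Q 1 x‖ := by gcongr
    _ = ‖kernel α Q 1 x‖ + ‖x‖ ^ m * ‖kernel α Q 1 x‖ := by ring
    _ ≤ _ := add_le_add (hC₀' x) h1

/-- Descending induction on the order of the symbol. The bound for `‖ξ‖^{2α} Q` and scaling give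
`‖x‖^M |∂_t k_t(x)| ≤ C t^{-c-1}` with `c = (n + d - M)/(2α)`. As `M < n + d`, this is integrable
over `(1, ∞)`, and `k_t(x) → 0` as `t → ∞`. After `k` such passages the order exceeds `M + 1`, where
integration by parts applies. -/
theorem exists_norm_rpow_mul_norm_kernel_le (hα : 0 < α) (k : ℕ) : ∀ {d : ℝ} {Q : Space n → ℂ}
    {M : ℝ}, IsHomogeneousSymbol d Q → 0 ≤ d → 0 ≤ M → M < n + d → M + 1 < d + 2 * α * k →
    ∃ C : ℝ, ∀ x, ‖x‖ ^ M * ‖kernel α Q 1 x‖ ≤ C := by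
  induction k with
  | zero =>
    intro d Q M hQ hd hM _ hMk
    exact exists_norm_rpow_mul_norm_kernel_le_of_lt hα hQ hM (by simpa using hMk)
  | succ k ih =>
    intro d Q M hQ hd hM hMd hMk
    obtain ⟨C, hC⟩ := ih (hQ.laplaceSymbol hα) (by positivity) hM (by linarith)
      (by push_cast at hMk; linarith)
    obtain ⟨C₀, hC₀, hC₀'⟩ := exists_norm_kernel_one_le α Q
    set c := (n + d - M) / (2 * α) with hc
    have hcpos : 0 < c := div_pos (by linarith) (by positivity)
    refine ⟨C / c, fun x => ?_⟩
    have hn0 : (0 : ℝ) < n + d := by linarith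
    have hlim : Tendsto (fun t => kernel α Q t x) atTop (𝓝 0) := by
      have h1 : Tendsto (fun t : ℝ => t ^ (-((n + d) / (2 * α))) * C₀) atTop (𝓝 0) := by
        simpa using (tendsto_rpow_neg_atTop (y := (n + d) / (2 * α)) (by positivity)).mul_const C₀
      refine squeeze_zero_norm' ?_ h1
      filter_upwards [eventually_gt_atTop 0] with t ht
      rw [kernel_smul_rpow hα hQ ht, norm_mul, Complex.norm_real,
        Real.norm_of_nonneg (Real.rpow_nonneg ht.le _)]
      gcongr
      exact hC₀' _
    have hlim2 : Tendsto (fun t => ‖x‖ ^ M * ‖kernel α Q t x - kernel α Q 1 x‖) atTop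
        (𝓝 (‖x‖ ^ M * ‖kernel α Q 1 x‖)) := by
      have := ((hlim.sub_const (kernel α Q 1 x)).norm).const_mul (‖x‖ ^ M)
      simpa using this
    have hlim3 : Tendsto (fun t : ℝ => C / c * (1 ^ (-c) - t ^ (-c))) atTop (𝓝 (C / c)) := by
      have := ((tendsto_rpow_neg_atTop hcpos).const_sub ((1 : ℝ) ^ (-c))).const_mul (C / c)
      simpa using this
    refine le_of_tendsto_of_tendsto hlim2 hlim3 ?_
    filter_upwards [eventually_ge_atTop 1] with t ht
    exact norm_rpow_mul_norm_laplace_le hα hQ hC hcpos.ne' hd one_pos ht x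

theorem one_add_rpow_le {M r : ℝ} (hM : 0 ≤ M) (hr : 0 ≤ r) :
    (1 + r) ^ M ≤ 2 ^ M * (1 + r ^ M) := by
  rcases le_total r 1 with h | h
  · calc (1 + r) ^ M ≤ 2 ^ M := Real.rpow_le_rpow (by linarith) (by linarith) hM
      _ ≤ 2 ^ M * (1 + r ^ M) := by
        have : 0 ≤ r ^ M := by positivity
        have : (0 : ℝ) < 2 ^ M := by positivity
        nlinarith
  · calc (1 + r) ^ M ≤ (2 * r) ^ M := Real.rpow_le_rpow (by linarith) (by linarith) hM
      _ = 2 ^ M * r ^ M := Real.mul_rpow two_pos.le hr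
      _ ≤ 2 ^ M * (1 + r ^ M) := by gcongr; linarith

theorem norm_le_one_add_norm_rpow {f : Space n → ℂ} {M C₀ C : ℝ} (hM : 0 ≤ M)
    (h₀ : ∀ x, ‖f x‖ ≤ C₀) (h : ∀ x, ‖x‖ ^ M * ‖f x‖ ≤ C) (x : Space n) :
    ‖f x‖ ≤ 2 ^ M * (C₀ + C) * (1 + ‖x‖) ^ (-M) := by
  have h1 : 0 < (1 + ‖x‖) ^ M := by positivity
  rw [Real.rpow_neg (by positivity), ← div_eq_mul_inv, le_div_iff₀ h1]
  calc ‖f x‖ * (1 + ‖x‖) ^ M ≤ ‖f x‖ * (2 ^ M * (1 + ‖x‖ ^ M)) := by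
        gcongr
        exact one_add_rpow_le hM (norm_nonneg _)
    _ = 2 ^ M * (‖f x‖ + ‖x‖ ^ M * ‖f x‖) := by ring
    _ ≤ _ := by gcongr; exacts [h₀ x, h x]

theorem IsHomogeneousSymbol.exists_norm_kernel_le (hα : 0 < α) (hd : 0 ≤ d)
    (hQ : IsHomogeneousSymbol d Q) {M : ℝ} (hM : 0 ≤ M) (hMd : M < n + d) :
    ∃ C : ℝ, ∀ x, ‖kernel α Q 1 x‖ ≤ C * (1 + ‖x‖) ^ (-M) := by
  obtain ⟨k, hk⟩ := exists_nat_gt ((M + 1 - d) / (2 * α))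
  rw [div_lt_iff₀ (by positivity)] at hk
  obtain ⟨C, hC⟩ := exists_norm_rpow_mul_norm_kernel_le hα k hQ hd hM hMd (by linarith)
  obtain ⟨C₀, -, hC₀⟩ := exists_norm_kernel_one_le α Q
  exact ⟨_, norm_le_one_add_norm_rpow hM hC₀ hC⟩

end KernelDecay

/-! ### Decay of the heat kernel beyond the order `n`. -/

section HeatKernel

open FourierTransform

variable {n : ℕ} {α : ℝ} [Nontrivial (Space n)]

/-- The heat kernel tends to a point mass at the origin. By the multiplication formula the integral
is a constant times `∫ 𝓕 ψ e^{-t‖ξ‖^{2α}}`, with `ψ` a dilate of `g`; as `t → 0` this tends to `∫ 𝓕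
ψ = ψ 0 = g 0 = 0`. -/
theorem tendsto_integral_smul_kernel (hα : 0 < α) {g : Space n → ℝ} (hg : ContDiff ℝ ∞ g)
    (hgc : HasCompactSupport g) (hg0 : g 0 = 0) :
    Tendsto (fun t => ∫ x, g x • kernel α (fun _ : Space n => 1) t x) (𝓝[>] 0) (𝓝 0) := by
  have hQ := isHomogeneousSymbol_one n
  set c : ℝ := -(2 * Real.pi)⁻¹ with hc
  have hπ := Real.pi_pos
  have hc0 : c ≠ 0 := neg_ne_zero.2 (inv_ne_zero (by positivity))
  set ψ : Space n → ℂ := fun y => ((g (c⁻¹ • y) : ℝ) : ℂ) with hψ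
  have hψs : ContDiff ℝ ∞ ψ :=
    Complex.ofRealCLM.contDiff.comp (hg.comp (contDiff_const_smul c⁻¹))
  have hψc : HasCompactSupport ψ := by
    have h1 : HasCompactSupport fun y : Space n => g (c⁻¹ • y) :=
      hgc.comp_smul (inv_ne_zero hc0)
    exact h1.comp_left (g := fun r : ℝ => (r : ℂ)) (by simp)
  set Ψ := hψc.toSchwartzMap hψs with hΨ
  have hψi : Integrable ψ := Ψ.integrable
  have hFψ : Integrable (𝓕 ψ) := (𝓕 Ψ).integrable
  have key : ∀ t, 0 < t → ∫ x, g x • kernel α (fun _ : Space n => 1) t x =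
      ((((2 * Real.pi) ^ n)⁻¹ : ℝ) : ℂ) * (|(c ^ n)⁻¹| • ∫ ξ, 𝓕 ψ ξ *
        ((Real.exp (-t * ‖ξ‖ ^ (2 * α)) : ℝ) : ℂ)) := by
    intro t ht
    set G : Space n → ℂ := fun ξ => (1 : ℂ) * ((Real.exp (-t * ‖ξ‖ ^ (2 * α)) : ℝ) : ℂ) with hG
    have hGi : Integrable G := hQ.integrable hα le_rfl ht
    have h1 := VectorFourier.integral_fourierIntegral_smul_eq_flip (L := innerₗ (Space n))
      Real.continuous_fourierChar continuous_inner hψi hGi (μ := volume) (ν := volume)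
    rw [flip_innerₗ] at h1
    have h2 : ∫ ξ, 𝓕 ψ ξ * ((Real.exp (-t * ‖ξ‖ ^ (2 * α)) : ℝ) : ℂ) = ∫ y, ψ y * 𝓕 G y := by
      refine Eq.trans ?_ h1
      refine integral_congr_ae (Eventually.of_forall fun ξ => ?_)
      simp only [hG, one_mul, smul_eq_mul]
      rfl
    have h3 := Measure.integral_comp_smul (volume : Measure (Space n)) (fun y => ψ y * 𝓕 G y) c
    rw [finrank_euclideanSpace, Fintype.card_fin] at h3
    have h4 : ∫ x, g x • kernel α (fun _ : Space n => 1) t x =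
        ((((2 * Real.pi) ^ n)⁻¹ : ℝ) : ℂ) * ∫ x, ψ (c • x) * 𝓕 G (c • x) := by
      rw [← integral_const_mul]
      refine integral_congr_ae (Eventually.of_forall fun x => ?_)
      simp only [kernel_eq_fourier, hψ, smul_smul, inv_mul_cancel₀ hc0, one_smul,
        Complex.real_smul]
      rw [← neg_smul, ← hc]
      ring
    rw [h4, h3, h2]
  have hlim : Tendsto (fun t : ℝ => ∫ ξ, 𝓕 ψ ξ *
      ((Real.exp (-t * ‖ξ‖ ^ (2 * α)) : ℝ) : ℂ)) (𝓝[>] 0) (𝓝 (∫ ξ, 𝓕 ψ ξ)) := by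
    refine tendsto_integral_filter_of_dominated_convergence (fun ξ => ‖𝓕 ψ ξ‖) ?_ ?_ hFψ.norm ?_
    · filter_upwards with t
      refine hFψ.1.mul (Continuous.aestronglyMeasurable ?_)
      exact Complex.continuous_ofReal.comp (Real.continuous_exp.comp (continuous_const.mul
        (continuous_norm.rpow_const fun _ => Or.inr (by positivity))))
    · filter_upwards [self_mem_nhdsWithin] with t ht
      filter_upwards with ξ
      rw [norm_mul, Complex.norm_real, Real.norm_of_nonneg (Real.exp_pos _).le]
      refine mul_le_of_le_one_right (norm_nonneg _) (Real.exp_le_one_iff.2 ?_)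
      have : 0 ≤ ‖ξ‖ ^ (2 * α) := by positivity
      have ht' : (0 : ℝ) < t := ht
      nlinarith
    · filter_upwards with ξ
      have h1 : Continuous fun t : ℝ => 𝓕 ψ ξ * ((Real.exp (-t * ‖ξ‖ ^ (2 * α)) : ℝ) : ℂ) := by
        fun_prop
      simpa using (h1.tendsto 0).mono_left nhdsWithin_le_nhds
  have hzero : ∫ ξ, 𝓕 ψ ξ = 0 := by
    have h1 := congrFun (hψs.continuous.fourierInv_fourier_eq hψi hFψ) 0
    rw [Real.fourierInv_eq'] at h1
    simpa [hψ, hg0] using h1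
  rw [hzero] at hlim
  have h5 := (hlim.const_smul (|(c ^ n)⁻¹|)).const_mul ((((2 * Real.pi) ^ n)⁻¹ : ℝ) : ℂ)
  rw [smul_zero, mul_zero] at h5
  refine h5.congr' ?_
  filter_upwards [self_mem_nhdsWithin] with t ht
  exact (key t ht).symm

/-- Integrating the time derivative up to `∞` stops at decay below `n`, which misses `L^1`. For `M >
n` the integral down to `t = 0` converges instead, so `K_s(x)` has a limit as `s → 0` for each `x ≠
0`, within `O(‖x‖^{-M})` of `K_1(x)`. The limit vanishes almost everywhere, because the heat kernel
concentrates at the origin. -/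
theorem exists_norm_heatKernel_le (hα : 0 < α) :
    ∃ M : ℝ, n < M ∧ ∃ C : ℝ, ∀ x : Space n,
      ‖kernel α (fun _ : Space n => 1) 1 x‖ ≤ C * (1 + ‖x‖) ^ (-M) := by
  have hQ := isHomogeneousSymbol_one n
  set K := kernel α (fun _ : Space n => 1) with hK
  set M : ℝ := n + α with hM
  have hn : (0 : ℝ) ≤ n := Nat.cast_nonneg n
  have hM0 : 0 ≤ M := by positivity
  obtain ⟨k, hk⟩ := exists_nat_gt ((M + 1 - (2 * α + 0)) / (2 * α))
  rw [div_lt_iff₀ (by positivity)] at hk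
  obtain ⟨C, hC⟩ := exists_norm_rpow_mul_norm_kernel_le hα k (hQ.laplaceSymbol hα) (by positivity)
    hM0 (by linarith) (by linarith)
  have hCn : 0 ≤ C := le_trans (by positivity) (hC 0)
  have hexp : (n + 0 - M) / (2 * α) = -(1 / 2) := by
    rw [hM]; field_simp; ring
  have hdiff : ∀ s t : ℝ, 0 < s → s ≤ t → t ≤ 1 → ∀ x : Space n,
      ‖x‖ ^ M * ‖K t x - K s x‖ ≤ 2 * C * t ^ (1 / 2 : ℝ) := by
    intro s t hs hst ht x
    have h := norm_rpow_mul_norm_laplace_le hα hQ hC (by rw [hexp]; norm_num) le_rfl hs hst x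
    rw [hexp, neg_neg] at h
    refine h.trans ?_
    have : 0 ≤ s ^ (1 / 2 : ℝ) := Real.rpow_nonneg hs.le _
    have e : C / -(1 / 2) * (s ^ (1 / 2 : ℝ) - t ^ (1 / 2 : ℝ)) =
      2 * C * t ^ (1 / 2 : ℝ) - 2 * C * s ^ (1 / 2 : ℝ) := by ring
    rw [e]
    nlinarith [mul_nonneg hCn this]
  set s : ℕ → ℝ := fun j => 1 / ((j : ℝ) + 1) with hs
  have hs0 : ∀ j, 0 < s j := fun j => by positivity
  have hs1 : ∀ j, s j ≤ 1 := fun j => by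
    rw [hs]; simp only; rw [div_le_one (by positivity)]
    have : (0 : ℝ) ≤ j := Nat.cast_nonneg j
    linarith
  have hslim : Tendsto s atTop (𝓝 0) := tendsto_one_div_add_atTop_nhds_zero_nat
  have hanti : Antitone s := fun i j hij => by
    simp only [hs]
    gcongr
  have hcauchy : ∀ x : Space n, x ≠ 0 → ∃ l, Tendsto (fun j => K (s j) x) atTop (𝓝 l) := by
    intro x hx
    have hxM : 0 < ‖x‖ ^ M := Real.rpow_pos_of_pos (norm_pos_iff.2 hx) _
    refine cauchySeq_tendsto_of_complete (cauchySeq_of_le_tendsto_0'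
      (fun j => 2 * C * (s j) ^ (1 / 2 : ℝ) / ‖x‖ ^ M) (fun i j hij => ?_) ?_)
    · rw [dist_eq_norm, le_div_iff₀ hxM, mul_comm]
      exact hdiff _ _ (hs0 j) (hanti hij) (hs1 i) x
    · have h1 : Tendsto (fun j => (s j) ^ (1 / 2 : ℝ)) atTop (𝓝 0) := by
        have := (Real.continuousAt_rpow_const 0 (1 / 2 : ℝ) (Or.inr (by norm_num))).tendsto.comp
          hslim
        simpa [Real.zero_rpow, Function.comp_def] using this
      simpa using (h1.const_mul (2 * C)).div_const (‖x‖ ^ M)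
  choose! l hl using hcauchy
  have hKc : ∀ t, 0 < t → Continuous (K t) := by
    intro t ht
    have h := continuousOn_kernel hα le_rfl hQ
    exact h.comp_continuous (f := fun x : Space n => (t, x)) (by fun_prop) fun x => ⟨ht, mem_univ _⟩
  have hbound : ∀ x ≠ 0, ‖x‖ ^ M * ‖K 1 x - l x‖ ≤ 2 * C := by
    intro x hx
    have h1 := (((hl x hx).const_sub (K 1 x)).norm).const_mul (‖x‖ ^ M)
    refine le_of_tendsto' h1 fun j => ?_
    simpa using hdiff _ _ (hs0 j) (hs1 j) le_rfl x
  have hlm : AEStronglyMeasurable l (volume : Measure (Space n)) :=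
    aestronglyMeasurable_of_tendsto_ae atTop (fun j => (hKc _ (hs0 j)).aestronglyMeasurable)
      (by filter_upwards [ae_ne_zero] with x hx using hl x hx)
  have hcpt : ∀ S : Set (Space n), IsCompact S → S ⊆ {0}ᶜ → ∃ B : ℝ, 0 ≤ B ∧
      ∀ x ∈ S, ∀ j, ‖K (s j) x‖ ≤ B := by
    intro S hS hS0
    have hc : ContinuousOn (fun x : Space n => ‖K 1 x‖ + 2 * C * ‖x‖ ^ (-M)) S := by
      refine (hKc 1 one_pos).norm.continuousOn.add (continuousOn_const.mul
        (continuous_norm.continuousOn.rpow_const fun x hx => Or.inl (norm_ne_zero_iff.2 (hS0 hx))))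
    obtain ⟨B, hB⟩ := hS.exists_bound_of_continuousOn hc
    refine ⟨max B 0, le_max_right _ _, fun x hx j => ?_⟩
    have hx0 : x ≠ 0 := hS0 hx
    have hxM : 0 < ‖x‖ ^ M := Real.rpow_pos_of_pos (norm_pos_iff.2 hx0) _
    have h1 := hdiff _ _ (hs0 j) (hs1 j) le_rfl x
    rw [Real.one_rpow, mul_one, mul_comm, ← le_div_iff₀ hxM, div_eq_mul_inv,
      ← Real.rpow_neg (norm_nonneg _)] at h1
    have h2 : ‖K (s j) x‖ ≤ ‖K 1 x‖ + ‖K 1 x - K (s j) x‖ := by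
      have := norm_sub_le (K 1 x) (K 1 x - K (s j) x)
      rwa [sub_sub_cancel] at this
    calc ‖K (s j) x‖ ≤ ‖K 1 x‖ + 2 * C * ‖x‖ ^ (-M) := h2.trans (by linarith)
      _ ≤ B := (le_abs_self _).trans (hB x hx)
      _ ≤ _ := le_max_left _ _
  have hlB : ∀ S : Set (Space n), IsCompact S → S ⊆ {0}ᶜ → ∃ B : ℝ, ∀ x ∈ S, ‖l x‖ ≤ B := by
    intro S hS hS0
    obtain ⟨B, _, hB⟩ := hcpt S hS hS0
    exact ⟨B, fun x hx => le_of_tendsto' ((hl x (hS0 hx)).norm) fun j => hB x hx j⟩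
  -- Tested against a smooth function supported away from the origin, the kernels tend both to the
  -- integral of `l` and to `0`.
  have hl0 : ∀ᵐ x : Space n, x ∈ ({0}ᶜ : Set (Space n)) → l x = 0 := by
    refine isOpen_compl_singleton.ae_eq_zero_of_integral_contDiff_smul_eq_zero ?_ ?_
    · refine (locallyIntegrableOn_iff isOpen_compl_singleton.isLocallyClosed).2 fun S hS0 hS => ?_
      obtain ⟨B, hB⟩ := hlB S hS hS0
      exact Measure.integrableOn_of_bounded (M := B) hS.measure_lt_top.ne hlm
        (by filter_upwards [ae_restrict_mem hS.measurableSet] with x hx using hB x hx)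
    · intro g hg hgc hgU
      have hg0 : g 0 = 0 := by
        by_contra h
        exact hgU (subset_tsupport g h) rfl
      have h1 := (tendsto_integral_smul_kernel hα hg hgc hg0).comp
        (tendsto_nhdsWithin_iff.2 ⟨hslim, Eventually.of_forall hs0⟩)
      obtain ⟨B, hB0, hB⟩ := hcpt _ hgc hgU
      have h2 : Tendsto (fun j => ∫ x, g x • K (s j) x) atTop (𝓝 (∫ x, g x • l x)) := by
        refine tendsto_integral_of_dominated_convergence (fun x => |g x| * B) ?_ ?_ ?_ ?_
        · exact fun j => (hg.continuous.smul (hKc _ (hs0 j))).aestronglyMeasurable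
        · exact ((hg.continuous.integrable_of_hasCompactSupport hgc).abs).mul_const B
        · intro j
          filter_upwards with x
          rw [norm_smul, Real.norm_eq_abs]
          by_cases hx : x ∈ tsupport g
          · gcongr
            exact hB x hx j
          · simp [image_eq_zero_of_notMem_tsupport hx]
        · filter_upwards [ae_ne_zero] with x hx
          exact (hl x hx).const_smul _
      exact tendsto_nhds_unique h2 h1
  obtain ⟨C₀, -, hC₀⟩ := exists_norm_kernel_one_le α (fun _ : Space n => 1)
  refine ⟨M, by linarith, _, norm_le_one_add_norm_rpow hM0 hC₀ (C := 2 * C) fun x => ?_⟩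
  -- The bound holds almost everywhere, hence on a dense set, and it is a closed condition because
  -- `K 1` is continuous.
  have hae : ∀ᵐ x : Space n, ‖x‖ ^ M * ‖K 1 x‖ ≤ 2 * C := by
    filter_upwards [hl0, ae_ne_zero] with x hx hx0
    have := hbound x hx0
    rwa [hx hx0, sub_zero] at this
  have hcl : IsClosed {x : Space n | ‖x‖ ^ M * ‖K 1 x‖ ≤ 2 * C} :=
    isClosed_le ((continuous_norm.rpow_const fun _ => Or.inr hM0).mul (hKc 1 one_pos).norm)
      continuous_const
  have hd := (Measure.dense_of_ae hae).closure_eq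
  rw [hcl.closure_eq] at hd
  have hx : x ∈ {x : Space n | ‖x‖ ^ M * ‖K 1 x‖ ≤ 2 * C} := by rw [hd]; exact mem_univ x
  exact hx

end HeatKernel

/-! ### Lebesgue norms of the kernel, its mass and its convolution identity. -/

section KernelLp

open FourierTransform

variable {n : ℕ} {α d : ℝ} {Q : Space n → ℂ} [Nontrivial (Space n)]

/-- Pointwise decay of `kernel α Q 1` which puts it in `L^m`. -/
def HasKernelLp (α : ℝ) (Q : Space n → ℂ) (m : ℝ) : Prop :=
  ∃ M C : ℝ, n < M * m ∧ ∀ x, ‖kernel α Q 1 x‖ ≤ C * (1 + ‖x‖) ^ (-M)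

theorem natCast_pos_of_nontrivial (n : ℕ) [Nontrivial (Space n)] : (0 : ℝ) < n := by
  have h : 0 < Module.finrank ℝ (Space n) := Module.finrank_pos
  rw [finrank_euclideanSpace, Fintype.card_fin] at h
  exact_mod_cast h

/-- The decay order `M` can be taken between `n / m` and `n` exactly because `m > 1`; the case `m =
1` is reserved for the heat kernel. -/
theorem IsHomogeneousSymbol.hasKernelLp (hα : 0 < α) (hd : 0 ≤ d) (hQ : IsHomogeneousSymbol d Q)
    {m : ℝ} (hm : 1 < m) : HasKernelLp α Q m := by
  have hn := natCast_pos_of_nontrivial n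
  have h1 : (n : ℝ) / m < n := div_lt_self hn hm
  obtain ⟨M, hM1, hM2⟩ := exists_between h1
  have hM0 : 0 ≤ M := le_trans (by positivity) hM1.le
  obtain ⟨C, hC⟩ := hQ.exists_norm_kernel_le hα hd hM0 (by linarith)
  exact ⟨M, C, (div_lt_iff₀ (by linarith)).1 hM1, hC⟩

theorem hasKernelLp_one (hα : 0 < α) {m : ℝ} (hm : 1 ≤ m) :
    HasKernelLp α (fun _ : Space n => 1) m := by
  obtain ⟨M, hM, C, hC⟩ := exists_norm_heatKernel_le (n := n) hα
  have hn : (0 : ℝ) ≤ n := Nat.cast_nonneg n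
  exact ⟨M, C, by nlinarith, hC⟩

theorem memLp_one_add_norm_rpow {M m : ℝ} (hm : 0 < m) (hM : n < M * m) :
    MemLp (fun x : Space n => (1 + ‖x‖) ^ (-M)) (ENNReal.ofReal m) volume := by
  have hc : Continuous fun x : Space n => (1 + ‖x‖) ^ (-M) :=
    Continuous.rpow_const (by fun_prop) fun x => Or.inl (by have := norm_nonneg x; positivity)
  rw [← integrable_norm_rpow_iff hc.aestronglyMeasurable (by simpa using hm) ENNReal.ofReal_ne_top]
  rw [ENNReal.toReal_ofReal hm.le]
  have h := integrable_one_add_norm (E := Space n) (μ := volume) (r := M * m) (by simpa using hM)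
  refine h.congr (Eventually.of_forall fun x => ?_)
  simp only
  rw [Real.norm_of_nonneg (by positivity), ← Real.rpow_mul (by positivity)]
  congr 1
  ring

theorem exists_norm_kernel_le_of_mem_Icc (hα : 0 < α) (hQ : IsHomogeneousSymbol d Q) {M C : ℝ}
    (hM : 0 ≤ M) (hC : ∀ x, ‖kernel α Q 1 x‖ ≤ C * (1 + ‖x‖) ^ (-M)) {a b : ℝ} (ha : 0 < a) :
    ∃ C' : ℝ, 0 ≤ C' ∧ ∀ t ∈ Icc a b, ∀ x, ‖kernel α Q t x‖ ≤ C' * (1 + ‖x‖) ^ (-M) := by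
  have hC0 : 0 ≤ C := by simpa using (norm_nonneg _).trans (hC 0)
  rcases lt_or_ge b a with hab | hab
  · exact ⟨0, le_rfl, fun t ht => absurd (ht.1.trans ht.2) (not_le.2 hab)⟩
  have hb : 0 < b := ha.trans_le hab
  obtain ⟨B, hB⟩ := (isCompact_Icc (a := a) (b := b)).exists_bound_of_continuousOn
    (f := fun t : ℝ => t ^ (-((n + d) / (2 * α))))
    (continuousOn_id.rpow_const fun t ht => Or.inl (ha.trans_le ht.1).ne')
  -- With this `c`, `c (1 + ‖x‖) ≤ 1 + t^{-1/(2α)} ‖x‖` for every `t ≤ b`, so decay at time `1`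
  -- passes to the whole interval.
  set c : ℝ := min 1 (b ^ (-(1 / (2 * α)))) with hc
  have hcpos : 0 < c := lt_min one_pos (Real.rpow_pos_of_pos hb _)
  refine ⟨max B 0 * (C * c ^ (-M)), by positivity, fun t ht x => ?_⟩
  have ht0 : 0 < t := ha.trans_le ht.1
  rw [kernel_smul_rpow hα hQ ht0, norm_mul, Complex.norm_real, mul_assoc (max B 0)]
  have h1 : c ≤ t ^ (-(1 / (2 * α))) := (min_le_right _ _).trans
    (Real.rpow_le_rpow_of_nonpos ht0 ht.2 (by
      have : 0 < 1 / (2 * α) := by positivity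
      linarith))
  refine mul_le_mul ((hB t ht).trans (le_max_left _ _)) ?_ (norm_nonneg _) (le_max_right _ _)
  refine (hC _).trans ?_
  rw [mul_assoc, ← Real.mul_rpow hcpos.le (by positivity)]
  gcongr C * ?_
  refine Real.rpow_le_rpow_of_nonpos (by positivity) ?_ (by linarith)
  rw [norm_smul, Real.norm_of_nonneg (Real.rpow_nonneg ht0.le _), mul_add, mul_one]
  gcongr
  exact min_le_left _ _

theorem continuous_kernel (hα : 0 < α) (hd : 0 ≤ d) (hQ : IsHomogeneousSymbol d Q) {t : ℝ}
    (ht : 0 < t) : Continuous (kernel α Q t) :=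
  (continuousOn_kernel hα hd hQ).comp_continuous (f := fun x : Space n => (t, x)) (by fun_prop)
    fun _ => ⟨ht, mem_univ _⟩

theorem HasKernelLp.memLp (hα : 0 < α) (hd : 0 ≤ d) (hQ : IsHomogeneousSymbol d Q) {m : ℝ}
    (hm : 1 ≤ m) (h : HasKernelLp α Q m) {t : ℝ} (ht : 0 < t) :
    MemLp (kernel α Q t) (ENNReal.ofReal m) volume := by
  obtain ⟨M, C, hM, hC⟩ := h
  have hn := natCast_pos_of_nontrivial n
  have hM0 : 0 ≤ M := by
    by_contra hlt
    nlinarith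
  obtain ⟨C', -, hC'⟩ := exists_norm_kernel_le_of_mem_Icc hα hQ hM0 hC (b := t) ht
  refine ((memLp_one_add_norm_rpow (by linarith) hM).const_mul C').of_le_mul (c := 1)
    (continuous_kernel hα hd hQ ht).aestronglyMeasurable (Eventually.of_forall fun x => ?_)
  rw [one_mul]
  exact (hC' t ⟨le_rfl, le_rfl⟩ x).trans (le_abs_self _)

theorem eLpNorm_comp_smul {f : Space n → ℂ} {c m : ℝ} (hc : 0 < c) (hm : 1 ≤ m) :
    eLpNorm (fun x => f (c • x)) (ENNReal.ofReal m) volume =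
      ENNReal.ofReal (c ^ (-(n / m))) * eLpNorm f (ENNReal.ofReal m) volume := by
  have hm0 : 0 < m := by linarith
  have hne : ENNReal.ofReal m ≠ 0 := by simpa using hm0
  rw [eLpNorm_eq_lintegral_rpow_enorm_toReal hne ENNReal.ofReal_ne_top,
    eLpNorm_eq_lintegral_rpow_enorm_toReal hne ENNReal.ofReal_ne_top, ENNReal.toReal_ofReal hm0.le]
  have h1 : ∫⁻ x, ‖f (c • x)‖ₑ ^ m = ENNReal.ofReal ((c ^ n)⁻¹) * ∫⁻ x, ‖f x‖ₑ ^ m := by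
    have h2 := Measure.map_addHaar_smul (volume : Measure (Space n)) hc.ne'
    rw [finrank_euclideanSpace, Fintype.card_fin, abs_of_pos (by positivity)] at h2
    have h3 : ∫⁻ x, ‖f x‖ₑ ^ m ∂(Measure.map (fun x : Space n => c • x) volume) =
        ∫⁻ x, ‖f (c • x)‖ₑ ^ m :=
      lintegral_map_equiv _ (Homeomorph.smulOfNeZero c hc.ne').toMeasurableEquiv
    rw [← h3]
    have h5 : Measure.map (fun x : Space n => c • x) volume =
      ENNReal.ofReal ((c ^ n)⁻¹) • (volume : Measure (Space n)) := h2
    rw [h5, lintegral_smul_measure, smul_eq_mul]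
  rw [h1, ENNReal.mul_rpow_of_nonneg _ _ (by positivity),
    ENNReal.ofReal_rpow_of_pos (by positivity)]
  congr 2
  rw [← Real.rpow_natCast, ← Real.rpow_neg hc.le, ← Real.rpow_mul hc.le]
  congr 1
  ring

theorem eLpNorm_kernel (hα : 0 < α) (hQ : IsHomogeneousSymbol d Q) {m : ℝ} (hm : 1 ≤ m)
    {t : ℝ} (ht : 0 < t) :
    eLpNorm (kernel α Q t) (ENNReal.ofReal m) volume =
      ENNReal.ofReal (t ^ (-((d + n * (1 - 1 / m)) / (2 * α)))) *
        eLpNorm (kernel α Q 1) (ENNReal.ofReal m) volume := by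
  have h1 : kernel α Q t = ((t ^ (-((n + d) / (2 * α))) : ℝ) : ℂ) •
      fun x => kernel α Q 1 (t ^ (-(1 / (2 * α))) • x) := funext fun x => kernel_smul_rpow hα hQ ht x
  have hp : 0 < t ^ (-(1 / (2 * α))) := Real.rpow_pos_of_pos ht _
  rw [h1, eLpNorm_const_smul, eLpNorm_comp_smul hp hm, ← mul_assoc]
  congr 1
  rw [← ofReal_norm, Complex.norm_real, Real.norm_of_nonneg (Real.rpow_nonneg ht.le _),
    ← ENNReal.ofReal_mul (Real.rpow_nonneg ht.le _), ← Real.rpow_mul ht.le, ← Real.rpow_add ht]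
  congr 2
  have : m ≠ 0 := by linarith
  field_simp
  ring

theorem HasKernelLp.tendsto_eLpNorm_sub (hα : 0 < α) (hd : 0 ≤ d) (hQ : IsHomogeneousSymbol d Q)
    {m : ℝ} (hm : 1 ≤ m) (h : HasKernelLp α Q m) {t₀ : ℝ} (ht₀ : 0 < t₀) :
    Tendsto (fun t => eLpNorm (kernel α Q t - kernel α Q t₀) (ENNReal.ofReal m) volume)
      (𝓝 t₀) (𝓝 0) := by
  obtain ⟨M, C, hM, hC⟩ := h
  have hn := natCast_pos_of_nontrivial n
  have hM0 : 0 ≤ M := by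
    by_contra hlt
    nlinarith
  have hm0 : 0 < m := by linarith
  obtain ⟨C', hC'0, hC'⟩ := exists_norm_kernel_le_of_mem_Icc hα hQ hM0 hC (a := t₀ / 2)
    (b := 2 * t₀) (half_pos ht₀)
  have hmem : Icc (t₀ / 2) (2 * t₀) ∈ 𝓝 t₀ := Icc_mem_nhds (by linarith) (by linarith)
  have hD : MemLp (fun x : Space n => 2 * C' * (1 + ‖x‖) ^ (-M)) (ENNReal.ofReal m) volume :=
    (memLp_one_add_norm_rpow hm0 hM).const_mul (2 * C')
  have hne : ENNReal.ofReal m ≠ 0 := by simpa using hm0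
  have hlim : Tendsto (fun t => ∫⁻ x, ‖(kernel α Q t - kernel α Q t₀) x‖ₑ ^ m) (𝓝 t₀)
      (𝓝 (∫⁻ _ : Space n, 0)) := by
    refine tendsto_lintegral_filter_of_dominated_convergence
      (fun x => ‖2 * C' * (1 + ‖x‖) ^ (-M)‖ₑ ^ m) ?_ ?_ ?_ ?_
    · filter_upwards [lt_mem_nhds ht₀] with t ht
      exact ((continuous_kernel hα hd hQ ht).sub
        (continuous_kernel hα hd hQ ht₀)).measurable.enorm.pow_const m
    · filter_upwards [hmem] with t ht
      filter_upwards with x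
      refine ENNReal.rpow_le_rpow ?_ hm0.le
      rw [enorm_le_iff_norm_le, Real.norm_of_nonneg (by positivity)]
      refine (norm_sub_le _ _).trans ?_
      have h1 := hC' t ht x
      have h2 := hC' t₀ (mem_of_mem_nhds hmem) x
      linarith
    · have := lintegral_rpow_enorm_lt_top_of_eLpNorm_lt_top hne ENNReal.ofReal_ne_top hD.2
      rw [ENNReal.toReal_ofReal hm0.le] at this
      exact this.ne
    · filter_upwards with x
      have h1 : ContinuousAt (fun t => kernel α Q t x) t₀ :=
        (hasDerivAt_kernel hα hd hQ ht₀ x).continuousAt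
      have h2 : Tendsto (fun t => (kernel α Q t - kernel α Q t₀) x) (𝓝 t₀) (𝓝 0) := by
        simpa using h1.tendsto.sub_const (kernel α Q t₀ x)
      have h3 := ((continuous_enorm.tendsto (0 : ℂ)).comp h2).ennrpow_const m
      simpa [ENNReal.zero_rpow_of_pos hm0, Function.comp_def] using h3
  simp only [lintegral_zero] at hlim
  have h4 := hlim.ennrpow_const (1 / m)
  rw [ENNReal.zero_rpow_of_pos (by positivity)] at h4
  refine h4.congr fun t => ?_
  rw [eLpNorm_eq_lintegral_rpow_enorm_toReal hne ENNReal.ofReal_ne_top, ENNReal.toReal_ofReal hm0.le]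

theorem integrable_heatKernel (hα : 0 < α) {t : ℝ} (ht : 0 < t) :
    Integrable (kernel α (fun _ : Space n => 1) t) := by
  have h := (hasKernelLp_one (n := n) hα le_rfl).memLp hα le_rfl (isHomogeneousSymbol_one n) le_rfl
    ht
  rw [ENNReal.ofReal_one] at h
  exact memLp_one_iff_integrable.1 h

/-- Fourier inversion for `e^{-t‖ξ‖^{2α}}`. Its Fourier transform is integrable because the heat
kernel is in `L^1`. -/
theorem integral_heatKernel_mul_exp (hα : 0 < α) {t : ℝ} (ht : 0 < t) (ξ : Space n) :
    ∫ z, kernel α (fun _ : Space n => 1) t z *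
      Complex.exp (-(Complex.I * ((inner ℝ z ξ : ℝ) : ℂ))) =
      ((Real.exp (-t * ‖ξ‖ ^ (2 * α)) : ℝ) : ℂ) := by
  have hπ := Real.pi_pos
  set G : Space n → ℂ := fun ξ => (1 : ℂ) * ((Real.exp (-t * ‖ξ‖ ^ (2 * α)) : ℝ) : ℂ) with hG
  have hGi : Integrable G := (isHomogeneousSymbol_one n).integrable hα le_rfl ht
  have hGc : Continuous G := by
    refine continuous_const.mul (Complex.continuous_ofReal.comp (Real.continuous_exp.comp
      (continuous_const.mul (continuous_norm.rpow_const fun _ => Or.inr (by positivity)))))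
  set c : ℝ := -(2 * Real.pi)⁻¹ with hc
  have hc0 : c ≠ 0 := neg_ne_zero.2 (inv_ne_zero (by positivity))
  have hK : ∀ x : Space n, kernel α (fun _ : Space n => 1) t x =
      (((2 * Real.pi) ^ n)⁻¹ : ℝ) * 𝓕 G (c • x) := by
    intro x
    rw [kernel_eq_fourier, hc, neg_smul]
  have hP : ((((2 * Real.pi) ^ n)⁻¹ : ℝ) : ℂ) ≠ 0 := by
    rw [Complex.ofReal_ne_zero]
    positivity
  have hFi : Integrable (𝓕 G) := by
    have h1 := integrable_heatKernel (n := n) hα ht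
    have h2 : Integrable fun x : Space n => 𝓕 G (c • x) := by
      refine (h1.const_mul ((((2 * Real.pi) ^ n)⁻¹ : ℝ) : ℂ)⁻¹).congr
        (Eventually.of_forall fun x => ?_)
      simp only [hK]
      rw [← mul_assoc, inv_mul_cancel₀ hP, one_mul]
    exact (integrable_comp_smul_iff volume (𝓕 G) hc0).1 h2
  have h1 := congrFun (hGc.fourierInv_fourier_eq hGi hFi) ξ
  rw [Real.fourierInv_eq'] at h1
  have h3 := Measure.integral_comp_smul (volume : Measure (Space n))
    (fun v => Complex.exp (((2 * Real.pi * inner ℝ v ξ : ℝ) : ℂ) * Complex.I) • 𝓕 G v) c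
  rw [finrank_euclideanSpace, Fintype.card_fin, h1] at h3
  have h4 : |(c ^ n)⁻¹| = (2 * Real.pi) ^ n := by
    rw [hc, abs_inv, abs_pow, abs_neg, abs_of_pos (by positivity), inv_pow, inv_inv]
  calc ∫ z, kernel α (fun _ : Space n => 1) t z *
      Complex.exp (-(Complex.I * ((inner ℝ z ξ : ℝ) : ℂ)))
      = ∫ z, ((((2 * Real.pi) ^ n)⁻¹ : ℝ) : ℂ) * (Complex.exp
        (((2 * Real.pi * inner ℝ (c • z) ξ : ℝ) : ℂ) * Complex.I) • 𝓕 G (c • z)) := by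
        refine integral_congr_ae (Eventually.of_forall fun z => ?_)
        simp only [hK, real_inner_smul_left, smul_eq_mul]
        have e : (((2 * Real.pi * (c * inner ℝ z ξ) : ℝ) : ℂ) * Complex.I) =
            -(Complex.I * ((inner ℝ z ξ : ℝ) : ℂ)) := by
          have : 2 * Real.pi * (c * inner ℝ z ξ) = -inner ℝ z ξ := by
            rw [hc]; field_simp
          rw [this]
          push_cast
          ring
        rw [e]
        ring
    _ = _ := by
        rw [integral_const_mul, h3, h4, Complex.real_smul, ← mul_assoc, ← Complex.ofReal_mul,
          inv_mul_cancel₀ (by positivity)]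
        simp [hG]

theorem integral_heatKernel (hα : 0 < α) {t : ℝ} (ht : 0 < t) :
    ∫ z, kernel α (fun _ : Space n => 1) t z = 1 := by
  have h := integral_heatKernel_mul_exp (n := n) hα ht 0
  simpa [Real.zero_rpow (by positivity : 2 * α ≠ 0)] using h

/-- The kernels form a semigroup under convolution. -/
theorem integral_heatKernel_mul_kernel (hα : 0 < α) (hd : 0 ≤ d) (hQ : IsHomogeneousSymbol d Q)
    {t s : ℝ} (ht : 0 < t) (hs : 0 < s) (x : Space n) :
    ∫ z, kernel α (fun _ : Space n => 1) t z * kernel α Q s (x - z) = kernel α Q (t + s) x := by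
  set K := kernel α (fun _ : Space n => 1) t with hK
  have hKi : Integrable K := integrable_heatKernel hα ht
  set G : Space n → ℂ := fun ξ => Q ξ * ((Real.exp (-s * ‖ξ‖ ^ (2 * α)) : ℝ) : ℂ) with hG
  have hGi : Integrable G := hQ.integrable hα hd hs
  set e : ℝ → ℂ := fun r => Complex.exp (Complex.I * (r : ℂ)) with he
  have hec : Continuous e := by fun_prop
  have hen : ∀ r, ‖e r‖ = 1 := fun r => by
    rw [he]; simp only; rw [mul_comm, Complex.norm_exp_ofReal_mul_I]
  have hprod : Integrable (fun p : Space n × Space n => e (inner ℝ (x - p.1) p.2) *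
      (K p.1 * G p.2)) (volume.prod volume) := by
    refine (hKi.mul_prod hGi).bdd_mul (c := 1) ?_ (Eventually.of_forall fun p => (hen _).le)
    exact (hec.comp (by fun_prop)).aestronglyMeasurable
  have h1 : ∀ z, K z * kernel α Q s (x - z) = ((((2 * Real.pi) ^ n)⁻¹ : ℝ) : ℂ) *
      ∫ ξ, e (inner ℝ (x - z) ξ) * (K z * G ξ) := by
    intro z
    rw [kernel, mul_left_comm, ← integral_const_mul]
    congr 1
    refine integral_congr_ae (Eventually.of_forall fun ξ => ?_)
    simp only [hG, he]
    ring
  simp_rw [h1]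
  rw [integral_const_mul, integral_integral_swap hprod, kernel]
  congr 1
  refine integral_congr_ae (Eventually.of_forall fun ξ => ?_)
  have h2 : ∀ z, e (inner ℝ (x - z) ξ) * (K z * G ξ) = e (inner ℝ x ξ) * G ξ *
      (K z * Complex.exp (-(Complex.I * ((inner ℝ z ξ : ℝ) : ℂ)))) := by
    intro z
    simp only [he, inner_sub_left]
    push_cast
    rw [mul_sub, sub_eq_add_neg, Complex.exp_add]
    ring
  simp_rw [h2]
  rw [integral_const_mul, integral_heatKernel_mul_exp hα ht]
  have h3 : Real.exp (-(t + s) * ‖ξ‖ ^ (2 * α)) =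
      Real.exp (-s * ‖ξ‖ ^ (2 * α)) * Real.exp (-t * ‖ξ‖ ^ (2 * α)) := by
    rw [← Real.exp_add]; congr 1; ring
  rw [h3]
  simp only [hG, he]
  push_cast
  ring

end KernelLp

/-! ### Inequalities of Minkowski and Young, interpolation, and continuity of translations. -/

section LpTools

variable {n : ℕ}

theorem eLpNorm_ofReal_eq {X : Type*} [MeasurableSpace X] {E : Type*} [NormedAddCommGroup E]
    {ν : Measure X} {f : X → E} {p : ℝ} (hp : 0 < p) :
    eLpNorm f (ENNReal.ofReal p) ν = (∫⁻ x, ‖f x‖ₑ ^ p ∂ν) ^ (1 / p) := by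
  rw [eLpNorm_eq_lintegral_rpow_enorm_toReal (by simpa using hp) ENNReal.ofReal_ne_top,
    ENNReal.toReal_ofReal hp.le]

/-- Writing `g^P ≤ g^{P-1} ∫ F`, Fubini and Hölder in `x` give `I ≤ I^{1-1/P} J` for `I = ∫ g^P`.
Dividing by the first factor requires `I` finite, which is why `g` is only a minorant of the
integral. -/
theorem lintegral_rpow_le_of_le_lintegral {S X : Type*} [MeasurableSpace S] [MeasurableSpace X]
    {μ : Measure S} {ν : Measure X} [SFinite μ] [SFinite ν] {P : ℝ} (hP : 1 ≤ P)
    {F : S → X → ℝ≥0∞} (hF : Measurable (Function.uncurry F)) {g : X → ℝ≥0∞} (hg : Measurable g)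
    (hle : ∀ x, g x ≤ ∫⁻ s, F s x ∂μ) (hfin : ∫⁻ x, g x ^ P ∂ν ≠ ⊤) :
    ∫⁻ x, g x ^ P ∂ν ≤ (∫⁻ s, (∫⁻ x, F s x ^ P ∂ν) ^ (1 / P) ∂μ) ^ P := by
  have hP0 : 0 < P := by linarith
  set I := ∫⁻ x, g x ^ P ∂ν with hI
  set J := ∫⁻ s, (∫⁻ x, F s x ^ P ∂ν) ^ (1 / P) ∂μ with hJ
  rcases eq_or_ne I 0 with h0 | h0
  · rw [h0]; exact zero_le
  have h1 : I ≤ I ^ (1 - 1 / P) * J := by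
    calc I ≤ ∫⁻ x, g x ^ (P - 1) * ∫⁻ s, F s x ∂μ ∂ν := by
          refine lintegral_mono fun x => ?_
          have : g x ^ P = g x ^ (P - 1) * g x := by
            conv_rhs => rw [← ENNReal.rpow_one (g x), ← ENNReal.rpow_mul, one_mul,
              ← ENNReal.rpow_add_of_nonneg _ _ (by linarith) zero_le_one]
            congr 1; ring
          rw [this]
          gcongr
          exact hle x
      _ = ∫⁻ x, ∫⁻ s, g x ^ (P - 1) * F s x ∂μ ∂ν := by
          refine lintegral_congr fun x => ?_
          exact (lintegral_const_mul _ (hF.comp (measurable_id.prodMk measurable_const))).symm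
      _ = ∫⁻ s, ∫⁻ x, g x ^ (P - 1) * F s x ∂ν ∂μ := by
          refine lintegral_lintegral_swap (f := fun x s => g x ^ (P - 1) * F s x) ?_
          exact (((hg.comp measurable_fst).pow_const _).mul
            (hF.comp measurable_swap)).aemeasurable
      _ ≤ ∫⁻ s, I ^ (1 - 1 / P) * (∫⁻ x, F s x ^ P ∂ν) ^ (1 / P) ∂μ := by
          refine lintegral_mono fun s => ?_
          have hFs : Measurable (F s) := hF.comp (measurable_const.prodMk measurable_id)
          have h2 := ENNReal.lintegral_mul_norm_pow_le (μ := ν) (f := fun x => g x ^ P)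
            (g := fun x => F s x ^ P) (p := 1 - 1 / P) (q := 1 / P) (hg.pow_const _).aemeasurable
            (hFs.pow_const _).aemeasurable
            (by rw [sub_nonneg, div_le_one hP0]; exact hP) (by positivity) (by ring)
          refine le_trans (le_of_eq ?_) h2
          refine lintegral_congr fun x => ?_
          rw [← ENNReal.rpow_mul, ← ENNReal.rpow_mul]
          have e1 : P * (1 - 1 / P) = P - 1 := by field_simp
          have e2 : P * (1 / P) = 1 := by field_simp
          rw [e1, e2, ENNReal.rpow_one]
      _ = I ^ (1 - 1 / P) * J := by
          rw [lintegral_const_mul']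
          refine ENNReal.rpow_ne_top_of_nonneg ?_ hfin
          rw [sub_nonneg, div_le_one hP0]; exact hP
  have h2 : I ^ (1 / P) ≤ J := by
    have h3 : I = I ^ (1 - 1 / P) * I ^ (1 / P) := by
      rw [← ENNReal.rpow_add _ _ h0 hfin]; simp
    have h4 : I ^ (1 - 1 / P) ≠ 0 := (ENNReal.rpow_pos (pos_iff_ne_zero.2 h0) hfin).ne'
    have h5 : I ^ (1 - 1 / P) ≠ ⊤ := ENNReal.rpow_ne_top_of_ne_zero h0 hfin
    conv_lhs at h1 => rw [h3]
    exact (ENNReal.mul_le_mul_iff_right h4 h5).1 h1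
  calc I = (I ^ (1 / P)) ^ P := by rw [← ENNReal.rpow_mul]; field_simp; simp
    _ ≤ J ^ P := ENNReal.rpow_le_rpow h2 hP0.le

/-- Minkowski's integral inequality. -/
theorem lintegral_lintegral_rpow_le {S : Type*} [MeasurableSpace S]
    {μ : Measure S} [SFinite μ] {P : ℝ} (hP : 1 ≤ P)
    {F : S → Space n → ℝ≥0∞} (hF : Measurable (Function.uncurry F)) :
    ∫⁻ x, (∫⁻ s, F s x ∂μ) ^ P ≤ (∫⁻ s, (∫⁻ x, F s x ^ P) ^ (1 / P) ∂μ) ^ P := by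
  have hP0 : 0 < P := by linarith
  set H : Space n → ℝ≥0∞ := fun x => ∫⁻ s, F s x ∂μ with hH
  have hHm : Measurable H := by
    have : Measurable fun z : Space n × S => F z.2 z.1 := hF.comp measurable_swap
    exact this.lintegral_prod_right'
  -- Truncation in value and in space makes the left-hand side finite; monotone convergence removes
  -- it at the end.
  set g : ℕ → Space n → ℝ≥0∞ := fun k => (Metric.ball (0 : Space n) k).indicator
    fun x => min (H x) k with hg
  have hgm : ∀ k, Measurable (g k) := fun k =>
    (hHm.min measurable_const).indicator measurableSet_ball
  have hgle : ∀ k x, g k x ≤ H x := fun k x => by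
    refine (indicator_le_self' (fun _ _ => zero_le) x).trans (min_le_left _ _)
  have hgk : ∀ k, ∫⁻ x, g k x ^ P ≤ (∫⁻ s, (∫⁻ x, F s x ^ P) ^ (1 / P) ∂μ) ^ P := by
    intro k
    refine lintegral_rpow_le_of_le_lintegral hP hF (hgm k) (hgle k) ?_
    have h1 : ∀ x, g k x ^ P ≤ (Metric.ball (0 : Space n) k).indicator
        (fun _ => (k : ℝ≥0∞) ^ P) x := by
      intro x
      by_cases hx : x ∈ Metric.ball (0 : Space n) k
      · simp only [hg, indicator_of_mem hx]
        exact ENNReal.rpow_le_rpow (min_le_right _ _) hP0.le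
      · simp [hg, indicator_of_notMem hx, hP0]
    refine ((lintegral_mono h1).trans_lt ?_).ne
    rw [lintegral_indicator measurableSet_ball, setLIntegral_const]
    exact ENNReal.mul_lt_top (b := volume (Metric.ball (0 : Space n) k)) (ENNReal.rpow_lt_top_of_nonneg hP0.le (ENNReal.natCast_ne_top k))
      measure_ball_lt_top
  have hmono : ∀ x, Monotone fun k => g k x := by
    intro x i j hij
    simp only [hg, indicator]
    split_ifs with h1 h2
    · gcongr
    · exact absurd (Metric.ball_subset_ball (by exact_mod_cast hij) h1) h2
    · exact zero_le
    · exact le_rfl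
  have hlim : ∀ x, Tendsto (fun k => g k x ^ P) atTop (𝓝 (H x ^ P)) := by
    intro x
    refine (ENNReal.continuous_rpow_const.tendsto _).comp ?_
    have h1 : Tendsto (fun k : ℕ => min (H x) (k : ℝ≥0∞)) atTop (𝓝 (min (H x) ⊤)) :=
      tendsto_const_nhds.min ENNReal.tendsto_nat_nhds_top
    rw [min_eq_left le_top] at h1
    refine h1.congr' ?_
    obtain ⟨N, hN⟩ := exists_nat_gt ‖x‖
    filter_upwards [eventually_ge_atTop N] with k hk
    have : x ∈ Metric.ball (0 : Space n) k := by
      rw [mem_ball_zero_iff]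
      exact hN.trans_le (by exact_mod_cast hk)
    simp only [hg, indicator_of_mem this]
  refine le_of_tendsto' (lintegral_tendsto_of_tendsto_of_monotone
    (fun k => ((hgm k).pow_const P).aemeasurable)
    (Eventually.of_forall fun x i j hij => ENNReal.rpow_le_rpow (hmono x hij) hP0.le)
    (Eventually.of_forall hlim)) hgk

/-- Minkowski's integral inequality for an integral of functions. -/
theorem eLpNorm_lintegral_enorm_le {S : Type*} [MeasurableSpace S]
    {μ : Measure S} [SFinite μ] {P : ℝ} (hP : 1 ≤ P) {F : S → Space n → ℂ}
    (hF : AEStronglyMeasurable (Function.uncurry F) (μ.prod volume)) :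
    (∫⁻ x, (∫⁻ s, ‖F s x‖ₑ ∂μ) ^ P) ^ (1 / P) ≤
      ∫⁻ s, eLpNorm (F s) (ENNReal.ofReal P) volume ∂μ := by
  have hP0 : 0 < P := by linarith
  obtain ⟨G, hGm, hFG⟩ := hF.enorm
  have h1 : ∀ᵐ s ∂μ, ∀ᵐ x, ‖F s x‖ₑ = G (s, x) := Measure.ae_ae_of_ae_prod hFG
  have h2 : ∀ᵐ x, ∀ᵐ s ∂μ, ‖F s x‖ₑ = G (s, x) := by
    have h3 : ∀ᵐ z ∂((volume : Measure (Space n)).prod μ), ‖F z.2 z.1‖ₑ = G (z.2, z.1) := by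
      rw [← Measure.prod_swap] at hFG
      exact ae_of_ae_map measurable_swap.aemeasurable hFG
    exact Measure.ae_ae_of_ae_prod h3
  have h4 := lintegral_lintegral_rpow_le (μ := μ) hP (F := fun s x => G (s, x)) hGm
  have h5 : ∫⁻ s, eLpNorm (F s) (ENNReal.ofReal P) volume ∂μ =
      ∫⁻ s, (∫⁻ x, G (s, x) ^ P) ^ (1 / P) ∂μ := by
    refine lintegral_congr_ae ?_
    filter_upwards [h1] with s hs
    rw [eLpNorm_ofReal_eq hP0]
    congr 1
    refine lintegral_congr_ae ?_
    filter_upwards [hs] with x hx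
    rw [hx]
  have h6 : ∫⁻ x, (∫⁻ s, ‖F s x‖ₑ ∂μ) ^ P = ∫⁻ x, (∫⁻ s, G (s, x) ∂μ) ^ P := by
    refine lintegral_congr_ae ?_
    filter_upwards [h2] with x hx
    rw [lintegral_congr_ae hx]
  rw [h5, h6]
  refine (ENNReal.rpow_le_rpow h4 (by positivity)).trans_eq ?_
  rw [← ENNReal.rpow_mul]
  field_simp
  simp

theorem eLpNorm_integral_le {S : Type*} [MeasurableSpace S]
    {μ : Measure S} [SFinite μ] {P : ℝ} (hP : 1 ≤ P) {F : S → Space n → ℂ}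
    (hF : AEStronglyMeasurable (Function.uncurry F) (μ.prod volume)) :
    eLpNorm (fun x => ∫ s, F s x ∂μ) (ENNReal.ofReal P) volume ≤
      ∫⁻ s, eLpNorm (F s) (ENNReal.ofReal P) volume ∂μ := by
  have hP0 : 0 < P := by linarith
  refine le_trans ?_ (eLpNorm_lintegral_enorm_le hP hF)
  rw [eLpNorm_ofReal_eq hP0]
  refine ENNReal.rpow_le_rpow (lintegral_mono fun x => ?_) (by positivity)
  exact ENNReal.rpow_le_rpow (enorm_integral_le_lintegral_enorm _) hP0.le

theorem ae_integrable_of_lintegral_eLpNorm_lt_top {S : Type*} [MeasurableSpace S]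
    {μ : Measure S} [SFinite μ] {P : ℝ} (hP : 1 ≤ P) {F : S → Space n → ℂ}
    (hF : AEStronglyMeasurable (Function.uncurry F) (μ.prod volume))
    (hfin : ∫⁻ s, eLpNorm (F s) (ENNReal.ofReal P) volume ∂μ < ⊤) :
    ∀ᵐ x, Integrable (fun s => F s x) μ := by
  have hP0 : 0 < P := by linarith
  have hF' : AEStronglyMeasurable (fun z : Space n × S => F z.2 z.1)
      ((volume : Measure (Space n)).prod μ) := by
    rw [← Measure.prod_swap] at hF
    exact hF.comp_measurable measurable_swap
  have h1 := (eLpNorm_lintegral_enorm_le hP hF).trans_lt hfin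
  have h2 : ∫⁻ x, (∫⁻ s, ‖F s x‖ₑ ∂μ) ^ P < ⊤ := by
    by_contra h
    rw [not_lt, top_le_iff] at h
    rw [h, ENNReal.top_rpow_of_pos (by positivity)] at h1
    exact lt_irrefl _ h1
  have h3 : ∀ᵐ x, (∫⁻ s, ‖F s x‖ₑ ∂μ) ^ P < ⊤ :=
    ae_lt_top' (hF'.enorm.lintegral_prod_right'.pow_const P) h2.ne
  filter_upwards [h3, hF'.prodMk_left] with x hx hxm
  refine ⟨hxm, ?_⟩
  rw [hasFiniteIntegral_iff_enorm]
  by_contra h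
  rw [not_lt, top_le_iff] at h
  rw [h, ENNReal.top_rpow_of_pos hP0] at hx
  exact lt_irrefl _ hx

/-- Young's convolution inequality for nonnegative functions. -/
theorem lintegral_convolution_rpow_le {h m P : ℝ} (hh : 1 ≤ h) (hm : 1 ≤ m) (hP : 1 ≤ P)
    (hhm : 1 / h + 1 / m = 1 + 1 / P) {f g : Space n → ℝ≥0∞} (hf : Measurable f)
    (hg : Measurable g) :
    (∫⁻ x, (∫⁻ y, f (x - y) * g y) ^ P) ^ (1 / P) ≤
      (∫⁻ x, f x ^ m) ^ (1 / m) * (∫⁻ x, g x ^ h) ^ (1 / h) := by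
  have hh0 : 0 < h := by linarith
  have hm0 : 0 < m := by linarith
  have hP0 : 0 < P := by linarith
  set A := ∫⁻ x, f x ^ m with hA
  set B := ∫⁻ x, g x ^ h with hB
  have hb : 0 ≤ 1 / m - 1 / P := by
    have : 1 / h ≤ 1 := by rw [div_le_one hh0]; exact hh
    linarith
  have hc : 0 ≤ 1 / h - 1 / P := by
    have : 1 / m ≤ 1 := by rw [div_le_one hm0]; exact hm
    linarith
  have hfA : ∀ x, ∫⁻ y, f (x - y) ^ m = A := fun x =>
    lintegral_sub_left_eq_self (fun y => f y ^ m) x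
  -- Hölder with three factors: `f g = (f^m g^h)^{1/P} (f^m)^{1/m-1/P} (g^h)^{1/h-1/P}`, whose
  -- exponents sum to `1` by the hypothesis on `h`, `m`, `P`.
  have key : ∀ x, ∫⁻ y, f (x - y) * g y ≤ (∫⁻ y, f (x - y) ^ m * g y ^ h) ^ (1 / P) *
      (A ^ (1 / m - 1 / P) * B ^ (1 / h - 1 / P)) := by
    intro x
    have hfx : Measurable fun y => f (x - y) := hf.comp (measurable_const.sub measurable_id)
    have := ENNReal.lintegral_prod_norm_pow_le (μ := (volume : Measure (Space n)))
      (Finset.univ : Finset (Fin 3))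
      (f := ![fun y => f (x - y) ^ m * g y ^ h, fun y => f (x - y) ^ m, fun y => g y ^ h])
      (p := ![1 / P, 1 / m - 1 / P, 1 / h - 1 / P]) (by
        intro i _
        fin_cases i
        · exact ((hfx.pow_const m).mul (hg.pow_const h)).aemeasurable
        · exact (hfx.pow_const m).aemeasurable
        · exact (hg.pow_const h).aemeasurable) (by
        simp only [Fin.sum_univ_three, Matrix.cons_val_zero, Matrix.cons_val_one, Matrix.cons_val]
        linarith) (by
        intro i _
        fin_cases i
        · exact (by positivity : 0 ≤ 1 / P)
        · exact hb
        · exact hc)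
    simp only [Fin.prod_univ_three, Matrix.cons_val_zero, Matrix.cons_val_one, Matrix.cons_val,
      hfA] at this
    rw [mul_assoc] at this
    refine le_trans (le_of_eq ?_) this
    refine lintegral_congr fun y => ?_
    rw [ENNReal.mul_rpow_of_nonneg _ _ (by positivity : 0 ≤ 1 / P), ← ENNReal.rpow_mul,
      ← ENNReal.rpow_mul, ← ENNReal.rpow_mul, ← ENNReal.rpow_mul]
    have e1 : f (x - y) = f (x - y) ^ (m * (1 / P)) * f (x - y) ^ (m * (1 / m - 1 / P)) := by
      rw [← ENNReal.rpow_add_of_nonneg _ _ (by positivity) (by positivity)]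
      have : m * (1 / P) + m * (1 / m - 1 / P) = 1 := by field_simp; ring
      rw [this, ENNReal.rpow_one]
    have e2 : g y = g y ^ (h * (1 / P)) * g y ^ (h * (1 / h - 1 / P)) := by
      rw [← ENNReal.rpow_add_of_nonneg _ _ (by positivity) (by positivity)]
      have : h * (1 / P) + h * (1 / h - 1 / P) = 1 := by field_simp; ring
      rw [this, ENNReal.rpow_one]
    conv_lhs => rw [e1, e2]
    ring
  have hfg : ∫⁻ x, ∫⁻ y, f (x - y) ^ m * g y ^ h = A * B := by
    rw [lintegral_lintegral_swap]
    · have : ∀ y, ∫⁻ x, f (x - y) ^ m * g y ^ h = A * g y ^ h := by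
        intro y
        refine (lintegral_mul_const _
          ((hf.comp (measurable_id.sub measurable_const)).pow_const m)).trans ?_
        congr 1
        exact lintegral_sub_right_eq_self (fun x => f x ^ m) y
      simp_rw [this]
      rw [lintegral_const_mul _ (hg.pow_const h)]
    · exact (((hf.comp (measurable_fst.sub measurable_snd)).pow_const m).mul
        ((hg.comp measurable_snd).pow_const h)).aemeasurable
  calc (∫⁻ x, (∫⁻ y, f (x - y) * g y) ^ P) ^ (1 / P)
      ≤ (∫⁻ x, (∫⁻ y, f (x - y) ^ m * g y ^ h) *
        (A ^ (1 / m - 1 / P) * B ^ (1 / h - 1 / P)) ^ P) ^ (1 / P) := by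
        refine ENNReal.rpow_le_rpow (lintegral_mono fun x => ?_) (by positivity)
        refine (ENNReal.rpow_le_rpow (key x) hP0.le).trans_eq ?_
        rw [ENNReal.mul_rpow_of_nonneg _ _ hP0.le, ← ENNReal.rpow_mul]
        congr 1
        have : 1 / P * P = 1 := by field_simp
        rw [this, ENNReal.rpow_one]
    _ = (A * B * (A ^ (1 / m - 1 / P) * B ^ (1 / h - 1 / P)) ^ P) ^ (1 / P) := by
        rw [lintegral_mul_const, hfg]
        exact Measurable.lintegral_prod_right'
          (f := fun z : Space n × Space n => f (z.1 - z.2) ^ m * g z.2 ^ h)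
          (((hf.comp (measurable_fst.sub measurable_snd)).pow_const m).mul
            ((hg.comp measurable_snd).pow_const h))
    _ = A ^ (1 / m) * B ^ (1 / h) := by
        rw [ENNReal.mul_rpow_of_nonneg _ _ (by positivity), ← ENNReal.rpow_mul,
          ENNReal.mul_rpow_of_nonneg _ _ (by positivity)]
        have e0 : P * (1 / P) = 1 := by field_simp
        rw [e0, ENNReal.rpow_one]
        have e1 : A ^ (1 / m) = A ^ (1 / P) * A ^ (1 / m - 1 / P) := by
          rw [← ENNReal.rpow_add_of_nonneg _ _ (by positivity) hb]; congr 1; ring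
        have e2 : B ^ (1 / h) = B ^ (1 / P) * B ^ (1 / h - 1 / P) := by
          rw [← ENNReal.rpow_add_of_nonneg _ _ (by positivity) hc]; congr 1; ring
        rw [e1, e2]
        ring

/-- Young's convolution inequality. -/
theorem eLpNorm_convolution_le {h m P : ℝ} (hh : 1 ≤ h) (hm : 1 ≤ m) (hP : 1 ≤ P)
    (hhm : 1 / h + 1 / m = 1 + 1 / P) {k g : Space n → ℂ} (hk : Measurable k)
    (hg : AEStronglyMeasurable g volume) :
    eLpNorm (fun x => ∫ y, k (x - y) * g y) (ENNReal.ofReal P) volume ≤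
      eLpNorm k (ENNReal.ofReal m) volume * eLpNorm g (ENNReal.ofReal h) volume := by
  have hg1 : eLpNorm g (ENNReal.ofReal h) volume = eLpNorm (hg.mk g) (ENNReal.ofReal h) volume :=
    eLpNorm_congr_ae hg.ae_eq_mk
  have hg2 : (fun x => ∫ y, k (x - y) * g y) = fun x => ∫ y, k (x - y) * hg.mk g y := by
    ext x
    refine integral_congr_ae ?_
    filter_upwards [hg.ae_eq_mk] with y hy
    rw [hy]
  have hgm : Measurable (hg.mk g) := hg.stronglyMeasurable_mk.measurable
  rw [hg1, hg2, eLpNorm_ofReal_eq (by linarith), eLpNorm_ofReal_eq (by linarith),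
    eLpNorm_ofReal_eq (by linarith)]
  refine le_trans ?_ (lintegral_convolution_rpow_le hh hm hP hhm hk.enorm hgm.enorm)
  refine ENNReal.rpow_le_rpow (lintegral_mono fun x => ?_) (by positivity)
  refine ENNReal.rpow_le_rpow ?_ (by linarith)
  refine (enorm_integral_le_lintegral_enorm _).trans_eq ?_
  simp_rw [enorm_mul]

/-- Interpolation of Lebesgue norms. -/
theorem eLpNorm_le_interpolation {p₀ p₁ P θ : ℝ} (hp₀ : 0 < p₀) (hp₁ : 0 < p₁) (hP : 0 < P)
    (hθ0 : 0 ≤ θ) (hθ1 : θ ≤ 1) (h : 1 / P = (1 - θ) / p₀ + θ / p₁) {f : Space n → ℂ}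
    (hf : AEStronglyMeasurable f volume) :
    eLpNorm f (ENNReal.ofReal P) volume ≤
      eLpNorm f (ENNReal.ofReal p₀) volume ^ (1 - θ) * eLpNorm f (ENNReal.ofReal p₁) volume ^ θ := by
  rw [eLpNorm_ofReal_eq hP, eLpNorm_ofReal_eq hp₀, eLpNorm_ofReal_eq hp₁]
  have h1 := ENNReal.lintegral_mul_norm_pow_le (μ := (volume : Measure (Space n)))
    (f := fun x => ‖f x‖ₑ ^ p₀) (g := fun x => ‖f x‖ₑ ^ p₁) (hf.enorm.pow_const _)
    (hf.enorm.pow_const _) (p := (1 - θ) * P / p₀) (q := θ * P / p₁)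
    (div_nonneg (mul_nonneg (by linarith) hP.le) hp₀.le) (by positivity) (by
      have : (1 - θ) * P / p₀ + θ * P / p₁ = P * ((1 - θ) / p₀ + θ / p₁) := by ring
      rw [this, ← h]
      field_simp)
  have h2 : ∫⁻ x, ‖f x‖ₑ ^ P = ∫⁻ x, (‖f x‖ₑ ^ p₀) ^ ((1 - θ) * P / p₀) *
      (‖f x‖ₑ ^ p₁) ^ (θ * P / p₁) := by
    refine lintegral_congr fun x => ?_
    rw [← ENNReal.rpow_mul, ← ENNReal.rpow_mul, ← ENNReal.rpow_add_of_nonneg]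
    · congr 1
      field_simp
      ring
    · exact mul_nonneg hp₀.le (div_nonneg (mul_nonneg (by linarith) hP.le) hp₀.le)
    · positivity
  rw [← h2] at h1
  refine (ENNReal.rpow_le_rpow h1 (by positivity)).trans_eq ?_
  rw [ENNReal.mul_rpow_of_nonneg _ _ (by positivity), ← ENNReal.rpow_mul, ← ENNReal.rpow_mul,
    ← ENNReal.rpow_mul, ← ENNReal.rpow_mul]
  congr 2 <;> field_simp

/-- Translation is a continuous action on `L^p` for `p < ∞`, evaluated at the identity. -/
theorem tendsto_eLpNorm_translate {p : ℝ} (hp : 1 ≤ p) {f : Space n → ℂ}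
    (hf : MemLp f (ENNReal.ofReal p) volume) :
    Tendsto (fun z => eLpNorm (fun x => f (z + x) - f x) (ENNReal.ofReal p) volume)
      (𝓝 (0 : Space n)) (𝓝 0) := by
  have : Fact (1 ≤ ENNReal.ofReal p) := ⟨by simpa using hp⟩
  have : Fact (ENNReal.ofReal p ≠ ⊤) := ⟨ENNReal.ofReal_ne_top⟩
  have hc : Continuous fun z : Space n => (DomAddAct.mk z) +ᵥ hf.toLp f := by
    have h1 : Continuous fun z : Space n => (DomAddAct.mk z : (Space n)ᵈᵃᵃ) :=
      DomAddAct.continuous_mk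
    exact h1.vadd continuous_const
  have h2 := (hc.tendsto 0).edist (tendsto_const_nhds (x := hf.toLp f))
  have h3 : edist ((DomAddAct.mk (0 : Space n)) +ᵥ hf.toLp f) (hf.toLp f) = 0 := by
    rw [DomAddAct.mk_zero, zero_vadd, edist_self]
  rw [h3] at h2
  refine h2.congr fun z => ?_
  rw [DomAddAct.mk_vadd_toLp, Lp.edist_toLp_toLp]
  rfl

end LpTools

/-! ### The operators `Q(D) S_α(t)` on Lebesgue spaces. -/

section SymbolSemigroup

variable {n : ℕ} {α d : ℝ} {Q : Space n → ℂ} [Nontrivial (Space n)]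

/-- Hölder: the condition on `M` puts the weight in the dual space of `L^h`, which is `L^∞` when `h
= 1`. The norm of the weight is translation invariant, hence uniform in `x`. -/
theorem exists_lintegral_weight_mul_le {h M : ℝ} (hh : 1 ≤ h) (hM : n * (1 - 1 / h) < M) :
    ∃ N : ℝ≥0∞, N ≠ ⊤ ∧ ∀ (x : Space n) (g : Space n → ℂ), AEStronglyMeasurable g volume →
      ∫⁻ y, ‖(1 + ‖x - y‖) ^ (-M)‖ₑ * ‖g y‖ₑ ≤ N * eLpNorm g (ENNReal.ofReal h) volume := by
  have hh0 : 0 < h := by linarith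
  have hn : (0 : ℝ) ≤ n := Nat.cast_nonneg n
  have h1h : 0 ≤ 1 - 1 / h := by
    rw [sub_nonneg, div_le_one hh0]; exact hh
  have hM0 : 0 < M := lt_of_le_of_lt (by positivity) hM
  set w : Space n → ℝ := fun x => (1 + ‖x‖) ^ (-M) with hw
  have hwc : Continuous w :=
    Continuous.rpow_const (by fun_prop) fun x => Or.inl (by have := norm_nonneg x; positivity)
  obtain ⟨h', hconj, hN⟩ : ∃ h' : ℝ≥0∞, ENNReal.HolderConjugate h' (ENNReal.ofReal h) ∧
      MemLp w h' volume := by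
    rcases hh.eq_or_lt with rfl | hlt
    · refine ⟨⊤, by rw [ENNReal.ofReal_one]; infer_instance, ?_⟩
      refine memLp_top_of_bound hwc.aestronglyMeasurable 1 (Eventually.of_forall fun x => ?_)
      rw [Real.norm_of_nonneg (by positivity)]
      exact Real.rpow_le_one_of_one_le_of_nonpos (by have := norm_nonneg x; linarith) (by linarith)
    · have hc := (Real.HolderConjugate.conjExponent hlt).symm
      refine ⟨ENNReal.ofReal h.conjExponent, hc.ennrealOfReal, ?_⟩
      have h0 : 0 < h.conjExponent := hc.pos
      refine memLp_one_add_norm_rpow h0 ?_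
      have e := hc.inv_add_inv_eq_one
      have e2 : 1 - 1 / h = h.conjExponent⁻¹ := by rw [one_div]; linarith
      rw [e2, ← div_eq_mul_inv, div_lt_iff₀ h0] at hM
      exact hM
  refine ⟨eLpNorm w h' volume, hN.2.ne, fun x g hg => ?_⟩
  have hwx : AEStronglyMeasurable (fun y => w (x - y)) volume :=
    (hwc.comp (continuous_const.sub continuous_id)).aestronglyMeasurable
  have h3 := eLpNorm_smul_le_mul_eLpNorm (p := h') (q := ENNReal.ofReal h) (r := 1) hg hwx
  have h4 : eLpNorm (fun y => w (x - y)) h' volume = eLpNorm w h' volume :=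
    eLpNorm_comp_measurePreserving (g := w) hwc.aestronglyMeasurable
      (volume.measurePreserving_sub_left x)
  rw [h4, eLpNorm_one_eq_lintegral_enorm] at h3
  refine le_trans (le_of_eq (lintegral_congr fun y => ?_)) h3
  rw [Pi.smul_apply', enorm_smul]

/-- The lower bound is what Hölder needs; the upper bound `M < n` makes the kernel decay available
even when `d = 0`. -/
theorem exists_weight_exponent (hn : (0 : ℝ) < n) {h : ℝ} (hh : 1 ≤ h) :
    ∃ M : ℝ, 0 ≤ M ∧ n * (1 - 1 / h) < M ∧ M < n := by
  have h1 : (n : ℝ) * (1 - 1 / h) < n := by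
    have : 0 < 1 / h := by positivity
    nlinarith
  obtain ⟨M, hM1, hM2⟩ := exists_between h1
  refine ⟨M, le_trans ?_ hM1.le, hM1, hM2⟩
  have : 1 / h ≤ 1 := by rw [div_le_one (by linarith)]; exact hh
  exact mul_nonneg hn.le (by linarith)

/-- Locally in `t`, convolution with the kernel is bounded on `L^h`, pointwise. -/
theorem exists_lintegral_kernel_mul_le (hα : 0 < α) (hd : 0 ≤ d) (hQ : IsHomogeneousSymbol d Q)
    {h a b : ℝ} (hh : 1 ≤ h) (ha : 0 < a) :
    ∃ N : ℝ≥0∞, N ≠ ⊤ ∧ ∀ t ∈ Icc a b, ∀ (x : Space n) (g : Space n → ℂ),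
      AEStronglyMeasurable g volume →
      ∫⁻ y, ‖kernel α Q t (x - y) * g y‖ₑ ≤ N * eLpNorm g (ENNReal.ofReal h) volume := by
  obtain ⟨M, hM0, hM1, hM2⟩ := exists_weight_exponent (natCast_pos_of_nontrivial n) hh
  obtain ⟨C, hC⟩ := hQ.exists_norm_kernel_le hα hd hM0 (by linarith)
  obtain ⟨C', hC'0, hC'⟩ := exists_norm_kernel_le_of_mem_Icc hα hQ hM0 hC (b := b) ha
  obtain ⟨N, hN, hN'⟩ := exists_lintegral_weight_mul_le (n := n) hh hM1
  refine ⟨ENNReal.ofReal C' * N, ENNReal.mul_ne_top ENNReal.ofReal_ne_top hN,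
    fun t ht x g hg => ?_⟩
  rw [mul_assoc]
  refine le_trans ?_ (mul_le_mul_right (hN' x g hg) _)
  rw [← lintegral_const_mul' _ _ ENNReal.ofReal_ne_top]
  refine lintegral_mono fun y => ?_
  rw [enorm_mul, ← mul_assoc]
  gcongr
  rw [← ofReal_norm, ← ofReal_norm, ← ENNReal.ofReal_mul hC'0]
  refine ENNReal.ofReal_le_ofReal ((hC' t ht _).trans_eq ?_)
  rw [Real.norm_of_nonneg (by positivity)]

theorem integrable_kernel_mul (hα : 0 < α) (hd : 0 ≤ d) (hQ : IsHomogeneousSymbol d Q)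
    {h t : ℝ} (hh : 1 ≤ h) (ht : 0 < t) {g : Space n → ℂ}
    (hg : MemLp g (ENNReal.ofReal h) volume) (x : Space n) :
    Integrable fun y => kernel α Q t (x - y) * g y := by
  obtain ⟨N, hN, hN'⟩ := exists_lintegral_kernel_mul_le (a := t) (b := t) hα hd hQ hh ht
  refine ⟨?_, ?_⟩
  · exact ((continuous_kernel hα hd hQ ht).comp
      (continuous_const.sub continuous_id)).aestronglyMeasurable.mul hg.1
  · rw [hasFiniteIntegral_iff_enorm]
    exact (hN' t ⟨le_rfl, le_rfl⟩ x g hg.1).trans_lt (ENNReal.mul_lt_top hN.lt_top hg.2)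

theorem symbolSemigroup_add (hα : 0 < α) (hd : 0 ≤ d) (hQ : IsHomogeneousSymbol d Q)
    {h₁ h₂ t : ℝ} (hh₁ : 1 ≤ h₁) (hh₂ : 1 ≤ h₂) (ht : 0 < t) {g₁ g₂ : Space n → ℂ}
    (hg₁ : MemLp g₁ (ENNReal.ofReal h₁) volume) (hg₂ : MemLp g₂ (ENNReal.ofReal h₂) volume)
    (x : Space n) :
    symbolSemigroup α Q t (fun y => g₁ y + g₂ y) x =
      symbolSemigroup α Q t g₁ x + symbolSemigroup α Q t g₂ x := by
  simp only [symbolSemigroup, mul_add]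
  exact integral_add (integrable_kernel_mul hα hd hQ hh₁ ht hg₁ x)
    (integrable_kernel_mul hα hd hQ hh₂ ht hg₂ x)

theorem symbolSemigroup_sub (hα : 0 < α) (hd : 0 ≤ d) (hQ : IsHomogeneousSymbol d Q)
    {h₁ h₂ t : ℝ} (hh₁ : 1 ≤ h₁) (hh₂ : 1 ≤ h₂) (ht : 0 < t) {g₁ g₂ : Space n → ℂ}
    (hg₁ : MemLp g₁ (ENNReal.ofReal h₁) volume) (hg₂ : MemLp g₂ (ENNReal.ofReal h₂) volume)
    (x : Space n) :
    symbolSemigroup α Q t (fun y => g₁ y - g₂ y) x =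
      symbolSemigroup α Q t g₁ x - symbolSemigroup α Q t g₂ x := by
  simp only [symbolSemigroup, mul_sub]
  exact integral_sub (integrable_kernel_mul hα hd hQ hh₁ ht hg₁ x)
    (integrable_kernel_mul hα hd hQ hh₂ ht hg₂ x)

theorem symbolSemigroup_congr_ae {g₁ g₂ : Space n → ℂ} (h : g₁ =ᵐ[volume] g₂) (t : ℝ)
    (x : Space n) : symbolSemigroup α Q t g₁ x = symbolSemigroup α Q t g₂ x := by
  refine integral_congr_ae ?_
  filter_upwards [h] with y hy
  rw [hy]

theorem tendsto_kernel (hα : 0 < α) (hd : 0 ≤ d) (hQ : IsHomogeneousSymbol d Q) {β : Type*}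
    {l : Filter β} {t : β → ℝ} {x : β → Space n} {t₀ : ℝ} {x₀ : Space n} (ht₀ : 0 < t₀)
    (ht : Tendsto t l (𝓝 t₀)) (hx : Tendsto x l (𝓝 x₀)) :
    Tendsto (fun b => kernel α Q (t b) (x b)) l (𝓝 (kernel α Q t₀ x₀)) := by
  have h0 := continuousOn_kernel hα hd hQ
  generalize kernel α Q = K at h0 ⊢
  have h2 : (Ioi 0 ×ˢ univ : Set (ℝ × Space n)) ∈ 𝓝 (t₀, x₀) :=
    prod_mem_nhds (Ioi_mem_nhds ht₀) univ_mem
  have h1 := (h0.continuousAt h2).tendsto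
  exact h1.comp (ht.prodMk_nhds hx)

/-- Joint continuity in the time lag, the source time and the point supplies the measurability
needed for Fubini and Minkowski in the Duhamel integral. The change of source is controlled by
Hölder uniformly in the other variables; for a fixed source, dominated convergence applies. -/
theorem continuousOn_symbolSemigroup (hα : 0 < α) (hd : 0 ≤ d) (hQ : IsHomogeneousSymbol d Q)
    {h : ℝ} (hh : 1 ≤ h) {I : Set ℝ} {g : ℝ → Space n → ℂ} (hg : ContinuousInLp I h g) :
    ContinuousOn (fun z : ℝ × ℝ × Space n => symbolSemigroup α Q z.1 (g z.2.1) z.2.2)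
      (Ioi 0 ×ˢ I ×ˢ univ) := by
  rintro ⟨t₀, s₀, x₀⟩ ⟨ht₀, hs₀, -⟩
  have ht₀ : 0 < t₀ := ht₀
  have hs₀ : s₀ ∈ I := hs₀
  obtain ⟨M, hM0, hM1, hM2⟩ := exists_weight_exponent (natCast_pos_of_nontrivial n) hh
  obtain ⟨C, hC⟩ := hQ.exists_norm_kernel_le hα hd hM0 (by linarith)
  obtain ⟨C', hC'0, hC'⟩ := exists_norm_kernel_le_of_mem_Icc hα hQ hM0 hC (a := t₀ / 2)
    (b := 2 * t₀) (half_pos ht₀)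
  obtain ⟨N, hN, hN'⟩ := exists_lintegral_kernel_mul_le (a := t₀ / 2) (b := 2 * t₀) hα hd hQ hh
    (half_pos ht₀)
  obtain ⟨N₂, hN₂, hN₂'⟩ := exists_lintegral_weight_mul_le (n := n) hh hM1
  set S : Set (ℝ × ℝ × Space n) := Ioi 0 ×ˢ I ×ˢ univ with hS
  set z₀ : ℝ × ℝ × Space n := (t₀, s₀, x₀) with hz₀
  have hmem : Icc (t₀ / 2) (2 * t₀) ∈ 𝓝 t₀ := Icc_mem_nhds (by linarith) (by linarith)
  have htev : ∀ᶠ z in 𝓝[S] z₀, z.1 ∈ Icc (t₀ / 2) (2 * t₀) :=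
    (continuous_fst.tendsto z₀).mono_left nhdsWithin_le_nhds hmem
  have hxev : ∀ᶠ z in 𝓝[S] z₀, z.2.2 ∈ Metric.ball x₀ 1 :=
    ((continuous_snd.comp continuous_snd).tendsto z₀).mono_left nhdsWithin_le_nhds
      (Metric.ball_mem_nhds _ one_pos)
  have hSev : ∀ᶠ z in 𝓝[S] z₀, z ∈ S := self_mem_nhdsWithin
  have hgs₀ := hg.memLp s₀ hs₀
  have hA : Tendsto (fun z : ℝ × ℝ × Space n =>
      symbolSemigroup α Q z.1 (fun y => g z.2.1 y - g s₀ y) z.2.2) (𝓝[S] z₀) (𝓝 0) := by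
    rw [tendsto_zero_iff_enorm_tendsto_zero]
    have h1 : Tendsto (fun z : ℝ × ℝ × Space n =>
        N * eLpNorm (g z.2.1 - g s₀) (ENNReal.ofReal h) volume) (𝓝[S] z₀) (𝓝 0) := by
      have h2 : Tendsto (fun z : ℝ × ℝ × Space n => z.2.1) (𝓝[S] z₀) (𝓝[I] s₀) := by
        refine tendsto_nhdsWithin_iff.2 ⟨?_, ?_⟩
        · exact ((continuous_fst.comp continuous_snd).tendsto z₀).mono_left nhdsWithin_le_nhds
        · filter_upwards [hSev] with z hz using hz.2.1
      have h3 := ENNReal.Tendsto.const_mul ((hg.tendsto s₀ hs₀).comp h2) (Or.inr hN)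
      simpa using h3
    refine tendsto_of_tendsto_of_tendsto_of_le_of_le' tendsto_const_nhds h1
      (Eventually.of_forall fun _ => zero_le) ?_
    filter_upwards [htev, hSev] with z hz hzS
    exact (enorm_integral_le_lintegral_enorm _).trans
      (hN' z.1 hz z.2.2 _ ((hg.memLp _ hzS.2.1).1.sub hgs₀.1))
  have hB : Tendsto (fun z : ℝ × ℝ × Space n => symbolSemigroup α Q z.1 (g s₀) z.2.2)
      (𝓝[S] z₀) (𝓝 (symbolSemigroup α Q t₀ (g s₀) x₀)) := by
    simp only [symbolSemigroup]
    refine tendsto_integral_filter_of_dominated_convergence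
      (fun y => C' * 2 ^ M * (‖(1 + ‖x₀ - y‖) ^ (-M)‖ * ‖g s₀ y‖)) ?_ ?_ ?_ ?_
    · filter_upwards [hSev] with z hz
      exact ((continuous_kernel hα hd hQ hz.1).comp
        (continuous_const.sub continuous_id)).aestronglyMeasurable.mul hgs₀.1
    · filter_upwards [htev, hxev] with z hz hzx
      filter_upwards with y
      rw [norm_mul, ← mul_assoc]
      gcongr
      refine (hC' z.1 hz _).trans ?_
      rw [mul_assoc]
      gcongr C' * ?_
      rw [Real.norm_of_nonneg (by positivity)]
      -- Within distance `1` of `x₀` the weights centred at the two points are comparable, so a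
      -- single dominating function suffices.
      have h5 : 1 + ‖x₀ - y‖ ≤ 2 * (1 + ‖z.2.2 - y‖) := by
        have h6 : ‖x₀ - y‖ ≤ ‖z.2.2 - x₀‖ + ‖z.2.2 - y‖ := by
          have := norm_sub_le (z.2.2 - y) (z.2.2 - x₀)
          rw [sub_sub_sub_cancel_left] at this
          linarith
        have h7 : ‖z.2.2 - x₀‖ < 1 := by simpa [dist_eq_norm] using hzx
        have := norm_nonneg (z.2.2 - y)
        linarith
      calc (1 + ‖z.2.2 - y‖) ^ (-M) = 2 ^ M * (2 * (1 + ‖z.2.2 - y‖)) ^ (-M) := by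
            rw [Real.mul_rpow two_pos.le (by positivity), ← mul_assoc, ← Real.rpow_add two_pos]
            simp
        _ ≤ 2 ^ M * (1 + ‖x₀ - y‖) ^ (-M) := by
            gcongr 2 ^ M * ?_
            exact Real.rpow_le_rpow_of_nonpos (by positivity) h5 (by linarith)
    · refine Integrable.const_mul ⟨?_, ?_⟩ _
      · refine AEStronglyMeasurable.mul (Continuous.aestronglyMeasurable ?_) hgs₀.1.norm
        refine Continuous.norm (Continuous.rpow_const (by fun_prop) fun y => Or.inl ?_)
        have := norm_nonneg (x₀ - y)
        positivity
      · rw [hasFiniteIntegral_iff_enorm]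
        refine lt_of_le_of_lt (le_of_eq ?_) ((hN₂' x₀ (g s₀) hgs₀.1).trans_lt
          (ENNReal.mul_lt_top hN₂.lt_top hgs₀.2))
        refine lintegral_congr fun y => ?_
        rw [enorm_mul, enorm_norm, enorm_norm]
    · filter_upwards with y
      refine Tendsto.mul_const _ ?_
      refine tendsto_kernel hα hd hQ ht₀ ?_ ?_
      · exact (continuous_fst.tendsto z₀).mono_left nhdsWithin_le_nhds
      · have : Continuous fun z : ℝ × ℝ × Space n => z.2.2 - y := by fun_prop
        exact (this.tendsto z₀).mono_left nhdsWithin_le_nhds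
  have h9 : Tendsto (fun z : ℝ × ℝ × Space n =>
      symbolSemigroup α Q z.1 (fun y => g z.2.1 y - g s₀ y) z.2.2 +
        symbolSemigroup α Q z.1 (g s₀) z.2.2) (𝓝[S] z₀)
      (𝓝 (symbolSemigroup α Q t₀ (g s₀) x₀)) := by
    have := hA.add hB
    rwa [zero_add] at this
  refine Tendsto.congr' ?_ h9
  filter_upwards [hSev] with z hz
  have h10 := symbolSemigroup_sub hα hd hQ hh hh (mem_Ioi.1 hz.1) (hg.memLp _ hz.2.1) hgs₀ z.2.2
  rw [h10, sub_add_cancel]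

theorem continuous_symbolSemigroup (hα : 0 < α) (hd : 0 ≤ d) (hQ : IsHomogeneousSymbol d Q)
    {h t : ℝ} (hh : 1 ≤ h) (ht : 0 < t) {g : Space n → ℂ}
    (hg : MemLp g (ENNReal.ofReal h) volume) : Continuous (symbolSemigroup α Q t g) := by
  have h1 : ContinuousInLp univ h fun _ => g :=
    ⟨fun _ _ => hg, fun _ _ => by simp⟩
  exact (continuousOn_symbolSemigroup hα hd hQ hh h1).comp_continuous
    (f := fun x : Space n => (t, (0 : ℝ), x)) (by fun_prop) fun x => ⟨ht, mem_univ _, mem_univ _⟩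

theorem semigroup_symbolSemigroup (hα : 0 < α) (hd : 0 ≤ d) (hQ : IsHomogeneousSymbol d Q)
    {h s t : ℝ} (hh : 1 ≤ h) (hs : 0 < s) (ht : 0 < t) {g : Space n → ℂ}
    (hg : MemLp g (ENNReal.ofReal h) volume) (x : Space n) :
    semigroup α s (symbolSemigroup α Q t g) x = symbolSemigroup α Q (s + t) g x := by
  set K := kernel α (fun _ : Space n => 1) s with hK
  have hKi : Integrable K := integrable_heatKernel hα hs
  have hKc : Continuous K := continuous_kernel hα le_rfl (isHomogeneousSymbol_one n) hs
  have hQc := continuous_kernel hα hd hQ ht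
  obtain ⟨N, hN, hN'⟩ := exists_lintegral_kernel_mul_le (a := t) (b := t) hα hd hQ hh ht
  have hmeas : AEStronglyMeasurable (fun p : Space n × Space n =>
      K (x - p.1) * (kernel α Q t (p.1 - p.2) * g p.2)) (volume.prod volume) := by
    refine (hKc.comp (continuous_const.sub continuous_fst)).aestronglyMeasurable.mul
      ((hQc.comp (continuous_fst.sub continuous_snd)).aestronglyMeasurable.mul ?_)
    exact hg.1.comp_snd
  have hprod : Integrable (Function.uncurry fun y z : Space n =>
      K (x - y) * (kernel α Q t (y - z) * g z)) (volume.prod volume) := by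
    refine ⟨hmeas, ?_⟩
    rw [hasFiniteIntegral_iff_enorm]
    refine (lintegral_prod (fun p : Space n × Space n =>
      ‖K (x - p.1) * (kernel α Q t (p.1 - p.2) * g p.2)‖ₑ) hmeas.enorm).trans_lt ?_
    have h1 : ∀ y, ∫⁻ z, ‖K (x - y) * (kernel α Q t (y - z) * g z)‖ₑ ≤
        ‖K (x - y)‖ₑ * (N * eLpNorm g (ENNReal.ofReal h) volume) := by
      intro y
      simp_rw [enorm_mul (K (x - y))]
      rw [lintegral_const_mul' _ _ enorm_ne_top]
      gcongr
      exact hN' t ⟨le_rfl, le_rfl⟩ y g hg.1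
    refine (lintegral_mono h1).trans_lt ?_
    rw [lintegral_mul_const']
    · refine ENNReal.mul_lt_top ?_ (ENNReal.mul_lt_top hN.lt_top hg.2)
      have := (hKi.comp_sub_left x).2
      rwa [hasFiniteIntegral_iff_enorm] at this
    · exact (ENNReal.mul_lt_top hN.lt_top hg.2).ne
  have h2 : semigroup α s (symbolSemigroup α Q t g) x =
      ∫ y, ∫ z, K (x - y) * (kernel α Q t (y - z) * g z) := by
    simp only [semigroup, symbolSemigroup]
    refine integral_congr_ae (Eventually.of_forall fun y => ?_)
    simp only
    rw [integral_const_mul]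
  rw [h2, integral_integral_swap hprod, symbolSemigroup]
  refine integral_congr_ae (Eventually.of_forall fun z => ?_)
  simp only
  have h3 : ∀ y, K (x - y) * (kernel α Q t (y - z) * g z) =
      (K (x - y) * kernel α Q t ((x - z) - (x - y))) * g z := by
    intro y
    have : x - z - (x - y) = y - z := by abel
    rw [this]; ring
  simp_rw [h3]
  rw [integral_mul_const]
  congr 1
  rw [← integral_heatKernel_mul_kernel hα hd hQ hs ht (x - z)]
  exact integral_sub_left_eq_self (fun w => K w * kernel α Q t ((x - z) - w)) volume x

/-- The norm of `kernel α Q 1` in `L^m` with `1 / m = 1 - y`. -/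
noncomputable def kernelNorm (α : ℝ) (Q : Space n → ℂ) (y : ℝ) : ℝ :=
  (eLpNorm (kernel α Q 1) (ENNReal.ofReal (1 / (1 - y))) volume).toReal

theorem kernelNorm_nonneg (α : ℝ) (Q : Space n → ℂ) (y : ℝ) : 0 ≤ kernelNorm α Q y :=
  ENNReal.toReal_nonneg

/-- Young's inequality with `1/m = 1 - (1/h - 1/P)`; the power of `t` is the scaling of the `L^m`
norm of the kernel. -/
theorem eLpNorm_symbolSemigroup_le_of_hasKernelLp (hα : 0 < α) (hd : 0 ≤ d)
    (hQ : IsHomogeneousSymbol d Q) {h P t : ℝ} (hh : 1 ≤ h) (hhP : h ≤ P)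
    (hK : HasKernelLp α Q (1 / (1 - (1 / h - 1 / P)))) (ht : 0 < t) {g : Space n → ℂ}
    (hg : AEStronglyMeasurable g volume) :
    eLpNorm (symbolSemigroup α Q t g) (ENNReal.ofReal P) volume ≤
      ENNReal.ofReal (kernelNorm α Q (1 / h - 1 / P) *
        t ^ (-((d + n * (1 / h - 1 / P)) / (2 * α)))) * eLpNorm g (ENNReal.ofReal h) volume := by
  have hh0 : 0 < h := by linarith
  have hP0 : 0 < P := by linarith
  have h1 : 1 / h ≤ 1 := by rw [div_le_one hh0]; exact hh
  have h2 : 0 < 1 / P := by positivity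
  have h3 : 1 / P ≤ 1 / h := one_div_le_one_div_of_le hh0 hhP
  set y := 1 / h - 1 / P with hy
  have hy1 : 0 < 1 - y := by linarith
  have hm : 1 ≤ 1 / (1 - y) := by rw [le_div_iff₀ hy1]; linarith
  have hfin := (hK.memLp hα hd hQ hm one_pos).2
  refine (eLpNorm_convolution_le (h := h) (m := 1 / (1 - y)) (P := P) hh hm (by linarith)
    (by rw [one_div_one_div]; linarith) (continuous_kernel hα hd hQ ht).measurable hg).trans_eq ?_
  rw [eLpNorm_kernel hα hQ hm ht, one_div_one_div, sub_sub_cancel,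
    ENNReal.ofReal_mul (kernelNorm_nonneg _ _ _), kernelNorm, ENNReal.ofReal_toReal hfin.ne]
  ring

theorem eLpNorm_symbolSemigroup_le (hα : 0 < α) (hd : 0 ≤ d)
    (hQ : IsHomogeneousSymbol d Q) {h P t : ℝ} (hh : 1 ≤ h) (hhP : h < P) (ht : 0 < t)
    {g : Space n → ℂ} (hg : AEStronglyMeasurable g volume) :
    eLpNorm (symbolSemigroup α Q t g) (ENNReal.ofReal P) volume ≤
      ENNReal.ofReal (kernelNorm α Q (1 / h - 1 / P) *
        t ^ (-((d + n * (1 / h - 1 / P)) / (2 * α)))) * eLpNorm g (ENNReal.ofReal h) volume := by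
  have hh0 : 0 < h := by linarith
  have h1 : 1 / h ≤ 1 := by rw [div_le_one hh0]; exact hh
  have h2 : 0 < 1 / P := one_div_pos.2 (by linarith)
  have h3 : 1 / P < 1 / h := one_div_lt_one_div_of_lt hh0 hhP
  refine eLpNorm_symbolSemigroup_le_of_hasKernelLp hα hd hQ hh hhP.le
    (hQ.hasKernelLp hα hd ?_) ht hg
  rw [lt_div_iff₀ (by linarith)]
  linarith

theorem eLpNorm_semigroup_le (hα : 0 < α) {h P t : ℝ} (hh : 1 ≤ h) (hhP : h ≤ P) (ht : 0 < t)
    {g : Space n → ℂ} (hg : AEStronglyMeasurable g volume) :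
    eLpNorm (semigroup α t g) (ENNReal.ofReal P) volume ≤
      ENNReal.ofReal (kernelNorm α (fun _ : Space n => 1) (1 / h - 1 / P) *
        t ^ (-(n / (2 * α) * (1 / h - 1 / P)))) * eLpNorm g (ENNReal.ofReal h) volume := by
  have hh0 : 0 < h := by linarith
  have h1 : 1 / h ≤ 1 := by rw [div_le_one hh0]; exact hh
  have h2 : 0 < 1 / P := one_div_pos.2 (by linarith)
  have h3 : 1 / P ≤ 1 / h := one_div_le_one_div_of_le hh0 hhP
  refine (eLpNorm_symbolSemigroup_le_of_hasKernelLp hα le_rfl (isHomogeneousSymbol_one n) hh hhP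
    (hasKernelLp_one hα ?_) ht hg).trans_eq ?_
  · rw [le_div_iff₀ (by linarith)]
    linarith
  · congr 5
    ring

theorem tendsto_eLpNorm_symbolSemigroup_sub (hα : 0 < α) (hd : 0 ≤ d)
    (hQ : IsHomogeneousSymbol d Q) {h P t₀ : ℝ} (hh : 1 ≤ h) (hhP : h ≤ P)
    (hK : HasKernelLp α Q (1 / (1 - (1 / h - 1 / P)))) (ht₀ : 0 < t₀) {g : Space n → ℂ}
    (hg : MemLp g (ENNReal.ofReal h) volume) :
    Tendsto (fun t => eLpNorm (symbolSemigroup α Q t g - symbolSemigroup α Q t₀ g)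
      (ENNReal.ofReal P) volume) (𝓝 t₀) (𝓝 0) := by
  have hh0 : 0 < h := by linarith
  have h1 : 1 / h ≤ 1 := by rw [div_le_one hh0]; exact hh
  have h2 : 0 < 1 / P := one_div_pos.2 (by linarith)
  have h3 : 1 / P ≤ 1 / h := one_div_le_one_div_of_le hh0 hhP
  set y := 1 / h - 1 / P with hy
  have hy1 : 0 < 1 - y := by linarith
  have hm : 1 ≤ 1 / (1 - y) := by rw [le_div_iff₀ hy1]; linarith
  have h4 := ENNReal.Tendsto.mul_const (b := eLpNorm g (ENNReal.ofReal h) volume)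
    (hK.tendsto_eLpNorm_sub hα hd hQ hm ht₀) (Or.inr hg.2.ne)
  rw [zero_mul] at h4
  refine tendsto_of_tendsto_of_tendsto_of_le_of_le' tendsto_const_nhds h4
    (Eventually.of_forall fun _ => zero_le) ?_
  filter_upwards [lt_mem_nhds ht₀] with t ht
  have h5 : symbolSemigroup α Q t g - symbolSemigroup α Q t₀ g =
      fun x => ∫ y, (kernel α Q t - kernel α Q t₀) (x - y) * g y := by
    ext x
    simp only [Pi.sub_apply, symbolSemigroup, sub_mul]
    exact (integral_sub (integrable_kernel_mul hα hd hQ hh ht hg x)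
      (integrable_kernel_mul hα hd hQ hh ht₀ hg x)).symm
  rw [h5]
  exact eLpNorm_convolution_le hh hm (by linarith) (by rw [one_div_one_div]; linarith)
    ((continuous_kernel hα hd hQ ht).measurable.sub (continuous_kernel hα hd hQ ht₀).measurable) hg.1

end SymbolSemigroup

/-! ### The heat semigroup near `t = 0`. -/

section HeatSemigroup

variable {n : ℕ} {α : ℝ} [Nontrivial (Space n)]

/-- After rescaling, the kernel is fixed and time enters only through a translation of `φ`; the
limit `t → 0` then rests on continuity of translations. -/
theorem semigroup_eq_integral_smul (hα : 0 < α) {t : ℝ} (ht : 0 < t) (φ : Space n → ℂ)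
    (x : Space n) :
    semigroup α t φ x =
      ∫ z, kernel α (fun _ : Space n => 1) 1 z * φ (x - t ^ (1 / (2 * α)) • z) := by
  set K := kernel α (fun _ : Space n => 1) 1 with hK
  set c : ℝ := t ^ (1 / (2 * α)) with hc
  have hc0 : 0 < c := Real.rpow_pos_of_pos ht _
  have hci : t ^ (-(1 / (2 * α))) = c⁻¹ := by rw [Real.rpow_neg ht.le]
  have hcn : t ^ (-((n + 0) / (2 * α))) = (c⁻¹) ^ n := by
    rw [← hci, ← Real.rpow_natCast, ← Real.rpow_mul ht.le]
    congr 1; ring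
  have h1 : semigroup α t φ x = ∫ w, kernel α (fun _ : Space n => 1) t w * φ (x - w) := by
    rw [semigroup, symbolSemigroup,
      ← integral_sub_left_eq_self (fun w => kernel α (fun _ : Space n => 1) t w * φ (x - w))
      volume x]
    simp
  have h2 : ∀ w, kernel α (fun _ : Space n => 1) t w * φ (x - w) =
      (((c⁻¹) ^ n : ℝ) : ℂ) * (K (c⁻¹ • w) * φ (x - c • (c⁻¹ • w))) := by
    intro w
    rw [kernel_smul_rpow hα (isHomogeneousSymbol_one n) ht, hcn, hci, smul_smul,
      mul_inv_cancel₀ hc0.ne', one_smul, mul_assoc]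
  rw [h1]
  simp_rw [h2]
  rw [integral_const_mul, Measure.integral_comp_smul volume (fun z => K z * φ (x - c • z))]
  rw [finrank_euclideanSpace, Fintype.card_fin, inv_pow, inv_inv, abs_of_pos (by positivity),
    Complex.real_smul, ← mul_assoc, ← Complex.ofReal_mul, inv_mul_cancel₀ (by positivity)]
  simp

/-- Strong continuity of the heat semigroup at `t = 0`. -/
theorem tendsto_eLpNorm_semigroup_sub_self (hα : 0 < α) {r : ℝ} (hr : 1 ≤ r) {φ : Space n → ℂ}
    (hφ : MemLp φ (ENNReal.ofReal r) volume) :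
    Tendsto (fun t => eLpNorm (semigroup α t φ - φ) (ENNReal.ofReal r) volume)
      (𝓝[>] 0) (𝓝 0) := by
  -- A measurable representative makes the integrand below jointly measurable, as Minkowski's
  -- inequality requires.
  wlog hm : StronglyMeasurable φ generalizing φ
  · have h1 := hφ.1.ae_eq_mk
    have h2 := this ((memLp_congr_ae h1).1 hφ) hφ.1.stronglyMeasurable_mk
    refine h2.congr fun t => ?_
    have h3 : semigroup α t (hφ.1.mk φ) = semigroup α t φ :=
      funext fun x => (symbolSemigroup_congr_ae h1 t x).symm
    rw [h3]
    exact eLpNorm_congr_ae (EventuallyEq.rfl.sub h1.symm)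
  have hr0 : 0 < r := by linarith
  set K := kernel α (fun _ : Space n => 1) 1 with hK
  have hKi : Integrable K := integrable_heatKernel hα one_pos
  have hKc : Continuous K := continuous_kernel hα le_rfl (isHomogeneousSymbol_one n) one_pos
  have hKone : ∫ z, K z = 1 := integral_heatKernel hα one_pos
  have hφm : Measurable φ := hm.measurable
  set F : ℝ → Space n → Space n → ℂ := fun t z x =>
    K z * (φ (x - t ^ (1 / (2 * α)) • z) - φ x) with hF
  have hFm : ∀ t, Measurable (Function.uncurry (F t)) := by
    intro t
    refine (hKc.measurable.comp measurable_fst).mul ((hφm.comp ?_).sub (hφm.comp measurable_snd))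
    exact Continuous.measurable (by fun_prop)
  have h1 : ∀ᶠ t in 𝓝[>] (0 : ℝ), eLpNorm (semigroup α t φ - φ) (ENNReal.ofReal r) volume ≤
      ∫⁻ z, eLpNorm (F t z) (ENNReal.ofReal r) volume := by
    filter_upwards [self_mem_nhdsWithin] with t ht
    have ht : 0 < t := ht
    refine le_trans (le_of_eq ?_) (eLpNorm_integral_le hr (hFm t).aestronglyMeasurable)
    congr 1
    ext x
    have h2 : Integrable fun z => K z * φ (x - t ^ (1 / (2 * α)) • z) := by
      have hc0 : t ^ (1 / (2 * α)) ≠ 0 := (Real.rpow_pos_of_pos ht _).ne'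
      have h3 := integrable_kernel_mul hα le_rfl (isHomogeneousSymbol_one n) hr ht hφ x
      have h4 := (h3.comp_sub_left x).comp_smul hc0
      refine (h4.const_mul (((t ^ (-((n + (0 : ℝ)) / (2 * α))) : ℝ) : ℂ)⁻¹)).congr
        (Eventually.of_forall fun z => ?_)
      simp only [sub_sub_cancel]
      rw [kernel_smul_rpow hα (isHomogeneousSymbol_one n) ht, smul_smul, ← Real.rpow_add ht,
        neg_add_cancel, Real.rpow_zero, one_smul, mul_assoc, ← mul_assoc, inv_mul_cancel₀, one_mul]
      exact Complex.ofReal_ne_zero.2 (Real.rpow_pos_of_pos ht _).ne'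
    simp only [hF, Pi.sub_apply, mul_sub]
    rw [integral_sub h2 (hKi.mul_const _), integral_mul_const, hKone, one_mul,
      semigroup_eq_integral_smul hα ht]
  have h5 : ∀ t z, eLpNorm (F t z) (ENNReal.ofReal r) volume =
      ‖K z‖ₑ * eLpNorm (fun x => φ (x - t ^ (1 / (2 * α)) • z) - φ x) (ENNReal.ofReal r) volume :=
    fun t z => eLpNorm_const_smul (K z) _ _ _
  have h6 : Tendsto (fun t => ∫⁻ z, eLpNorm (F t z) (ENNReal.ofReal r) volume) (𝓝[>] (0 : ℝ))
      (𝓝 (∫⁻ _ : Space n, 0)) := by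
    refine tendsto_lintegral_filter_of_dominated_convergence
      (fun z => ‖K z‖ₑ * (2 * eLpNorm φ (ENNReal.ofReal r) volume)) ?_ ?_ ?_ ?_
    · refine Eventually.of_forall fun t => ?_
      simp_rw [eLpNorm_ofReal_eq hr0]
      exact (((hFm t).enorm.pow_const r).lintegral_prod_right').pow_const _
    · refine Eventually.of_forall fun t => Eventually.of_forall fun z => ?_
      rw [h5]
      gcongr
      refine (eLpNorm_sub_le ?_ hφ.1 (by simpa using hr)).trans_eq ?_
      · exact (hφm.comp (measurable_id.sub_const _)).aestronglyMeasurable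
      · rw [two_mul (eLpNorm φ _ _)]
        congr 1
        exact eLpNorm_comp_measurePreserving (g := φ) hφ.1
          (measurePreserving_sub_right volume (t ^ (1 / (2 * α)) • z))
    · rw [lintegral_mul_const _ hKc.enorm.measurable]
      have := hKi.2
      rw [hasFiniteIntegral_iff_enorm] at this
      exact (ENNReal.mul_lt_top this (ENNReal.mul_lt_top ENNReal.ofNat_lt_top hφ.2)).ne
    · refine Eventually.of_forall fun z => ?_
      simp_rw [h5]
      have h7 : Tendsto (fun t : ℝ => -(t ^ (1 / (2 * α)) • z)) (𝓝[>] 0) (𝓝 0) := by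
        have h8 : ContinuousAt (fun t : ℝ => -(t ^ (1 / (2 * α)) • z)) 0 :=
          ((Real.continuousAt_rpow_const _ _ (Or.inr (by positivity))).smul_const z).neg
        have h9 := h8.tendsto
        rw [Real.zero_rpow (by positivity), zero_smul, neg_zero] at h9
        exact h9.mono_left nhdsWithin_le_nhds
      have h10 := ENNReal.Tendsto.const_mul (a := ‖K z‖ₑ)
        ((tendsto_eLpNorm_translate hr hφ).comp h7) (Or.inr enorm_ne_top)
      rw [mul_zero] at h10
      refine h10.congr fun t => ?_
      simp only [Function.comp_apply]
      congr 3
      ext x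
      rw [neg_add_eq_sub]
  rw [lintegral_zero] at h6
  exact tendsto_of_tendsto_of_tendsto_of_le_of_le' tendsto_const_nhds h6
    (Eventually.of_forall fun _ => zero_le) h1

theorem memLp_semigroup (hα : 0 < α) {h P t : ℝ} (hh : 1 ≤ h) (hhP : h ≤ P) (ht : 0 < t)
    {g : Space n → ℂ} (hg : MemLp g (ENNReal.ofReal h) volume) :
    MemLp (semigroup α t g) (ENNReal.ofReal P) volume :=
  ⟨(continuous_symbolSemigroup hα le_rfl (isHomogeneousSymbol_one n) hh ht
    hg).aestronglyMeasurable, (eLpNorm_semigroup_le hα hh hhP ht hg.1).trans_lt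
      (ENNReal.mul_lt_top ENNReal.ofReal_lt_top hg.2)⟩

theorem continuousInLp_semigroup (hα : 0 < α) {h P : ℝ} (hh : 1 ≤ h) (hhP : h ≤ P)
    {g : Space n → ℂ} (hg : MemLp g (ENNReal.ofReal h) volume) :
    ContinuousInLp (Ioi 0) P fun t => semigroup α t g := by
  refine ⟨fun t ht => memLp_semigroup hα hh hhP ht hg, fun t ht => ?_⟩
  have h1 : (1 : ℝ) ≤ 1 / (1 - (1 / h - 1 / P)) := by
    have h1 : 1 / h ≤ 1 := by rw [div_le_one (by linarith)]; exact hh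
    have h2 : 0 < 1 / P := one_div_pos.2 (by linarith)
    have h3 : 1 / P ≤ 1 / h := one_div_le_one_div_of_le (by linarith) hhP
    rw [le_div_iff₀ (by linarith)]
    linarith
  exact (tendsto_eLpNorm_symbolSemigroup_sub hα le_rfl (isHomogeneousSymbol_one n) hh hhP
    (hasKernelLp_one hα h1) ht hg).mono_left nhdsWithin_le_nhds

/-- The heat semigroup, extended by the initial value to `t = 0`. -/
theorem continuousInLp_semigroup_ite (hα : 0 < α) {h : ℝ} (hh : 1 ≤ h)
    {g : Space n → ℂ} (hg : MemLp g (ENNReal.ofReal h) volume) :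
    ContinuousInLp (Ici 0) h fun t => if t = 0 then g else semigroup α t g := by
  refine ⟨fun t ht => ?_, fun t ht => ?_⟩
  · rcases eq_or_lt_of_le (mem_Ici.1 ht) with rfl | h0
    · simpa using hg
    · simpa [h0.ne'] using memLp_semigroup hα hh le_rfl h0 hg
  · rcases eq_or_lt_of_le (mem_Ici.1 ht) with rfl | h0
    · rw [← Ioi_insert, nhdsWithin_insert, tendsto_sup]
      refine ⟨by rw [tendsto_pure_left]; intro s hs; simpa using mem_of_mem_nhds hs, ?_⟩
      refine (tendsto_eLpNorm_semigroup_sub_self hα hh hg).congr' ?_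
      filter_upwards [self_mem_nhdsWithin] with s hs
      simp [(mem_Ioi.1 hs).ne']
    · have h1 := (continuousInLp_semigroup hα hh le_rfl hg).tendsto t h0
      rw [nhdsWithin_eq_nhds.2 (Ioi_mem_nhds h0)] at h1
      refine (h1.congr' ?_).mono_left nhdsWithin_le_nhds
      filter_upwards [Ioi_mem_nhds h0] with s hs
      simp [(mem_Ioi.1 hs).ne', h0.ne']

/-- Density: split `φ = (φ - ψ) + ψ` with `ψ` continuous of compact support. The first part
contributes at most a multiple of `‖φ - ψ‖_r`, uniformly in `t`. Since `ψ ∈ L^P`, the second part is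
`O(t^β)` with `β > 0`. -/
theorem tendsto_mul_eLpNorm_semigroup (hα : 0 < α) {r P : ℝ} (hr : 1 ≤ r) (hrP : r < P)
    {φ : Space n → ℂ} (hφ : MemLp φ (ENNReal.ofReal r) volume) :
    Tendsto (fun t => ENNReal.ofReal (t ^ (n / (2 * α) * (1 / r - 1 / P))) *
      eLpNorm (semigroup α t φ) (ENNReal.ofReal P) volume) (𝓝[>] 0) (𝓝 0) := by
  have hn := natCast_pos_of_nontrivial n
  have hr0 : 0 < r := by linarith
  have hP0 : 0 < P := by linarith
  set β : ℝ := n / (2 * α) * (1 / r - 1 / P) with hβ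
  have hβ0 : 0 < β := by
    have : 1 / P < 1 / r := one_div_lt_one_div_of_lt hr0 hrP
    have : 0 < 1 / r - 1 / P := by linarith
    positivity
  set A := kernelNorm α (fun _ : Space n => 1) (1 / r - 1 / P) with hA
  set B := kernelNorm α (fun _ : Space n => 1) (1 / P - 1 / P) with hB
  have hA0 : 0 ≤ A := kernelNorm_nonneg _ _ _
  have hB0 : 0 ≤ B := kernelNorm_nonneg _ _ _
  rw [ENNReal.tendsto_nhds_zero]
  intro ε hε
  wlog hεt : ε ≠ ⊤ generalizing ε
  · rw [not_not] at hεt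
    exact Eventually.of_forall fun _ => hεt ▸ le_top
  -- Division by `A + 1` rather than by `A`, which may vanish.
  obtain ⟨e, he0, he⟩ : ∃ e : ℝ≥0∞, e ≠ 0 ∧ ENNReal.ofReal A * e ≤ ε / 2 := by
    refine ⟨ε / 2 / ENNReal.ofReal (A + 1), ?_, ?_⟩
    · exact ENNReal.div_ne_zero.2 ⟨(ENNReal.half_pos hε.ne').ne', ENNReal.ofReal_ne_top⟩
    · rw [← mul_div_assoc]
      refine ENNReal.div_le_of_le_mul ?_
      rw [mul_comm]
      gcongr
      linarith
  obtain ⟨ψ, hψc, hψe, hψ, hψr⟩ := hφ.exists_hasCompactSupport_eLpNorm_sub_le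
    ENNReal.ofReal_ne_top he0
  have hψP : MemLp ψ (ENNReal.ofReal P) volume := hψ.memLp_of_hasCompactSupport hψc
  have h1 : Tendsto (fun t : ℝ => ENNReal.ofReal (t ^ β) *
      (ENNReal.ofReal B * eLpNorm ψ (ENNReal.ofReal P) volume)) (𝓝[>] 0) (𝓝 0) := by
    have h2 : Tendsto (fun t : ℝ => ENNReal.ofReal (t ^ β)) (𝓝[>] 0) (𝓝 0) := by
      have h3 := (Real.continuousAt_rpow_const 0 β (Or.inr hβ0.le)).tendsto
      rw [Real.zero_rpow hβ0.ne'] at h3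
      have h4 := (ENNReal.continuous_ofReal.tendsto 0).comp h3
      rw [ENNReal.ofReal_zero] at h4
      exact h4.mono_left nhdsWithin_le_nhds
    have h5 := ENNReal.Tendsto.mul_const h2
      (Or.inr (ENNReal.mul_ne_top ENNReal.ofReal_ne_top hψP.2.ne) :
        (0 : ℝ≥0∞) ≠ 0 ∨ ENNReal.ofReal B * eLpNorm ψ (ENNReal.ofReal P) volume ≠ ⊤)
    rwa [zero_mul] at h5
  filter_upwards [self_mem_nhdsWithin, (ENNReal.tendsto_nhds_zero.1 h1) (ε / 2)
    (ENNReal.half_pos hε.ne')] with t ht htB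
  have ht : 0 < t := ht
  have h6 : semigroup α t φ = semigroup α t (φ - ψ) + semigroup α t ψ := by
    ext x
    have := symbolSemigroup_add hα le_rfl (isHomogeneousSymbol_one n) hr hr ht (hφ.sub hψr) hψr x
    simpa [semigroup] using this
  rw [h6]
  calc _ ≤ ENNReal.ofReal (t ^ β) * (eLpNorm (semigroup α t (φ - ψ)) (ENNReal.ofReal P) volume +
        eLpNorm (semigroup α t ψ) (ENNReal.ofReal P) volume) := by
        gcongr
        exact eLpNorm_add_le (memLp_semigroup hα hr hrP.le ht (hφ.sub hψr)).1
          (memLp_semigroup hα hr hrP.le ht hψr).1 (by simp; linarith)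
    _ = ENNReal.ofReal (t ^ β) * eLpNorm (semigroup α t (φ - ψ)) (ENNReal.ofReal P) volume +
        ENNReal.ofReal (t ^ β) * eLpNorm (semigroup α t ψ) (ENNReal.ofReal P) volume := mul_add _ _ _
    _ ≤ ε / 2 + ε / 2 := by
        gcongr
        · calc _ ≤ ENNReal.ofReal (t ^ β) * (ENNReal.ofReal (A * t ^ (-β)) * e) := by
                gcongr
                refine (eLpNorm_semigroup_le hα hr hrP.le ht (hφ.sub hψr).1).trans ?_
                gcongr
            _ = ENNReal.ofReal A * e := by
                rw [← mul_assoc, ← ENNReal.ofReal_mul (by positivity), mul_left_comm,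
                  ← Real.rpow_add ht, add_neg_cancel, Real.rpow_zero, mul_one]
            _ ≤ ε / 2 := he
        · refine le_trans ?_ htB
          gcongr
          refine (eLpNorm_semigroup_le hα (by linarith) le_rfl ht hψr.1).trans ?_
          simp [hB]
    _ = ε := ENNReal.add_halves ε

end HeatSemigroup

/-! ### Beta integrals in time. -/

section BetaIntegral

/-- The beta integral `∫₀¹ (1-s)^{-σ} s^{-γ} ds`. -/
noncomputable def betaConst (σ γ : ℝ) : ℝ :=
  (∫⁻ s in Ioo (0 : ℝ) 1, ENNReal.ofReal ((1 - s) ^ (-σ) * s ^ (-γ))).toReal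

theorem betaConst_nonneg (σ γ : ℝ) : 0 ≤ betaConst σ γ := ENNReal.toReal_nonneg

theorem lintegral_beta_lt_top {σ γ : ℝ} (hσ : σ < 1) (hγ : γ < 1) :
    ∫⁻ s in Ioo (0 : ℝ) 1, ENNReal.ofReal ((1 - s) ^ (-σ) * s ^ (-γ)) < ⊤ := by
  have h := Complex.betaIntegral_convergent (u := ((1 - γ : ℝ) : ℂ)) (v := ((1 - σ : ℝ) : ℂ))
    (by simpa using hγ) (by simpa using hσ)
  rw [intervalIntegrable_iff_integrableOn_Ioo_of_le zero_le_one] at h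
  have h1 := h.2
  rw [hasFiniteIntegral_iff_enorm] at h1
  refine lt_of_le_of_lt (le_of_eq ?_) h1
  refine setLIntegral_congr_fun measurableSet_Ioo fun s hs => ?_
  have h0 : 0 < s := hs.1
  have h2 : 0 < 1 - s := sub_pos.2 hs.2
  rw [← ofReal_norm, norm_mul]
  congr 1
  have e1 : (1 : ℂ) - s = ((1 - s : ℝ) : ℂ) := by push_cast; ring
  have e2 : ((1 - γ : ℝ) : ℂ) - 1 = ((-γ : ℝ) : ℂ) := by push_cast; ring
  have e3 : ((1 - σ : ℝ) : ℂ) - 1 = ((-σ : ℝ) : ℂ) := by push_cast; ring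
  rw [e1, e2, e3, Complex.norm_cpow_eq_rpow_re_of_pos h0, Complex.norm_cpow_eq_rpow_re_of_pos h2,
    Complex.ofReal_re, Complex.ofReal_re, mul_comm]

theorem setLIntegral_Ioo_zero_eq {t : ℝ} (ht : 0 < t) (F : ℝ → ℝ≥0∞) :
    ∫⁻ s in Ioo 0 t, F s = ENNReal.ofReal t * ∫⁻ s in Ioo (0 : ℝ) 1, F (t * s) := by
  have h1 : Ioo 0 t = (fun s => t * s) '' Ioo 0 1 := by
    rw [image_mul_left_Ioo ht, mul_zero, mul_one]
  rw [h1, lintegral_image_eq_lintegral_abs_deriv_mul measurableSet_Ioo (f' := fun _ => t)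
    (fun s _ => by simpa using ((hasDerivAt_id s).const_mul t).hasDerivWithinAt)
    (mul_right_injective₀ ht.ne').injOn, abs_of_pos ht, lintegral_const_mul' _ _
    ENNReal.ofReal_ne_top]

theorem setIntegral_Ioo_zero_eq {t : ℝ} (ht : 0 < t) (F : ℝ → ℂ) :
    ∫ s in Ioo 0 t, F s = (t : ℂ) * ∫ s in Ioo (0 : ℝ) 1, F (t * s) := by
  have h1 : Ioo 0 t = (fun s => t * s) '' Ioo 0 1 := by
    rw [image_mul_left_Ioo ht, mul_zero, mul_one]
  rw [h1, integral_image_eq_integral_abs_deriv_smul measurableSet_Ioo (f' := fun _ => t)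
    (fun s _ => by simpa using ((hasDerivAt_id s).const_mul t).hasDerivWithinAt)
    (mul_right_injective₀ ht.ne').injOn, abs_of_pos ht, integral_smul, Complex.real_smul]

theorem lintegral_rpow_mul_rpow {σ γ t : ℝ} (hσ : σ < 1) (hγ : γ < 1) (ht : 0 < t) :
    ∫⁻ s in Ioo 0 t, ENNReal.ofReal ((t - s) ^ (-σ) * s ^ (-γ)) =
      ENNReal.ofReal (betaConst σ γ * t ^ (1 - σ - γ)) := by
  rw [setLIntegral_Ioo_zero_eq ht]
  have h1 : ∀ s ∈ Ioo (0 : ℝ) 1, ENNReal.ofReal ((t - t * s) ^ (-σ) * (t * s) ^ (-γ)) =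
      ENNReal.ofReal (t ^ (-σ - γ)) * ENNReal.ofReal ((1 - s) ^ (-σ) * s ^ (-γ)) := by
    intro s hs
    have h0 : 0 ≤ s := hs.1.le
    have h2 : 0 ≤ 1 - s := sub_nonneg.2 hs.2.le
    rw [← ENNReal.ofReal_mul (by positivity)]
    congr 1
    have : t - t * s = t * (1 - s) := by ring
    rw [this, Real.mul_rpow ht.le h2, Real.mul_rpow ht.le h0, sub_eq_add_neg (-σ),
      Real.rpow_add ht]
    ring
  rw [setLIntegral_congr_fun measurableSet_Ioo h1, lintegral_const_mul' _ _ ENNReal.ofReal_ne_top,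
    ENNReal.ofReal_mul (betaConst_nonneg _ _), betaConst,
    ENNReal.ofReal_toReal (lintegral_beta_lt_top hσ hγ).ne, ← mul_assoc,
    ← ENNReal.ofReal_mul ht.le, mul_comm]
  congr 2
  rw [sub_sub, sub_eq_add_neg 1, Real.rpow_add ht, Real.rpow_one]
  ring_nf

end BetaIntegral

/-! ### The Duhamel integral: bounds, restarting, measurability. -/

section Duhamel

variable {n : ℕ} {α d : ℝ} {Q : Space n → ℂ}

/-- The Duhamel integral of the source `g`. -/
noncomputable def duhamel (α : ℝ) (Q : Space n → ℂ) (g : ℝ → Space n → ℂ) (t : ℝ) (x : Space n) :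
    ℂ :=
  ∫ s in Ioo 0 t, symbolSemigroup α Q (t - s) (g s) x

/-- The `L^P` mass of the integrand of the Duhamel integral. -/
noncomputable def duhamelMass (α : ℝ) (Q : Space n → ℂ) (g : ℝ → Space n → ℂ) (P t : ℝ) : ℝ≥0∞ :=
  ∫⁻ s in Ioo 0 t, eLpNorm (symbolSemigroup α Q (t - s) (g s)) (ENNReal.ofReal P) volume

variable [Nontrivial (Space n)]

theorem aestronglyMeasurable_symbolSemigroup (hα : 0 < α) (hd : 0 ≤ d)
    (hQ : IsHomogeneousSymbol d Q) {h : ℝ} (hh : 1 ≤ h) {I : Set ℝ} {g : ℝ → Space n → ℂ}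
    (hg : ContinuousInLp I h g) {J : Set ℝ} (hJ : MeasurableSet J) {a b : ℝ → ℝ}
    (ha : ContinuousOn a J) (hb : ContinuousOn b J) (ha0 : ∀ s ∈ J, 0 < a s)
    (hbI : ∀ s ∈ J, b s ∈ I) :
    AEStronglyMeasurable (Function.uncurry fun s x => symbolSemigroup α Q (a s) (g (b s)) x)
      ((volume.restrict J).prod (volume : Measure (Space n))) := by
  have h1 : (volume.restrict J).prod (volume : Measure (Space n)) =
      (volume.prod volume).restrict (J ×ˢ univ) := by
    rw [← Measure.prod_restrict, Measure.restrict_univ]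
  rw [h1]
  have h3 := continuousOn_symbolSemigroup hα hd hQ hh hg
  set Φ : ℝ × ℝ × Space n → ℂ := fun z => symbolSemigroup α Q z.1 (g z.2.1) z.2.2 with hΦ
  have h4 : (Function.uncurry fun s x => symbolSemigroup α Q (a s) (g (b s)) x) =
      fun z : ℝ × Space n => Φ (a z.1, b z.1, z.2) := rfl
  rw [h4]
  clear_value Φ
  refine ContinuousOn.aestronglyMeasurable ?_ (hJ.prod MeasurableSet.univ)
  have h2 : ContinuousOn (fun z : ℝ × Space n => (a z.1, b z.1, z.2)) (J ×ˢ univ) :=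
    (ha.comp continuousOn_fst fun z hz => hz.1).prodMk
      ((hb.comp continuousOn_fst fun z hz => hz.1).prodMk continuousOn_snd)
  exact h3.comp h2 fun z hz => ⟨ha0 _ hz.1, hbI _ hz.1, mem_univ _⟩

theorem aestronglyMeasurable_uncurry_duhamel (hα : 0 < α) (hd : 0 ≤ d)
    (hQ : IsHomogeneousSymbol d Q) {h : ℝ} (hh : 1 ≤ h) {g : ℝ → Space n → ℂ}
    (hg : ContinuousInLp (Ioi 0) h g) (t : ℝ) :
    AEStronglyMeasurable (Function.uncurry fun s x => symbolSemigroup α Q (t - s) (g s) x)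
      ((volume.restrict (Ioo 0 t)).prod (volume : Measure (Space n))) :=
  aestronglyMeasurable_symbolSemigroup hα hd hQ hh hg measurableSet_Ioo (a := fun s => t - s)
    (b := fun s => s) (by fun_prop) (by fun_prop) (fun s hs => sub_pos.2 hs.2) fun s hs => hs.1

theorem aestronglyMeasurable_duhamel (hα : 0 < α) (hd : 0 ≤ d)
    (hQ : IsHomogeneousSymbol d Q) {h : ℝ} (hh : 1 ≤ h) {g : ℝ → Space n → ℂ}
    (hg : ContinuousInLp (Ioi 0) h g) (t : ℝ) :
    AEStronglyMeasurable (duhamel α Q g t) volume := by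
  have h1 := aestronglyMeasurable_uncurry_duhamel hα hd hQ hh hg t
  rw [← Measure.prod_swap] at h1
  exact (h1.comp_measurable measurable_swap).integral_prod_right'

theorem eLpNorm_duhamel_le (hα : 0 < α) (hd : 0 ≤ d)
    (hQ : IsHomogeneousSymbol d Q) {h : ℝ} (hh : 1 ≤ h) {g : ℝ → Space n → ℂ}
    (hg : ContinuousInLp (Ioi 0) h g) {P : ℝ} (hP : 1 ≤ P) (t : ℝ) :
    eLpNorm (duhamel α Q g t) (ENNReal.ofReal P) volume ≤ duhamelMass α Q g P t :=
  eLpNorm_integral_le hP (aestronglyMeasurable_uncurry_duhamel hα hd hQ hh hg t)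

theorem ae_integrableOn_of_duhamelMass (hα : 0 < α) (hd : 0 ≤ d)
    (hQ : IsHomogeneousSymbol d Q) {h : ℝ} (hh : 1 ≤ h) {g : ℝ → Space n → ℂ}
    (hg : ContinuousInLp (Ioi 0) h g) {P : ℝ} (hP : 1 ≤ P) {t : ℝ}
    (hfin : duhamelMass α Q g P t < ⊤) :
    ∀ᵐ x, IntegrableOn (fun s => symbolSemigroup α Q (t - s) (g s) x) (Ioo 0 t) :=
  ae_integrable_of_lintegral_eLpNorm_lt_top hP
    (aestronglyMeasurable_uncurry_duhamel hα hd hQ hh hg t) hfin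

/-- The order of the singularity of `Q(D) S_α(t)` from `L^h` to `L^P`, where `y = 1/h - 1/P`. -/
noncomputable def smoothingOrder (n : ℕ) (α d y : ℝ) : ℝ := (d + n * y) / (2 * α)

/-- Smoothing under the time integral leaves `∫ (t-s)^{-σ} s^{-γ} ds`, finite because `σ, γ < 1`;
its scaling gives the power of `t`. -/
theorem duhamelMass_le (hα : 0 < α) (hd : 0 ≤ d) (hQ : IsHomogeneousSymbol d Q) {h P : ℝ}
    (hh : 1 ≤ h) (hhP : h < P) {g : ℝ → Space n → ℂ} {γ G t : ℝ} (hG : 0 ≤ G) (ht : 0 < t)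
    (hσ : smoothingOrder n α d (1 / h - 1 / P) < 1) (hγ : γ < 1)
    (hgm : ∀ s ∈ Ioo 0 t, AEStronglyMeasurable (g s) volume)
    (hg : ∀ s ∈ Ioo 0 t, eLpNorm (g s) (ENNReal.ofReal h) volume ≤ ENNReal.ofReal (G * s ^ (-γ))) :
    duhamelMass α Q g P t ≤ ENNReal.ofReal (kernelNorm α Q (1 / h - 1 / P) *
      betaConst (smoothingOrder n α d (1 / h - 1 / P)) γ * G *
        t ^ (1 - smoothingOrder n α d (1 / h - 1 / P) - γ)) := by
  set k := kernelNorm α Q (1 / h - 1 / P) with hk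
  set σ := smoothingOrder n α d (1 / h - 1 / P) with hσd
  have hk0 : 0 ≤ k := kernelNorm_nonneg _ _ _
  calc duhamelMass α Q g P t
      ≤ ∫⁻ s in Ioo 0 t, ENNReal.ofReal (k * G) *
          ENNReal.ofReal ((t - s) ^ (-σ) * s ^ (-γ)) := by
        refine setLIntegral_mono' measurableSet_Ioo fun s hs => ?_
        refine (eLpNorm_symbolSemigroup_le hα hd hQ hh hhP (sub_pos.2 hs.2) (hgm s hs)).trans ?_
        refine (mul_le_mul_right (hg s hs) _).trans_eq ?_
        have h1 : 0 ≤ t - s := (sub_pos.2 hs.2).le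
        rw [← ENNReal.ofReal_mul (by positivity), ← ENNReal.ofReal_mul (by positivity), hσd,
          smoothingOrder]
        congr 1
        ring
    _ = _ := by
        rw [lintegral_const_mul' _ _ ENNReal.ofReal_ne_top, lintegral_rpow_mul_rpow hσ hγ ht,
          ← ENNReal.ofReal_mul (by positivity)]
        congr 1
        ring

/-- Away from `t = 0`, the Duhamel integral of a source that is integrable near `t = 0` in `L^{h₀}`
and locally bounded in `L^h`. -/
theorem exists_duhamelMass_le (hα : 0 < α) (hd : 0 ≤ d) (hQ : IsHomogeneousSymbol d Q)
    {h₀ h P : ℝ} (hh₀ : 1 ≤ h₀) (hh₀P : h₀ < P) (hh : 1 ≤ h) (hhP : h < P)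
    {g : ℝ → Space n → ℂ} {G a b : ℝ} (ha : 0 < a)
    (hσ : smoothingOrder n α d (1 / h - 1 / P) < 1)
    (hgm : ∀ s ∈ Ioi (0 : ℝ), AEStronglyMeasurable (g s) volume)
    (hg₀ : ∫⁻ s in Ioc 0 b, eLpNorm (g s) (ENNReal.ofReal h₀) volume < ⊤)
    (hg : ∀ s ∈ Icc (a / 2) b, eLpNorm (g s) (ENNReal.ofReal h) volume ≤ ENNReal.ofReal G) :
    ∃ C : ℝ, ∀ t ∈ Icc a b, duhamelMass α Q g P t ≤ ENNReal.ofReal C := by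
  set k := kernelNorm α Q (1 / h - 1 / P) with hk
  set k₀ := kernelNorm α Q (1 / h₀ - 1 / P) with hk₀
  set σ := smoothingOrder n α d (1 / h - 1 / P) with hσd
  set σ₀ := smoothingOrder n α d (1 / h₀ - 1 / P) with hσd₀
  have hk0 : 0 ≤ k := kernelNorm_nonneg _ _ _
  have hk₀0 : 0 ≤ k₀ := kernelNorm_nonneg _ _ _
  have hσ₀ : 0 ≤ σ₀ := by
    have : 1 / P < 1 / h₀ := one_div_lt_one_div_of_lt (by linarith) hh₀P
    have : 0 < 1 / h₀ - 1 / P := by linarith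
    simp only [hσd₀, smoothingOrder]
    positivity
  set I := ∫⁻ s in Ioc 0 b, eLpNorm (g s) (ENNReal.ofReal h₀) volume with hI
  have hkey : ∀ t ∈ Icc a b, duhamelMass α Q g P t ≤
      ENNReal.ofReal (k₀ * (a / 2) ^ (-σ₀)) * I +
        ENNReal.ofReal (k * |G|) * ENNReal.ofReal (betaConst σ 0 * t ^ (1 - σ - 0)) := by
    intro t ht
    have ht0 : 0 < t := ha.trans_le ht.1
    rw [← lintegral_rpow_mul_rpow hσ one_pos ht0, hI, ← lintegral_const_mul' _ _
      ENNReal.ofReal_ne_top, ← lintegral_const_mul' _ _ ENNReal.ofReal_ne_top]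
    refine le_trans ?_ (add_le_add (lintegral_mono_set (fun s hs =>
      ⟨hs.1, hs.2.le.trans ht.2⟩ : Ioo 0 t ⊆ Ioc 0 b)) le_rfl)
    rw [← lintegral_add_right]
    · refine setLIntegral_mono' measurableSet_Ioo fun s hs => ?_
      have h1 : 0 < t - s := sub_pos.2 hs.2
      -- For `s ≤ t/2` the lag is at least `a/2`, so the kernel is not singular and the source need
      -- only be integrable in time. For `s ≥ t/2 ≥ a/2` the source is bounded and the singularity
      -- `σ < 1` is integrable.
      rcases le_total s (t / 2) with hst | hst
      · refine le_add_right ((eLpNorm_symbolSemigroup_le hα hd hQ hh₀ hh₀P h1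
          (hgm s hs.1)).trans ?_)
        gcongr
        have h2 : a / 2 ≤ t - s := by
          have := ht.1
          linarith
        exact Real.rpow_le_rpow_of_nonpos (by positivity) h2 (neg_nonpos.2 hσ₀)
      · refine le_add_left ((eLpNorm_symbolSemigroup_le hα hd hQ hh hhP h1 (hgm s hs.1)).trans ?_)
        have h2 : s ∈ Icc (a / 2) b := ⟨by have := ht.1; linarith, hs.2.le.trans ht.2⟩
        refine (mul_le_mul_right (hg s h2) _).trans ?_
        rw [← ENNReal.ofReal_mul (by positivity), ← ENNReal.ofReal_mul (by positivity), neg_zero,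
          Real.rpow_zero]
        refine ENNReal.ofReal_le_ofReal ?_
        rw [mul_one, mul_right_comm]
        refine mul_le_mul_of_nonneg_right (mul_le_mul_of_nonneg_left (le_abs_self G) hk0) ?_
        positivity
    · exact Measurable.const_mul (by fun_prop) _
  refine ⟨k₀ * (a / 2) ^ (-σ₀) * I.toReal +
    k * |G| * (betaConst σ 0 * (b ^ (1 - σ))), fun t ht => (hkey t ht).trans ?_⟩
  have hb0 : 0 < b := ha.trans_le (ht.1.trans ht.2)
  have h0 : 0 ≤ betaConst σ 0 := betaConst_nonneg _ _
  rw [ENNReal.ofReal_add (by positivity) (by positivity),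
    ENNReal.ofReal_mul (p := k₀ * (a / 2) ^ (-σ₀)) (by positivity),
    ENNReal.ofReal_toReal hg₀.ne, ← ENNReal.ofReal_mul (by positivity), sub_zero]
  gcongr
  · exact (ha.trans_le ht.1).le
  · exact ht.2

/-- Fubini and the semigroup law. Finiteness of the mass in one `L^P` makes the double integral
absolutely convergent at every `x`. -/
theorem semigroup_duhamel (hα : 0 < α) (hd : 0 ≤ d) (hQ : IsHomogeneousSymbol d Q) {h : ℝ}
    (hh : 1 ≤ h) {g : ℝ → Space n → ℂ} (hg : ContinuousInLp (Ioi 0) h g) {P : ℝ} (hP : 1 ≤ P)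
    {t τ : ℝ} (hτ : 0 < τ) (hfin : duhamelMass α Q g P t < ⊤) (x : Space n) :
    semigroup α τ (duhamel α Q g t) x =
      ∫ s in Ioo 0 t, symbolSemigroup α Q (t + τ - s) (g s) x := by
  set K := kernel α (fun _ : Space n => 1) τ with hK
  have hKc : Continuous K := continuous_kernel hα le_rfl (isHomogeneousSymbol_one n) hτ
  obtain ⟨N, hN, hN'⟩ := exists_lintegral_kernel_mul_le (n := n) (a := τ) (b := τ) hα le_rfl
    (isHomogeneousSymbol_one n) hP hτ
  have hm := aestronglyMeasurable_uncurry_duhamel hα hd hQ hh hg t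
  have hint : Integrable (Function.uncurry fun s y =>
      K (x - y) * symbolSemigroup α Q (t - s) (g s) y)
      ((volume.restrict (Ioo 0 t)).prod (volume : Measure (Space n))) := by
    have hmeas : AEStronglyMeasurable (Function.uncurry fun s y =>
        K (x - y) * symbolSemigroup α Q (t - s) (g s) y)
        ((volume.restrict (Ioo 0 t)).prod (volume : Measure (Space n))) :=
      ((hKc.comp (continuous_const.sub continuous_snd)).aestronglyMeasurable).mul hm
    refine ⟨hmeas, ?_⟩
    rw [hasFiniteIntegral_iff_enorm]
    refine (lintegral_prod (fun z : ℝ × Space n =>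
      ‖K (x - z.2) * symbolSemigroup α Q (t - z.1) (g z.1) z.2‖ₑ) hmeas.enorm).trans_lt ?_
    refine lt_of_le_of_lt (b := N * duhamelMass α Q g P t) ?_
      (ENNReal.mul_lt_top hN.lt_top hfin)
    rw [duhamelMass, ← lintegral_const_mul' _ _ hN]
    refine setLIntegral_mono' measurableSet_Ioo fun s hs => ?_
    exact hN' τ ⟨le_rfl, le_rfl⟩ x _ (continuous_symbolSemigroup hα hd hQ hh (sub_pos.2 hs.2)
      (hg.memLp s hs.1)).aestronglyMeasurable
  have h1 : semigroup α τ (duhamel α Q g t) x =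
      ∫ y, ∫ s in Ioo 0 t, K (x - y) * symbolSemigroup α Q (t - s) (g s) y := by
    simp only [semigroup, symbolSemigroup, duhamel, integral_const_mul]
    rfl
  rw [h1, ← integral_integral_swap hint]
  refine setIntegral_congr_fun measurableSet_Ioo fun s hs => ?_
  have h2 := semigroup_symbolSemigroup hα hd hQ hh hτ (sub_pos.2 hs.2) (hg.memLp s hs.1) x
  have e : τ + (t - s) = t + τ - s := by ring
  rw [e] at h2
  exact h2

theorem duhamel_add {g : ℝ → Space n → ℂ} {t τ : ℝ} (ht : 0 ≤ t) (hτ : 0 < τ) {x : Space n}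
    (hint : IntegrableOn (fun s => symbolSemigroup α Q (t + τ - s) (g s) x) (Ioo 0 (t + τ))) :
    duhamel α Q g (t + τ) x = (∫ s in Ioo 0 t, symbolSemigroup α Q (t + τ - s) (g s) x) +
      duhamel α Q (fun s => g (t + s)) τ x := by
  have h1 : duhamel α Q (fun s => g (t + s)) τ x =
      ∫ s in Ioo t (t + τ), symbolSemigroup α Q (t + τ - s) (g s) x := by
    rw [duhamel, ← integral_Ioc_eq_integral_Ioo, ← integral_Ioc_eq_integral_Ioo,
      ← intervalIntegral.integral_of_le hτ.le, ← intervalIntegral.integral_of_le (by linarith)]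
    have := intervalIntegral.integral_comp_add_left (a := 0) (b := τ)
      (fun s => symbolSemigroup α Q (t + τ - s) (g s) x) t
    rw [add_zero] at this
    rw [← this]
    refine intervalIntegral.integral_congr fun s _ => ?_
    have e : t + τ - (t + s) = τ - s := by ring
    rw [e]
  rw [h1, duhamel, ← integral_Ioc_eq_integral_Ioo, ← integral_Ioc_eq_integral_Ioo,
    ← integral_Ioc_eq_integral_Ioo, ← setIntegral_union (by
      rw [Set.disjoint_left]; intro s hs hs'; exact absurd hs.2 (not_le.2 hs'.1))
      measurableSet_Ioc]
  · rw [Ioc_union_Ioc_eq_Ioc ht (by linarith)]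
  · rw [integrableOn_Ioc_iff_integrableOn_Ioo]
    exact hint.mono_set (Ioo_subset_Ioo_right (by linarith))
  · rw [integrableOn_Ioc_iff_integrableOn_Ioo]
    exact hint.mono_set (Ioo_subset_Ioo_left ht)

theorem tendsto_eLpNorm_symbolSemigroup_comp (hα : 0 < α) (hd : 0 ≤ d)
    (hQ : IsHomogeneousSymbol d Q) {h P : ℝ} (hh : 1 ≤ h) (hhP : h < P) {ι : Type*} {l : Filter ι}
    {τ : ι → ℝ} {τ₀ : ℝ} (hτ₀ : 0 < τ₀) (hτ : Tendsto τ l (𝓝 τ₀)) {g : ι → Space n → ℂ}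
    {g₀ : Space n → ℂ} (hg₀ : MemLp g₀ (ENNReal.ofReal h) volume)
    (hg : ∀ᶠ i in l, MemLp (g i) (ENNReal.ofReal h) volume)
    (hlim : Tendsto (fun i => eLpNorm (g i - g₀) (ENNReal.ofReal h) volume) l (𝓝 0)) :
    Tendsto (fun i => eLpNorm (symbolSemigroup α Q (τ i) (g i) - symbolSemigroup α Q τ₀ g₀)
      (ENNReal.ofReal P) volume) l (𝓝 0) := by
  set k := kernelNorm α Q (1 / h - 1 / P) with hk
  set σ := (d + n * (1 / h - 1 / P)) / (2 * α) with hσ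
  have hK : HasKernelLp α Q (1 / (1 - (1 / h - 1 / P))) := by
    have h1 : 1 / h ≤ 1 := by rw [div_le_one (by linarith)]; exact hh
    have h2 : 0 < 1 / P := one_div_pos.2 (by linarith)
    have h3 : 1 / P < 1 / h := one_div_lt_one_div_of_lt (by linarith) hhP
    refine hQ.hasKernelLp hα hd ?_
    rw [lt_div_iff₀ (by linarith)]
    linarith
  have h1 : Tendsto (fun i => ENNReal.ofReal (k * τ i ^ (-σ)) *
      eLpNorm (g i - g₀) (ENNReal.ofReal h) volume +
      eLpNorm (symbolSemigroup α Q (τ i) g₀ - symbolSemigroup α Q τ₀ g₀) (ENNReal.ofReal P) volume)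
      l (𝓝 0) := by
    have h2 : Tendsto (fun i => ENNReal.ofReal (k * τ i ^ (-σ))) l
        (𝓝 (ENNReal.ofReal (k * τ₀ ^ (-σ)))) :=
      (ENNReal.continuous_ofReal.tendsto _).comp
        ((hτ.rpow_const (Or.inl hτ₀.ne')).const_mul k)
    have h3 := ENNReal.Tendsto.mul h2 (Or.inr ENNReal.zero_ne_top) hlim
      (Or.inr ENNReal.ofReal_ne_top)
    have h4 := (tendsto_eLpNorm_symbolSemigroup_sub hα hd hQ hh hhP.le hK hτ₀ hg₀).comp hτ
    simpa using h3.add h4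
  refine tendsto_of_tendsto_of_tendsto_of_le_of_le' tendsto_const_nhds h1
    (Eventually.of_forall fun _ => zero_le) ?_
  filter_upwards [hg, hτ.eventually (lt_mem_nhds hτ₀)] with i hgi hτi
  have h5 : symbolSemigroup α Q (τ i) (g i) - symbolSemigroup α Q τ₀ g₀ =
      symbolSemigroup α Q (τ i) (g i - g₀) +
        (symbolSemigroup α Q (τ i) g₀ - symbolSemigroup α Q τ₀ g₀) := by
    ext x
    have := symbolSemigroup_sub hα hd hQ hh hh hτi hgi hg₀ x
    have e : (g i - g₀) = fun y => g i y - g₀ y := rfl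
    simp only [Pi.sub_apply, Pi.add_apply, e, this]
    ring
  rw [h5]
  refine (eLpNorm_add_le ?_ ?_ (by simp; linarith)).trans ?_
  · exact (continuous_symbolSemigroup hα hd hQ hh hτi (hgi.sub hg₀)).aestronglyMeasurable
  · exact ((continuous_symbolSemigroup hα hd hQ hh hτi hg₀).sub
      (continuous_symbolSemigroup hα hd hQ hh hτ₀ hg₀)).aestronglyMeasurable
  · gcongr
    exact eLpNorm_symbolSemigroup_le hα hd hQ hh hhP hτi (hgi.sub hg₀).1

end Duhamel

/-! ### Continuity in time of the Duhamel integral. -/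

section DuhamelContinuity

variable {n : ℕ} {α d : ℝ} {Q : Space n → ℂ}

theorem tendsto_eLpNorm_smul_sub {ι : Type*} {l : Filter ι} {P : ℝ} {c : ι → ℂ}
    {c₀ : ℂ} {A : ι → Space n → ℂ} {A₀ : Space n → ℂ} (hP : 1 ≤ P) (hc : Tendsto c l (𝓝 c₀))
    (hA₀ : MemLp A₀ (ENNReal.ofReal P) volume)
    (hAm : ∀ᶠ i in l, AEStronglyMeasurable (A i) volume)
    (hA : Tendsto (fun i => eLpNorm (A i - A₀) (ENNReal.ofReal P) volume) l (𝓝 0)) :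
    Tendsto (fun i => eLpNorm (c i • A i - c₀ • A₀) (ENNReal.ofReal P) volume) l (𝓝 0) := by
  have h1 : Tendsto (fun i => ‖c i‖ₑ * eLpNorm (A i - A₀) (ENNReal.ofReal P) volume +
      ‖c i - c₀‖ₑ * eLpNorm A₀ (ENNReal.ofReal P) volume) l (𝓝 0) := by
    have h2 := ENNReal.Tendsto.mul hc.enorm (Or.inr ENNReal.zero_ne_top) hA (Or.inr enorm_ne_top)
    have h3 : Tendsto (fun i => ‖c i - c₀‖ₑ) l (𝓝 0) := by
      have := (hc.sub_const c₀).enorm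
      simpa using this
    have h4 := ENNReal.Tendsto.mul_const h3
      (Or.inr hA₀.2.ne : (0 : ℝ≥0∞) ≠ 0 ∨ eLpNorm A₀ (ENNReal.ofReal P) volume ≠ ⊤)
    simpa using h2.add h4
  refine tendsto_of_tendsto_of_tendsto_of_le_of_le' tendsto_const_nhds h1
    (Eventually.of_forall fun _ => zero_le) ?_
  filter_upwards [hAm] with i hi
  have h5 : c i • A i - c₀ • A₀ = c i • (A i - A₀) + (c i - c₀) • A₀ := by
    rw [smul_sub, sub_smul]; abel
  rw [h5]
  refine (eLpNorm_add_le ((hi.sub hA₀.1).const_smul _) (hA₀.1.const_smul _) (by simpa)).trans ?_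
  rw [eLpNorm_const_smul, eLpNorm_const_smul]

variable [Nontrivial (Space n)]

/-- The substitution `s ↦ t s` moves the integral to the fixed interval `(0, 1)`. Both singularities
then sit at its end points for every `t`, and near `t₀` one beta integrand dominates the `L^P`
norms. -/
theorem continuousInLp_duhamel (hα : 0 < α) (hd : 0 ≤ d) (hQ : IsHomogeneousSymbol d Q)
    {h P : ℝ} (hh : 1 ≤ h) (hhP : h < P) {g : ℝ → Space n → ℂ} {γ : ℝ}
    (hσ : smoothingOrder n α d (1 / h - 1 / P) < 1) (hγ : γ < 1)
    (hg : ContinuousInLp (Ioi 0) h g)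
    (hb : ∀ T : ℝ, 0 < T → ∃ G : ℝ, 0 ≤ G ∧ ∀ s ∈ Ioc 0 T,
      eLpNorm (g s) (ENNReal.ofReal h) volume ≤ ENNReal.ofReal (G * s ^ (-γ))) :
    ContinuousInLp (Ioi 0) P (duhamel α Q g) := by
  have hP : 1 ≤ P := hh.trans hhP.le
  have hP0 : 0 < P := by linarith
  have hmem : ∀ t ∈ Ioi (0 : ℝ), MemLp (duhamel α Q g t) (ENNReal.ofReal P) volume := by
    intro t ht
    obtain ⟨G, hG0, hG⟩ := hb t ht
    refine ⟨aestronglyMeasurable_duhamel hα hd hQ hh hg t,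
      (eLpNorm_duhamel_le hα hd hQ hh hg hP t).trans_lt
        ((duhamelMass_le hα hd hQ hh hhP hG0 ht hσ hγ (fun s hs => (hg.memLp s hs.1).1)
          fun s hs => hG s ⟨hs.1, hs.2.le⟩).trans_lt ENNReal.ofReal_lt_top)⟩
  refine ⟨hmem, fun t₀ ht₀ => ?_⟩
  have ht₀ : 0 < t₀ := ht₀
  set k := kernelNorm α Q (1 / h - 1 / P) with hk
  set σ := smoothingOrder n α d (1 / h - 1 / P) with hσd
  have hk0 : 0 ≤ k := kernelNorm_nonneg _ _ _
  set F : ℝ → ℝ → Space n → ℂ := fun t s => symbolSemigroup α Q (t * (1 - s)) (g (t * s)) with hF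
  set E : ℝ → Space n → ℂ := fun t x => ∫ s in Ioo (0 : ℝ) 1, F t s x with hE
  have hDE : ∀ t, 0 < t → duhamel α Q g t = (t : ℂ) • E t := by
    intro t ht
    ext x
    rw [duhamel, setIntegral_Ioo_zero_eq ht]
    simp only [Pi.smul_apply, smul_eq_mul, hE, hF]
    congr 1
    refine integral_congr_ae (Eventually.of_forall fun s => ?_)
    have e : t - t * s = t * (1 - s) := by ring
    simp only [e]
  have hFm : ∀ t, 0 < t → AEStronglyMeasurable (Function.uncurry (F t))
      ((volume.restrict (Ioo 0 1)).prod (volume : Measure (Space n))) := by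
    intro t ht
    exact aestronglyMeasurable_symbolSemigroup hα hd hQ hh hg measurableSet_Ioo
      (a := fun s => t * (1 - s)) (b := fun s => t * s) (by fun_prop) (by fun_prop)
      (fun s hs => mul_pos ht (sub_pos.2 hs.2)) fun s hs => mul_pos ht hs.1
  obtain ⟨G, hG0, hG⟩ := hb (2 * t₀) (by linarith)
  have hFb : ∀ t, 0 < t → t ≤ 2 * t₀ → ∀ s ∈ Ioo (0 : ℝ) 1,
      eLpNorm (F t s) (ENNReal.ofReal P) volume ≤ ENNReal.ofReal (k * G * t ^ (-σ - γ)) *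
        ENNReal.ofReal ((1 - s) ^ (-σ) * s ^ (-γ)) := by
    intro t ht ht2 s hs
    have h1 : 0 < 1 - s := sub_pos.2 hs.2
    have h2 : t * s ∈ Ioc 0 (2 * t₀) :=
      ⟨mul_pos ht hs.1, by nlinarith [hs.1, hs.2]⟩
    refine (eLpNorm_symbolSemigroup_le hα hd hQ hh hhP (mul_pos ht h1)
      (hg.memLp _ h2.1).1).trans ((mul_le_mul_right (hG _ h2) _).trans_eq ?_)
    have hs0 := hs.1
    rw [← ENNReal.ofReal_mul (by positivity), ← ENNReal.ofReal_mul (by positivity),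
      Real.mul_rpow ht.le h1.le, Real.mul_rpow ht.le hs0.le, sub_eq_add_neg (-σ), Real.rpow_add ht,
      hσd, smoothingOrder]
    congr 1
    ring
  have hFfin : ∀ t, 0 < t → t ≤ 2 * t₀ →
      ∫⁻ s in Ioo (0 : ℝ) 1, eLpNorm (F t s) (ENNReal.ofReal P) volume < ⊤ := by
    intro t ht ht2
    refine (setLIntegral_mono' measurableSet_Ioo (hFb t ht ht2)).trans_lt ?_
    rw [lintegral_const_mul' _ _ ENNReal.ofReal_ne_top]
    exact ENNReal.mul_lt_top ENNReal.ofReal_lt_top (lintegral_beta_lt_top hσ hγ)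
  have hEm : ∀ t, 0 < t → AEStronglyMeasurable (E t) volume := by
    intro t ht
    have h1 := hFm t ht
    rw [← Measure.prod_swap] at h1
    exact (h1.comp_measurable measurable_swap).integral_prod_right'
  have hEmem : MemLp (E t₀) (ENNReal.ofReal P) volume :=
    ⟨hEm t₀ ht₀, (eLpNorm_integral_le hP (hFm t₀ ht₀)).trans_lt (hFfin t₀ ht₀ (by linarith))⟩
  have hnear : ∀ᶠ t in 𝓝 t₀, 0 < t ∧ t ≤ 2 * t₀ := by
    filter_upwards [Ioo_mem_nhds ht₀ (by linarith : t₀ < 2 * t₀)] with t ht using ⟨ht.1, ht.2.le⟩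
  have hlim : Tendsto (fun t => ∫⁻ s in Ioo (0 : ℝ) 1,
      eLpNorm (F t s - F t₀ s) (ENNReal.ofReal P) volume) (𝓝 t₀)
      (𝓝 (∫⁻ _ in Ioo (0 : ℝ) 1, 0)) := by
    set B := t₀ ^ (-σ - γ) + 1 with hB
    have hB0 : 0 < B := by positivity
    have hBev : ∀ᶠ t : ℝ in 𝓝 t₀, t ^ (-σ - γ) ≤ B :=
      ((Real.continuousAt_rpow_const t₀ _ (Or.inl ht₀.ne')).tendsto.eventually
        (gt_mem_nhds (lt_add_one _))).mono fun t ht => ht.le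
    refine tendsto_lintegral_filter_of_dominated_convergence'
      (fun s => 2 * ENNReal.ofReal (k * G * B) * ENNReal.ofReal ((1 - s) ^ (-σ) * s ^ (-γ)))
      ?_ ?_ ?_ ?_
    · filter_upwards [hnear] with t ht
      simp_rw [eLpNorm_ofReal_eq hP0]
      exact ((((hFm t ht.1).sub (hFm t₀ ht₀)).enorm.pow_const P).lintegral_prod_right').pow_const _
    · filter_upwards [hnear, hBev] with t ht htB
      filter_upwards [ae_restrict_mem measurableSet_Ioo] with s hs
      have h1 : ∀ t', 0 < t' → t' ≤ 2 * t₀ → t' ^ (-σ - γ) ≤ B →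
          eLpNorm (F t' s) (ENNReal.ofReal P) volume ≤ ENNReal.ofReal (k * G * B) *
            ENNReal.ofReal ((1 - s) ^ (-σ) * s ^ (-γ)) := by
        intro t' h0 h2 h3
        refine (hFb t' h0 h2 s hs).trans ?_
        gcongr
      have hc : ∀ t', 0 < t' → AEStronglyMeasurable (F t' s) volume := fun t' h0 =>
        (continuous_symbolSemigroup hα hd hQ hh (mul_pos h0 (sub_pos.2 hs.2))
          (hg.memLp _ (mul_pos h0 hs.1))).aestronglyMeasurable
      refine (eLpNorm_sub_le (hc t ht.1) (hc t₀ ht₀) (by simpa)).trans ?_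
      rw [mul_assoc, two_mul (ENNReal.ofReal (k * G * B) * _)]
      exact add_le_add (h1 t ht.1 ht.2 htB) (h1 t₀ ht₀ (by linarith) (by simp [hB]))
    · rw [lintegral_const_mul' _ _ (ENNReal.mul_ne_top (by simp) ENNReal.ofReal_ne_top)]
      exact (ENNReal.mul_lt_top (ENNReal.mul_lt_top (by simp) ENNReal.ofReal_lt_top)
        (lintegral_beta_lt_top hσ hγ)).ne
    · filter_upwards [ae_restrict_mem measurableSet_Ioo] with s hs
      have hτ0 : 0 < t₀ * (1 - s) := mul_pos ht₀ (sub_pos.2 hs.2)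
      have hts : t₀ * s ∈ Ioi (0 : ℝ) := mul_pos ht₀ hs.1
      refine tendsto_eLpNorm_symbolSemigroup_comp hα hd hQ hh hhP hτ0
        ((continuous_id.mul continuous_const).tendsto t₀) (hg.memLp _ hts) ?_ ?_
      · filter_upwards [hnear] with t ht using hg.memLp _ (mul_pos ht.1 hs.1)
      · have h1 := hg.tendsto _ hts
        rw [nhdsWithin_eq_nhds.2 (Ioi_mem_nhds hts)] at h1
        exact h1.comp ((continuous_id.mul continuous_const).tendsto t₀)
  rw [lintegral_zero] at hlim
  have hElim : Tendsto (fun t => eLpNorm (E t - E t₀) (ENNReal.ofReal P) volume) (𝓝 t₀) (𝓝 0) := by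
    refine tendsto_of_tendsto_of_tendsto_of_le_of_le' tendsto_const_nhds hlim
      (Eventually.of_forall fun _ => zero_le) ?_
    filter_upwards [hnear] with t ht
    have h1 := ae_integrable_of_lintegral_eLpNorm_lt_top hP (hFm t ht.1) (hFfin t ht.1 ht.2)
    have h2 := ae_integrable_of_lintegral_eLpNorm_lt_top hP (hFm t₀ ht₀)
      (hFfin t₀ ht₀ (by linarith))
    refine le_trans (le_of_eq (eLpNorm_congr_ae ?_))
      (eLpNorm_integral_le hP (F := fun s => F t s - F t₀ s) ((hFm t ht.1).sub (hFm t₀ ht₀)))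
    filter_upwards [h1, h2] with x hx1 hx2
    exact (integral_sub hx1 hx2).symm
  have hfinal := tendsto_eLpNorm_smul_sub hP ((Complex.continuous_ofReal.tendsto t₀)) hEmem
    (hnear.mono fun t ht => hEm t ht.1) hElim
  rw [hDE t₀ ht₀]
  refine (hfinal.congr' ?_).mono_left nhdsWithin_le_nhds
  filter_upwards [hnear] with t ht
  rw [hDE t ht.1]

end DuhamelContinuity

/-! ### Calculus of functions continuous in time with values in `L^p`. -/

section ContinuousInLp

variable {n : ℕ} {I : Set ℝ} {p : ℝ} {v : ℝ → Space n → ℂ}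

theorem ContinuousInLp.mono (hv : ContinuousInLp I p v) {J : Set ℝ} (hJ : J ⊆ I) :
    ContinuousInLp J p v :=
  ⟨fun t ht => hv.memLp t (hJ ht), fun t ht => (hv.tendsto t (hJ ht)).mono_left
    (nhdsWithin_mono t hJ)⟩

theorem ContinuousInLp.congr (hv : ContinuousInLp I p v) {w : ℝ → Space n → ℂ}
    (h : ∀ t ∈ I, w t =ᵐ[volume] v t) : ContinuousInLp I p w := by
  refine ⟨fun t ht => (memLp_congr_ae (h t ht)).2 (hv.memLp t ht), fun t ht => ?_⟩
  refine (hv.tendsto t ht).congr' ?_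
  filter_upwards [self_mem_nhdsWithin] with s hs
  exact eLpNorm_congr_ae ((h s hs).symm.sub (h t ht).symm)

theorem ContinuousInLp.add (hp : 1 ≤ p) (hv : ContinuousInLp I p v) {w : ℝ → Space n → ℂ}
    (hw : ContinuousInLp I p w) : ContinuousInLp I p fun t x => v t x + w t x := by
  refine ⟨fun t ht => (hv.memLp t ht).add (hw.memLp t ht), fun t ht => ?_⟩
  have h1 := (hv.tendsto t ht).add (hw.tendsto t ht)
  rw [add_zero] at h1
  refine tendsto_of_tendsto_of_tendsto_of_le_of_le' tendsto_const_nhds h1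
    (Eventually.of_forall fun _ => zero_le) ?_
  filter_upwards [self_mem_nhdsWithin] with s hs
  refine le_trans (le_of_eq ?_) (eLpNorm_add_le ((hv.memLp s hs).sub (hv.memLp t ht)).1
    ((hw.memLp s hs).sub (hw.memLp t ht)).1 (by simpa))
  congr 1
  ext x
  simp only [Pi.sub_apply, Pi.add_apply]
  ring

theorem ContinuousInLp.sub (hp : 1 ≤ p) (hv : ContinuousInLp I p v) {w : ℝ → Space n → ℂ}
    (hw : ContinuousInLp I p w) : ContinuousInLp I p fun t x => v t x - w t x := by
  refine ⟨fun t ht => (hv.memLp t ht).sub (hw.memLp t ht), fun t ht => ?_⟩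
  have h1 := (hv.tendsto t ht).add (hw.tendsto t ht)
  rw [add_zero] at h1
  refine tendsto_of_tendsto_of_tendsto_of_le_of_le' tendsto_const_nhds h1
    (Eventually.of_forall fun _ => zero_le) ?_
  filter_upwards [self_mem_nhdsWithin] with s hs
  refine le_trans (le_of_eq ?_) (eLpNorm_sub_le ((hv.memLp s hs).sub (hv.memLp t ht)).1
    ((hw.memLp s hs).sub (hw.memLp t ht)).1 (by simpa))
  congr 1
  ext x
  simp only [Pi.sub_apply]
  ring

theorem continuousInLp_zero (I : Set ℝ) (p : ℝ) :
    ContinuousInLp I p fun _ (_ : Space n) => (0 : ℂ) :=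
  ⟨fun _ _ => MemLp.zero', fun _ _ => by simp [tendsto_const_nhds]⟩

theorem ContinuousInLp.sum (hp : 1 ≤ p) {ι : Type*} (s : Finset ι) {w : ι → ℝ → Space n → ℂ}
    (hw : ∀ i ∈ s, ContinuousInLp I p (w i)) : ContinuousInLp I p fun t x => ∑ i ∈ s, w i t x := by
  classical
  induction s using Finset.induction_on with
  | empty => simpa using continuousInLp_zero I p
  | insert a s ha ih =>
    simp only [Finset.sum_insert ha]
    exact (hw a (Finset.mem_insert_self a s)).add hp
      (ih fun i hi => hw i (Finset.mem_insert_of_mem hi))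

theorem ContinuousInLp.comp_const_add {v : ℝ → Space n → ℂ} (hv : ContinuousInLp (Ioi 0) p v)
    {t : ℝ} (ht : 0 < t) : ContinuousInLp (Ici 0) p fun s => v (t + s) := by
  have hmem : ∀ s ∈ Ici (0 : ℝ), t + s ∈ Ioi (0 : ℝ) := fun s hs => by
    have : 0 ≤ s := hs
    exact mem_Ioi.2 (by linarith)
  refine ⟨fun s hs => hv.memLp _ (hmem s hs), fun s hs => ?_⟩
  refine (hv.tendsto _ (hmem s hs)).comp (tendsto_nhdsWithin_iff.2 ⟨?_, ?_⟩)
  · exact ((continuous_const.add continuous_id).tendsto s).mono_left nhdsWithin_le_nhds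
  · filter_upwards [self_mem_nhdsWithin] with r hr using hmem r hr

theorem ContinuousInLp.continuousOn_toReal (hp : 1 ≤ p) (hv : ContinuousInLp I p v) :
    ContinuousOn (fun t => (eLpNorm (v t) (ENNReal.ofReal p) volume).toReal) I := by
  have hp' : 1 ≤ ENNReal.ofReal p := by simpa
  intro t ht
  have h1 := (ENNReal.tendsto_toReal ENNReal.zero_ne_top).comp (hv.tendsto t ht)
  rw [ENNReal.toReal_zero] at h1
  rw [ContinuousWithinAt, tendsto_iff_norm_sub_tendsto_zero]
  refine squeeze_zero' (Eventually.of_forall fun _ => norm_nonneg _) ?_ h1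
  filter_upwards [self_mem_nhdsWithin] with s hs
  have hs := hv.memLp s hs
  have ht := hv.memLp t ht
  have hst := hs.sub ht
  have e1 : eLpNorm (v s) (ENNReal.ofReal p) volume ≤ eLpNorm (v t) (ENNReal.ofReal p) volume +
      eLpNorm (v s - v t) (ENNReal.ofReal p) volume := by
    have := eLpNorm_add_le ht.1 hst.1 hp'
    rwa [add_sub_cancel] at this
  have e2 : eLpNorm (v t) (ENNReal.ofReal p) volume ≤ eLpNorm (v s) (ENNReal.ofReal p) volume +
      eLpNorm (v s - v t) (ENNReal.ofReal p) volume := by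
    have := eLpNorm_sub_le hs.1 hst.1 hp'
    rwa [sub_sub_cancel] at this
  have f1 := ENNReal.toReal_mono (ENNReal.add_ne_top.2 ⟨ht.2.ne, hst.2.ne⟩) e1
  have f2 := ENNReal.toReal_mono (ENNReal.add_ne_top.2 ⟨hs.2.ne, hst.2.ne⟩) e2
  rw [ENNReal.toReal_add ht.2.ne hst.2.ne] at f1
  rw [ENNReal.toReal_add hs.2.ne hst.2.ne] at f2
  rw [Real.norm_eq_abs, abs_le]
  simp only [Function.comp_apply]
  constructor <;> linarith

theorem ContinuousInLp.tendsto_eLpNorm (hp : 1 ≤ p) (hv : ContinuousInLp I p v) {t : ℝ}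
    (ht : t ∈ I) : Tendsto (fun s => eLpNorm (v s) (ENNReal.ofReal p) volume) (𝓝[I] t)
      (𝓝 (eLpNorm (v t) (ENNReal.ofReal p) volume)) := by
  have h1 := (ENNReal.continuous_ofReal.tendsto _).comp (hv.continuousOn_toReal hp t ht)
  rw [ENNReal.ofReal_toReal (hv.memLp t ht).2.ne] at h1
  refine h1.congr' ?_
  filter_upwards [self_mem_nhdsWithin] with s hs
  simp [ENNReal.ofReal_toReal (hv.memLp s hs).2.ne]

theorem ContinuousInLp.exists_le (hp : 1 ≤ p) (hv : ContinuousInLp I p v) {K : Set ℝ}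
    (hK : IsCompact K) (hKI : K ⊆ I) :
    ∃ G : ℝ, 0 ≤ G ∧ ∀ s ∈ K, eLpNorm (v s) (ENNReal.ofReal p) volume ≤ ENNReal.ofReal G := by
  obtain ⟨G, hG⟩ := hK.exists_bound_of_continuousOn ((hv.continuousOn_toReal hp).mono hKI)
  refine ⟨|G|, abs_nonneg _, fun s hs => ?_⟩
  rw [← ENNReal.ofReal_toReal (hv.memLp s (hKI hs)).2.ne]
  refine ENNReal.ofReal_le_ofReal ?_
  have := hG s hs
  rw [Real.norm_of_nonneg ENNReal.toReal_nonneg] at this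
  exact this.trans (le_abs_self _)

/-- Continuity in `L^{p₀}` and local boundedness in `L^{p₁}` give continuity in `L^P` for every `P`
between, `P ≠ p₁`. -/
theorem ContinuousInLp.interpolate {p₀ p₁ P θ : ℝ} (hp₀ : 0 < p₀) (hp₁ : 1 ≤ p₁) (hP : 0 < P)
    (hθ0 : 0 ≤ θ) (hθ1 : θ < 1) (h : 1 / P = (1 - θ) / p₀ + θ / p₁)
    (hv : ContinuousInLp I p₀ v)
    (hb : ∀ t ∈ I, ∃ G : ℝ, ∀ᶠ s in 𝓝[I] t,
      eLpNorm (v s) (ENNReal.ofReal p₁) volume ≤ ENNReal.ofReal G) :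
    ContinuousInLp I P v := by
  have hb0 : ∀ t ∈ I, eLpNorm (v t) (ENNReal.ofReal p₁) volume < ⊤ := by
    intro t ht
    obtain ⟨G, hG⟩ := hb t ht
    exact (hG.self_of_nhdsWithin ht).trans_lt ENNReal.ofReal_lt_top
  refine ⟨fun t ht => ⟨(hv.memLp t ht).1, ?_⟩, fun t ht => ?_⟩
  · refine (eLpNorm_le_interpolation hp₀ (by linarith) hP hθ0 hθ1.le h (hv.memLp t ht).1).trans_lt ?_
    exact ENNReal.mul_lt_top (ENNReal.rpow_lt_top_of_nonneg (by linarith) (hv.memLp t ht).2.ne)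
      (ENNReal.rpow_lt_top_of_nonneg hθ0 (hb0 t ht).ne)
  · obtain ⟨G, hG⟩ := hb t ht
    set B := ENNReal.ofReal G + eLpNorm (v t) (ENNReal.ofReal p₁) volume with hB
    have hBtop : B ≠ ⊤ := ENNReal.add_ne_top.2 ⟨ENNReal.ofReal_ne_top, (hb0 t ht).ne⟩
    have h1 : Tendsto (fun s => eLpNorm (v s - v t) (ENNReal.ofReal p₀) volume ^ (1 - θ) * B ^ θ)
        (𝓝[I] t) (𝓝 0) := by
      have h2 := (ENNReal.continuous_rpow_const (y := 1 - θ)).tendsto 0 |>.comp (hv.tendsto t ht)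
      rw [ENNReal.zero_rpow_of_pos (by linarith)] at h2
      have h3 := ENNReal.Tendsto.mul_const h2
        (Or.inr (ENNReal.rpow_ne_top_of_nonneg hθ0 hBtop) : (0 : ℝ≥0∞) ≠ 0 ∨ B ^ θ ≠ ⊤)
      rwa [zero_mul] at h3
    refine tendsto_of_tendsto_of_tendsto_of_le_of_le' tendsto_const_nhds h1
      (Eventually.of_forall fun _ => zero_le) ?_
    filter_upwards [self_mem_nhdsWithin, hG] with s hs hsG
    refine (eLpNorm_le_interpolation hp₀ (by linarith) hP hθ0 hθ1.le h
      ((hv.memLp s hs).1.sub (hv.memLp t ht).1)).trans ?_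
    gcongr
    exact (eLpNorm_sub_le (hv.memLp s hs).1 (hv.memLp t ht).1 (by simpa)).trans
      (add_le_add hsG le_rfl)

end ContinuousInLp

/-! ### Power nonlinearities and their estimates in Lebesgue spaces. -/

section PowerType

/-- A nonlinearity of power type `b + 1`. -/
structure PowerType (b L : ℝ) (f : ℂ → ℂ) : Prop where
  nonneg : 0 ≤ L
  zero : f 0 = 0
  bound : ∀ z w, ‖f z - f w‖ ≤ L * (‖z‖ ^ b + ‖w‖ ^ b) * ‖z - w‖

variable {b L : ℝ} {f : ℂ → ℂ}

theorem abs_rpow_sub_rpow_le {b s t : ℝ} (hb : 0 ≤ b) (hs : 0 ≤ s) (ht : 0 ≤ t) :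
    |s ^ (b + 1) - t ^ (b + 1)| ≤ (b + 1) * (s ^ b + t ^ b) * |s - t| := by
  wlog hst : t ≤ s generalizing s t
  · have := this ht hs (le_of_not_ge hst)
    rwa [abs_sub_comm, abs_sub_comm t s, add_comm (t ^ b)] at this
  have h1 : ∀ x ∈ Icc t s, HasDerivWithinAt (fun x : ℝ => x ^ (b + 1))
      ((b + 1) * x ^ (b + 1 - 1)) (Icc t s) x := fun x _ =>
    (Real.hasDerivAt_rpow_const (Or.inr (by linarith))).hasDerivWithinAt
  have h2 : ∀ x ∈ Icc t s, ‖(b + 1) * x ^ (b + 1 - 1)‖ ≤ (b + 1) * (s ^ b + t ^ b) := by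
    intro x hx
    have hx0 : 0 ≤ x := ht.trans hx.1
    rw [Real.norm_of_nonneg (by positivity), add_sub_cancel_right]
    gcongr
    have h3 : x ^ b ≤ s ^ b := Real.rpow_le_rpow hx0 hx.2 hb
    have h4 : 0 ≤ t ^ b := by positivity
    linarith
  have h5 := (convex_Icc t s).norm_image_sub_le_of_norm_hasDerivWithin_le h1 h2
    (left_mem_Icc.2 hst) (right_mem_Icc.2 hst)
  simpa [Real.norm_eq_abs] using h5

theorem PowerType.neg (h : PowerType b L f) : PowerType b L fun z => -f z :=
  ⟨h.nonneg, by simp [h.zero], fun z w => by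
    rw [neg_sub_neg, norm_sub_rev]
    exact h.bound z w⟩

theorem powerType_abs (hb : 0 ≤ b) : PowerType b (b + 1) fun z => ((‖z‖ ^ (b + 1) : ℝ) : ℂ) := by
  refine ⟨by linarith, by simp [Real.zero_rpow (by linarith : b + 1 ≠ 0)], fun z w => ?_⟩
  rw [← Complex.ofReal_sub, Complex.norm_real, Real.norm_eq_abs]
  refine (abs_rpow_sub_rpow_le hb (norm_nonneg z) (norm_nonneg w)).trans ?_
  have := abs_norm_sub_norm_le z w
  gcongr

/-- For `‖w‖ ≤ ‖z‖` the difference is `‖z‖^b (z - w) + (‖z‖^b - ‖w‖^b) w`, and the second term is at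
most `‖z‖^{b+1} - ‖w‖^{b+1}`. This reduces to the real power, constant `b + 1`, plus one more. -/
theorem powerType_signed (hb : 0 < b) : PowerType b (b + 2) fun z => ((‖z‖ ^ b : ℝ) : ℂ) * z := by
  refine ⟨by linarith, by simp, fun z w => ?_⟩
  wlog hzw : ‖w‖ ≤ ‖z‖ generalizing z w
  · have := this w z (le_of_not_ge hzw)
    rwa [norm_sub_rev, norm_sub_rev w, add_comm (‖w‖ ^ b)] at this
  have hw0 := norm_nonneg w
  have hz0 := norm_nonneg z
  have e : ((‖z‖ ^ b : ℝ) : ℂ) * z - ((‖w‖ ^ b : ℝ) : ℂ) * w =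
      ((‖z‖ ^ b : ℝ) : ℂ) * (z - w) + ((‖z‖ ^ b - ‖w‖ ^ b : ℝ) : ℂ) * w := by
    push_cast
    ring
  have h1 : ‖z‖ ^ b * ‖w‖ - ‖w‖ ^ b * ‖w‖ ≤ ‖z‖ ^ (b + 1) - ‖w‖ ^ (b + 1) := by
    rw [Real.rpow_add_one' hz0 (by linarith), Real.rpow_add_one' hw0 (by linarith)]
    have := Real.rpow_nonneg hz0 b
    nlinarith
  have h2 := (le_abs_self _).trans (abs_rpow_sub_rpow_le hb.le hz0 hw0)
  have h3 := abs_norm_sub_norm_le z w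
  have h4 : ‖w‖ ^ b ≤ ‖z‖ ^ b := Real.rpow_le_rpow hw0 hzw hb.le
  have hzb := Real.rpow_nonneg hz0 b
  have hwb := Real.rpow_nonneg hw0 b
  rw [e]
  refine (norm_add_le _ _).trans ?_
  rw [norm_mul, norm_mul, Complex.norm_real, Complex.norm_real, Real.norm_of_nonneg hzb,
    Real.norm_of_nonneg (sub_nonneg.2 h4), sub_mul]
  have h5 : (b + 1) * (‖z‖ ^ b + ‖w‖ ^ b) * |‖z‖ - ‖w‖| ≤
      (b + 1) * (‖z‖ ^ b + ‖w‖ ^ b) * ‖z - w‖ := by gcongr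
  have h6 : 0 ≤ ‖w‖ ^ b * ‖z - w‖ := by positivity
  linarith

theorem IsSignedPower.exists_powerType (hb : 0 < b) (hf : IsSignedPower b f) :
    ∃ L, PowerType b L f := by
  rcases hf with h | h
  · exact ⟨_, (funext h : f = _) ▸ powerType_signed hb⟩
  · exact ⟨_, (funext h : f = _) ▸ (powerType_signed hb).neg⟩

theorem IsAbsPower.exists_powerType (hb : 0 < b) (hf : IsAbsPower b f) :
    ∃ L, PowerType b L f := by
  rcases hf with h | h
  · exact ⟨_, (funext h : f = _) ▸ powerType_abs hb.le⟩
  · exact ⟨_, (funext h : f = _) ▸ (powerType_abs hb.le).neg⟩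

theorem IsSignedPower.norm_eq (hb : 0 < b) (hf : IsSignedPower b f) (z : ℂ) :
    ‖f z‖ = ‖z‖ ^ (1 + b) := by
  have h0 := norm_nonneg z
  have h1 : ‖((‖z‖ ^ b : ℝ) : ℂ) * z‖ = ‖z‖ ^ (1 + b) := by
    rw [norm_mul, Complex.norm_real, Real.norm_of_nonneg (by positivity), add_comm,
      Real.rpow_add_one' h0 (by linarith)]
  rcases hf with h | h
  · rw [h, h1]
  · rw [h, norm_neg, h1]

theorem IsAbsPower.norm_eq (hf : IsAbsPower b f) (z : ℂ) : ‖f z‖ = ‖z‖ ^ (1 + b) := by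
  have h1 : ‖((‖z‖ ^ (b + 1) : ℝ) : ℂ)‖ = ‖z‖ ^ (1 + b) := by
    rw [Complex.norm_real, Real.norm_of_nonneg (by positivity), add_comm]
  rcases hf with h | h
  · rw [h, h1]
  · rw [h, norm_neg, h1]

theorem PowerType.continuous (hb : 0 < b) (h : PowerType b L f) : Continuous f := by
  refine continuous_iff_continuousAt.2 fun w => ?_
  rw [ContinuousAt, tendsto_iff_norm_sub_tendsto_zero]
  refine squeeze_zero (fun _ => norm_nonneg _) (fun z => h.bound z w) ?_
  have h1 : Continuous fun z : ℂ => L * (‖z‖ ^ b + ‖w‖ ^ b) * ‖z - w‖ := by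
    have : Continuous fun z : ℂ => ‖z‖ ^ b := continuous_norm.rpow_const fun _ => Or.inr hb.le
    fun_prop
  simpa using h1.tendsto w

variable {n : ℕ} {h P x : ℝ}

/-- Hölder with `|u|^b ∈ L^{1/x}`, that is, `u ∈ L^{b/x}`. -/
theorem eLpNorm_norm_rpow_mul_le (hb : 0 < b) (hx : 0 < x) (hh : 0 < h) (hP : 0 < P)
    (hhP : 1 / h = x + 1 / P) {u w : Space n → ℂ} (hu : AEStronglyMeasurable u volume)
    (hw : AEStronglyMeasurable w volume) :
    eLpNorm (fun y => (‖u y‖ ^ b : ℝ) • w y) (ENNReal.ofReal h) volume ≤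
      eLpNorm u (ENNReal.ofReal (b / x)) volume ^ b * eLpNorm w (ENNReal.ofReal P) volume := by
  have ht : ENNReal.HolderTriple (ENNReal.ofReal (1 / x)) (ENNReal.ofReal P)
      (ENNReal.ofReal h) := ⟨by
    rw [← ENNReal.ofReal_inv_of_pos (by positivity), ← ENNReal.ofReal_inv_of_pos hP,
      ← ENNReal.ofReal_inv_of_pos hh, ← ENNReal.ofReal_add (by positivity) (by positivity)]
    congr 1
    rw [← one_div h, hhP]
    simp⟩
  have h1 := eLpNorm_smul_le_mul_eLpNorm (p := ENNReal.ofReal (1 / x)) (q := ENNReal.ofReal P)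
    (r := ENNReal.ofReal h) (f := w) (φ := fun y => (‖u y‖ ^ b : ℝ)) (μ := volume) hw
    (hu.norm.aemeasurable.pow_const b).aestronglyMeasurable
  refine h1.trans_eq ?_
  rw [eLpNorm_norm_rpow _ hb, ← ENNReal.ofReal_mul (by positivity)]
  congr 4
  field_simp

theorem PowerType.eLpNorm_sub_le (hb : 0 < b) (hf : PowerType b L f) (hx : 0 < x) (hh : 1 ≤ h)
    (hP : 0 < P) (hhP : 1 / h = x + 1 / P) {u v : Space n → ℂ}
    (hu : AEStronglyMeasurable u volume) (hv : AEStronglyMeasurable v volume) :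
    eLpNorm (fun y => f (u y) - f (v y)) (ENNReal.ofReal h) volume ≤
      ENNReal.ofReal L * ((eLpNorm u (ENNReal.ofReal (b / x)) volume ^ b +
        eLpNorm v (ENNReal.ofReal (b / x)) volume ^ b) *
          eLpNorm (u - v) (ENNReal.ofReal P) volume) := by
  have hm : ∀ w : Space n → ℂ, AEStronglyMeasurable w volume →
      AEStronglyMeasurable (fun y => (‖w y‖ ^ b : ℝ) • (u - v) y) volume := fun w hw =>
    (hw.norm.aemeasurable.pow_const b).aestronglyMeasurable.smul (hu.sub hv)
  have hle : ∀ y, ‖f (u y) - f (v y)‖ ≤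
      ‖L • ((‖‖u y‖ ^ b • (u - v) y‖ : ℝ) + ‖‖v y‖ ^ b • (u - v) y‖)‖ := by
    intro y
    rw [norm_smul, norm_smul, norm_smul, Real.norm_of_nonneg hf.nonneg,
      Real.norm_of_nonneg (by positivity : 0 ≤ ‖u y‖ ^ b),
      Real.norm_of_nonneg (by positivity : 0 ≤ ‖v y‖ ^ b),
      Real.norm_of_nonneg (by positivity), Pi.sub_apply, ← add_mul, ← mul_assoc]
    exact hf.bound _ _
  refine (eLpNorm_mono hle).trans ?_
  refine (eLpNorm_const_smul L (fun y => ‖‖u y‖ ^ b • (u - v) y‖ + ‖‖v y‖ ^ b • (u - v) y‖) _ _).le.trans ?_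
  rw [Real.enorm_of_nonneg hf.nonneg]
  gcongr
  refine (eLpNorm_add_le (hm u hu).norm (hm v hv).norm (by simpa)).trans ?_
  rw [eLpNorm_norm, eLpNorm_norm, add_mul]
  exact add_le_add (eLpNorm_norm_rpow_mul_le hb hx (by linarith) hP hhP hu (hu.sub hv))
    (eLpNorm_norm_rpow_mul_le hb hx (by linarith) hP hhP hv (hu.sub hv))

theorem PowerType.eLpNorm_le (hb : 0 < b) (hf : PowerType b L f) (hx : 0 < x) (hh : 1 ≤ h)
    (hP : 0 < P) (hhP : 1 / h = x + 1 / P) {u : Space n → ℂ}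
    (hu : AEStronglyMeasurable u volume) :
    eLpNorm (fun y => f (u y)) (ENNReal.ofReal h) volume ≤
      ENNReal.ofReal L * (eLpNorm u (ENNReal.ofReal (b / x)) volume ^ b *
          eLpNorm u (ENNReal.ofReal P) volume) := by
  have h1 := hf.eLpNorm_sub_le hb hx hh hP hhP hu
    (aestronglyMeasurable_const : AEStronglyMeasurable (fun _ : Space n => (0 : ℂ)) volume)
  have e : u - (fun _ => (0 : ℂ)) = u := by ext; simp
  have e0 : eLpNorm (fun _ : Space n => (0 : ℂ)) (ENNReal.ofReal (b / x)) volume = 0 :=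
    eLpNorm_zero'
  rw [e, e0, ENNReal.zero_rpow_of_pos hb, add_zero] at h1
  simpa [hf.zero] using h1

theorem PowerType.continuousInLp (hb : 0 < b) (hf : PowerType b L f) (hx : 0 < x) (hbx : x ≤ b)
    (hh : 1 ≤ h) (hP : 1 ≤ P) (hhP : 1 / h = x + 1 / P) {I : Set ℝ} {u : ℝ → Space n → ℂ}
    (hu : ContinuousInLp I (b / x) u) (huP : ContinuousInLp I P u) :
    ContinuousInLp I h fun t y => f (u t y) := by
  have hbx1 : 1 ≤ b / x := by rwa [one_le_div hx]
  refine ⟨fun t ht => ⟨(hf.continuous hb).comp_aestronglyMeasurable (hu.memLp t ht).1, ?_⟩,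
    fun t ht => ?_⟩
  · refine (hf.eLpNorm_le hb hx hh (by linarith) hhP (hu.memLp t ht).1).trans_lt ?_
    exact ENNReal.mul_lt_top ENNReal.ofReal_lt_top (ENNReal.mul_lt_top
      (ENNReal.rpow_lt_top_of_nonneg hb.le (hu.memLp t ht).2.ne) (huP.memLp t ht).2)
  · have h1 : Tendsto (fun s => ENNReal.ofReal L *
        ((eLpNorm (u s) (ENNReal.ofReal (b / x)) volume ^ b +
        eLpNorm (u t) (ENNReal.ofReal (b / x)) volume ^ b) *
          eLpNorm (u s - u t) (ENNReal.ofReal P) volume)) (𝓝[I] t) (𝓝 0) := by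
      have h2 := ((ENNReal.continuous_rpow_const (y := b)).tendsto _).comp
        (hu.tendsto_eLpNorm hbx1 ht)
      have hfin : eLpNorm (u t) (ENNReal.ofReal (b / x)) volume ^ b ≠ ⊤ :=
        ENNReal.rpow_ne_top_of_nonneg hb.le (hu.memLp t ht).2.ne
      have h3 := ENNReal.Tendsto.mul (h2.add_const
        (eLpNorm (u t) (ENNReal.ofReal (b / x)) volume ^ b)) (Or.inr ENNReal.zero_ne_top)
        (huP.tendsto t ht) (Or.inr (ENNReal.add_ne_top.2 ⟨hfin, hfin⟩))
      have h4 := ENNReal.Tendsto.const_mul (a := ENNReal.ofReal L) h3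
        (Or.inr ENNReal.ofReal_ne_top)
      simpa using h4
    refine tendsto_of_tendsto_of_tendsto_of_le_of_le' tendsto_const_nhds h1
      (Eventually.of_forall fun _ => zero_le) ?_
    filter_upwards [self_mem_nhdsWithin] with s hs
    exact hf.eLpNorm_sub_le hb hx hh (by linarith) hhP (hu.memLp s hs).1 (hu.memLp t ht).1

/-- `f(u) ∈ L^h` controls `u ∈ L^{h(1+b)}` when `|f(z)| = |z|^{1+b}`. -/
theorem eLpNorm_comp_eq_rpow (hb : 0 < b) (hf : ∀ z, ‖f z‖ = ‖z‖ ^ (1 + b)) (hh : 0 < h)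
    (u : Space n → ℂ) :
    eLpNorm (fun y => f (u y)) (ENNReal.ofReal h) volume =
      eLpNorm u (ENNReal.ofReal (h * (1 + b))) volume ^ (1 + b) := by
  rw [ENNReal.ofReal_mul hh.le, ← eLpNorm_norm_rpow _ (by linarith)]
  refine eLpNorm_congr_norm_ae (Eventually.of_forall fun y => ?_)
  rw [hf, Real.norm_of_nonneg (by positivity)]

end PowerType

/-! ### Norms weighted by powers of time. -/

section WeightedBound

variable {n : ℕ}

/-- `‖v(t)‖_P ≤ M t^{-β}` for `0 < t ≤ T`. -/
def WeightedBound (P β M T : ℝ) (v : ℝ → Space n → ℂ) : Prop :=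
  ∀ t ∈ Ioc 0 T, eLpNorm (v t) (ENNReal.ofReal P) volume ≤ ENNReal.ofReal (M * t ^ (-β))

variable {P β M T : ℝ} {v w : ℝ → Space n → ℂ}

theorem WeightedBound.mono (hv : WeightedBound P β M T v) {M' : ℝ} (h : M ≤ M') :
    WeightedBound P β M' T v := fun t ht =>
  (hv t ht).trans (ENNReal.ofReal_le_ofReal (mul_le_mul_of_nonneg_right h
    (Real.rpow_nonneg ht.1.le _)))

theorem WeightedBound.mono_right (hv : WeightedBound P β M T v) {T' : ℝ} (h : T' ≤ T) :
    WeightedBound P β M T' v := fun t ht => hv t ⟨ht.1, ht.2.trans h⟩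

theorem WeightedBound.congr (hv : WeightedBound P β M T v)
    (h : ∀ t ∈ Ioc 0 T, w t =ᵐ[volume] v t) : WeightedBound P β M T w := fun t ht => by
  rw [eLpNorm_congr_ae (h t ht)]
  exact hv t ht

theorem weightedBound_zero :
    WeightedBound P β M T fun _ (_ : Space n) => (0 : ℂ) := fun t ht => by
  have : eLpNorm (fun _ : Space n => (0 : ℂ)) (ENNReal.ofReal P) volume = 0 := eLpNorm_zero'
  rw [this]
  exact zero_le

theorem WeightedBound.add (hP : 1 ≤ P) {M' : ℝ} (hM : 0 ≤ M) (hM' : 0 ≤ M')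
    (hv : WeightedBound P β M T v) (hw : WeightedBound P β M' T w)
    (hvm : ∀ t ∈ Ioc 0 T, AEStronglyMeasurable (v t) volume)
    (hwm : ∀ t ∈ Ioc 0 T, AEStronglyMeasurable (w t) volume) :
    WeightedBound P β (M + M') T fun t x => v t x + w t x := fun t ht => by
  have h0 := Real.rpow_nonneg ht.1.le (-β)
  refine (eLpNorm_add_le (hvm t ht) (hwm t ht) (by simpa)).trans ?_
  rw [add_mul, ENNReal.ofReal_add (by positivity) (by positivity)]
  exact add_le_add (hv t ht) (hw t ht)

theorem WeightedBound.sub (hP : 1 ≤ P) {M' : ℝ} (hM : 0 ≤ M) (hM' : 0 ≤ M')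
    (hv : WeightedBound P β M T v) (hw : WeightedBound P β M' T w)
    (hvm : ∀ t ∈ Ioc 0 T, AEStronglyMeasurable (v t) volume)
    (hwm : ∀ t ∈ Ioc 0 T, AEStronglyMeasurable (w t) volume) :
    WeightedBound P β (M + M') T fun t => v t - w t := fun t ht => by
  have h0 := Real.rpow_nonneg ht.1.le (-β)
  refine (eLpNorm_sub_le (hvm t ht) (hwm t ht) (by simpa)).trans ?_
  rw [add_mul, ENNReal.ofReal_add (by positivity) (by positivity)]
  exact add_le_add (hv t ht) (hw t ht)

theorem WeightedBound.sum (hP : 1 ≤ P) {ι : Type*} (s : Finset ι) {M : ι → ℝ}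
    {w : ι → ℝ → Space n → ℂ} (hM : ∀ i ∈ s, 0 ≤ M i)
    (hw : ∀ i ∈ s, WeightedBound P β (M i) T (w i))
    (hwm : ∀ i ∈ s, ∀ t ∈ Ioc 0 T, AEStronglyMeasurable (w i t) volume) :
    WeightedBound P β (∑ i ∈ s, M i) T fun t x => ∑ i ∈ s, w i t x := fun t ht => by
  have h0 := Real.rpow_nonneg ht.1.le (-β)
  have h1 := eLpNorm_sum_le (fun i hi => hwm i hi t ht) (by simpa : 1 ≤ ENNReal.ofReal P)
  have e : (∑ i ∈ s, w i t) = fun x => ∑ i ∈ s, w i t x := by ext x; simp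
  rw [e] at h1
  refine h1.trans ?_
  rw [Finset.sum_mul, ENNReal.ofReal_sum_of_nonneg fun i hi => mul_nonneg (hM i hi) h0]
  exact Finset.sum_le_sum fun i hi => hw i hi t ht

/-- In `L^{1/x}` both `|u|^b` and `|v|^b` are at most `ρ^b t^{-θ}`, whatever `b` is. The Lipschitz
estimate adds `θ` to the weight and is linear in the size `M` of the difference. -/
theorem PowerType.weightedBound_sub {b L x h P θ β ρ M T : ℝ} {f : ℂ → ℂ} (hb : 0 < b)
    (hf : PowerType b L f) (hx : 0 < x) (hh : 1 ≤ h) (hP : 0 < P) (hhP : 1 / h = x + 1 / P)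
    (hρ : 0 ≤ ρ) {u v : ℝ → Space n → ℂ}
    (hum : ∀ t ∈ Ioc 0 T, AEStronglyMeasurable (u t) volume)
    (hvm : ∀ t ∈ Ioc 0 T, AEStronglyMeasurable (v t) volume)
    (hu : WeightedBound (b / x) (θ / b) ρ T u) (hv : WeightedBound (b / x) (θ / b) ρ T v)
    (huv : WeightedBound P β M T fun t => u t - v t) :
    WeightedBound h (θ + β) (2 * L * ρ ^ b * M) T fun t y => f (u t y) - f (v t y) := by
  intro t ht
  have ht0 : 0 < t := ht.1
  have hL := hf.nonneg
  refine (hf.eLpNorm_sub_le hb hx hh hP hhP (hum t ht) (hvm t ht)).trans ?_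
  calc _ ≤ ENNReal.ofReal L * ((ENNReal.ofReal (ρ * t ^ (-(θ / b))) ^ b +
        ENNReal.ofReal (ρ * t ^ (-(θ / b))) ^ b) * ENNReal.ofReal (M * t ^ (-β))) := by
        gcongr
        · exact hu t ht
        · exact hv t ht
        · exact huv t ht
    _ = _ := by
        rw [ENNReal.ofReal_rpow_of_nonneg (by positivity) hb.le,
          ← ENNReal.ofReal_add (by positivity) (by positivity),
          ← ENNReal.ofReal_mul (by positivity), ← ENNReal.ofReal_mul (by positivity),
          Real.mul_rpow hρ (by positivity), ← Real.rpow_mul ht0.le]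
        congr 1
        have e1 : -(θ / b) * b = -θ := by field_simp
        have e2 : -(θ + β) = -θ + -β := by ring
        rw [e1, e2, Real.rpow_add ht0]
        ring

end WeightedBound

/-! ### Systems of powers sharing one auxiliary exponent: the contraction estimate. -/

section PowerSystem

variable {n : ℕ} {ι : Type*} [Fintype ι]

/-- The decay rate `θ` such that `|u|^{b_j}` is bounded by `t^{-θ}` in `L^{1/x}`. -/
noncomputable def decayRate (n : ℕ) (α d x : ℝ) : ℝ := 1 - smoothingOrder n α d x

/-- The data of the equation, and an auxiliary exponent `x` such that `|u|^{b_j}` is estimated in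
`L^{1/x}` for all `j`. -/
structure IsPowerSystem (α d x : ℝ) (Q : Space n → ℂ) (b L : ι → ℝ) (f : ι → ℂ → ℂ) : Prop where
  alpha_pos : 0 < α
  order_nonneg : 0 ≤ d
  symbol : IsHomogeneousSymbol d Q
  pos : ∀ j, 0 < b j
  power : ∀ j, PowerType (b j) (L j) (f j)
  x_pos : 0 < x
  x_lt : n * x < 2 * α - d
  lt_x : ∀ j, 2 * α - d < n * (x * (1 + b j))
  x_le : ∀ j, x * (1 + b j) ≤ b j

namespace IsPowerSystem

variable {α d x : ℝ} {Q : Space n → ℂ} {b L : ι → ℝ} {f : ι → ℂ → ℂ}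

theorem smoothingOrder_lt (hS : IsPowerSystem α d x Q b L f) {y : ℝ} (hy : n * y < 2 * α - d) :
    smoothingOrder n α d y < 1 := by
  have := hS.alpha_pos
  rw [smoothingOrder, div_lt_one (by positivity)]
  linarith

theorem decayRate_pos (hS : IsPowerSystem α d x Q b L f) : 0 < decayRate n α d x :=
  sub_pos.2 (hS.smoothingOrder_lt hS.x_lt)

theorem x_lt_b (hS : IsPowerSystem α d x Q b L f) (j : ι) : x < b j := by
  have h1 := hS.x_le j
  have h2 := hS.pos j
  have h3 := hS.x_pos
  nlinarith

theorem one_le_div (hS : IsPowerSystem α d x Q b L f) (j : ι) : 1 ≤ b j / x := by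
  rw [_root_.one_le_div hS.x_pos]
  exact (hS.x_lt_b j).le

theorem div_pos (hS : IsPowerSystem α d x Q b L f) (j : ι) : 0 < b j / x := by
  linarith [hS.one_le_div j]

/-- By `x_le`: the nonlinear term `f_j(u)` of `u ∈ L^{b_j/x}` lands in a Lebesgue space of exponent
at least `1`. -/
theorem add_one_div_le (hS : IsPowerSystem α d x Q b L f) (j : ι) : x + 1 / (b j / x) ≤ 1 := by
  have h1 := hS.x_le j
  have h2 := hS.pos j
  rw [one_div_div, ← sub_nonneg]
  have : 1 - (x + x / b j) = (b j - x * (1 + b j)) / b j := by field_simp; ring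
  rw [this]
  exact _root_.div_nonneg (by linarith) h2.le

/-- A reformulation of `lt_x`: the source `f_j(u)`, of size `t^{-θ-θ/b_j}`, is integrable at `t =
0`. -/
theorem decayRate_add_lt (hS : IsPowerSystem α d x Q b L f) (j : ι) :
    decayRate n α d x + decayRate n α d x / b j < 1 := by
  have hb := hS.pos j
  have hα := hS.alpha_pos
  have hd := hS.order_nonneg
  have h1 := hS.lt_x j
  have hs : smoothingOrder n α d x * (1 + b j) > 1 := by
    rw [smoothingOrder, div_mul_eq_mul_div, gt_iff_lt, lt_div_iff₀ (by positivity)]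
    nlinarith
  rw [decayRate]
  have : 1 - smoothingOrder n α d x + (1 - smoothingOrder n α d x) / b j =
      1 - (smoothingOrder n α d x * (1 + b j) - 1) / b j := by field_simp; ring
  rw [this]
  have : 0 < (smoothingOrder n α d x * (1 + b j) - 1) / b j := _root_.div_pos (by linarith) hb
  linarith

theorem one_le_exponent (hS : IsPowerSystem α d x Q b L f) {P : ℝ} (hP : 1 ≤ P)
    (hxP : x + 1 / P ≤ 1) : 1 ≤ 1 / (x + 1 / P) := by
  have := hS.x_pos
  have : 0 < 1 / P := by positivity
  rw [le_div_iff₀ (by linarith)]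
  linarith

theorem continuousInLp_source (hS : IsPowerSystem α d x Q b L f) (j : ι) {I : Set ℝ}
    {u : ℝ → Space n → ℂ} (hu : ContinuousInLp I (b j / x) u) {P : ℝ} (hP : 1 ≤ P)
    (hxP : x + 1 / P ≤ 1) (huP : ContinuousInLp I P u) :
    ContinuousInLp I (1 / (x + 1 / P)) fun s y => f j (u s y) :=
  (hS.power j).continuousInLp (hS.pos j) hS.x_pos (hS.x_lt_b j).le (hS.one_le_exponent hP hxP) hP
    (one_div_one_div _) hu huP

variable [Nontrivial (Space n)]

/-- The exponent `P` in which the difference is measured and the target `p` are kept apart: `p = P`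
gives the contraction, while other values of `p` serve to reach `L^{r_k}` and `L^{p_k}`. -/
theorem duhamelMass_sub_le (hS : IsPowerSystem α d x Q b L f) (j : ι) {u v : ℝ → Space n → ℂ}
    {P β p ρ M T : ℝ} (hP : 1 ≤ P) (hxP : x + 1 / P ≤ 1) (hβ : decayRate n α d x + β < 1)
    (hp0 : 0 < p) (hp : 0 < x + 1 / P - 1 / p) (hp' : n * (x + 1 / P - 1 / p) < 2 * α - d)
    (hρ : 0 ≤ ρ) (hM : 0 ≤ M)
    (hum : ∀ t ∈ Ioc 0 T, AEStronglyMeasurable (u t) volume)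
    (hvm : ∀ t ∈ Ioc 0 T, AEStronglyMeasurable (v t) volume)
    (hu : WeightedBound (b j / x) (decayRate n α d x / b j) ρ T u)
    (hv : WeightedBound (b j / x) (decayRate n α d x / b j) ρ T v)
    (huv : WeightedBound P β M T fun t => u t - v t) {t : ℝ} (ht : t ∈ Ioc 0 T) :
    duhamelMass α Q (fun s y => f j (u s y) - f j (v s y)) p t ≤
      ENNReal.ofReal (kernelNorm α Q (x + 1 / P - 1 / p) *
        betaConst (smoothingOrder n α d (x + 1 / P - 1 / p)) (decayRate n α d x + β) *
        (2 * L j * ρ ^ b j * M) *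
        t ^ (1 - smoothingOrder n α d (x + 1 / P - 1 / p) - (decayRate n α d x + β))) := by
  have hh := hS.one_le_exponent hP hxP
  have hL := (hS.power j).nonneg
  have h0 : 0 < x + 1 / P := add_pos hS.x_pos (by positivity)
  have h1 := (hS.power j).weightedBound_sub (hS.pos j) hS.x_pos hh (by linarith)
    (one_div_one_div _) hρ hum hvm hu hv huv
  have h2 : 1 / (x + 1 / P) < p := by
    rw [div_lt_iff₀ h0]
    have : p * (1 / p) = 1 := by field_simp
    nlinarith
  have h3 := duhamelMass_le hS.alpha_pos hS.order_nonneg hS.symbol hh h2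
    (g := fun s y => f j (u s y) - f j (v s y)) (γ := decayRate n α d x + β)
    (G := 2 * L j * ρ ^ b j * M) (by positivity) ht.1
    (hS.smoothingOrder_lt (by rwa [one_div_one_div])) hβ
    (fun s hs => (((hS.power j).continuous (hS.pos j)).comp_aestronglyMeasurable
      (hum s ⟨hs.1, hs.2.le.trans ht.2⟩)).sub
      (((hS.power j).continuous (hS.pos j)).comp_aestronglyMeasurable
      (hvm s ⟨hs.1, hs.2.le.trans ht.2⟩)))
    fun s hs => h1 s ⟨hs.1, hs.2.le.trans ht.2⟩
  rwa [one_div_one_div] at h3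

theorem duhamelMass_le (hS : IsPowerSystem α d x Q b L f) (j : ι) {u : ℝ → Space n → ℂ}
    {P β p ρ M T : ℝ} (hP : 1 ≤ P) (hxP : x + 1 / P ≤ 1) (hβ : decayRate n α d x + β < 1)
    (hp0 : 0 < p) (hp : 0 < x + 1 / P - 1 / p) (hp' : n * (x + 1 / P - 1 / p) < 2 * α - d)
    (hρ : 0 ≤ ρ) (hM : 0 ≤ M)
    (hum : ∀ t ∈ Ioc 0 T, AEStronglyMeasurable (u t) volume)
    (hu : WeightedBound (b j / x) (decayRate n α d x / b j) ρ T u)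
    (huP : WeightedBound P β M T u) {t : ℝ} (ht : t ∈ Ioc 0 T) :
    duhamelMass α Q (fun s y => f j (u s y)) p t ≤
      ENNReal.ofReal (kernelNorm α Q (x + 1 / P - 1 / p) *
        betaConst (smoothingOrder n α d (x + 1 / P - 1 / p)) (decayRate n α d x + β) *
        (2 * L j * ρ ^ b j * M) *
        t ^ (1 - smoothingOrder n α d (x + 1 / P - 1 / p) - (decayRate n α d x + β))) := by
  have h1 := hS.duhamelMass_sub_le j (v := fun _ _ => 0) hP hxP hβ hp0 hp hp' hρ hM hum
    (fun _ _ => aestronglyMeasurable_const) hu weightedBound_zero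
    (huP.congr fun t _ => Eventually.of_forall fun y => by simp) ht
  simpa only [(hS.power j).zero, sub_zero] using h1

theorem continuousInLp_duhamel (hS : IsPowerSystem α d x Q b L f) (j : ι) {u : ℝ → Space n → ℂ}
    {P β p ρ M : ℝ} (hP : 1 ≤ P) (hxP : x + 1 / P ≤ 1) (hβ : decayRate n α d x + β < 1)
    (hp0 : 0 < p) (hp : 0 < x + 1 / P - 1 / p) (hp' : n * (x + 1 / P - 1 / p) < 2 * α - d)
    (hρ : 0 ≤ ρ) (hM : 0 ≤ M) (huc : ContinuousInLp (Ioi 0) (b j / x) u)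
    (huPc : ContinuousInLp (Ioi 0) P u)
    (hu : ∀ T, WeightedBound (b j / x) (decayRate n α d x / b j) ρ T u)
    (huP : ∀ T, WeightedBound P β M T u) :
    ContinuousInLp (Ioi 0) p (duhamel α Q fun s y => f j (u s y)) := by
  have hh := hS.one_le_exponent hP hxP
  have hL := (hS.power j).nonneg
  have h0 : 0 < x + 1 / P := add_pos hS.x_pos (by positivity)
  have h2 : 1 / (x + 1 / P) < p := by
    rw [div_lt_iff₀ h0]
    have : p * (1 / p) = 1 := by field_simp
    nlinarith
  refine FracDissipative.continuousInLp_duhamel hS.alpha_pos hS.order_nonneg hS.symbol hh h2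
    (hS.smoothingOrder_lt (by rwa [one_div_one_div])) hβ
    (hS.continuousInLp_source j huc hP hxP huPc) fun T hT =>
      ⟨2 * L j * ρ ^ b j * M, by positivity, ?_⟩
  have h1 := (hS.power j).weightedBound_sub (v := fun _ _ => 0) (T := T) (hS.pos j) hS.x_pos hh
    (by linarith) (one_div_one_div _) hρ (fun s hs => (huc.memLp s hs.1).1)
    (fun _ _ => aestronglyMeasurable_const) (hu T) weightedBound_zero
    ((huP T).congr fun t _ => Eventually.of_forall fun y => by simp)
  unfold WeightedBound at h1
  simpa only [(hS.power j).zero, sub_zero] using h1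

theorem ae_integrableOn_duhamel (hS : IsPowerSystem α d x Q b L f) (j : ι) {u : ℝ → Space n → ℂ}
    {ρ T : ℝ} (hρ : 0 ≤ ρ) (huc : ContinuousInLp (Ioi 0) (b j / x) u)
    (hu : WeightedBound (b j / x) (decayRate n α d x / b j) ρ T u) {t : ℝ} (ht : t ∈ Ioc 0 T) :
    ∀ᵐ y, IntegrableOn (fun s => symbolSemigroup α Q (t - s) (fun z => f j (u s z)) y)
      (Ioo 0 t) := by
  have hP := hS.one_le_div j
  have hxP := hS.add_one_div_le j
  have e : x + 1 / (b j / x) - 1 / (b j / x) = x := by ring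
  have h1 := hS.duhamelMass_le j hP hxP (hS.decayRate_add_lt j) (hS.div_pos j)
    (by rw [e]; exact hS.x_pos) (by rw [e]; exact hS.x_lt) hρ hρ (fun s hs => (huc.memLp s hs.1).1)
    hu hu ht
  exact ae_integrableOn_of_duhamelMass hS.alpha_pos hS.order_nonneg hS.symbol
    (hS.one_le_exponent hP hxP) (hS.continuousInLp_source j huc hP hxP huc) hP
    (h1.trans_lt ENNReal.ofReal_lt_top)

theorem duhamel_sub (hS : IsPowerSystem α d x Q b L f) (j : ι) {u v : ℝ → Space n → ℂ}
    {ρ T : ℝ} (hρ : 0 ≤ ρ) (huc : ContinuousInLp (Ioi 0) (b j / x) u)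
    (hvc : ContinuousInLp (Ioi 0) (b j / x) v)
    (hu : WeightedBound (b j / x) (decayRate n α d x / b j) ρ T u)
    (hv : WeightedBound (b j / x) (decayRate n α d x / b j) ρ T v) {t : ℝ} (ht : t ∈ Ioc 0 T) :
    ∀ᵐ y, duhamel α Q (fun s z => f j (u s z)) t y - duhamel α Q (fun s z => f j (v s z)) t y =
      duhamel α Q (fun s z => f j (u s z) - f j (v s z)) t y := by
  have hP := hS.one_le_div j
  have hxP := hS.add_one_div_le j
  have hh := hS.one_le_exponent hP hxP
  have h3 := hS.continuousInLp_source j huc hP hxP huc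
  have h4 := hS.continuousInLp_source j hvc hP hxP hvc
  filter_upwards [hS.ae_integrableOn_duhamel j hρ huc hu ht,
    hS.ae_integrableOn_duhamel j hρ hvc hv ht] with y h1 h2
  simp only [duhamel]
  rw [← integral_sub h1 h2]
  refine setIntegral_congr_fun measurableSet_Ioo fun s hs => ?_
  exact (symbolSemigroup_sub hS.alpha_pos hS.order_nonneg hS.symbol hh hh (sub_pos.2 hs.2)
    (h3.memLp s hs.1) (h4.memLp s hs.1) y).symm

theorem aestronglyMeasurable_duhamel (hS : IsPowerSystem α d x Q b L f) (j : ι)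
    {u : ℝ → Space n → ℂ} (huc : ContinuousInLp (Ioi 0) (b j / x) u) (t : ℝ) :
    AEStronglyMeasurable (duhamel α Q (fun s z => f j (u s z)) t) volume :=
  FracDissipative.aestronglyMeasurable_duhamel hS.alpha_pos hS.order_nonneg hS.symbol
    (hS.one_le_exponent (hS.one_le_div j) (hS.add_one_div_le j))
    (hS.continuousInLp_source j huc (hS.one_le_div j) (hS.add_one_div_le j) huc) t

/-- The size of the Lipschitz constants of the nonlinear terms on functions of size `ρ`. -/
noncomputable def lipConst (_ : IsPowerSystem α d x Q b L f) (ρ : ℝ) : ℝ :=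
  ∑ j, 2 * L j * ρ ^ b j

theorem lipConst_nonneg (hS : IsPowerSystem α d x Q b L f) {ρ : ℝ} (hρ : 0 ≤ ρ) :
    0 ≤ hS.lipConst ρ :=
  Finset.sum_nonneg fun j _ => by
    have := (hS.power j).nonneg
    positivity

/-- The norm of the Duhamel operator with target `L^P` and weight `t^{-β}`. -/
noncomputable def opConst (_ : IsPowerSystem α d x Q b L f) (β : ℝ) : ℝ :=
  kernelNorm α Q x * betaConst (smoothingOrder n α d x) (decayRate n α d x + β)

theorem opConst_nonneg (hS : IsPowerSystem α d x Q b L f) (β : ℝ) : 0 ≤ hS.opConst β :=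
  mul_nonneg (kernelNorm_nonneg _ _ _) (betaConst_nonneg _ _)

/-- The contraction estimate. -/
theorem weightedBound_duhamel_sub (hS : IsPowerSystem α d x Q b L f) {u v : ℝ → Space n → ℂ}
    {P β ρ M T : ℝ} (hP : 1 ≤ P) (hxP : x + 1 / P ≤ 1) (hβ : decayRate n α d x + β < 1)
    (hρ : 0 ≤ ρ) (hM : 0 ≤ M) (huc : ∀ j, ContinuousInLp (Ioi 0) (b j / x) u)
    (hvc : ∀ j, ContinuousInLp (Ioi 0) (b j / x) v)
    (hu : ∀ j, WeightedBound (b j / x) (decayRate n α d x / b j) ρ T u)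
    (hv : ∀ j, WeightedBound (b j / x) (decayRate n α d x / b j) ρ T v)
    (huv : WeightedBound P β M T fun t => u t - v t) :
    WeightedBound P β (hS.opConst β * hS.lipConst ρ * M) T fun t y =>
      ∑ j, (duhamel α Q (fun s z => f j (u s z)) t y -
        duhamel α Q (fun s z => f j (v s z)) t y) := by
  have e : hS.opConst β * hS.lipConst ρ * M =
      ∑ j, hS.opConst β * (2 * L j * ρ ^ b j * M) := by
    rw [lipConst, Finset.mul_sum, Finset.sum_mul]
    exact Finset.sum_congr rfl fun j _ => by ring
  rw [e]
  refine WeightedBound.sum hP Finset.univ (fun j _ => ?_) (fun j _ => ?_) fun j _ t _ =>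
    (hS.aestronglyMeasurable_duhamel j (huc j) t).sub (hS.aestronglyMeasurable_duhamel j (hvc j) t)
  · have := (hS.power j).nonneg
    have := hS.opConst_nonneg β
    positivity
  · intro t ht
    have hxx : x + 1 / P - 1 / P = x := by ring
    have h1 := hS.duhamelMass_sub_le j hP hxP hβ (by linarith : 0 < P)
      (by rw [hxx]; exact hS.x_pos) (by rw [hxx]; exact hS.x_lt) hρ hM
      (fun s hs => ((huc j).memLp s hs.1).1) (fun s hs => ((hvc j).memLp s hs.1).1) (hu j) (hv j)
      huv ht
    rw [eLpNorm_congr_ae (hS.duhamel_sub j hρ (huc j) (hvc j) (hu j) (hv j) ht)]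
    have hP1 := hS.one_le_div j
    have hxP1 := hS.add_one_div_le j
    refine (eLpNorm_duhamel_le hS.alpha_pos hS.order_nonneg hS.symbol
      (hS.one_le_exponent hP1 hxP1) ((hS.continuousInLp_source j (huc j) hP1 hxP1 (huc j)).sub
        (hS.one_le_exponent hP1 hxP1) (hS.continuousInLp_source j (hvc j) hP1 hxP1 (hvc j))) hP
        t).trans (h1.trans_eq ?_)
    rw [hxx, opConst]
    congr 3
    -- The singularity is `σ = 1 - θ`, so the time exponent `1 - σ - (θ + β)` equals `-β`: the
    -- weight reproduces itself.
    rw [decayRate]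
    ring

end IsPowerSystem

end PowerSystem

/-! ### Limits of geometrically convergent sequences in `L^P`. -/

section GeometricConvergence

variable {n : ℕ} {P : ℝ}

theorem tendsto_ofReal_mul_geometric (C : ℝ) :
    Tendsto (fun m : ℕ => ENNReal.ofReal (C * (1 / 2) ^ m)) atTop (𝓝 0) := by
  have h1 : Tendsto (fun m : ℕ => C * (1 / 2 : ℝ) ^ m) atTop (𝓝 0) := by
    simpa using (tendsto_pow_atTop_nhds_zero_of_lt_one (r := (1 / 2 : ℝ)) (by norm_num)
      (by norm_num)).const_mul C
  have h2 := (ENNReal.continuous_ofReal.tendsto 0).comp h1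
  rwa [ENNReal.ofReal_zero] at h2

theorem eLpNorm_sub_le_of_geometric (hP : 1 ≤ P) {v : ℕ → Space n → ℂ}
    (hm : ∀ m, AEStronglyMeasurable (v m) volume) {B : ℝ} (hB : 0 ≤ B)
    (h : ∀ m, eLpNorm (v (m + 1) - v m) (ENNReal.ofReal P) volume ≤
      ENNReal.ofReal (B * (1 / 2) ^ m)) (m k : ℕ) :
    eLpNorm (v (m + k) - v m) (ENNReal.ofReal P) volume ≤ ENNReal.ofReal (2 * B * (1 / 2) ^ m) := by
  -- The subtracted term makes the telescoping induction close; it is dropped at the end.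
  have key : ∀ k, eLpNorm (v (m + k) - v m) (ENNReal.ofReal P) volume ≤
      ENNReal.ofReal (2 * B * ((1 / 2) ^ m - (1 / 2) ^ (m + k))) := by
    intro k
    induction k with
    | zero => simp
    | succ k ih =>
      have e : v (m + (k + 1)) - v m = (v (m + k + 1) - v (m + k)) + (v (m + k) - v m) := by
        rw [← add_assoc]; abel
      have h0 : ((1 : ℝ) / 2) ^ (m + k) ≤ (1 / 2) ^ m :=
        pow_le_pow_of_le_one (by norm_num) (by norm_num) (Nat.le_add_right m k)
      rw [e]
      refine (eLpNorm_add_le ((hm _).sub (hm _)) ((hm _).sub (hm _)) (by simpa)).trans ?_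
      refine (add_le_add (h _) ih).trans_eq ?_
      rw [← ENNReal.ofReal_add (by positivity)
        (mul_nonneg (by positivity) (sub_nonneg.2 h0))]
      congr 1
      rw [← add_assoc, pow_succ]
      ring
  refine (key k).trans (ENNReal.ofReal_le_ofReal ?_)
  have : (0 : ℝ) ≤ (1 / 2) ^ (m + k) := by positivity
  nlinarith

theorem ae_exists_tendsto_of_geometric (hP : 1 ≤ P) {v : ℕ → Space n → ℂ}
    (hm : ∀ m, AEStronglyMeasurable (v m) volume) {B : ℝ} (hB : 0 ≤ B)
    (h : ∀ m, eLpNorm (v (m + 1) - v m) (ENNReal.ofReal P) volume ≤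
      ENNReal.ofReal (B * (1 / 2) ^ m)) :
    ∀ᵐ x, ∃ l, Tendsto (fun m => v m x) atTop (𝓝 l) := by
  -- Two tails of size `2 B (1/2)^N`; the additional `1` makes the inequality strict even when `B =
  -- 0`.
  have hs : Summable fun N : ℕ => (4 * B + 1) * (1 / 2 : ℝ) ^ N :=
    (summable_geometric_of_lt_one (by norm_num) (by norm_num)).mul_left _
  refine Lp.ae_tendsto_of_cauchy_eLpNorm hm (p := ENNReal.ofReal P) (by simpa)
    (B := fun N => ENNReal.ofReal ((4 * B + 1) * (1 / 2) ^ N)) hs.tsum_ofReal_ne_top ?_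
  intro N j k hj hk
  obtain ⟨j, rfl⟩ := Nat.exists_eq_add_of_le hj
  obtain ⟨k, rfl⟩ := Nat.exists_eq_add_of_le hk
  have e : v (N + j) - v (N + k) = (v (N + j) - v N) - (v (N + k) - v N) := by abel
  rw [e]
  refine (eLpNorm_sub_le ((hm _).sub (hm _)) ((hm _).sub (hm _)) (by simpa)).trans_lt ?_
  refine (add_le_add (eLpNorm_sub_le_of_geometric hP hm hB h N j)
    (eLpNorm_sub_le_of_geometric hP hm hB h N k)).trans_lt ?_
  rw [← ENNReal.ofReal_add (by positivity) (by positivity)]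
  refine (ENNReal.ofReal_lt_ofReal_iff (by positivity)).2 ?_
  have : (0 : ℝ) < (1 / 2) ^ N := by positivity
  nlinarith

theorem eLpNorm_lim_sub_le_of_geometric (hP : 1 ≤ P) {v : ℕ → Space n → ℂ}
    (hm : ∀ m, AEStronglyMeasurable (v m) volume) {B : ℝ} (hB : 0 ≤ B)
    (h : ∀ m, eLpNorm (v (m + 1) - v m) (ENNReal.ofReal P) volume ≤
      ENNReal.ofReal (B * (1 / 2) ^ m)) {u : Space n → ℂ}
    (hu : ∀ᵐ x, Tendsto (fun m => v m x) atTop (𝓝 (u x))) (m : ℕ) :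
    eLpNorm (u - v m) (ENNReal.ofReal P) volume ≤ ENNReal.ofReal (2 * B * (1 / 2) ^ m) := by
  have h1 : ∀ᵐ x, Tendsto (fun k => (v (m + k) - v m) x) atTop (𝓝 ((u - v m) x)) := by
    filter_upwards [hu] with x hx
    have h2 : Tendsto (fun k => m + k) atTop atTop := tendsto_atTop_mono (fun k => Nat.le_add_left k m) tendsto_id
    exact (hx.comp h2).sub_const _
  refine (Lp.eLpNorm_lim_le_liminf_eLpNorm (fun k => (hm (m + k)).sub (hm m)) _ h1).trans ?_
  refine (liminf_le_liminf (Eventually.of_forall fun k =>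
    eLpNorm_sub_le_of_geometric hP hm hB h m k)).trans_eq ?_
  exact liminf_const _

/-- The weight `t^{-β}` is locally bounded on `(0, ∞)`, so the convergence is locally uniform in
time and continuity passes to the limit. -/
theorem continuousInLp_of_geometric (hP : 1 ≤ P) {v : ℕ → ℝ → Space n → ℂ} {u : ℝ → Space n → ℂ}
    {B β : ℝ} (hB : 0 ≤ B) (hv : ∀ m, ContinuousInLp (Ioi 0) P (v m))
    (hum : ∀ t ∈ Ioi (0 : ℝ), AEStronglyMeasurable (u t) volume)
    (h : ∀ m, ∀ t ∈ Ioi (0 : ℝ), eLpNorm (u t - v m t) (ENNReal.ofReal P) volume ≤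
      ENNReal.ofReal (B * t ^ (-β) * (1 / 2) ^ m)) :
    ContinuousInLp (Ioi 0) P u := by
  have hP' : 1 ≤ ENNReal.ofReal P := by simpa
  refine ⟨fun t ht => ?_, fun t₀ ht₀ => ?_⟩
  · have e : u t = (u t - v 0 t) + v 0 t := by abel
    rw [e]
    exact MemLp.add ⟨(hum t ht).sub ((hv 0).memLp t ht).1,
      (h 0 t ht).trans_lt ENNReal.ofReal_lt_top⟩ ((hv 0).memLp t ht)
  · have ht₀' : 0 < t₀ := ht₀
    set c := t₀ ^ (-β) + 1 with hc
    have hc0 : 0 < c := by positivity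
    have hcev : ∀ᶠ t : ℝ in 𝓝[Ioi 0] t₀, t ^ (-β) ≤ c :=
      (((Real.continuousAt_rpow_const t₀ _ (Or.inl ht₀'.ne')).tendsto.eventually
        (gt_mem_nhds (lt_add_one _))).mono fun t ht => ht.le).filter_mono nhdsWithin_le_nhds
    rw [ENNReal.tendsto_nhds_zero]
    intro ε hε
    have hlim := tendsto_ofReal_mul_geometric (B * c)
    have hε3 : 0 < ε / 3 := ENNReal.div_pos hε.ne' (by simp)
    obtain ⟨m, hm⟩ := ((ENNReal.tendsto_nhds_zero.1 hlim) (ε / 3) hε3).exists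
    filter_upwards [self_mem_nhdsWithin, hcev,
      (ENNReal.tendsto_nhds_zero.1 ((hv m).tendsto t₀ ht₀)) (ε / 3) hε3] with t ht htc hvt
    have hbd : ∀ t' ∈ Ioi (0 : ℝ), t' ^ (-β) ≤ c →
        eLpNorm (u t' - v m t') (ENNReal.ofReal P) volume ≤ ε / 3 := by
      intro t' ht' htc'
      refine (h m t' ht').trans (le_trans ?_ hm)
      gcongr
    have e : u t - u t₀ = (u t - v m t) + (v m t - v m t₀) - (u t₀ - v m t₀) := by abel
    have m1 := (hum t ht).sub ((hv m).memLp t ht).1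
    have m2 := ((hv m).memLp t ht).1.sub ((hv m).memLp t₀ ht₀).1
    have m3 := (hum t₀ ht₀).sub ((hv m).memLp t₀ ht₀).1
    rw [e]
    refine (eLpNorm_sub_le (m1.add m2) m3 hP').trans ?_
    refine (add_le_add (eLpNorm_add_le m1 m2 hP') le_rfl).trans ?_
    refine (add_le_add (add_le_add (hbd t ht htc) hvt) (hbd t₀ ht₀ (by simp [hc]))).trans ?_
    rw [ENNReal.add_thirds]

end GeometricConvergence

/-! ### Picard iteration: existence and uniqueness of small solutions. -/

section Existence

variable {n : ℕ} {ι : Type*} [Fintype ι] {α d x : ℝ} {Q : Space n → ℂ} {b L : ι → ℝ}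
  {f : ι → ℂ → ℂ} [Nontrivial (Space n)]

/-- The right-hand side of the integral equation. -/
noncomputable def mildStep (α : ℝ) (Q : Space n → ℂ) (f : ι → ℂ → ℂ) (φ : Space n → ℂ)
    (u : ℝ → Space n → ℂ) (t : ℝ) (y : Space n) : ℂ :=
  semigroup α t φ y + ∑ j, duhamel α Q (fun s z => f j (u s z)) t y

/-- Pairs `(P, β)` such that the equation is contractive in `L^P` with weight `t^{-β}`. -/
structure IsTarget (n : ℕ) (α d x P β : ℝ) : Prop where
  one_le : 1 ≤ P
  add_le : x + 1 / P ≤ 1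
  add_lt : decayRate n α d x + β < 1

/-- Solutions that are small in the critical spaces. -/
structure IsSmallSolution (α d x : ℝ) (Q : Space n → ℂ) (b : ι → ℝ) (f : ι → ℂ → ℂ)
    (φ : Space n → ℂ) (ρ T : ℝ) (u : ℝ → Space n → ℂ) : Prop where
  cont : ∀ j, ContinuousInLp (Ioi 0) (b j / x) u
  bound : ∀ j, WeightedBound (b j / x) (decayRate n α d x / b j) ρ T u
  eq : ∀ t ∈ Ioc 0 T, u t =ᵐ[volume] mildStep α Q f φ u t

namespace IsPowerSystem

theorem isTarget (hS : IsPowerSystem α d x Q b L f) (j : ι) :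
    IsTarget n α d x (b j / x) (decayRate n α d x / b j) :=
  ⟨hS.one_le_div j, hS.add_one_div_le j, hS.decayRate_add_lt j⟩

variable {φ : Space n → ℂ} {ρ : ℝ}

theorem weightedBound_mildStep_sub (hS : IsPowerSystem α d x Q b L f) {u v : ℝ → Space n → ℂ}
    {P β M T : ℝ} (hP : IsTarget n α d x P β) (hρ : 0 ≤ ρ) (hM : 0 ≤ M)
    (hsmall : hS.opConst β * hS.lipConst ρ ≤ 1 / 2)
    (huc : ∀ j, ContinuousInLp (Ioi 0) (b j / x) u)
    (hvc : ∀ j, ContinuousInLp (Ioi 0) (b j / x) v)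
    (hu : ∀ j, WeightedBound (b j / x) (decayRate n α d x / b j) ρ T u)
    (hv : ∀ j, WeightedBound (b j / x) (decayRate n α d x / b j) ρ T v)
    (huv : WeightedBound P β M T fun t => u t - v t) :
    WeightedBound P β (M / 2) T fun t => mildStep α Q f φ u t - mildStep α Q f φ v t := by
  have h1 := hS.weightedBound_duhamel_sub hP.one_le hP.add_le hP.add_lt hρ hM huc hvc hu hv huv
  have h2 := h1.mono (M' := M / 2) (by nlinarith)
  refine h2.congr fun t _ => Eventually.of_forall fun y => ?_
  simp only [Pi.sub_apply, mildStep, Finset.sum_sub_distrib]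
  ring

theorem weightedBound_mildStep (hS : IsPowerSystem α d x Q b L f) {u : ℝ → Space n → ℂ}
    {P β A M T : ℝ} (hP : IsTarget n α d x P β) (hρ : 0 ≤ ρ) (hM : 0 ≤ M) (hA : 0 ≤ A)
    (hsmall : hS.opConst β * hS.lipConst ρ ≤ 1 / 2)
    (hφ : WeightedBound P β A T fun t => semigroup α t φ)
    (hφm : ∀ t ∈ Ioc 0 T, AEStronglyMeasurable (semigroup α t φ) volume)
    (huc : ∀ j, ContinuousInLp (Ioi 0) (b j / x) u)
    (hu : ∀ j, WeightedBound (b j / x) (decayRate n α d x / b j) ρ T u)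
    (huP : WeightedBound P β M T u) :
    WeightedBound P β (A + M / 2) T (mildStep α Q f φ u) := by
  have h1 := hS.weightedBound_duhamel_sub hP.one_le hP.add_le hP.add_lt hρ hM huc
    (fun j => continuousInLp_zero _ _) hu (fun j => weightedBound_zero)
    (huP.congr (w := fun t => u t - fun _ => (0 : ℂ)) fun t _ =>
      Eventually.of_forall fun y => by simp)
  have h2 := h1.mono (M' := M / 2) (by nlinarith)
  have h0 : ∀ t y, duhamel α Q (fun _ _ => (0 : ℂ)) t y = 0 := fun t y => by
    simp [duhamel, symbolSemigroup]
  simp only [(hS.power _).zero, h0, sub_zero] at h2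
  exact hφ.add hP.one_le hA (by positivity) h2 hφm fun t _ =>
    Finset.aestronglyMeasurable_fun_sum _ fun j _ => hS.aestronglyMeasurable_duhamel j (huc j) t

theorem continuousInLp_mildStep (hS : IsPowerSystem α d x Q b L f) {u : ℝ → Space n → ℂ}
    {P β M : ℝ} (hP : IsTarget n α d x P β) (hρ : 0 ≤ ρ) (hM : 0 ≤ M)
    (hφc : ContinuousInLp (Ioi 0) P fun t => semigroup α t φ)
    (huc : ∀ j, ContinuousInLp (Ioi 0) (b j / x) u) (huPc : ContinuousInLp (Ioi 0) P u)
    (hu : ∀ j T, WeightedBound (b j / x) (decayRate n α d x / b j) ρ T u)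
    (huP : ∀ T, WeightedBound P β M T u) :
    ContinuousInLp (Ioi 0) P (mildStep α Q f φ u) := by
  have e : x + 1 / P - 1 / P = x := by ring
  have hP1 := hP.one_le
  exact hφc.add hP1 (ContinuousInLp.sum hP1 _ fun j _ =>
    hS.continuousInLp_duhamel j hP1 hP.add_le hP.add_lt (by linarith) (by rw [e]; exact hS.x_pos)
      (by rw [e]; exact hS.x_lt) hρ hM (huc j) huPc (hu j) huP)

end IsPowerSystem

/-- Picard iterates. -/
noncomputable def picard (α : ℝ) (Q : Space n → ℂ) (f : ι → ℂ → ℂ) (φ : Space n → ℂ) :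
    ℕ → ℝ → Space n → ℂ
  | 0 => fun _ _ => 0
  | m + 1 => mildStep α Q f φ (picard α Q f φ m)

namespace IsPowerSystem

variable {φ : Space n → ℂ} {ρ : ℝ}

/-- With contraction factor `1/2` the bound `2A` is stable, since `A + (2A)/2 = 2A`. -/
theorem picard_step (hS : IsPowerSystem α d x Q b L f) (hρ : 0 ≤ ρ)
    {P β A : ℝ} (hP : IsTarget n α d x P β) (hA : 0 ≤ A)
    (hsmall : hS.opConst β * hS.lipConst ρ ≤ 1 / 2)
    (hφc : ContinuousInLp (Ioi 0) P fun t => semigroup α t φ)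
    (hφ : ∀ T, WeightedBound P β A T fun t => semigroup α t φ) {m : ℕ}
    (hc : ∀ j, ContinuousInLp (Ioi 0) (b j / x) (picard α Q f φ m))
    (hb : ∀ j T, WeightedBound (b j / x) (decayRate n α d x / b j) ρ T (picard α Q f φ m))
    (hcP : ContinuousInLp (Ioi 0) P (picard α Q f φ m))
    (hbP : ∀ T, WeightedBound P β (2 * A) T (picard α Q f φ m)) :
    ContinuousInLp (Ioi 0) P (picard α Q f φ (m + 1)) ∧
      ∀ T, WeightedBound P β (2 * A) T (picard α Q f φ (m + 1)) := by
  refine ⟨hS.continuousInLp_mildStep hP hρ (by positivity : 0 ≤ 2 * A) hφc hc hcP hb hbP,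
    fun T => ?_⟩
  have := hS.weightedBound_mildStep hP hρ (by positivity : 0 ≤ 2 * A) hA hsmall (hφ T)
    (fun t ht => (hφc.memLp t ht.1).1) hc (fun j => hb j T) (hbP T)
  exact this.mono (by linarith)

theorem picard_bound (hS : IsPowerSystem α d x Q b L f) (hρ : 0 ≤ ρ)
    (hsmall : ∀ j, hS.opConst (decayRate n α d x / b j) * hS.lipConst ρ ≤ 1 / 2)
    (hφc : ∀ j, ContinuousInLp (Ioi 0) (b j / x) fun t => semigroup α t φ)
    (hφ : ∀ j T, WeightedBound (b j / x) (decayRate n α d x / b j) (ρ / 2) T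
      fun t => semigroup α t φ) (m : ℕ) :
    (∀ j, ContinuousInLp (Ioi 0) (b j / x) (picard α Q f φ m)) ∧
      ∀ j T, WeightedBound (b j / x) (decayRate n α d x / b j) ρ T (picard α Q f φ m) := by
  induction m with
  | zero => exact ⟨fun j => continuousInLp_zero _ _, fun j T => weightedBound_zero⟩
  | succ m ih =>
    have e : 2 * (ρ / 2) = ρ := by ring
    have key : ∀ j, ContinuousInLp (Ioi 0) (b j / x) (picard α Q f φ (m + 1)) ∧
        ∀ T, WeightedBound (b j / x) (decayRate n α d x / b j) (2 * (ρ / 2)) T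
          (picard α Q f φ (m + 1)) := fun j =>
      hS.picard_step hρ (hS.isTarget j) (by positivity) (hsmall j) (hφc j) (hφ j) ih.1 ih.2
        (ih.1 j) (by rw [e]; exact ih.2 j)
    rw [e] at key
    exact ⟨fun j => (key j).1, fun j => (key j).2⟩

/-- The iteration closes in the spaces `L^{b_j/x}` alone. In any further target the estimate is
linear in the size, with a factor that depends on `ρ` but not on `A`, so `A` need not be small. The
initial `4A` is the crude sum of the bounds on two iterates. -/
theorem picard_target (hS : IsPowerSystem α d x Q b L f) (hρ : 0 ≤ ρ)
    (hsmall : ∀ j, hS.opConst (decayRate n α d x / b j) * hS.lipConst ρ ≤ 1 / 2)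
    (hφc : ∀ j, ContinuousInLp (Ioi 0) (b j / x) fun t => semigroup α t φ)
    (hφ : ∀ j T, WeightedBound (b j / x) (decayRate n α d x / b j) (ρ / 2) T
      fun t => semigroup α t φ)
    {P β A : ℝ} (hP : IsTarget n α d x P β) (hA : 0 ≤ A)
    (hsmallP : hS.opConst β * hS.lipConst ρ ≤ 1 / 2)
    (hφcP : ContinuousInLp (Ioi 0) P fun t => semigroup α t φ)
    (hφP : ∀ T, WeightedBound P β A T fun t => semigroup α t φ) (m : ℕ) :
    ContinuousInLp (Ioi 0) P (picard α Q f φ m) ∧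
      (∀ T, WeightedBound P β (2 * A) T (picard α Q f φ m)) ∧
      ∀ T, WeightedBound P β (4 * A * (1 / 2) ^ m) T
        fun t => picard α Q f φ (m + 1) t - picard α Q f φ m t := by
  have hb := hS.picard_bound hρ hsmall hφc hφ
  have key : ∀ m, ContinuousInLp (Ioi 0) P (picard α Q f φ m) ∧
      (∀ T, WeightedBound P β (2 * A) T (picard α Q f φ m)) := by
    intro m
    induction m with
    | zero => exact ⟨continuousInLp_zero _ _, fun T => weightedBound_zero⟩
    | succ m ih =>
      exact hS.picard_step hρ hP hA hsmallP hφcP hφP (hb m).1 (hb m).2 ih.1 ih.2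
  refine ⟨(key m).1, (key m).2, fun T => ?_⟩
  induction m with
  | zero =>
    have := ((key 1).2 T).sub hP.one_le (by positivity) (by positivity) ((key 0).2 T)
      (fun t ht => ((key 1).1.memLp t ht.1).1) fun t ht => ((key 0).1.memLp t ht.1).1
    exact this.mono (by rw [pow_zero]; linarith)
  | succ m ih =>
    have := hS.weightedBound_mildStep_sub (φ := φ) hP hρ (by positivity) hsmallP (hb (m + 1)).1
      (hb m).1 (fun j => (hb (m + 1)).2 j T) (fun j => (hb m).2 j T) ih
    exact this.mono (by rw [pow_succ]; linarith)

/-- Existence of a small global solution, with bounds in all target spaces. -/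
theorem exists_isSmallSolution [Nonempty ι] (hS : IsPowerSystem α d x Q b L f) (hρ : 0 ≤ ρ)
    (hsmall : ∀ j, hS.opConst (decayRate n α d x / b j) * hS.lipConst ρ ≤ 1 / 2)
    (hφc : ∀ j, ContinuousInLp (Ioi 0) (b j / x) fun t => semigroup α t φ)
    (hφ : ∀ j T, WeightedBound (b j / x) (decayRate n α d x / b j) (ρ / 2) T
      fun t => semigroup α t φ) :
    ∃ u : ℝ → Space n → ℂ, (∀ T, IsSmallSolution α d x Q b f φ ρ T u) ∧
      ∀ P β A, IsTarget n α d x P β → 0 ≤ A → hS.opConst β * hS.lipConst ρ ≤ 1 / 2 →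
        (ContinuousInLp (Ioi 0) P fun t => semigroup α t φ) →
        (∀ T, WeightedBound P β A T fun t => semigroup α t φ) →
        ContinuousInLp (Ioi 0) P u ∧ ∀ T, WeightedBound P β (2 * A) T u := by
  obtain ⟨j₀⟩ := ‹Nonempty ι›
  set v := picard α Q f φ with hv
  -- A pointwise limit, so that the same function serves in all target spaces at once.
  set u : ℝ → Space n → ℂ := fun t y => limUnder atTop fun m => v m t y with hu
  have hb := hS.picard_bound hρ hsmall hφc hφ
  have hvm : ∀ m, ∀ t ∈ Ioi (0 : ℝ), AEStronglyMeasurable (v m t) volume := fun m t ht =>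
    (((hb m).1 j₀).memLp t ht).1
  have hgeo : ∀ P β A, IsTarget n α d x P β → 0 ≤ A → hS.opConst β * hS.lipConst ρ ≤ 1 / 2 →
        (ContinuousInLp (Ioi 0) P fun t => semigroup α t φ) →
        (∀ T, WeightedBound P β A T fun t => semigroup α t φ) → ∀ t ∈ Ioi (0 : ℝ), ∀ m,
        eLpNorm (v (m + 1) t - v m t) (ENNReal.ofReal P) volume ≤
          ENNReal.ofReal (4 * A * t ^ (-β) * (1 / 2) ^ m) := by
    intro P β A hP hA hsm hc hw t ht m
    refine ((hS.picard_target hρ hsmall hφc hφ hP hA hsm hc hw m).2.2 t t ⟨ht, le_rfl⟩).trans_eq ?_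
    congr 1
    ring
  have hlim : ∀ t ∈ Ioi (0 : ℝ), ∀ᵐ y, Tendsto (fun m => v m t y) atTop (𝓝 (u t y)) := by
    intro t ht
    have ht' : 0 < t := ht
    have := ae_exists_tendsto_of_geometric (hS.one_le_div j₀) (v := fun m => v m t)
      (fun m => hvm m t ht) (by positivity) (hgeo _ _ (ρ / 2) (hS.isTarget j₀) (by positivity)
        (hsmall j₀) (hφc j₀) (hφ j₀) t ht)
    filter_upwards [this] with y hy
    exact tendsto_nhds_limUnder hy
  have hum : ∀ t ∈ Ioi (0 : ℝ), AEStronglyMeasurable (u t) volume := fun t ht =>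
    aestronglyMeasurable_of_tendsto_ae atTop (fun m => hvm m t ht) (hlim t ht)
  have hclose : ∀ P β A, IsTarget n α d x P β → 0 ≤ A → hS.opConst β * hS.lipConst ρ ≤ 1 / 2 →
        (ContinuousInLp (Ioi 0) P fun t => semigroup α t φ) →
        (∀ T, WeightedBound P β A T fun t => semigroup α t φ) → ∀ m, ∀ t ∈ Ioi (0 : ℝ),
        eLpNorm (u t - v m t) (ENNReal.ofReal P) volume ≤
          ENNReal.ofReal (8 * A * t ^ (-β) * (1 / 2) ^ m) := by
    intro P β A hP hA hsm hc hw m t ht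
    have ht' : 0 < t := ht
    refine (eLpNorm_lim_sub_le_of_geometric hP.one_le (v := fun m => v m t)
      (fun m => hvm m t ht) (by positivity) (hgeo P β A hP hA hsm hc hw t ht)
      (hlim t ht) m).trans_eq ?_
    congr 1
    ring
  have hmain : ∀ P β A, IsTarget n α d x P β → 0 ≤ A → hS.opConst β * hS.lipConst ρ ≤ 1 / 2 →
        (ContinuousInLp (Ioi 0) P fun t => semigroup α t φ) →
        (∀ T, WeightedBound P β A T fun t => semigroup α t φ) →
        ContinuousInLp (Ioi 0) P u ∧ ∀ T, WeightedBound P β (2 * A) T u := by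
    intro P β A hP hA hsm hc hw
    have hpt := hS.picard_target hρ hsmall hφc hφ hP hA hsm hc hw
    refine ⟨continuousInLp_of_geometric hP.one_le (by positivity) (fun m => (hpt m).1) hum
      (hclose P β A hP hA hsm hc hw), fun T t ht => ?_⟩
    refine (Lp.eLpNorm_lim_le_liminf_eLpNorm (fun m => hvm m t ht.1) _ (hlim t ht.1)).trans ?_
    exact (liminf_le_liminf (Eventually.of_forall fun m => (hpt m).2.1 T t ht)).trans_eq
      (liminf_const _)
  have e : 2 * (ρ / 2) = ρ := by ring
  have hmainj : ∀ j, ContinuousInLp (Ioi 0) (b j / x) u ∧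
      ∀ T, WeightedBound (b j / x) (decayRate n α d x / b j) ρ T u := by
    intro j
    have := hmain _ _ (ρ / 2) (hS.isTarget j) (by positivity) (hsmall j) (hφc j) (hφ j)
    rwa [e] at this
  refine ⟨u, fun T => ⟨fun j => (hmainj j).1, fun j => (hmainj j).2 T, fun t ht => ?_⟩, hmain⟩
  have ht0 : 0 < t := ht.1
  set c := t ^ (-(decayRate n α d x / b j₀)) with hc
  have hc0 : 0 ≤ c := by positivity
  have hcj := hclose _ _ (ρ / 2) (hS.isTarget j₀) (by positivity) (hsmall j₀) (hφc j₀) (hφ j₀)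
  have hstepm : AEStronglyMeasurable (mildStep α Q f φ u t) volume :=
    ((hφc j₀).memLp t ht0).1.add (Finset.aestronglyMeasurable_fun_sum _ fun j _ =>
      hS.aestronglyMeasurable_duhamel j (hmainj j).1 t)
  -- The defect of `u` is `(u - v_{m+1})` plus the difference of the steps applied to `v_m` and `u`.
  -- Both are `O(2^{-m})`, so the defect vanishes.
  have hkey : ∀ m : ℕ, eLpNorm (u t - mildStep α Q f φ u t) (ENNReal.ofReal (b j₀ / x)) volume ≤
      ENNReal.ofReal (8 * ρ * c * (1 / 2) ^ m) := by
    intro m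
    have h1 : WeightedBound (b j₀ / x) (decayRate n α d x / b j₀) (8 * (ρ / 2) * (1 / 2) ^ m) t
        fun s => v m s - u s := by
      intro s hs
      rw [eLpNorm_sub_comm]
      refine (hcj m s hs.1).trans_eq ?_
      congr 1
      ring
    have h2 := hS.weightedBound_mildStep_sub (φ := φ) (hS.isTarget j₀) hρ (by positivity)
      (hsmall j₀) (hb m).1 (fun j => (hmainj j).1) (fun j => (hb m).2 j t)
      (fun j => (hmainj j).2 t) h1 t ⟨ht0, le_rfl⟩
    have e2 : u t - mildStep α Q f φ u t = (u t - v (m + 1) t) +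
        (mildStep α Q f φ (v m) t - mildStep α Q f φ u t) := by
      simp only [hv, picard]
      abel
    rw [e2]
    refine (eLpNorm_add_le ((hum t ht0).sub (hvm _ t ht0)) ((hvm (m + 1) t ht0).sub hstepm)
      (by simpa using hS.one_le_div j₀)).trans ?_
    refine (add_le_add (hcj (m + 1) t ht0) h2).trans ?_
    rw [← ENNReal.ofReal_add (by positivity) (by positivity)]
    refine ENNReal.ofReal_le_ofReal ?_
    have : 0 ≤ ρ * c * (1 / 2) ^ m := by positivity
    rw [pow_succ, ← hc]
    nlinarith
  have hlim0 := tendsto_ofReal_mul_geometric (8 * ρ * c)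
  have h0 := le_antisymm (ge_of_tendsto' hlim0 hkey) zero_le
  rw [eLpNorm_eq_zero_iff ((hum t ht0).sub hstepm) (by simpa using hS.div_pos j₀)] at h0
  filter_upwards [h0] with y hy
  exact sub_eq_zero.1 hy

/-- Small solutions with the same initial value coincide. -/
theorem isSmallSolution_unique [Nonempty ι] (hS : IsPowerSystem α d x Q b L f) (hρ : 0 ≤ ρ)
    (hsmall : ∀ j, hS.opConst (decayRate n α d x / b j) * hS.lipConst ρ ≤ 1 / 2) {T : ℝ}
    {u v : ℝ → Space n → ℂ} (hu : IsSmallSolution α d x Q b f φ ρ T u)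
    (hv : IsSmallSolution α d x Q b f φ ρ T v) {t : ℝ} (ht : t ∈ Ioc 0 T) :
    u t =ᵐ[volume] v t := by
  obtain ⟨j₀⟩ := ‹Nonempty ι›
  have hum : ∀ s ∈ Ioi (0 : ℝ), AEStronglyMeasurable (u s) volume := fun s hs =>
    ((hu.cont j₀).memLp s hs).1
  have hvm : ∀ s ∈ Ioi (0 : ℝ), AEStronglyMeasurable (v s) volume := fun s hs =>
    ((hv.cont j₀).memLp s hs).1
  -- The difference is at most `2ρ` at the outset, and each use of the equation halves the bound.
  have key : ∀ m : ℕ, WeightedBound (b j₀ / x) (decayRate n α d x / b j₀) (2 * ρ * (1 / 2) ^ m) T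
      fun s => u s - v s := by
    intro m
    induction m with
    | zero =>
      refine ((hu.bound j₀).sub (hS.one_le_div j₀) hρ hρ (hv.bound j₀) (fun s hs => hum s hs.1)
        fun s hs => hvm s hs.1).mono ?_
      rw [pow_zero]; linarith
    | succ m ih =>
      have := hS.weightedBound_mildStep_sub (φ := φ) (hS.isTarget j₀) hρ (by positivity)
        (hsmall j₀) hu.cont hv.cont hu.bound hv.bound ih
      refine (this.mono ?_).congr fun s hs => (hu.eq s hs).sub (hv.eq s hs)
      rw [pow_succ]; linarith
  set c := t ^ (-(decayRate n α d x / b j₀)) with hc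
  have hlim0 := tendsto_ofReal_mul_geometric (2 * ρ * c)
  have hkey : ∀ m : ℕ, eLpNorm (u t - v t) (ENNReal.ofReal (b j₀ / x)) volume ≤
      ENNReal.ofReal (2 * ρ * c * (1 / 2) ^ m) := fun m =>
    (key m t ht).trans_eq (congrArg _ (mul_right_comm _ _ _))
  have h0 := le_antisymm (ge_of_tendsto' hlim0 hkey) zero_le
  rw [eLpNorm_eq_zero_iff ((hum t ht.1).sub (hvm t ht.1)) (by simpa using hS.div_pos j₀)] at h0
  filter_upwards [h0] with y hy
  exact sub_eq_zero.1 hy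

/-- Decay of the weighted norms of a small solution as `t → 0`. -/
theorem exists_weightedBound_of_semigroup (hS : IsPowerSystem α d x Q b L f) (hρ : 0 ≤ ρ)
    {u : ℝ → Space n → ℂ} {T : ℝ} (hu : IsSmallSolution α d x Q b f φ ρ T u) {P β A ε : ℝ}
    (hP : IsTarget n α d x P β) (hA : 0 ≤ A) (hε : 0 < ε)
    (hsmallP : hS.opConst β * hS.lipConst ρ ≤ 1 / 2)
    (hφm : ∀ t ∈ Ioc 0 T, AEStronglyMeasurable (semigroup α t φ) volume)
    (hφε : WeightedBound P β ε T fun t => semigroup α t φ)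
    (huP : WeightedBound P β A T u) : WeightedBound P β (3 * ε) T u := by
  -- Each use of the equation replaces a bound `M` by `ε + M / 2`, whose fixed point is `2ε`.
  have key : ∀ m : ℕ, WeightedBound P β (2 * ε + A * (1 / 2) ^ m) T u := by
    intro m
    induction m with
    | zero =>
      refine huP.mono ?_
      rw [pow_zero]; linarith
    | succ m ih =>
      have := hS.weightedBound_mildStep hP hρ (by positivity) hε.le hsmallP hφε hφm
        hu.cont hu.bound ih
      refine (this.mono ?_).congr hu.eq
      rw [pow_succ]; linarith
  have hlim : Tendsto (fun m : ℕ => A * (1 / 2 : ℝ) ^ m) atTop (𝓝 0) := by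
    simpa using (tendsto_pow_atTop_nhds_zero_of_lt_one (r := (1 / 2 : ℝ)) (by norm_num)
      (by norm_num)).const_mul A
  obtain ⟨m, hm⟩ := (hlim.eventually (gt_mem_nhds hε)).exists
  exact (key m).mono (by linarith)

end IsPowerSystem

end Existence

/-! ### Weighted bounds for the linear evolution. -/

section Heat

variable {n : ℕ} {α : ℝ}

/-- The decay rate of `S_α(t)` from `L^r` to `L^p`. -/
noncomputable def heatRate (n : ℕ) (α r p : ℝ) : ℝ := n / (2 * α) * (1 / r - 1 / p)

variable [Nontrivial (Space n)]

theorem weightedBound_semigroup (hα : 0 < α) {r p : ℝ} (hr : 1 ≤ r) (hrp : r ≤ p)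
    {φ : Space n → ℂ} (hφ : AEStronglyMeasurable φ volume) {N : ℝ}
    (hN : eLpNorm φ (ENNReal.ofReal r) volume ≤ ENNReal.ofReal N) (T : ℝ) :
    WeightedBound p (heatRate n α r p)
      (kernelNorm α (fun _ : Space n => 1) (1 / r - 1 / p) * N) T fun t => semigroup α t φ := by
  intro t ht
  have ht0 : 0 < t := ht.1
  have hk := kernelNorm_nonneg α (fun _ : Space n => 1) (1 / r - 1 / p)
  refine (eLpNorm_semigroup_le hα hr hrp ht0 hφ).trans ((mul_le_mul_right hN _).trans_eq ?_)
  rw [← ENNReal.ofReal_mul (by positivity), heatRate]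
  congr 1
  ring

theorem weightedBound_of_tendsto {P β : ℝ} {v : ℝ → Space n → ℂ}
    (h : Tendsto (fun t : ℝ => ENNReal.ofReal (t ^ β) * eLpNorm (v t) (ENNReal.ofReal P) volume)
      (𝓝[>] 0) (𝓝 0)) {ε : ℝ} (hε : 0 < ε) : ∃ T : ℝ, 0 < T ∧ WeightedBound P β ε T v := by
  have h1 := (ENNReal.tendsto_nhds_zero.1 h) (ENNReal.ofReal ε) (ENNReal.ofReal_pos.2 hε)
  obtain ⟨T, hT, hT'⟩ := mem_nhdsGT_iff_exists_Ioc_subset.1 h1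
  refine ⟨T, hT, fun t ht => ?_⟩
  have h2 := hT' ht
  have ht0 : 0 < t := ht.1
  have h3 : ENNReal.ofReal (t ^ (-β)) * ENNReal.ofReal (t ^ β) = 1 := by
    rw [← ENNReal.ofReal_mul (by positivity), ← Real.rpow_add ht0, neg_add_cancel, Real.rpow_zero,
      ENNReal.ofReal_one]
  calc eLpNorm (v t) (ENNReal.ofReal P) volume
      = ENNReal.ofReal (t ^ (-β)) * (ENNReal.ofReal (t ^ β) *
        eLpNorm (v t) (ENNReal.ofReal P) volume) := by rw [← mul_assoc, h3, one_mul]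
    _ ≤ ENNReal.ofReal (t ^ (-β)) * ENNReal.ofReal ε := mul_le_mul_right h2 _
    _ = ENNReal.ofReal (ε * t ^ (-β)) := by rw [← ENNReal.ofReal_mul (by positivity), mul_comm]

theorem WeightedBound.rpow_mul_le {P β M T : ℝ} {v : ℝ → Space n → ℂ} (hv : WeightedBound P β M T v)
    {t : ℝ} (ht : t ∈ Ioc 0 T) :
    ENNReal.ofReal (t ^ β) * eLpNorm (v t) (ENNReal.ofReal P) volume ≤ ENNReal.ofReal M := by
  have ht0 : 0 < t := ht.1
  refine (mul_le_mul_right (hv t ht) _).trans_eq ?_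
  rw [← ENNReal.ofReal_mul (by positivity), mul_left_comm, ← Real.rpow_add ht0, add_neg_cancel,
    Real.rpow_zero, mul_one]

theorem tendsto_of_weightedBound {P β : ℝ} {v : ℝ → Space n → ℂ}
    (h : ∀ ε : ℝ, 0 < ε → ∃ T : ℝ, 0 < T ∧ WeightedBound P β ε T v) :
    Tendsto (fun t : ℝ => ENNReal.ofReal (t ^ β) * eLpNorm (v t) (ENNReal.ofReal P) volume)
      (𝓝[>] 0) (𝓝 0) := by
  rw [ENNReal.tendsto_nhds_zero]
  intro ε hε
  wlog hεt : ε ≠ ⊤ generalizing ε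
  · rw [not_not] at hεt
    exact Eventually.of_forall fun _ => hεt ▸ le_top
  obtain ⟨T, hT, hb⟩ := h ε.toReal (ENNReal.toReal_pos hε.ne' hεt)
  filter_upwards [Ioc_mem_nhdsGT hT] with t ht
  exact (hb.rpow_mul_le ht).trans_eq (ENNReal.ofReal_toReal hεt)

end Heat

/-! ### From small solutions to the solution class. -/

section Existence

variable {n : ℕ} {ι : Type*} [Fintype ι] {α d x : ℝ} {Q : Space n → ℂ} {b L : ι → ℝ}
  {f : ι → ℂ → ℂ} [Nontrivial (Space n)]

namespace IsPowerSystem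

variable {φ : Space n → ℂ} {ρ : ℝ}

/-- All `b_j` are positive, so the Lipschitz constants tend to `0` with the radius. -/
theorem exists_lipConst_le (hS : IsPowerSystem α d x Q b L f) (K : ℝ) :
    ∃ ρ : ℝ, 0 < ρ ∧ K * hS.lipConst ρ ≤ 1 / 2 := by
  have h1 : Tendsto (fun ρ : ℝ => K * hS.lipConst ρ) (𝓝[>] 0) (𝓝 0) := by
    have h2 : Tendsto (fun ρ : ℝ => K * ∑ j, 2 * L j * ρ ^ b j) (𝓝[>] 0)
        (𝓝 (K * ∑ j, 2 * L j * (0 : ℝ) ^ b j)) :=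
      (tendsto_finsetSum _ fun j _ => ((Real.continuousAt_rpow_const 0 (b j)
        (Or.inr (hS.pos j).le)).tendsto.mono_left nhdsWithin_le_nhds).const_mul _).const_mul K
    have h3 : K * ∑ j, 2 * L j * (0 : ℝ) ^ b j = 0 := by
      simp [Real.zero_rpow (hS.pos _).ne']
    rwa [h3] at h2
  obtain ⟨ρ, h2, h3⟩ := ((h1.eventually (gt_mem_nhds (by norm_num : (0 : ℝ) < 1 / 2))).and
    self_mem_nhdsWithin).exists
  exact ⟨ρ, h3, h2.le⟩

/-- Criticality of `r`: the rate at which `S_α(t)` decays from `L^{r}` to `L^{b_j/x}` is the one for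
which `|u|^{b_j}` decays like `t^{-θ}`, with `θ` independent of `j`. -/
theorem decayRate_div_eq (hS : IsPowerSystem α d x Q b L f) {j : ι} {r : ℝ} (hr0 : 0 < r)
    (hr : r * (2 * α - d) = n * b j) : decayRate n α d x / b j = heatRate n α r (b j / x) := by
  have hα := hS.alpha_pos
  have hb := hS.pos j
  have hx := hS.x_pos
  rw [heatRate, decayRate, smoothingOrder]
  field_simp
  linarith

theorem div_gt (hS : IsPowerSystem α d x Q b L f) {j : ι} {r : ℝ} (hr0 : 0 < r)
    (hr : r * (2 * α - d) = n * b j) : r < b j / x := by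
  have hx := hS.x_pos
  have hx2 := hS.x_lt
  have hn := natCast_pos_of_nontrivial n
  rw [lt_div_iff₀ hx]
  by_contra h
  push Not at h
  nlinarith

/-- By `lt_x`, `1/r < x + x/b_j`, so the source exponent lies strictly below `r`. The Duhamel terms
therefore reach down to `L^{r}` by smoothing that is strictly improving. -/
theorem gain_pos (hS : IsPowerSystem α d x Q b L f) {j : ι} {r p : ℝ} (hr0 : 0 < r)
    (hr : r * (2 * α - d) = n * b j) (hrp : r ≤ p) : 0 < x + 1 / (b j / x) - 1 / p := by
  have hx := hS.x_pos
  have hb := hS.pos j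
  have h1 := hS.lt_x j
  have hn := natCast_pos_of_nontrivial n
  have h2 : 1 / p ≤ 1 / r := one_div_le_one_div_of_le hr0 hrp
  have h3 : b j < r * (x * (1 + b j)) := by
    by_contra h
    push Not at h
    nlinarith
  have h4 : 1 / r < x + 1 / (b j / x) := by
    rw [div_lt_iff₀ hr0, one_div_div]
    have : (x + x / b j) * r = r * (x * (1 + b j)) / b j := by field_simp; ring
    rw [this, lt_div_iff₀ hb]
    linarith
  linarith

theorem gain_lt (hS : IsPowerSystem α d x Q b L f) {j : ι} {p : ℝ} (hp0 : 0 < p)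
    (hp : p ≤ b j / x) : n * (x + 1 / (b j / x) - 1 / p) < 2 * α - d := by
  have h2 : 1 / (b j / x) ≤ 1 / p := one_div_le_one_div_of_le hp0 hp
  have hn := natCast_pos_of_nontrivial n
  have := hS.x_lt
  nlinarith

/-- The Duhamel terms in `L^p`, for `r_k ≤ p ≤ b_k / x`. -/
theorem exists_weightedBound_duhamel (hS : IsPowerSystem α d x Q b L f) (hρ : 0 ≤ ρ)
    {k : ι} {r p : ℝ} (hr0 : 0 < r) (hr : r * (2 * α - d) = n * b k) (hrp : r ≤ p)
    (hp : p ≤ b k / x) (hp1 : 1 ≤ p) :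
    ∃ C : ℝ, 0 ≤ C ∧ ∀ (u : ℝ → Space n → ℂ) (M T : ℝ), 0 ≤ M →
      (∀ j, ContinuousInLp (Ioi 0) (b j / x) u) →
      (∀ j, WeightedBound (b j / x) (decayRate n α d x / b j) ρ T u) →
      WeightedBound (b k / x) (decayRate n α d x / b k) M T u →
      WeightedBound p (heatRate n α r p) (C * M) T fun t y =>
        ∑ j, duhamel α Q (fun s z => f j (u s z)) t y := by
  have hp0 : 0 < p := hr0.trans_le hrp
  set y := x + 1 / (b k / x) - 1 / p with hy
  set C₀ := kernelNorm α Q y * betaConst (smoothingOrder n α d y)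
    (decayRate n α d x + decayRate n α d x / b k) with hC₀
  have hC₀0 : 0 ≤ C₀ := mul_nonneg (kernelNorm_nonneg _ _ _) (betaConst_nonneg _ _)
  refine ⟨C₀ * hS.lipConst ρ, mul_nonneg hC₀0 (hS.lipConst_nonneg hρ),
    fun u M T hM huc hu hM' => ?_⟩
  have e : C₀ * hS.lipConst ρ * M = ∑ j, C₀ * (2 * L j * ρ ^ b j * M) := by
    rw [lipConst, Finset.mul_sum, Finset.sum_mul]
    exact Finset.sum_congr rfl fun j _ => by ring
  rw [e]
  refine WeightedBound.sum hp1 Finset.univ (fun j _ => ?_) (fun j _ => ?_) fun j _ t _ =>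
    hS.aestronglyMeasurable_duhamel j (huc j) t
  · have := (hS.power j).nonneg
    positivity
  · intro t ht
    have h1 := hS.duhamelMass_le j (hS.one_le_div k) (hS.add_one_div_le k) (hS.decayRate_add_lt k)
      hp0 (hS.gain_pos hr0 hr hrp) (hS.gain_lt hp0 hp) hρ hM
      (fun s hs => ((huc j).memLp s hs.1).1) (hu j) hM' ht
    refine (eLpNorm_duhamel_le hS.alpha_pos hS.order_nonneg hS.symbol
      (hS.one_le_exponent (hS.one_le_div j) (hS.add_one_div_le j))
      (hS.continuousInLp_source j (huc j) (hS.one_le_div j) (hS.add_one_div_le j) (huc j)) hp1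
        t).trans (h1.trans_eq ?_)
    -- Criticality again: the remaining power of time is exactly `-heatRate n α r p`.
    congr 3
    rw [hS.decayRate_div_eq hr0 hr, decayRate, heatRate, heatRate, smoothingOrder, smoothingOrder]
    have := hS.alpha_pos
    field_simp
    ring

/-- The rate grows with `p`, and at the extreme value `p = r (1 + b_k)` it is `(2α - d)/(2α(1 +
b_k))`, which is less than `nx/(2α)` by `lt_x`. Since `θ = 1 - (d + nx)/(2α)`, the sum of the two
rates stays below `1`. -/
theorem isTarget_of_le (hS : IsPowerSystem α d x Q b L f) {k : ι} {r p : ℝ} (hr0 : 0 < r)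
    (hr : r * (2 * α - d) = n * b k) (hp : b k / x ≤ p) (hp' : p ≤ r * (1 + b k)) :
    IsTarget n α d x p (heatRate n α r p) := by
  have hP := hS.one_le_div k
  have hp0 : 0 < p := by linarith
  have hb := hS.pos k
  have hα := hS.alpha_pos
  have hn := natCast_pos_of_nontrivial n
  refine ⟨hP.trans hp, ?_, ?_⟩
  · have h2 : 1 / p ≤ 1 / (b k / x) := one_div_le_one_div_of_le (hS.div_pos k) hp
    linarith [hS.add_one_div_le k]
  · have h1 : 1 / (r * (1 + b k)) ≤ 1 / p := one_div_le_one_div_of_le hp0 hp'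
    have h2 : heatRate n α r p ≤ n / (2 * α) * (1 / r - 1 / (r * (1 + b k))) := by
      rw [heatRate]
      gcongr
    have h3 : n / (2 * α) * (1 / r - 1 / (r * (1 + b k))) =
        (2 * α - d) / (2 * α * (1 + b k)) := by
      have : (2 * α - d) = n * b k / r := by rw [← hr]; field_simp
      rw [this]
      field_simp
      ring
    have h4 : (2 * α - d) / (2 * α * (1 + b k)) < n * x / (2 * α) := by
      rw [div_lt_div_iff₀ (by positivity) (by positivity)]
      nlinarith [hS.lt_x k]
    have h5 : decayRate n α d x = 1 - d / (2 * α) - n * x / (2 * α) := by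
      rw [decayRate, smoothingOrder]; ring
    have h6 : 0 ≤ d / (2 * α) := by have := hS.order_nonneg; positivity
    linarith

/-- Existence of small global solutions, with the properties of the solution class. -/
theorem exists_solution [Nonempty ι] (hS : IsPowerSystem α d x Q b L f) (hρ : 0 < ρ)
    {r p : ι → ℝ} (hr1 : ∀ j, 1 < r j) (hr : ∀ j, r j * (2 * α - d) = n * b j)
    (hrp : ∀ j, r j < p j) (hp : ∀ j, p j ≤ r j * (1 + b j))
    (hsmall : ∀ j, hS.opConst (decayRate n α d x / b j) * hS.lipConst ρ ≤ 1 / 2)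
    (hsmallp : ∀ j, hS.opConst (heatRate n α (r j) (p j)) * hS.lipConst ρ ≤ 1 / 2)
    (hφr : ∀ j, MemLp φ (ENNReal.ofReal (r j)) volume)
    (hφ : ∀ j T, WeightedBound (b j / x) (decayRate n α d x / b j) (ρ / 2) T
      fun t => semigroup α t φ) :
    ∃ u : ℝ → Space n → ℂ, (∀ T, IsSmallSolution α d x Q b f φ ρ T u) ∧
      (∀ j, ContinuousInLp (Ici 0) (r j) fun t => if t = 0 then φ else u t) ∧
      ∀ j, ContinuousInLp (Ioi 0) (p j) u ∧
        (∃ C, ∀ T, WeightedBound (p j) (heatRate n α (r j) (p j)) C T u) ∧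
        ∀ ε, 0 < ε → ∃ T, 0 < T ∧ WeightedBound (p j) (heatRate n α (r j) (p j)) ε T u := by
  have hα := hS.alpha_pos
  have hr0 : ∀ j, 0 < r j := fun j => by linarith [hr1 j]
  have hSc : ∀ j P, r j ≤ P → ContinuousInLp (Ioi 0) P fun t => semigroup α t φ := fun j P hP =>
    continuousInLp_semigroup hα (hr1 j).le hP (hφr j)
  have hSb : ∀ j P, r j ≤ P → ∃ N : ℝ, 0 ≤ N ∧ ∀ T, WeightedBound P (heatRate n α (r j) P) N T
      fun t => semigroup α t φ := fun j P hP =>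
    ⟨_, mul_nonneg (kernelNorm_nonneg _ _ _) ENNReal.toReal_nonneg, fun T =>
      weightedBound_semigroup hα (hr1 j).le hP (hφr j).1
        (ENNReal.ofReal_toReal (hφr j).2.ne).ge T⟩
  have hSε : ∀ j P, r j < P → ∀ ε, 0 < ε → ∃ T, 0 < T ∧
      WeightedBound P (heatRate n α (r j) P) ε T fun t => semigroup α t φ := fun j P hP ε hε =>
    weightedBound_of_tendsto (tendsto_mul_eLpNorm_semigroup hα (hr1 j).le hP (hφr j)) hε
  have hrP : ∀ j, r j < b j / x := fun j => hS.div_gt (hr0 j) (hr j)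
  have hφc : ∀ j, ContinuousInLp (Ioi 0) (b j / x) fun t => semigroup α t φ := fun j =>
    hSc j _ (hrP j).le
  obtain ⟨u, hu, htgt⟩ := hS.exists_isSmallSolution hρ.le hsmall hφc hφ
  have hucont := (hu 0).cont
  have hub : ∀ j T, WeightedBound (b j / x) (decayRate n α d x / b j) ρ T u := fun j T =>
    (hu T).bound j
  -- The weighted norm of `S_α(t)φ` vanishes as `t → 0`; the contraction transfers this to `u` at
  -- the cost of a factor `3`.
  have hdecay : ∀ j ε, 0 < ε → ∃ T, 0 < T ∧
      WeightedBound (b j / x) (decayRate n α d x / b j) ε T u := by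
    intro j ε hε
    obtain ⟨T, hT, hTb⟩ := hSε j _ (hrP j) (ε / 3) (by positivity)
    rw [← hS.decayRate_div_eq (hr0 j) (hr j)] at hTb
    refine ⟨T, hT, (hS.exists_weightedBound_of_semigroup hρ.le (hu T) (hS.isTarget j) hρ.le
      (by positivity) (hsmall j) (fun t ht => ((hφc j).memLp t ht.1).1) hTb (hub j T)).mono ?_⟩
    linarith
  have heq : ∀ t, 0 < t → u t =ᵐ[volume] mildStep α Q f φ u t := fun t ht =>
    (hu t).eq t ⟨ht, le_rfl⟩
  have hDc : ∀ k P, r k ≤ P → P ≤ b k / x → ContinuousInLp (Ioi 0) P fun t y =>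
      ∑ j, duhamel α Q (fun s z => f j (u s z)) t y := fun k P hP hP' =>
    ContinuousInLp.sum ((hr1 k).le.trans hP) _ fun j _ =>
      hS.continuousInLp_duhamel j (hS.one_le_div k) (hS.add_one_div_le k) (hS.decayRate_add_lt k)
        ((hr0 k).trans_le hP) (hS.gain_pos (hr0 k) (hr k) hP)
        (hS.gain_lt ((hr0 k).trans_le hP) hP') hρ.le hρ.le (hucont j) (hucont k) (hub j) (hub k)
  have huc : ∀ k P, r k ≤ P → P ≤ b k / x → ContinuousInLp (Ioi 0) P u := fun k P hP hP' =>
    ((hSc k P hP).add ((hr1 k).le.trans hP) (hDc k P hP hP')).congr fun t ht => heq t ht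
  refine ⟨u, hu, fun k => ?_, fun k => ?_⟩
  · have h1 := continuousInLp_semigroup_ite hα (hr1 k).le (hφr k)
    have h2 := huc k (r k) le_rfl (hrP k).le
    refine ⟨fun t ht => ?_, fun t ht => ?_⟩
    · rcases eq_or_lt_of_le (mem_Ici.1 ht) with rfl | h0
      · simpa using hφr k
      · simpa [h0.ne'] using h2.memLp t h0
    · rcases eq_or_lt_of_le (mem_Ici.1 ht) with rfl | h0
      · rw [← Ioi_insert, nhdsWithin_insert, tendsto_sup]
        refine ⟨by rw [tendsto_pure_left]; intro s hs; simpa using mem_of_mem_nhds hs, ?_⟩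
        -- In `L^{r_k}` the rate is `0`, and the Duhamel terms are bounded by a multiple of the
        -- weighted norm of `u` in `L^{b_k/x}`, which vanishes as `t → 0`. Continuity at `t = 0`
        -- thus reduces to that of the semigroup.
        obtain ⟨C, hC0, hC⟩ := hS.exists_weightedBound_duhamel hρ.le (hr0 k) (hr k) le_rfl
          (hrP k).le (hr1 k).le
        have h3 : Tendsto (fun t : ℝ => ENNReal.ofReal (t ^ (0 : ℝ)) *
            eLpNorm (fun y => ∑ j, duhamel α Q (fun s z => f j (u s z)) t y)
              (ENNReal.ofReal (r k)) volume) (𝓝[>] 0) (𝓝 0) := by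
          refine tendsto_of_weightedBound fun ε hε => ?_
          obtain ⟨T, hT, hTb⟩ := hdecay k (ε / (C + 1)) (by positivity)
          refine ⟨T, hT, ?_⟩
          have h4 := hC u _ T (by positivity) hucont (fun j => hub j T) hTb
          have e0 : heatRate n α (r k) (r k) = 0 := by simp [heatRate]
          rw [e0] at h4
          refine h4.mono ?_
          rw [← mul_div_assoc, div_le_iff₀ (by positivity)]
          nlinarith
        have h5 := h3.add (tendsto_eLpNorm_semigroup_sub_self hα (hr1 k).le (hφr k))
        rw [add_zero] at h5
        refine tendsto_of_tendsto_of_tendsto_of_le_of_le' tendsto_const_nhds h5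
          (Eventually.of_forall fun _ => zero_le) ?_
        filter_upwards [self_mem_nhdsWithin] with t ht
        have ht0 : 0 < t := ht
        have e1 : ((if t = 0 then φ else u t) - if (0 : ℝ) = 0 then φ else u 0) =ᵐ[volume]
            (fun y => ∑ j, duhamel α Q (fun s z => f j (u s z)) t y) + (semigroup α t φ - φ) := by
          filter_upwards [heq t ht0] with y hy
          simp only [Pi.sub_apply, Pi.add_apply, ht0.ne', if_false, if_true, hy, mildStep]
          ring
        rw [eLpNorm_congr_ae e1, Real.rpow_zero, ENNReal.ofReal_one, one_mul]
        exact eLpNorm_add_le ((hDc k (r k) le_rfl (hrP k).le).memLp t ht).1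
          (((hSc k (r k) le_rfl).memLp t ht).1.sub (hφr k).1) (by simpa using (hr1 k).le)
      · have h3 := h2.tendsto t h0
        rw [nhdsWithin_eq_nhds.2 (Ioi_mem_nhds h0)] at h3
        refine (h3.congr' ?_).mono_left nhdsWithin_le_nhds
        filter_upwards [Ioi_mem_nhds h0] with s hs
        simp [(mem_Ioi.1 hs).ne', h0.ne']
  · obtain ⟨N, hN0, hN⟩ := hSb k (p k) (hrp k).le
    have hp1 : 1 ≤ p k := ((hr1 k).trans (hrp k)).le
    -- Below `b_k / x` the norm follows from the one in `L^{b_k/x}` by the Duhamel formula. Above,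
    -- `L^{p_k}` is itself a space of contraction.
    rcases le_total (p k) (b k / x) with hle | hle
    · obtain ⟨C, hC0, hC⟩ := hS.exists_weightedBound_duhamel hρ.le (hr0 k) (hr k) (hrp k).le
        hle hp1
      have hD := hDc k (p k) (hrp k).le hle
      have hsum : ∀ M N' T, 0 ≤ M → 0 ≤ N' →
          WeightedBound (p k) (heatRate n α (r k) (p k)) N' T (fun t => semigroup α t φ) →
          WeightedBound (b k / x) (decayRate n α d x / b k) M T u →
          WeightedBound (p k) (heatRate n α (r k) (p k)) (N' + C * M) T u :=
        fun M N' T hM hN' hb1 hb2 => (hb1.add hp1 hN' (by positivity)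
          (hC u M T hM hucont (fun j => hub j T) hb2)
          (fun t ht => ((hSc k (p k) (hrp k).le).memLp t ht.1).1)
          fun t ht => (hD.memLp t ht.1).1).congr fun t ht => heq t ht.1
      refine ⟨huc k _ (hrp k).le hle, ⟨N + C * ρ, fun T => hsum ρ N T hρ.le hN0 (hN T) (hub k T)⟩,
        fun ε hε => ?_⟩
      obtain ⟨T₁, hT₁, hb₁⟩ := hSε k (p k) (hrp k) (ε / 2) (by positivity)
      obtain ⟨T₂, hT₂, hb₂⟩ := hdecay k (ε / 2 / (C + 1)) (by positivity)
      refine ⟨min T₁ T₂, lt_min hT₁ hT₂, (hsum _ _ _ (by positivity) (by positivity)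
        (hb₁.mono_right (min_le_left _ _)) (hb₂.mono_right (min_le_right _ _))).mono ?_⟩
      have : C * (ε / 2 / (C + 1)) ≤ ε / 2 := by
        rw [← mul_div_assoc, div_le_iff₀ (by positivity)]
        nlinarith
      linarith
    · have hT := hS.isTarget_of_le (hr0 k) (hr k) hle (hp k)
      obtain ⟨h1, h2⟩ := htgt _ _ N hT hN0 (hsmallp k) (hSc k _ (hrp k).le) hN
      refine ⟨h1, ⟨_, h2⟩, fun ε hε => ?_⟩
      obtain ⟨T, hT0, hTb⟩ := hSε k (p k) (hrp k) (ε / 3) (by positivity)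
      refine ⟨T, hT0, (hS.exists_weightedBound_of_semigroup hρ.le (hu T) hT
        (by positivity : 0 ≤ 2 * N) (by positivity) (hsmallp k)
        (fun t ht => ((hSc k (p k) (hrp k).le).memLp t ht.1).1) hTb (h2 T)).mono ?_⟩
      linarith

end IsPowerSystem

end Existence

/-! ### Uniqueness: regularity of arbitrary solutions and the passage to small ones. -/

section Bootstrap

variable {n : ℕ}

/-- `v ∈ L^∞_loc((0,∞); L^P)`. -/
def LocallyBoundedLp (P : ℝ) (v : ℝ → Space n → ℂ) : Prop :=
  ∀ a c : ℝ, 0 < a → ∃ G : ℝ, 0 ≤ G ∧ ∀ s ∈ Icc a c,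
    eLpNorm (v s) (ENNReal.ofReal P) volume ≤ ENNReal.ofReal G

theorem ContinuousInLp.locallyBoundedLp {P : ℝ} (hP : 1 ≤ P) {v : ℝ → Space n → ℂ}
    (hv : ContinuousInLp (Ioi 0) P v) : LocallyBoundedLp P v := fun _ _ ha =>
  hv.exists_le hP isCompact_Icc fun _ hs => ha.trans_le hs.1

/-- Continuity method: at the first time when some `g j` reaches `ρ`, all of them have been at most
`ρ`, and the hypothesis excludes equality. -/
theorem forall_lt_of_continuousOn {ι : Type*} [Finite ι] {g : ι → ℝ → ℝ} {ρ T : ℝ}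
    (hg : ∀ j, ContinuousOn (g j) (Icc 0 T)) (h0 : ∀ j, g j 0 < ρ)
    (h : ∀ τ ∈ Ioc 0 T, (∀ j, ∀ s ∈ Icc 0 τ, g j s ≤ ρ) → ∀ j, g j τ < ρ) :
    ∀ j, ∀ τ ∈ Icc 0 T, g j τ < ρ := by
  by_contra hcon
  push Not at hcon
  obtain ⟨j₀, τ₀, hτ₀, hj₀⟩ := hcon
  set B : Set ℝ := ⋃ j, Icc 0 T ∩ g j ⁻¹' Ici ρ with hB
  have hBc : IsCompact B := by
    refine isCompact_Icc.of_isClosed_subset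
      (isClosed_iUnion_of_finite fun j => (hg j).preimage_isClosed_of_isClosed isClosed_Icc
        isClosed_Ici) (iUnion_subset fun j => inter_subset_left)
  have hBne : B.Nonempty := ⟨τ₀, mem_iUnion.2 ⟨j₀, hτ₀, hj₀⟩⟩
  obtain ⟨τ, hτB, hτmin⟩ := hBc.exists_isLeast hBne
  obtain ⟨j, hτ, hj⟩ := mem_iUnion.1 hτB
  have hτpos : 0 < τ := by
    rcases eq_or_lt_of_le hτ.1 with rfl | h1
    · exact absurd hj (not_le.2 (h0 j))
    · exact h1
  have hlt : ∀ i, ∀ s ∈ Ico 0 τ, g i s < ρ := by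
    intro i s hs
    by_contra hcon
    exact absurd (hτmin (mem_iUnion.2 ⟨i, ⟨hs.1, hs.2.le.trans hτ.2⟩, not_lt.1 hcon⟩))
      (not_le.2 hs.2)
  have hle : ∀ i, ∀ s ∈ Icc 0 τ, g i s ≤ ρ := by
    intro i s hs
    rcases eq_or_lt_of_le hs.2 with rfl | h1
    · have hcl : s ∈ closure (Ico 0 s) := by
        rw [closure_Ico hτpos.ne]
        exact hs
      have hcont : ContinuousWithinAt (g i) (Ico 0 s) s :=
        ((hg i) s hτ).mono fun y hy => ⟨hy.1, hy.2.le.trans hτ.2⟩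
      have : (𝓝[Ico 0 s] s).NeBot := mem_closure_iff_nhdsWithin_neBot.1 hcl
      refine le_of_tendsto hcont.tendsto ?_
      filter_upwards [self_mem_nhdsWithin] with y hy using (hlt i y hy).le
    · exact (hlt i s ⟨hs.1, h1⟩).le
  exact absurd hj (not_le.2 (h τ ⟨hτpos, hτ.2⟩ hle j))

variable {ι : Type*} [Fintype ι] {α d x : ℝ} {Q : Space n → ℂ} {b L : ι → ℝ}
  {f : ι → ℂ → ℂ} [Nontrivial (Space n)]

/-- The regularity of the nonlinear terms that enters the definition of a mild solution, together
with local bounds in spaces where the nonlinear terms are subcritical. -/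
structure HasSources (α d : ℝ) (b : ι → ℝ) (f : ι → ℂ → ℂ) (h P' : ι → ℝ)
    (v : ℝ → Space n → ℂ) : Prop where
  meas : ∀ t ∈ Ioi (0 : ℝ), AEStronglyMeasurable (v t) volume
  one_le : ∀ j, 1 ≤ h j
  le : ∀ j, h j * (1 + b j) ≤ P' j
  subcritical : ∀ j, n * (b j / P' j) < 2 * α - d
  locallyBounded : ∀ j, LocallyBoundedLp (P' j) v
  source : ∀ j, ContinuousInLp (Ioi 0) (h j) fun s y => f j (v s y)
  integrable : ∀ j, ∀ T : ℝ, 0 < T →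
    ∫⁻ s in Ioc 0 T, eLpNorm (fun y => f j (v s y)) (ENNReal.ofReal (h j)) volume < ⊤

namespace IsPowerSystem

variable {φ : Space n → ℂ} {ρ : ℝ} {h P' : ι → ℝ} {v : ℝ → Space n → ℂ}

/-- For times above `a / 2`, Hölder with `|v|^{b_j} ∈ L^{P'_j/b_j}` and `v ∈ L^P` bounds the source;
near `t = 0` only its integrability in `L^{h_j}` is used. The gain condition is the integrability of
the resulting kernel singularity. -/
theorem exists_duhamelMass_le (hS : IsPowerSystem α d x Q b L f)
    (hv : HasSources α d b f h P' v) (j : ι) {P p : ℝ} (hP : P' j ≤ P) (hPp : P ≤ p)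
    (hgain : n * (b j / P' j + (1 / P - 1 / p)) < 2 * α - d) (hvP : LocallyBoundedLp P v)
    {a c : ℝ} (ha : 0 < a) :
    ∃ C : ℝ, ∀ t ∈ Icc a c, duhamelMass α Q (fun s y => f j (v s y)) p t ≤ ENNReal.ofReal C := by
  rcases lt_or_ge c a with hca | hac
  · exact ⟨0, fun t ht => absurd (ht.1.trans ht.2) (not_le.2 hca)⟩
  have hb := hS.pos j
  have hh := hv.one_le j
  have hle := hv.le j
  have hP'1 : 1 + b j ≤ P' j := by nlinarith
  have hP'0 : 0 < P' j := by linarith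
  have hP0 : 0 < P := by linarith
  have hp0 : 0 < p := by linarith
  set y := b j / P' j with hy
  have hy0 : 0 < y := by positivity
  have hyP : y + 1 / P ≤ 1 := by
    have h1 : 1 / P ≤ 1 / P' j := one_div_le_one_div_of_le hP'0 hP
    have h2 : y + 1 / P' j ≤ 1 := by
      rw [hy, ← add_div, div_le_one hP'0]
      linarith
    linarith
  have hyP0 : 0 < y + 1 / P := by positivity
  have h1 : 1 ≤ 1 / (y + 1 / P) := by
    rw [le_div_iff₀ hyP0]
    linarith
  have h2 : 1 / (y + 1 / P) < p := by
    rw [div_lt_iff₀ hyP0]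
    have h3 : p * (1 / P) ≥ 1 := by
      rw [ge_iff_le, mul_one_div, le_div_iff₀ hP0]
      linarith
    nlinarith [mul_pos hp0 hy0]
  obtain ⟨G₁, hG₁, hG₁'⟩ := hv.locallyBounded j (a / 2) c (half_pos ha)
  obtain ⟨G₂, hG₂, hG₂'⟩ := hvP (a / 2) c (half_pos ha)
  have hL := (hS.power j).nonneg
  have hby : b j / y = P' j := by rw [hy]; field_simp
  refine FracDissipative.exists_duhamelMass_le hS.alpha_pos hS.order_nonneg hS.symbol hh
    (by nlinarith : h j < p) h1 h2 (G := L j * (G₁ ^ b j * G₂)) ha ?_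
    (fun s hs => ((hv.source j).memLp s hs).1) (hv.integrable j c (ha.trans_le hac)) ?_
  · refine hS.smoothingOrder_lt ?_
    rw [one_div_one_div, add_sub_assoc]
    exact hgain
  · intro s hs
    have hs0 : 0 < s := (half_pos ha).trans_le hs.1
    refine ((hS.power j).eLpNorm_le hb hy0 h1 hP0 (one_div_one_div _) (hv.meas s hs0)).trans ?_
    rw [hby, ENNReal.ofReal_mul hL, ENNReal.ofReal_mul (by positivity),
      ← ENNReal.ofReal_rpow_of_nonneg hG₁ hb.le]
    gcongr
    · exact hG₁' s hs
    · exact hG₂' s hs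

theorem locallyBoundedLp_step (hS : IsPowerSystem α d x Q b L f)
    (hv : HasSources α d b f h P' v) {P p : ℝ} (hP : ∀ j, P' j ≤ P) (hPp : P ≤ p) (hp : 1 ≤ p)
    (hgain : ∀ j, n * (b j / P' j + (1 / P - 1 / p)) < 2 * α - d)
    (hφc : ContinuousInLp (Ioi 0) p fun t => semigroup α t φ)
    (heq : ∀ t ∈ Ioi (0 : ℝ), v t =ᵐ[volume] mildStep α Q f φ v t)
    (hvP : LocallyBoundedLp P v) : LocallyBoundedLp p v := by
  intro a c ha
  obtain ⟨G, hG0, hG⟩ := hφc.locallyBoundedLp hp a c ha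
  choose C hC using fun j => hS.exists_duhamelMass_le hv j (hP j) hPp (hgain j) hvP (c := c) ha
  refine ⟨G + ∑ j, |C j|, by positivity, fun t ht => ?_⟩
  have ht0 : 0 < t := ha.trans_le ht.1
  have hDm : ∀ j, AEStronglyMeasurable (duhamel α Q (fun s y => f j (v s y)) t) volume := fun j =>
    FracDissipative.aestronglyMeasurable_duhamel hS.alpha_pos hS.order_nonneg hS.symbol
      (hv.one_le j) (hv.source j) t
  rw [eLpNorm_congr_ae (heq t ht0)]
  have e : mildStep α Q f φ v t =
      semigroup α t φ + ∑ j, duhamel α Q (fun s y => f j (v s y)) t := by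
    ext y; simp [mildStep]
  rw [e]
  refine (eLpNorm_add_le (hφc.memLp t ht0).1 (Finset.aestronglyMeasurable_sum _ fun j _ => hDm j)
    (by simpa)).trans ?_
  rw [ENNReal.ofReal_add hG0 (by positivity), ENNReal.ofReal_sum_of_nonneg fun _ _ => abs_nonneg _]
  refine add_le_add (hG t ht) ((eLpNorm_sum_le (fun j _ => hDm j) (by simpa)).trans
    (Finset.sum_le_sum fun j _ => ?_))
  exact (eLpNorm_duhamel_le hS.alpha_pos hS.order_nonneg hS.symbol (hv.one_le j) (hv.source j) hp
    t).trans ((hC j t ht).trans (ENNReal.ofReal_le_ofReal (le_abs_self _)))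

/-- Bootstrap: solutions are locally bounded in `L^p` for all large `p`. -/
theorem locallyBoundedLp_of_le (hS : IsPowerSystem α d x Q b L f)
    (hv : HasSources α d b f h P' v) {m : ι} (hm : ∀ j, P' j ≤ P' m)
    (hφc : ∀ p, P' m ≤ p → ContinuousInLp (Ioi 0) p fun t => semigroup α t φ)
    (heq : ∀ t ∈ Ioi (0 : ℝ), v t =ᵐ[volume] mildStep α Q f φ v t) {p : ℝ} (hp : P' m ≤ p) :
    LocallyBoundedLp p v := by
  have hP'1 : 1 < P' m := by
    have := hS.pos m
    have := hv.one_le m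
    have := hv.le m
    nlinarith
  have hn := natCast_pos_of_nontrivial n
  have : Nonempty ι := ⟨m⟩
  obtain ⟨k, hk⟩ := Finite.exists_max fun j => b j / P' j
  -- Subcriticality is strict. Half of the worst gap, divided by `n`, is an improvement of `1/P`
  -- that every step can afford.
  obtain ⟨ε, hε0, hε⟩ : ∃ ε : ℝ, 0 < ε ∧ ∀ j, n * (b j / P' j + ε) < 2 * α - d := by
    have h1 := hv.subcritical k
    refine ⟨(2 * α - d - n * (b k / P' k)) / (2 * n), by apply _root_.div_pos <;> linarith,
      fun j => ?_⟩
    have h2 := mul_le_mul_of_nonneg_left (hk j) hn.le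
    have e : n * (b j / P' j + (2 * α - d - n * (b k / P' k)) / (2 * n)) =
        n * (b j / P' j) + (2 * α - d - n * (b k / P' k)) / 2 := by field_simp
    rw [e]
    linarith
  have key : ∀ N : ℕ, ∀ p, P' m ≤ p → 1 / P' m - 1 / p ≤ N * ε → LocallyBoundedLp p v := by
    intro N
    induction N with
    | zero =>
      intro p hp hle
      rw [Nat.cast_zero, zero_mul, sub_nonpos] at hle
      have h1 : p ≤ P' m := by
        rwa [one_div_le_one_div (by linarith) (by linarith)] at hle
      rw [le_antisymm h1 hp]
      exact hv.locallyBounded m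
    | succ N ih =>
      intro p hp hle
      have hp0 : 0 < p := by linarith
      rcases le_total (1 / P' m - 1 / p) (N * ε) with h1 | h1
      · exact ih p hp h1
      -- The exponent `1 / s` is the one reached after `N` full steps; a last step of length at most
      -- `ε` leads to `p`.
      · set s := 1 / P' m - N * ε with hs
        have hs1 : 1 / p ≤ s := by linarith
        have hs0 : 0 < s := lt_of_lt_of_le (by positivity) hs1
        have hN : 0 ≤ N * ε := by positivity
        have h2 : P' m ≤ 1 / s := by
          rw [le_div_iff₀ hs0]
          have : P' m * (1 / P' m) = 1 := by field_simp
          nlinarith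
        have h3 : 1 / s ≤ p := by
          rw [div_le_iff₀ hs0]
          have : p * (1 / p) = 1 := by field_simp
          nlinarith
        refine hS.locallyBoundedLp_step hv (fun j => (hm j).trans h2) h3 (by linarith)
          (fun j => ?_) (hφc p hp) heq (ih (1 / s) h2 ?_)
        · rw [one_div_one_div]
          refine lt_of_le_of_lt ?_ (hε j)
          push_cast at hle
          gcongr
          linarith
        · rw [one_div_one_div]
          linarith
  obtain ⟨N, hN⟩ := exists_nat_ge ((1 / P' m) / ε)
  refine key N p hp ?_
  rw [div_le_iff₀ hε0] at hN
  have : 0 < 1 / p := one_div_pos.2 (by linarith)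
  linarith

/-- Interpolation between continuity in `L^r` and the local boundedness in a space `L^q`, `q > p`,
provided by the bootstrap. -/
theorem continuousInLp_of_sources (hS : IsPowerSystem α d x Q b L f)
    (hv : HasSources α d b f h P' v) {m : ι} (hm : ∀ j, P' j ≤ P' m)
    (hφc : ∀ p, P' m ≤ p → ContinuousInLp (Ioi 0) p fun t => semigroup α t φ)
    (heq : ∀ t ∈ Ioi (0 : ℝ), v t =ᵐ[volume] mildStep α Q f φ v t) {r p : ℝ} (hr : 1 ≤ r)
    (hrp : r < p) (hvr : ContinuousInLp (Ioi 0) r v) : ContinuousInLp (Ioi 0) p v := by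
  set q := max (P' m) (p + 1) with hq
  have hpq : p < q := lt_of_lt_of_le (by linarith) (le_max_right _ _)
  have hb := hS.locallyBoundedLp_of_le hv hm hφc heq (le_max_left (P' m) (p + 1))
  have h1 : 1 / p < 1 / r := one_div_lt_one_div_of_lt (by linarith) hrp
  have h2 : 1 / q < 1 / p := one_div_lt_one_div_of_lt (by linarith) hpq
  have h3 : 0 < 1 / r - 1 / q := by linarith
  refine hvr.interpolate (p₁ := q) (θ := (1 / r - 1 / p) / (1 / r - 1 / q)) (by linarith)
    (by linarith) (by linarith) (div_nonneg (by linarith) h3.le)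
    ((div_lt_one h3).2 (by linarith)) ?_ fun t ht => ?_
  · have : (1 / r - 1 / p) / (1 / r - 1 / q) * (1 / r - 1 / q) = 1 / r - 1 / p :=
      div_mul_cancel₀ _ h3.ne'
    generalize (1 / r - 1 / p) / (1 / r - 1 / q) = θ at this ⊢
    have e : (1 - θ) / r + θ / q = 1 / r - θ * (1 / r - 1 / q) := by ring
    rw [e, this]
    ring
  · have ht0 : 0 < t := ht
    obtain ⟨G, -, hG⟩ := hb (t / 2) (2 * t) (half_pos ht0)
    refine ⟨G, nhdsWithin_le_nhds ?_⟩
    filter_upwards [Icc_mem_nhds (by linarith : t / 2 < t) (by linarith : t < 2 * t)] with s hs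
    exact hG s hs

theorem duhamelMass_lt_top (hS : IsPowerSystem α d x Q b L f)
    (hv : HasSources α d b f h P' v) {m : ι} (hm : ∀ j, P' j ≤ P' m) (j : ι) {t : ℝ} (ht : 0 < t) :
    duhamelMass α Q (fun s y => f j (v s y)) (P' m) t < ⊤ := by
  obtain ⟨C, hC⟩ := hS.exists_duhamelMass_le hv j (hm j) le_rfl
    (by rw [sub_self, add_zero]; exact hv.subcritical j) (hv.locallyBounded m) (c := t) ht
  exact (hC t ⟨le_rfl, le_rfl⟩).trans_lt ENNReal.ofReal_lt_top

theorem semigroup_sum (hα : 0 < α) {p τ : ℝ} (hp : 1 ≤ p) (hτ : 0 < τ) (s : Finset ι)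
    {g : ι → Space n → ℂ} (hg : ∀ j ∈ s, MemLp (g j) (ENNReal.ofReal p) volume) (y : Space n) :
    semigroup α τ (fun z => ∑ j ∈ s, g j z) y = ∑ j ∈ s, semigroup α τ (g j) y := by
  classical
  induction s using Finset.induction_on with
  | empty => simp [semigroup, symbolSemigroup]
  | insert a s ha ih =>
    simp only [Finset.sum_insert ha]
    rw [← ih fun j hj => hg j (Finset.mem_insert_of_mem hj)]
    exact symbolSemigroup_add hα le_rfl (isHomogeneousSymbol_one n) hp hp hτ
      (hg a (Finset.mem_insert_self a s))
      (memLp_finsetSum s fun j hj => hg j (Finset.mem_insert_of_mem hj)) y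

/-- The integral equation restarted at time `t₀`. -/
theorem mildStep_restart (hS : IsPowerSystem α d x Q b L f)
    (hv : HasSources α d b f h P' v) {m : ι} (hm : ∀ j, P' j ≤ P' m) {r : ℝ} (hr : 1 ≤ r)
    (hrm : r ≤ P' m) (hφ : MemLp φ (ENNReal.ofReal r) volume)
    (heq : ∀ t ∈ Ioi (0 : ℝ), v t =ᵐ[volume] mildStep α Q f φ v t) {t₀ τ : ℝ} (ht₀ : 0 < t₀)
    (hτ : 0 < τ) :
    v (t₀ + τ) =ᵐ[volume] mildStep α Q f (v t₀) (fun s => v (t₀ + s)) τ := by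
  have hα := hS.alpha_pos
  have hd := hS.order_nonneg
  have hQ := hS.symbol
  have hp : 1 ≤ P' m := hr.trans hrm
  have ht : 0 < t₀ + τ := by linarith
  have hint : ∀ᵐ y, ∀ j, IntegrableOn
      (fun s => symbolSemigroup α Q (t₀ + τ - s) (fun z => f j (v s z)) y) (Ioo 0 (t₀ + τ)) := by
    rw [ae_all_iff]
    exact fun j => ae_integrableOn_of_duhamelMass hα hd hQ (hv.one_le j) (hv.source j) hp
      (hS.duhamelMass_lt_top hv hm j ht)
  have hDmem : ∀ j, MemLp (duhamel α Q (fun s z => f j (v s z)) t₀) (ENNReal.ofReal (P' m))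
      volume := fun j =>
    ⟨FracDissipative.aestronglyMeasurable_duhamel hα hd hQ (hv.one_le j) (hv.source j) t₀,
      (eLpNorm_duhamel_le hα hd hQ (hv.one_le j) (hv.source j) hp t₀).trans_lt
        (hS.duhamelMass_lt_top hv hm j ht₀)⟩
  filter_upwards [heq _ ht, hint] with y hy hyint
  rw [hy]
  have h1 : semigroup α τ (v t₀) y = semigroup α (t₀ + τ) φ y +
      ∑ j, ∫ s in Ioo 0 t₀, symbolSemigroup α Q (t₀ + τ - s) (fun z => f j (v s z)) y := by
    have h2 : semigroup α τ (v t₀) y = semigroup α τ (fun z => semigroup α t₀ φ z +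
        ∑ j, duhamel α Q (fun s z => f j (v s z)) t₀ z) y :=
      symbolSemigroup_congr_ae (heq t₀ ht₀) τ y
    have h3 : semigroup α τ (fun z => semigroup α t₀ φ z +
        ∑ j, duhamel α Q (fun s z => f j (v s z)) t₀ z) y = semigroup α τ (semigroup α t₀ φ) y +
        semigroup α τ (fun z => ∑ j, duhamel α Q (fun s z => f j (v s z)) t₀ z) y :=
      symbolSemigroup_add hα le_rfl (isHomogeneousSymbol_one n) hp hp hτ
        (memLp_semigroup hα hr hrm ht₀ hφ) (memLp_finsetSum _ fun j _ => hDmem j) y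
    have h4 : semigroup α τ (semigroup α t₀ φ) y = semigroup α (t₀ + τ) φ y := by
      rw [add_comm t₀ τ]
      exact semigroup_symbolSemigroup hα le_rfl (isHomogeneousSymbol_one n) hr hτ ht₀ hφ y
    rw [h2, h3, h4, semigroup_sum hα hp hτ _ fun j _ => hDmem j]
    congr 1
    exact Finset.sum_congr rfl fun j _ => semigroup_duhamel hα hd hQ (hv.one_le j) (hv.source j) hp
      hτ (hS.duhamelMass_lt_top hv hm j ht₀) y
  simp only [mildStep]
  rw [h1, add_assoc, ← Finset.sum_add_distrib]
  congr 1
  exact Finset.sum_congr rfl fun j _ => duhamel_add ht₀.le hτ (hyint j)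

/-- A solution that is continuous up to `t = 0` in the spaces `L^{b_j/x}` stays small. -/
theorem isSmallSolution_of_continuous (hS : IsPowerSystem α d x Q b L f) (hρ : 0 < ρ)
    (hsmall : ∀ j, hS.opConst (decayRate n α d x / b j) * hS.lipConst ρ ≤ 1 / 2)
    (hφc : ∀ j, ContinuousInLp (Ioi 0) (b j / x) fun t => semigroup α t φ)
    (hφ : ∀ j T, WeightedBound (b j / x) (decayRate n α d x / b j) (ρ / 4) T
      fun t => semigroup α t φ)
    (hv : ∀ j, ContinuousInLp (Ici 0) (b j / x) v)
    (heq : ∀ t ∈ Ioi (0 : ℝ), v t =ᵐ[volume] mildStep α Q f φ v t) (T : ℝ) :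
    IsSmallSolution α d x Q b f φ ρ T v := by
  have hvc : ∀ j, ContinuousInLp (Ioi 0) (b j / x) v := fun j => (hv j).mono Ioi_subset_Ici_self
  have hβ : ∀ j, 0 < decayRate n α d x / b j := fun j => _root_.div_pos hS.decayRate_pos (hS.pos j)
  -- Since `v` is continuous up to `0` in `L^{b_j/x}` and the weight is a positive power of time, `g
  -- j` is continuous on `[0, T]` and vanishes at `0`.
  set g : ι → ℝ → ℝ := fun j τ => τ ^ (decayRate n α d x / b j) *
    (eLpNorm (v τ) (ENNReal.ofReal (b j / x)) volume).toReal with hg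
  have hgle : ∀ j, ∀ τ, 0 < τ → ∀ M, 0 ≤ M → (g j τ ≤ M ↔
      eLpNorm (v τ) (ENNReal.ofReal (b j / x)) volume ≤
        ENNReal.ofReal (M * τ ^ (-(decayRate n α d x / b j)))) := by
    intro j τ hτ M hM
    have hfin := ((hvc j).memLp τ hτ).2.ne
    rw [ENNReal.le_ofReal_iff_toReal_le hfin (by positivity), Real.rpow_neg hτ.le,
      ← div_eq_mul_inv, le_div_iff₀ (by positivity), mul_comm]
  have key : ∀ j, ∀ τ ∈ Icc 0 T, g j τ < ρ := by
    refine forall_lt_of_continuousOn (fun j => ?_) (fun j => ?_) fun τ hτ hle j => ?_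
    · exact (Continuous.continuousOn (Real.continuous_rpow_const (hβ j).le)).mul
        (((hv j).continuousOn_toReal (hS.one_le_div j)).mono Icc_subset_Ici_self)
    · simp [hg, Real.zero_rpow (hβ j).ne', hρ]
    · have hb : ∀ i, WeightedBound (b i / x) (decayRate n α d x / b i) ρ τ v := fun i s hs =>
        (hgle i s hs.1 ρ hρ.le).1 (hle i s ⟨hs.1.le, hs.2⟩)
      have h1 := (hS.weightedBound_mildStep (hS.isTarget j) hρ.le hρ.le (by positivity)
        (hsmall j) (hφ j τ) (fun t ht => ((hφc j).memLp t ht.1).1) hvc hb (hb j)).congr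
        fun t ht => heq t ht.1
      -- The bound `ρ` up to time `τ` improves to `ρ/4 + ρ/2 < ρ`. This strict gain is the reason
      -- for asking `ρ/4` of the linear evolution.
      have h2 := (hgle j τ hτ.1 (ρ / 4 + ρ / 2) (by positivity)).2 (h1 τ ⟨hτ.1, le_rfl⟩)
      linarith
  exact ⟨hvc, fun j t ht => (hgle j t ht.1 ρ hρ.le).1 (key j t ⟨ht.1.le, ht.2⟩).le,
    fun t ht => heq t ht.1⟩

/-- Solutions in the solution class with small initial values are small solutions. -/
theorem isSmallSolution_of_sources [Nonempty ι] (hS : IsPowerSystem α d x Q b L f) (hρ : 0 < ρ)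
    (hsmall : ∀ j, hS.opConst (decayRate n α d x / b j) * hS.lipConst ρ ≤ 1 / 2)
    {r N : ι → ℝ} (hr1 : ∀ j, 1 < r j) (hr : ∀ j, r j * (2 * α - d) = n * b j)
    (hN : ∀ j, kernelNorm α (fun _ : Space n => 1) (1 / r j - 1 / (b j / x)) * N j ≤ ρ / 4)
    (hv : HasSources α d b f h P' v) (hrP' : ∀ j, r j ≤ P' j)
    (hvr : ∀ j, ContinuousInLp (Ici 0) (r j) v) (hv0 : v 0 =ᵐ[volume] φ)
    (hφN : ∀ j, eLpNorm φ (ENNReal.ofReal (r j)) volume < ENNReal.ofReal (N j))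
    (heq : ∀ t ∈ Ioi (0 : ℝ), v t =ᵐ[volume] mildStep α Q f φ v t) (T : ℝ) :
    IsSmallSolution α d x Q b f φ ρ T v := by
  have hα := hS.alpha_pos
  have hr0 : ∀ j, 0 < r j := fun j => by linarith [hr1 j]
  have hrP : ∀ j, r j < b j / x := fun j => hS.div_gt (hr0 j) (hr j)
  obtain ⟨m, hm⟩ := Finite.exists_max P'
  have hvr' : ∀ j, ContinuousInLp (Ioi 0) (r j) v := fun j => (hvr j).mono Ioi_subset_Ici_self
  have hφr : ∀ j, MemLp φ (ENNReal.ofReal (r j)) volume := fun j =>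
    (memLp_congr_ae hv0).1 ((hvr j).memLp 0 self_mem_Ici)
  have hSc : ∀ p, P' m ≤ p → ContinuousInLp (Ioi 0) p fun t => semigroup α t φ := fun p hp =>
    continuousInLp_semigroup hα (hr1 m).le ((hrP' m).trans hp) (hφr m)
  have hvP : ∀ j, ContinuousInLp (Ioi 0) (b j / x) v := fun j =>
    hS.continuousInLp_of_sources hv hm hSc heq (hr1 j).le (hrP j) (hvr' j)
  -- The smallness of `φ` is strict, so continuity at `t = 0` in `L^{r_j}` passes it to `v t₀` for
  -- all small `t₀ > 0`.
  have hnear : ∀ᶠ t in 𝓝[>] (0 : ℝ), ∀ j, eLpNorm (v t) (ENNReal.ofReal (r j)) volume <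
      ENNReal.ofReal (N j) := by
    rw [eventually_all]
    intro j
    have h1 := (hvr j).tendsto_eLpNorm (hr1 j).le (self_mem_Ici : (0 : ℝ) ∈ Ici 0)
    rw [eLpNorm_congr_ae hv0] at h1
    exact (h1.mono_left (nhdsWithin_mono 0 Ioi_subset_Ici_self)).eventually (gt_mem_nhds (hφN j))
  have hrestart : ∀ᶠ t₀ in 𝓝[>] (0 : ℝ), ∀ T,
      IsSmallSolution α d x Q b f (v t₀) ρ T fun s => v (t₀ + s) := by
    filter_upwards [hnear, self_mem_nhdsWithin] with t₀ ht₀N ht₀ T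
    have ht₀ : 0 < t₀ := ht₀
    refine hS.isSmallSolution_of_continuous hρ hsmall
      (fun j => continuousInLp_semigroup hα (hr1 j).le (hrP j).le ((hvr' j).memLp t₀ ht₀))
      (fun j T => ?_) (fun j => (hvP j).comp_const_add ht₀)
      (fun τ hτ => hS.mildStep_restart hv hm (hr1 m).le (hrP' m) (hφr m) heq ht₀ hτ) T
    have h1 := weightedBound_semigroup hα (hr1 j).le (hrP j).le ((hvr' j).memLp t₀ ht₀).1
      (ht₀N j).le T
    rw [← hS.decayRate_div_eq (hr0 j) (hr j)] at h1
    exact h1.mono (hN j)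
  refine ⟨hvP, fun j t ht => ?_, fun t ht => heq t ht.1⟩
  have ht0 : 0 < t := ht.1
  -- The solution restarted at `t₀` obeys the bound with weight `(t - t₀)^{-θ/b_j}` and a constant
  -- independent of `t₀`; now `t₀ → 0`.
  have h1 : Tendsto (fun t₀ : ℝ => ENNReal.ofReal (ρ * (t - t₀) ^ (-(decayRate n α d x / b j))))
      (𝓝[>] 0) (𝓝 (ENNReal.ofReal (ρ * t ^ (-(decayRate n α d x / b j))))) := by
    have h2 : Tendsto (fun t₀ : ℝ => t - t₀) (𝓝[>] 0) (𝓝 t) := by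
      have : Tendsto (fun t₀ : ℝ => t - t₀) (𝓝 0) (𝓝 (t - 0)) :=
        (continuous_const.sub continuous_id).tendsto 0
      rw [sub_zero] at this
      exact this.mono_left nhdsWithin_le_nhds
    exact (ENNReal.continuous_ofReal.tendsto _).comp
      ((h2.rpow_const (Or.inl ht0.ne')).const_mul ρ)
  refine ge_of_tendsto h1 ?_
  filter_upwards [hrestart, Ioo_mem_nhdsGT ht0] with t₀ h2 ht₀
  have h3 := (h2 t).bound j (t - t₀) ⟨by linarith [ht₀.2], by linarith [ht₀.1]⟩
  simpa using h3

end IsPowerSystem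

end Bootstrap

/-! ### Well-posedness for finitely many nonlinear terms. -/

section MainTheorem

variable {n : ℕ} {ι : Type*} [Fintype ι] {α d x : ℝ} {Q : Space n → ℂ} {b L : ι → ℝ}
  {f : ι → ℂ → ℂ} {φ : Space n → ℂ} {r p : ι → ℝ} {q : ι → ℝ≥0∞}

/-- Mild solutions in the solution class, for finitely many nonlinear terms. -/
structure IsClassSolution (α : ℝ) (Q : Space n → ℂ) (f : ι → ℂ → ℂ) (r p : ι → ℝ) (q : ι → ℝ≥0∞)
    (φ : Space n → ℂ) (u : ℝ → Space n →ₘ[volume] ℂ) : Prop where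
  cont : ∀ j, ContinuousInLp (Ici 0) (r j) fun t => u t
  dotC : ∀ j, MemDotC (q j) (p j) fun t => u t
  initial : u 0 =ᵐ[volume] φ
  source : ∀ j, AdmissibleSource (f j) u
  integrable : ∀ t : ℝ, 0 < t → ∀ᵐ y : Space n,
    IntegrableOn (fun s => symbolSemigroup α Q (t - s) (fun z => ∑ j, f j (u s z)) y) (Ioo 0 t)
  integral_eq : ∀ t : ℝ, 0 < t → ∀ᵐ y : Space n,
    u t y = semigroup α t φ y +
      ∫ s in Ioo 0 t, symbolSemigroup α Q (t - s) (fun z => ∑ j, f j (u s z)) y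

/-- Here `κ = (2α - d)/n`. The smallest power imposes the strictest constraints, so `x` is taken
between `κ/(1 + b)` and the minimum of `b/(1 + b)` and `κ` for that `b`; the interval is nonempty
because `κ < b`. -/
theorem exists_auxiliary_exponent [Nonempty ι] {κ : ℝ} (hκ : 0 < κ) (hb : ∀ j, 0 < b j)
    (hκb : ∀ j, κ < b j) :
    ∃ x : ℝ, 0 < x ∧ x < κ ∧ (∀ j, κ < x * (1 + b j)) ∧ ∀ j, x * (1 + b j) ≤ b j := by
  obtain ⟨m, hm⟩ := Finite.exists_min b
  have hm0 := hb m
  have h1 : κ / (1 + b m) < min (b m / (1 + b m)) κ := by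
    refine lt_min (div_lt_div_of_pos_right (hκb m) (by linarith)) ?_
    rw [div_lt_iff₀ (by linarith)]
    nlinarith
  obtain ⟨x, hx1, hx2⟩ := exists_between h1
  have hx0 : 0 < x := lt_trans (by positivity) hx1
  rw [div_lt_iff₀ (by linarith)] at hx1
  have hx3 := (hx2.trans_le (min_le_left _ _)).le
  rw [le_div_iff₀ (by linarith)] at hx3
  -- Needed for monotonicity: `x (1 + b) ≤ b` reads `x ≤ (1 - x) b`, which persists as `b` grows
  -- only if `x ≤ 1`.
  have hx4 : x < 1 := by
    by_contra h
    push Not at h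
    nlinarith
  refine ⟨x, hx0, hx2.trans_le (min_le_right _ _), fun j => ?_, fun j => ?_⟩
  · nlinarith [hm j]
  · nlinarith [hm j]

variable [Nontrivial (Space n)]

theorem symbolSemigroup_sum (hα : 0 < α) (hd : 0 ≤ d) (hQ : IsHomogeneousSymbol d Q) {h : ι → ℝ}
    (hh : ∀ j, 1 ≤ h j) {t : ℝ} (ht : 0 < t) {g : ι → Space n → ℂ}
    (hg : ∀ j, MemLp (g j) (ENNReal.ofReal (h j)) volume) (y : Space n) :
    symbolSemigroup α Q t (fun z => ∑ j, g j z) y = ∑ j, symbolSemigroup α Q t (g j) y := by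
  simp only [symbolSemigroup, Finset.mul_sum]
  exact integral_finsetSum _ fun j _ => integrable_kernel_mul hα hd hQ (hh j) ht (hg j) y

theorem integrableOn_symbolSemigroup_sum (hα : 0 < α) (hd : 0 ≤ d) (hQ : IsHomogeneousSymbol d Q)
    {h : ι → ℝ} (hh : ∀ j, 1 ≤ h j) {g : ι → ℝ → Space n → ℂ}
    (hg : ∀ j, ContinuousInLp (Ioi 0) (h j) (g j)) {t : ℝ} {y : Space n}
    (hint : ∀ j, IntegrableOn (fun s => symbolSemigroup α Q (t - s) (g j s) y) (Ioo 0 t)) :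
    IntegrableOn (fun s => symbolSemigroup α Q (t - s) (fun z => ∑ j, g j s z) y) (Ioo 0 t) ∧
      ∫ s in Ioo 0 t, symbolSemigroup α Q (t - s) (fun z => ∑ j, g j s z) y =
        ∑ j, duhamel α Q (g j) t y := by
  have h1 : ∀ s ∈ Ioo 0 t, symbolSemigroup α Q (t - s) (fun z => ∑ j, g j s z) y =
      ∑ j, symbolSemigroup α Q (t - s) (g j s) y := fun s hs =>
    symbolSemigroup_sum hα hd hQ hh (sub_pos.2 hs.2) (fun j => (hg j).memLp s hs.1) y
  constructor
  · exact IntegrableOn.congr_fun (integrable_finsetSum _ fun j _ => hint j)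
      (fun s hs => (h1 s hs).symm) measurableSet_Ioo
  · rw [setIntegral_congr_fun measurableSet_Ioo h1]
    exact integral_finsetSum _ fun j _ => hint j

theorem duhamel_congr {g g' : ℝ → Space n → ℂ} {t : ℝ} (h : ∀ s ∈ Ioo 0 t, g s =ᵐ[volume] g' s)
    (y : Space n) : duhamel α Q g t y = duhamel α Q g' t y :=
  setIntegral_congr_fun measurableSet_Ioo fun s hs => symbolSemigroup_congr_ae (h s hs) _ _

theorem WeightedBound.lintegral_lt_top {P γ M T : ℝ} {g : ℝ → Space n → ℂ} (hγ : γ < 1)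
    (hT : 0 < T) (hg : WeightedBound P γ M T g) :
    ∫⁻ s in Ioc 0 T, eLpNorm (g s) (ENNReal.ofReal P) volume < ⊤ := by
  have h1 : IntegrableOn (fun s : ℝ => M * s ^ (-γ)) (Ioc 0 T) :=
    ((intervalIntegrable_iff_integrableOn_Ioc_of_le hT.le).1
      (intervalIntegral.intervalIntegrable_rpow' (by linarith))).const_mul M
  refine lt_of_le_of_lt (setLIntegral_mono' measurableSet_Ioc hg) ?_
  exact h1.lintegral_lt_top

namespace IsPowerSystem

theorem weightedBound_source (hS : IsPowerSystem α d x Q b L f) (j : ι) {u : ℝ → Space n → ℂ}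
    {ρ T : ℝ} (hρ : 0 ≤ ρ) (hum : ∀ t ∈ Ioc 0 T, AEStronglyMeasurable (u t) volume)
    (hu : WeightedBound (b j / x) (decayRate n α d x / b j) ρ T u) :
    WeightedBound (1 / (x + 1 / (b j / x))) (decayRate n α d x + decayRate n α d x / b j)
      (2 * L j * ρ ^ b j * ρ) T fun t y => f j (u t y) := by
  have h1 := (hS.power j).weightedBound_sub (hS.pos j) hS.x_pos
    (hS.one_le_exponent (hS.one_le_div j) (hS.add_one_div_le j)) (hS.div_pos j)
    (one_div_one_div _) hρ hum (v := fun _ _ => 0) (fun _ _ => aestronglyMeasurable_const) hu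
    (weightedBound_zero.mono hρ)
    (hu.congr fun t _ => Eventually.of_forall fun y => by simp)
  simpa [(hS.power j).zero] using h1

/-- The modification of a small solution on null sets and at `t = 0` is a solution in the
solution class. -/
theorem isClassSolution (hS : IsPowerSystem α d x Q b L f) {ρ : ℝ} (hρ : 0 < ρ)
    (hrp : ∀ j, r j < p j) (hr1 : ∀ j, 1 < r j)
    (hq : ∀ j, (q j)⁻¹ = ENNReal.ofReal (heatRate n α (r j) (p j))) {w : ℝ → Space n → ℂ}
    (hw : ∀ T, IsSmallSolution α d x Q b f φ ρ T w)
    (hwr : ∀ j, ContinuousInLp (Ici 0) (r j) fun t => if t = 0 then φ else w t)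
    (hwp : ∀ j, ContinuousInLp (Ioi 0) (p j) w)
    (hwC : ∀ j, ∃ C, ∀ T, WeightedBound (p j) (heatRate n α (r j) (p j)) C T w)
    (hwε : ∀ j, ∀ ε, 0 < ε → ∃ T, 0 < T ∧ WeightedBound (p j) (heatRate n α (r j) (p j)) ε T w)
    {u : ℝ → Space n →ₘ[volume] ℂ} (hu0 : u 0 =ᵐ[volume] φ) (hu : ∀ t > 0, u t =ᵐ[volume] w t) :
    IsClassSolution α Q f r p q φ u := by
  have hα := hS.alpha_pos
  have hd := hS.order_nonneg
  have hQ := hS.symbol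
  have hwc := fun j => (hw 1).cont j
  have hrate : ∀ j, (q j)⁻¹.toReal = heatRate n α (r j) (p j) := fun j => by
    have h1 := one_div_le_one_div_of_le (by linarith [hr1 j]) (hrp j).le
    have h2 : 0 ≤ 1 / r j - 1 / p j := by linarith
    rw [hq, ENNReal.toReal_ofReal]
    rw [heatRate]
    positivity
  set h : ι → ℝ := fun j => 1 / (x + 1 / (b j / x)) with hh
  have hh1 : ∀ j, 1 ≤ h j := fun j =>
    hS.one_le_exponent (hS.one_le_div j) (hS.add_one_div_le j)
  have hsw : ∀ j, ContinuousInLp (Ioi 0) (h j) fun s y => f j (w s y) := fun j =>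
    hS.continuousInLp_source j (hwc j) (hS.one_le_div j) (hS.add_one_div_le j) (hwc j)
  have hfu : ∀ j, ∀ s > 0, (fun y => f j (u s y)) =ᵐ[volume] fun y => f j (w s y) :=
    fun j s hs => (hu s hs).fun_comp (f j)
  have hsu : ∀ j, ContinuousInLp (Ioi 0) (h j) fun s y => f j (u s y) := fun j =>
    (hsw j).congr fun s hs => hfu j s hs
  have hint : ∀ t : ℝ, 0 < t → ∀ᵐ y, ∀ j, IntegrableOn
      (fun s => symbolSemigroup α Q (t - s) (fun z => f j (u s z)) y) (Ioo 0 t) := by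
    intro t ht
    rw [ae_all_iff]
    intro j
    filter_upwards [hS.ae_integrableOn_duhamel j hρ.le (hwc j) ((hw t).bound j) ⟨ht, le_rfl⟩]
      with y hy
    exact hy.congr_fun (fun s hs => (symbolSemigroup_congr_ae (hfu j s hs.1) _ _).symm)
      measurableSet_Ioo
  refine ⟨fun j => (hwr j).congr fun t ht => ?_, fun j => ⟨(hwp j).congr fun t ht => hu t ht,
    ?_, ?_⟩, hu0, fun j => ⟨h j, hh1 j, hsu j, fun T hT => ?_⟩, fun t ht => ?_, fun t ht => ?_⟩
  · rcases (mem_Ici.1 ht).eq_or_lt with rfl | ht0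
    · simpa using hu0
    · simpa [ht0.ne'] using hu t ht0
  · obtain ⟨C, hC⟩ := hwC j
    refine ⟨C, fun t ht => ?_⟩
    rw [hrate, eLpNorm_congr_ae (hu t ht)]
    exact (hC t).rpow_mul_le ⟨ht, le_rfl⟩
  · refine (tendsto_of_weightedBound (hwε j)).congr' ?_
    filter_upwards [self_mem_nhdsWithin] with t ht
    rw [hrate, eLpNorm_congr_ae (hu t ht)]
  · have hL := (hS.power j).nonneg
    refine ((hS.weightedBound_source j hρ.le (fun t ht => ((hwc j).memLp t ht.1).1)
      ((hw T).bound j)).congr fun t ht => hfu j t ht.1).lintegral_lt_top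
        (hS.decayRate_add_lt j) hT
  · filter_upwards [hint t ht] with y hy
    exact (integrableOn_symbolSemigroup_sum hα hd hQ hh1 hsu hy).1
  · filter_upwards [hint t ht, hu t ht, (hw t).eq t ⟨ht, le_rfl⟩] with y hy h1 h2
    rw [(integrableOn_symbolSemigroup_sum hα hd hQ hh1 hsu hy).2, h1, h2, mildStep]
    congr 1
    exact Finset.sum_congr rfl fun j _ =>
      duhamel_congr (fun s hs => (hfu j s hs.1).symm) y

/-- A solution in the solution class has the sources needed for the uniqueness argument. -/
theorem exists_hasSources (hS : IsPowerSystem α d x Q b L f)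
    (hf : ∀ j z, ‖f j z‖ = ‖z‖ ^ (1 + b j)) (hr1 : ∀ j, 1 < r j)
    (hr : ∀ j, r j * (2 * α - d) = n * b j) (hrp : ∀ j, r j < p j)
    {v : ℝ → Space n →ₘ[volume] ℂ} (hv : IsClassSolution α Q f r p q φ v) :
    ∃ h P' : ι → ℝ, HasSources α d b f h P' (fun t => v t) ∧ ∀ j, r j ≤ P' j := by
  choose h hh1 hsrc hint using hv.source
  refine ⟨h, fun j => max (p j) (h j * (1 + b j)), ⟨fun t _ => (v t).aestronglyMeasurable, hh1,
    fun j => le_max_right _ _, fun j => ?_, fun j => ?_, hsrc, hint⟩,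
    fun j => (hrp j).le.trans (le_max_left _ _)⟩
  -- The strict inequality `r j < p j` is what makes the exponent `P'` subcritical.
  · have h1 : r j < max (p j) (h j * (1 + b j)) := (hrp j).trans_le (le_max_left _ _)
    have h2 := hr1 j
    have h3 := hS.x_lt
    have h4 := hS.x_pos
    have h5 : (0 : ℝ) ≤ n := n.cast_nonneg
    have h6 : 0 < 2 * α - d := by nlinarith
    rw [← mul_div_assoc, ← hr j, div_lt_iff₀ (by linarith)]
    nlinarith
  · rcases max_choice (p j) (h j * (1 + b j)) with h1 | h1
    · simp only [h1]
      exact (hv.dotC j).continuous.locallyBoundedLp (by linarith [hr1 j, hrp j])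
    · simp only [h1]
      intro a c ha
      have hb := hS.pos j
      obtain ⟨G, hG0, hG⟩ := (hsrc j).locallyBoundedLp (hh1 j) a c ha
      refine ⟨G ^ (1 + b j)⁻¹, by positivity, fun s hs => ?_⟩
      have h2 := hG s hs
      -- Since `‖f z‖ = ‖z‖^{1+b}`, a bound on the source is a bound on the solution in
      -- `L^{h(1+b)}`.
      rw [eLpNorm_comp_eq_rpow (hS.pos j) (hf j) (by linarith [hh1 j])] at h2
      rw [← ENNReal.ofReal_rpow_of_nonneg hG0 (by positivity),
        ← ENNReal.rpow_le_rpow_iff (z := 1 + b j) (by positivity), ← ENNReal.rpow_mul,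
        inv_mul_cancel₀ (by positivity), ENNReal.rpow_one]
      exact h2

/-- The definition of a solution has one integral of the whole nonlinearity. It splits because each
term has finite mass in `L^{P'_m}`, so that each is integrable separately. -/
theorem mildStep_of_isClassSolution [Nonempty ι] (hS : IsPowerSystem α d x Q b L f) {h P' : ι → ℝ}
    {v : ℝ → Space n →ₘ[volume] ℂ} (hv : IsClassSolution α Q f r p q φ v)
    (hr1 : ∀ j, 1 < r j) (hrP' : ∀ j, r j ≤ P' j)
    (hsrc : HasSources α d b f h P' fun t => v t) {t : ℝ} (ht : 0 < t) :
    v t =ᵐ[volume] mildStep α Q f φ (fun s => v s) t := by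
  obtain ⟨m, hm⟩ := Finite.exists_max P'
  have h1 : ∀ᵐ y, ∀ j, IntegrableOn
      (fun s => symbolSemigroup α Q (t - s) (fun z => f j (v s z)) y) (Ioo 0 t) :=
    ae_all_iff.2 fun j => ae_integrableOn_of_duhamelMass hS.alpha_pos hS.order_nonneg hS.symbol
      (hsrc.one_le j) (hsrc.source j) (by linarith [hr1 m, hrP' m])
      (hS.duhamelMass_lt_top hsrc hm j ht)
  filter_upwards [h1, hv.integral_eq t ht] with y h2 h3
  rw [h3, mildStep, (integrableOn_symbolSemigroup_sum hS.alpha_pos hS.order_nonneg hS.symbol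
    hsrc.one_le hsrc.source h2).2]

end IsPowerSystem

/-- Well-posedness for small initial values, for finitely many nonlinear terms. -/
theorem exists_forall_isClassSolution [Nonempty ι] (hα : 0 < α) (hd₀ : 0 ≤ d) (hd : d < 2 * α)
    (hQ : IsHomogeneousSymbol d Q) (hb : ∀ j, 0 < b j) (hpow : ∀ j, PowerType (b j) (L j) (f j))
    (hf : ∀ j z, ‖f j z‖ = ‖z‖ ^ (1 + b j)) (hr1 : ∀ j, 1 < r j)
    (hr : ∀ j, r j * (2 * α - d) = n * b j) (hrp : ∀ j, r j < p j)
    (hp : ∀ j, p j ≤ r j * (1 + b j))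
    (hq : ∀ j, (q j)⁻¹ = ENNReal.ofReal (n / (2 * α) * (1 / r j - 1 / p j))) :
    ∃ δ : ℝ, 0 < δ ∧ ∀ φ : Space n → ℂ, (∀ j, MemLp φ (ENNReal.ofReal (r j)) volume) →
      (∀ j, eLpNorm φ (ENNReal.ofReal (r j)) volume < ENNReal.ofReal δ) →
      ∃ u, IsClassSolution α Q f r p q φ u ∧
        ∀ v, IsClassSolution α Q f r p q φ v → ∀ t : ℝ, 0 ≤ t → v t = u t := by
  have hn := natCast_pos_of_nontrivial n
  have hκ : 0 < (2 * α - d) / n := div_pos (by linarith) hn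
  obtain ⟨x, hx0, hxκ, hκx, hxb⟩ := exists_auxiliary_exponent hκ hb fun j => by
    rw [div_lt_iff₀ hn, mul_comm (b j), ← hr j]
    nlinarith [hr1 j]
  have hS : IsPowerSystem α d x Q b L f :=
    ⟨hα, hd₀, hQ, hb, hpow, hx0, by rwa [lt_div_iff₀ hn, mul_comm] at hxκ,
      fun j => by have := hκx j; rwa [div_lt_iff₀ hn, mul_comm _ (n : ℝ)] at this, hxb⟩
  -- One radius for all the target spaces involved: the sum of the operator constants dominates each
  -- of them.
  obtain ⟨ρ, hρ, hK⟩ := hS.exists_lipConst_le (∑ j, (hS.opConst (decayRate n α d x / b j) +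
    hS.opConst (heatRate n α (r j) (p j))))
  have hlip := hS.lipConst_nonneg hρ.le
  have hle : ∀ j, hS.opConst (decayRate n α d x / b j) + hS.opConst (heatRate n α (r j) (p j)) ≤
      ∑ j, (hS.opConst (decayRate n α d x / b j) + hS.opConst (heatRate n α (r j) (p j))) :=
    fun j => Finset.single_le_sum (f := fun j => hS.opConst (decayRate n α d x / b j) +
      hS.opConst (heatRate n α (r j) (p j)))
      (fun i _ => add_nonneg (hS.opConst_nonneg _) (hS.opConst_nonneg _)) (Finset.mem_univ j)
  have hsmall : ∀ j, hS.opConst (decayRate n α d x / b j) * hS.lipConst ρ ≤ 1 / 2 := fun j =>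
    (mul_le_mul_of_nonneg_right
      ((le_add_of_nonneg_right (hS.opConst_nonneg _)).trans (hle j)) hlip).trans hK
  have hsmallp : ∀ j, hS.opConst (heatRate n α (r j) (p j)) * hS.lipConst ρ ≤ 1 / 2 := fun j =>
    (mul_le_mul_of_nonneg_right
      ((le_add_of_nonneg_left (hS.opConst_nonneg _)).trans (hle j)) hlip).trans hK
  set k : ι → ℝ := fun j => kernelNorm α (fun _ : Space n => 1) (1 / r j - 1 / (b j / x)) with hk
  have hk0 : ∀ j, 0 ≤ k j := fun j => kernelNorm_nonneg _ _ _
  have hks : 0 ≤ ∑ j, k j := Finset.sum_nonneg fun j _ => hk0 j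
  have hkle : ∀ j, k j ≤ ∑ j, k j := fun j =>
    Finset.single_le_sum (fun i _ => hk0 i) (Finset.mem_univ j)
  have hN : ∀ j, k j * (ρ / (4 * (∑ j, k j + 1))) ≤ ρ / 4 := fun j => by
    rw [← mul_div_assoc, div_le_div_iff₀ (by positivity) (by norm_num)]
    nlinarith [hkle j]
  -- With this `δ` the linear evolution has weighted norms at most `ρ/4`; existence needs only
  -- `ρ/2`, uniqueness uses `ρ/4`. The `+ 1` keeps the denominator positive.
  refine ⟨ρ / (4 * (∑ j, k j + 1)), by positivity, fun φ hφr hφN => ?_⟩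
  have hr0 : ∀ j, 0 < r j := fun j => by linarith [hr1 j]
  obtain ⟨w, hw, hwr, hwp⟩ := hS.exists_solution hρ hr1 hr hrp hp hsmall hsmallp hφr fun j T => by
    have h1 := weightedBound_semigroup hα (hr1 j).le (hS.div_gt (hr0 j) (hr j)).le (hφr j).1
      (hφN j).le T
    rw [← hS.decayRate_div_eq (hr0 j) (hr j)] at h1
    exact h1.mono ((hN j).trans (by linarith))
  obtain ⟨m⟩ := ‹Nonempty ι›
  have : Nonempty ι := ⟨m⟩
  -- The Picard limit is meaningful only for `t > 0`: the value at `0` is set to `φ`, and negative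
  -- times get the default `0`.
  set u : ℝ → Space n →ₘ[volume] ℂ := fun t => if ht : 0 ≤ t then
    AEEqFun.mk (if t = 0 then φ else w t) ((hwr m).memLp t ht).1 else 0 with hu
  have hu0 : u 0 =ᵐ[volume] φ := by
    simp only [hu, le_refl, dite_true]
    exact (AEEqFun.coeFn_mk _ _).trans (Eventually.of_forall fun y => by simp)
  have huw : ∀ t > 0, u t =ᵐ[volume] w t := fun t ht => by
    simp only [hu, ht.le, dite_true]
    exact (AEEqFun.coeFn_mk _ _).trans (Eventually.of_forall fun y => by simp [ht.ne'])
  refine ⟨u, hS.isClassSolution hρ hrp hr1 hq hw hwr (fun j => (hwp j).1) (fun j => (hwp j).2.1)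
    (fun j => (hwp j).2.2) hu0 huw, fun v hv t ht => AEEqFun.ext ?_⟩
  rcases ht.eq_or_lt with rfl | ht0
  · exact hv.initial.trans hu0.symm
  · obtain ⟨h, P', hsrc, hrP'⟩ := hS.exists_hasSources hf hr1 hr hrp hv
    have hvs := hS.isSmallSolution_of_sources hρ hsmall hr1 hr hN hsrc hrP' hv.cont hv.initial
      hφN (fun t ht => hS.mildStep_of_isClassSolution hv hr1 hrP' hsrc ht) t
    exact (hS.isSmallSolution_unique hρ.le hsmall hvs (hw t) ⟨ht0, le_rfl⟩).trans (huw t ht0).symm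

end MainTheorem

/-! ### The cases of two nonlinear terms and of one. -/

section Specialization

variable {n : ℕ} {α : ℝ} {Q : Space n → ℂ} {φ : Space n → ℂ} {u : ℝ → Space n →ₘ[volume] ℂ}

theorem isClassSolution_fin_two_iff {f₁ f₂ : ℂ → ℂ} {r₁ r₂ p₁ p₂ : ℝ} {q₁ q₂ : ℝ≥0∞} :
    IsClassSolution α Q ![f₁, f₂] ![r₁, r₂] ![p₁, p₂] ![q₁, q₂] φ u ↔
      ContinuousInLp (Ici 0) r₁ (fun t => u t) ∧ ContinuousInLp (Ici 0) r₂ (fun t => u t) ∧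
        MemDotC q₁ p₁ (fun t => u t) ∧ MemDotC q₂ p₂ (fun t => u t) ∧
        IsMildSolution α Q f₁ f₂ φ u := by
  constructor
  · rintro ⟨h1, h2, h3, h4, h5, h6⟩
    simp only [Fin.sum_univ_two] at h5 h6
    exact ⟨h1 0, h1 1, h2 0, h2 1, h3, h4 0, h4 1, h5, h6⟩
  · rintro ⟨h1, h1', h2, h2', h3, h4, h4', h5, h6⟩
    refine ⟨Fin.forall_fin_two.2 ⟨h1, h1'⟩, Fin.forall_fin_two.2 ⟨h2, h2'⟩, h3,
      Fin.forall_fin_two.2 ⟨h4, h4'⟩, ?_, ?_⟩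
    · simp only [Fin.sum_univ_two]
      exact h5
    · simp only [Fin.sum_univ_two]
      exact h6

theorem admissibleSource_zero (u : ℝ → Space n →ₘ[volume] ℂ) : AdmissibleSource (fun _ => 0) u :=
  ⟨1, le_rfl, continuousInLp_zero _ _, fun T _ => by simp⟩

theorem isClassSolution_unit_iff {f₁ : ℂ → ℂ} {r₁ p₁ : ℝ} {q₁ : ℝ≥0∞} :
    IsClassSolution α Q (fun _ : Unit => f₁) (fun _ => r₁) (fun _ => p₁) (fun _ => q₁) φ u ↔
      ContinuousInLp (Ici 0) r₁ (fun t => u t) ∧ MemDotC q₁ p₁ (fun t => u t) ∧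
        IsMildSolution α Q f₁ (fun _ => 0) φ u := by
  constructor
  · rintro ⟨h1, h2, h3, h4, h5, h6⟩
    simp only [Finset.univ_unique, Finset.sum_singleton] at h5 h6
    exact ⟨h1 (), h2 (), h3, h4 (), admissibleSource_zero u, by simpa only [add_zero] using h5,
      by simpa only [add_zero] using h6⟩
  · rintro ⟨h1, h2, h3, h4, -, h5, h6⟩
    simp only [add_zero] at h5 h6
    refine ⟨fun _ => h1, fun _ => h2, h3, fun _ => h4, ?_, ?_⟩
    · simpa only [Finset.univ_unique, Finset.sum_singleton] using h5
    · simpa only [Finset.univ_unique, Finset.sum_singleton] using h6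

end Specialization

end FracDissipative

open FracDissipative
theorem theorem5p5 (n : ℕ) (α d : ℝ) (hα : 0 < α) (hd₀ : 0 ≤ d) (hd : d < 2 * α)
    (b₁ b₂ : ℝ) (hb₂ : 0 < b₂) (hb : b₂ ≤ b₁)
    (Q : Space n → ℂ) (hQ : IsHomogeneousSymbol d Q)
    (f₁ f₂ : ℂ → ℂ)
    (hf : (IsSignedPower b₁ f₁ ∧ IsSignedPower b₂ f₂) ∨ (IsAbsPower b₁ f₁ ∧ IsAbsPower b₂ f₂))
    (r₁ r₂ p₁ p₂ : ℝ) (q₁ q₂ : ℝ≥0∞)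
    (hr₁ : r₁ = n * b₁ / (2 * α - d)) (hr₂ : r₂ = n * b₂ / (2 * α - d))
    (hr₁_one : 1 < r₁) (hr₂_one : 1 < r₂)
    (hadm₁ : IsGenAdmissible n α q₁ p₁ r₁) (hadm₂ : IsGenAdmissible n α q₂ p₂ r₂)
    (hrp₁ : r₁ < p₁) (hrp₂ : r₂ < p₂)
    (hp₁ : p₁ ≤ r₁ * (1 + b₁)) (hp₂ : p₂ ≤ r₂ * (1 + b₂)) :
    (∃ δ : ℝ, 0 < δ ∧ ∀ φ : Space n → ℂ,
      MemLp φ (ENNReal.ofReal r₁) volume → MemLp φ (ENNReal.ofReal r₂) volume →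
      eLpNorm φ (ENNReal.ofReal r₁) volume + eLpNorm φ (ENNReal.ofReal r₂) volume
        < ENNReal.ofReal δ →
      ∃ u : ℝ → Space n →ₘ[volume] ℂ,
        (ContinuousInLp (Ici 0) r₁ (fun t => u t) ∧ ContinuousInLp (Ici 0) r₂ (fun t => u t) ∧
          MemDotC q₁ p₁ (fun t => u t) ∧ MemDotC q₂ p₂ (fun t => u t) ∧
          IsMildSolution α Q f₁ f₂ φ u) ∧
        ∀ v : ℝ → Space n →ₘ[volume] ℂ,
          (ContinuousInLp (Ici 0) r₁ (fun t => v t) ∧ ContinuousInLp (Ici 0) r₂ (fun t => v t) ∧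
            MemDotC q₁ p₁ (fun t => v t) ∧ MemDotC q₂ p₂ (fun t => v t) ∧
            IsMildSolution α Q f₁ f₂ φ v) →
          ∀ t : ℝ, 0 ≤ t → v t = u t) ∧
    (b₁ = b₂ → ∃ δ : ℝ, 0 < δ ∧ ∀ φ : Space n → ℂ,
      MemLp φ (ENNReal.ofReal r₁) volume →
      eLpNorm φ (ENNReal.ofReal r₁) volume < ENNReal.ofReal δ →
      ∃ u : ℝ → Space n →ₘ[volume] ℂ,
        (ContinuousInLp (Ici 0) r₁ (fun t => u t) ∧ MemDotC q₁ p₁ (fun t => u t) ∧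
          IsMildSolution α Q f₁ (fun _ => 0) φ u) ∧
        ∀ v : ℝ → Space n →ₘ[volume] ℂ,
          (ContinuousInLp (Ici 0) r₁ (fun t => v t) ∧ MemDotC q₁ p₁ (fun t => v t) ∧
            IsMildSolution α Q f₁ (fun _ => 0) φ v) →
          ∀ t : ℝ, 0 ≤ t → v t = u t) := by
  -- In dimension `0` the exponent `r₁` would vanish, contrary to `1 < r₁`.
  have hn : n ≠ 0 := by
    rintro rfl
    simp at hr₁
    linarith
  have : Nonempty (Fin n) := ⟨⟨0, Nat.pos_of_ne_zero hn⟩⟩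
  have hb₁ : 0 < b₁ := hb₂.trans_le hb
  have hda : 2 * α - d ≠ 0 := by linarith
  obtain ⟨⟨L₁, hL₁⟩, ⟨L₂, hL₂⟩, hn₁, hn₂⟩ : (∃ L, PowerType b₁ L f₁) ∧ (∃ L, PowerType b₂ L f₂) ∧
      (∀ z, ‖f₁ z‖ = ‖z‖ ^ (1 + b₁)) ∧ ∀ z, ‖f₂ z‖ = ‖z‖ ^ (1 + b₂) := by
    rcases hf with ⟨h₁, h₂⟩ | ⟨h₁, h₂⟩
    · exact ⟨h₁.exists_powerType hb₁, h₂.exists_powerType hb₂, h₁.norm_eq hb₁, h₂.norm_eq hb₂⟩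
    · exact ⟨h₁.exists_powerType hb₁, h₂.exists_powerType hb₂, h₁.norm_eq, h₂.norm_eq⟩
  have hr₁' : r₁ * (2 * α - d) = n * b₁ := by rw [hr₁, div_mul_cancel₀ _ hda]
  have hr₂' : r₂ * (2 * α - d) = n * b₂ := by rw [hr₂, div_mul_cancel₀ _ hda]
  constructor
  · obtain ⟨δ, hδ, H⟩ := exists_forall_isClassSolution (b := ![b₁, b₂]) (L := ![L₁, L₂])
      (f := ![f₁, f₂]) (r := ![r₁, r₂]) (p := ![p₁, p₂]) (q := ![q₁, q₂]) hα hd₀ hd hQ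
      (Fin.forall_fin_two.2 ⟨hb₁, hb₂⟩) (Fin.forall_fin_two.2 ⟨hL₁, hL₂⟩)
      (Fin.forall_fin_two.2 ⟨hn₁, hn₂⟩) (Fin.forall_fin_two.2 ⟨hr₁_one, hr₂_one⟩)
      (Fin.forall_fin_two.2 ⟨hr₁', hr₂'⟩) (Fin.forall_fin_two.2 ⟨hrp₁, hrp₂⟩)
      (Fin.forall_fin_two.2 ⟨hp₁, hp₂⟩) (Fin.forall_fin_two.2 ⟨hadm₁.inv_eq, hadm₂.inv_eq⟩)
    refine ⟨δ, hδ, fun φ hφ₁ hφ₂ hφ => ?_⟩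
    obtain ⟨u, hu, huniq⟩ := H φ (Fin.forall_fin_two.2 ⟨hφ₁, hφ₂⟩)
      (Fin.forall_fin_two.2 ⟨le_self_add.trans_lt hφ, le_add_self.trans_lt hφ⟩)
    simp only [isClassSolution_fin_two_iff] at hu huniq
    exact ⟨u, hu, huniq⟩
  · rintro -
    -- The index type `Unit` gives the equation with the single term `f₁`, with smallness measured
    -- in `L^{r₁}` alone.
    obtain ⟨δ, hδ, H⟩ := exists_forall_isClassSolution (ι := Unit) (b := fun _ => b₁)
      (L := fun _ => L₁) (f := fun _ => f₁) (r := fun _ => r₁) (p := fun _ => p₁)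
      (q := fun _ => q₁) hα hd₀ hd hQ (fun _ => hb₁) (fun _ => hL₁) (fun _ => hn₁)
      (fun _ => hr₁_one) (fun _ => hr₁') (fun _ => hrp₁) (fun _ => hp₁) (fun _ => hadm₁.inv_eq)
    refine ⟨δ, hδ, fun φ hφ₁ hφ => ?_⟩
    obtain ⟨u, hu, huniq⟩ := H φ (fun _ => hφ₁) (fun _ => hφ)
    simp only [isClassSolution_unit_iff] at hu huniq
    exact ⟨u, hu, huniq⟩
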